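/- Let $n\ge 1$, $\beta>0$ and $g,g_0,g_1,g_0',g_1'\ge 0$. Put $\gamma=i\beta/2$, $\mu=i\beta g$, $\mu_\delta=i\beta g_\delta$, $\mu'_\delta=i\beta g'_\delta$ ($\delta=0,1$), $q=e^{-\beta}$, and $$v_a(z)=\frac{\sin\frac12(\mu+z)}{\sin\frac12 z},\qquad v_b(z)=\frac{\sin\frac12(\mu_0+z)}{\sin\frac12 z}\,\frac{\cos\frac12(\mu_1+z)}{\cos\frac12 z}\,\frac{\sin\frac12(\mu_0'+\gamma+z)}{\sin\frac12(\gamma+z)}\,\frac{\cos\frac12(\mu_1'+\gamma+z)}{\cos\frac12(\gamma+z)}.$$ For disjoint $J,K\subset\{1,\dots,n\}$ and signs $\varepsilon_j=\pm1$ ($j\in J$) let $$V_{\varepsilon J;K}=\prod_{j\in J}v_b(\varepsilon_jx_j)\prod_{\substack{j,j'\in J\\ j<j'}}v_a(\varepsilon_jx_j+\varepsilon_{j'}x_{j'})\,v_a(\varepsilon_jx_j+\varepsilon_{j'}x_{j'}+2\gamma)\prod_{j\in J,\,k\in K}v_a(\varepsilon_jx_j+x_k)\,v_a(\varepsilon_jx_j-x_k).$$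 Let $T_{\varepsilon J}$ be the translation $(T_{\varepsilon J}f)(x)=f\big(x+i\beta\sum_{j\in J}\varepsilon_je_j\big)$, where $e_1,\dots,e_n$ is the standard basis. For $r=1,\dots,n$ let $\hat D_r$ be the difference operator $$\hat D_r=\sum_{\substack{|J|=r\\ \varepsilon_j=\pm1,\,j\in J}}\ \sum_{\substack{\emptyset=J_0\subsetneq J_1\subsetneq\cdots\subsetneq J_s=J\\ 1\le s\le r}}(-1)^{s-1}\prod_{1\le s'\le s}V_{\varepsilon(J_{s'}\setminus J_{s'-1});\,J_{s'}^c}\ \big(T_{\varepsilon J_1}-1\big),$$ acting on functions of $x\in\mathbb C^n$ modulo equality on open dense sets (as the coefficients have poles), and let $\mathbb D=\mathbb R[\hat D_1,\dots,\hat D_n]$ be the real algebra of operators that they generate. Let $\mathcal P^+=\{\lambda\in\mathbb Z^n:\lambda_1\ge\dots\ge\lambda_n\ge0\}$, partially ordered by $\lambda'\le\lambda$ iff $\sum_{j\le k}\lambda'_j\le\sum_{j\le k}\lambda_j$ for $k=1,\dots,n$. Let $m_\lambda(x)=\sum_{\lambda'\in W\lambda}e^{i\sum_j\lambda'_jx_j}$,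 with $W$ the group of permutations and sign changes of the coordinates. With $(a;q)_\infty=\prod_{m\ge0}(1-aq^m)$ and $(a_1,\dots,a_k;q)_\infty=\prod_{s}(a_s;q)_\infty$, let $d_c(z)=d_c^+(z)d_c^+(-z)$ ($c=a,b$), where $$d_a^+(z)=\frac{(e^{iz};q)_\infty}{(q^{g}e^{iz};q)_\infty},\qquad d_b^+(z)=\frac{(e^{2iz};q)_\infty}{(q^{g_0}e^{iz},\,-q^{g_1}e^{iz},\,q^{g_0'+1/2}e^{iz},\,-q^{g_1'+1/2}e^{iz};q)_\infty},$$ and let $$\Delta(x)=\prod_{j<k}d_a(x_j+x_k)\,d_a(x_j-x_k)\prod_jd_b(x_j),\qquad \langle f,h\rangle_\Delta=\int_{[-\pi,\pi]^n}f\,\overline h\,\Delta\,dx.$$ For $\lambda\in\mathcal P^+$ the Koornwinder polynomial $p_\lambda$ is the unique function in $m_\lambda+\mathrm{span}_{\mathbb C}\{m_{\lambda'}:\lambda'\in\mathcal P^+,\lambda'<\lambda\}$ with $\langle p_\lambda,m_{\lambda'}\rangle_\Delta=0$ for all $\lambda'\in\mathcal P^+$, $\lambda'<\lambda$. Let $\rho_j=(n-j)g+(g_0+g_1+g_0'+g_1')/2$,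 let $\mathbb R[\mathrm{ch}\,\beta\theta_1,\dots,\mathrm{ch}\,\beta\theta_n]^{S_n}$ be the real algebra of functions of $\theta\in\mathbb R^n$ that are symmetric polynomials in the $\mathrm{ch}\,\beta\theta_j$, and let $$E_{r,n}(\theta)=\sum_{0\le s\le r}(-1)^{r+s}\Big(\sum_{|J|=s}\prod_{j\in J}\mathrm{ch}\,\beta\theta_j\Big)\Big(\sum_{r\le i_1\le\cdots\le i_{r-s}\le n}\mathrm{ch}\,\beta\rho_{i_1}\cdots\mathrm{ch}\,\beta\rho_{i_{r-s}}\Big).$$ **Theorem.** The Koornwinder polynomials $p_\lambda$ are well defined (they exist and are unique). For each $S\in\mathbb R[\mathrm{ch}\,\beta\theta_1,\dots,\mathrm{ch}\,\beta\theta_n]^{S_n}$ there is a unique difference operator $\hat D\in\mathbb D$ such that $$\hat D\,p_\lambda=S(\lambda+\rho)\,p_\lambda\qquad\text{for all }\lambda\in\mathcal P^+ .$$ Moreover, there is an isomorphism of real algebras $HC:\mathbb D\to\mathbb R[\mathrm{ch}\,\beta\theta_1,\dots,\mathrm{ch}\,\beta\theta_n]^{S_n}$ with $\hat D\,p_\lambda=HC(\hat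 D)(\lambda+\rho)\,p_\lambda$ for all $\hat D\in\mathbb D$, $\lambda\in\mathcal P^+$, and it sends $\hat D_r$ to $2^rE_{r,n}(\theta)$, $r=1,\dots,n$. -/

import Mathlib

namespace Koornwinder

noncomputable section

/-- The scale factor `β` and the five coupling constants. -/
structure Params where
  β : ℝ
  g : ℝ
  g₀ : ℝ
  g₁ : ℝ
  g₀' : ℝ
  g₁' : ℝ

/-! ### Functions up to equality on open dense sets, and operators on them -/

/-- The filter of those sets that contain an open dense set. -/
def openDense (X : Type*) [TopologicalSpace X] : Filter X where
  sets := {s | ∃ U : Set X, IsOpen U ∧ Dense U ∧ U ⊆ s}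
  univ_sets := ⟨Set.univ, isOpen_univ, dense_univ, subset_rfl⟩
  sets_of_superset := by
    rintro s t ⟨U, hU, hd, hs⟩ hst
    exact ⟨U, hU, hd, hs.trans hst⟩
  inter_sets := by
    rintro s t ⟨U, hU, hUd, hUs⟩ ⟨V, hV, hVd, hVt⟩
    exact ⟨U ∩ V, hU.inter hV, hUd.inter_of_isOpen_left hVd hU,
      Set.inter_subset_inter hUs hVt⟩

/-- Complex functions of `x = (x₁, …, xₙ) ∈ ℂⁿ`, two of them being identified when they agree on
an open dense set. (The coefficients of the difference operators have poles, so that they are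
defined on an open dense set only.) -/
abbrev Fun (n : ℕ) : Type := Filter.Germ (openDense (Fin n → ℂ)) ℂ

/-- The class in `Fun n` of a function on `ℂⁿ`. -/
def toFun {n : ℕ} (f : (Fin n → ℂ) → ℂ) : Fun n := (f : Fun n)

lemma tendsto_add_openDense {n : ℕ} (a : Fin n → ℂ) :
    Filter.Tendsto (fun x : Fin n → ℂ => x + a) (openDense _) (openDense _) := by
  rintro s ⟨U, hU, hd, hs⟩
  exact ⟨(fun x : Fin n → ℂ => x + a) ⁻¹' U, hU.preimage (by fun_prop),
    hd.preimage (Homeomorph.addRight a).isOpenMap, Set.preimage_mono hs⟩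

/-- Multiplication by the function `V`. -/
def mulOp {n : ℕ} (V : (Fin n → ℂ) → ℂ) : Module.End ℂ (Fun n) where
  toFun f := toFun V * f
  map_add' := mul_add _
  map_smul' c f := by
    induction f using Filter.Germ.inductionOn with
    | _ f =>
      refine congrArg (fun h : (Fin n → ℂ) → ℂ => (h : Fun n)) ?_
      funext x
      exact mul_left_comm _ _ _

/-- The translation operator `exp(-β ∑ⱼ κⱼ θ̂ⱼ)`, where `θ̂ⱼ = -i ∂/∂xⱼ`:
it sends `f` to `x ↦ f(x + iβκ)`. -/
def shiftOp {n : ℕ} (β : ℝ) (κ : Fin n → ℤ) : Module.End ℂ (Fun n) where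
  toFun f := f.compTendsto (fun x => x + fun j => Complex.I * (β : ℂ) * (κ j : ℂ))
    (tendsto_add_openDense _)
  map_add' f h := by
    induction f, h using Filter.Germ.inductionOn₂ with
    | _ f h => rfl
  map_smul' c f := by
    induction f using Filter.Germ.inductionOn with
    | _ f => rfl

/-! ### The difference operators -/

variable (P : Params)

/-- `v_a(z)`, with `μ = iβg`. -/
def va (z : ℂ) : ℂ :=
  Complex.sin ((Complex.I * P.β * P.g + z) / 2) / Complex.sin (z / 2)

/-- `v_b(z)`, with `γ = iβ/2`, `μ_δ = iβg_δ` and `μ'_δ = iβg'_δ`. -/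
def vb (z : ℂ) : ℂ :=
  let γ : ℂ := Complex.I * P.β / 2
  (Complex.sin ((Complex.I * P.β * P.g₀ + z) / 2) / Complex.sin (z / 2)) *
  (Complex.cos ((Complex.I * P.β * P.g₁ + z) / 2) / Complex.cos (z / 2)) *
  (Complex.sin ((Complex.I * P.β * P.g₀' + γ + z) / 2) / Complex.sin ((γ + z) / 2)) *
  (Complex.cos ((Complex.I * P.β * P.g₁' + γ + z) / 2) / Complex.cos ((γ + z) / 2))

variable {n : ℕ}

/-- The coefficient function `V_{εJ;K}`. -/
def V (ε : Fin n → ℤ) (J K : Finset (Fin n)) (x : Fin n → ℂ) : ℂ :=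
  (∏ j ∈ J, vb P (ε j * x j)) *
  (∏ j ∈ J, ∏ k ∈ J with j < k,
    va P (ε j * x j + ε k * x k) * va P (ε j * x j + ε k * x k + Complex.I * P.β)) *
  (∏ j ∈ J, ∏ k ∈ K, va P (ε j * x j + x k) * va P (ε j * x j - x k))

/-- The choices of signs `εⱼ = ±1`, `j ∈ J` (extended by `0` outside `J`). -/
def signs (J : Finset (Fin n)) : Finset (Fin n → ℤ) :=
  Fintype.piFinset fun j => if j ∈ J then {1, -1} else {0}

open Classical in
/-- The strictly increasing sequences `∅ = J₀ ⊊ J₁ ⊊ ⋯ ⊊ J_s = J`. -/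
def chains (J : Finset (Fin n)) (s : ℕ) : Finset (Fin (s + 1) → Finset (Fin n)) :=
  Finset.univ.filter fun C => StrictMono C ∧ C 0 = ∅ ∧ C (Fin.last s) = J

/-- The difference operator `D̂_r` in `n` variables, `1 ≤ r ≤ n`. -/
def diffOp (n r : ℕ) : Module.End ℂ (Fun n) :=
  ∑ J ∈ Finset.powersetCard r (Finset.univ : Finset (Fin n)), ∑ ε ∈ signs J,
    ∑ s ∈ Finset.Icc 1 r, ∑ C ∈ chains J s,
      mulOp (fun x => (-1) ^ (s - 1) *
          ∏ t : Fin s, V P ε (C t.succ \ C t.castSucc) (C t.succ)ᶜ x) *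
        (shiftOp P.β (fun j => if j ∈ C 1 then ε j else 0) - 1)

/-- The real algebra `𝔻 = ℝ[D̂₁, …, D̂ₙ]` of difference operators. -/
def diffAlg (n : ℕ) : Subalgebra ℝ (Module.End ℂ (Fun n)) :=
  Algebra.adjoin ℝ (diffOp P n '' Set.Icc 1 n)

/-! ### Koornwinder's polynomials -/

/-- Dominant weights: `λ₁ ≥ λ₂ ≥ ⋯ ≥ λₙ ≥ 0`. -/
def Dominant (l : Fin n → ℤ) : Prop := Antitone l ∧ ∀ j, 0 ≤ l j

/-- The partial order on weights: all partial sums `∑_{j ≤ k} l'ⱼ` are at most those of `l`. -/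
def WeightLE (l' l : Fin n → ℤ) : Prop :=
  ∀ k : Fin n, ∑ j ∈ Finset.Iic k, l' j ≤ ∑ j ∈ Finset.Iic k, l j

/-- The orbit of `l` under permutations and sign flips. -/
def orbit (l : Fin n → ℤ) : Finset (Fin n → ℤ) :=
  Finset.univ.image fun w : Equiv.Perm (Fin n) × (Fin n → ℤˣ) => fun j => (w.2 j : ℤ) * l (w.1 j)

/-- The monomial symmetric function `m_l`. -/
def monomial (l : Fin n → ℤ) (x : Fin n → ℂ) : ℂ :=
  ∑ l' ∈ orbit l, Complex.exp (Complex.I * ∑ j, (l' j : ℂ) * x j)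

/-- The `q`-shifted factorial `(a; q)_∞ = ∏_{m ≥ 0} (1 - a q^m)` with `q = e^{-β}`. -/
def qfac (a : ℂ) : ℂ := ∏' m : ℕ, (1 - a * (Real.exp (-P.β) : ℂ) ^ m)

/-- `d_a^+(z)`. -/
def daPlus (z : ℂ) : ℂ :=
  let y := Complex.exp (Complex.I * z)
  qfac P y / qfac P (Real.exp (-P.β * P.g) * y)

/-- `d_b^+(z)`. -/
def dbPlus (z : ℂ) : ℂ :=
  let y := Complex.exp (Complex.I * z)
  qfac P (Complex.exp (2 * Complex.I * z)) /
    (qfac P (Real.exp (-P.β * P.g₀) * y) *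
     qfac P (-Real.exp (-P.β * P.g₁) * y) *
     qfac P (Real.exp (-P.β * (P.g₀' + 1 / 2)) * y) *
     qfac P (-Real.exp (-P.β * (P.g₁' + 1 / 2)) * y))

/-- `d_a(z) = d_a^+(z) d_a^+(-z)`. -/
def da (z : ℂ) : ℂ := daPlus P z * daPlus P (-z)

/-- `d_b(z) = d_b^+(z) d_b^+(-z)`. -/
def db (z : ℂ) : ℂ := dbPlus P z * dbPlus P (-z)

/-- The weight function `Δ`. -/
def weight (x : Fin n → ℂ) : ℂ :=
  (∏ j, ∏ k with j < k, da P (x j + x k) * da P (x j - x k)) * ∏ j, db P (x j)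

/-- The inner product `⟨f, h⟩_Δ = ∫_𝕋 f h̄ Δ dx` over the torus `𝕋 = ℝⁿ / 2πℤⁿ`. -/
def innerΔ (f h : (Fin n → ℂ) → ℂ) : ℂ :=
  ∫ x in Set.Icc (fun _ : Fin n => -Real.pi) (fun _ => Real.pi),
    f (fun j => (x j : ℂ)) * (starRingEnd ℂ) (h fun j => (x j : ℂ)) * weight P fun j => (x j : ℂ)

/-- `p` satisfies the defining conditions of the Koornwinder polynomial of the weight `l`:
`p = m_l +` a linear combination of the `m_{l'}` with `l' < l` dominant, and `p` is orthogonal to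
all these `m_{l'}`. -/
def IsKoornwinder (l : Fin n → ℤ) (p : (Fin n → ℂ) → ℂ) : Prop :=
  p - monomial l ∈
      Submodule.span ℂ (monomial '' {l' : Fin n → ℤ | Dominant l' ∧ WeightLE l' l ∧ l' ≠ l}) ∧
    ∀ l' : Fin n → ℤ, Dominant l' → WeightLE l' l → l' ≠ l → innerΔ P p (monomial l') = 0

/-- The Koornwinder polynomial `p_l`: the function determined by `IsKoornwinder`. -/
def koornwinder (l : Fin n → ℤ) : (Fin n → ℂ) → ℂ := Classical.epsilon (IsKoornwinder P l)

/-! ### The symmetric algebra -/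

/-- `ρⱼ = (n - j) g + (g₀ + g₁ + g₀' + g₁') / 2`, `j = 1, …, n`
(the index `j : Fin n` below starts at `0`). -/
def rho (j : Fin n) : ℝ :=
  ((n : ℝ) - ((j : ℕ) + 1)) * P.g + (P.g₀ + P.g₁ + P.g₀' + P.g₁') / 2

/-- `l + ρ`. -/
def shifted (l : Fin n → ℤ) : Fin n → ℝ := fun j => (l j : ℝ) + rho P j

/-- The algebra `ℝ[ch βθ₁, …, ch βθₙ]^{Sₙ}` of functions of `θ ∈ ℝⁿ`: polynomials in the
`ch βθⱼ` that are invariant under permutations of `θ₁, …, θₙ`. -/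
def symAlg (n : ℕ) : Subalgebra ℝ ((Fin n → ℝ) → ℝ) :=
  Algebra.adjoin ℝ (Set.range fun (j : Fin n) (θ : Fin n → ℝ) => Real.cosh (P.β * θ j)) ⊓
  { carrier := {S | ∀ (σ : Equiv.Perm (Fin n)) (θ : Fin n → ℝ), S (θ ∘ σ) = S θ}
    mul_mem' := fun ha hb σ θ => by simp [ha σ θ, hb σ θ]
    add_mem' := fun ha hb σ θ => by simp [ha σ θ, hb σ θ]
    algebraMap_mem' := fun _ _ _ => rfl }

open Classical in
/-- `E_{r,n}(t₁, …, tₙ; p_r, …, pₙ) = ∑_{0 ≤ s ≤ r} (-1)^{r+s} (∑_{|J| = s} ∏_{j ∈ J} tⱼ)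
(∑_{r ≤ i₁ ≤ ⋯ ≤ i_{r-s} ≤ n} p_{i₁} ⋯ p_{i_{r-s}})`. -/
def E (r : ℕ) (t p : Fin n → ℝ) : ℝ :=
  ∑ s ∈ Finset.range (r + 1), (-1) ^ (r + s) *
    (∑ J ∈ Finset.powersetCard s (Finset.univ : Finset (Fin n)), ∏ j ∈ J, t j) *
    (∑ i ∈ (Finset.univ : Finset (Fin (r - s) → Fin n)).filter
        (fun i : Fin (r - s) → Fin n => Monotone i ∧ ∀ k, r ≤ (i k : ℕ) + 1), ∏ k, p (i k))

/-- `E_{r,n}(θ) = E_{r,n}(ch βθ₁, …, ch βθₙ; ch βρ_r, …, ch βρₙ)`. -/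
def Eθ (r : ℕ) (θ : Fin n → ℝ) : ℝ :=
  E r (fun j => Real.cosh (P.β * θ j)) (fun j => Real.cosh (P.β * rho P j))

end

end Koornwinder

namespace Koornwinder

open Filter Topology

noncomputable section

variable {n : ℕ}

/-! ### Exponential polynomials -/

/-- The exponential function `x ↦ exp (i κ·x)`. -/
def ex (κ : Fin n → ℤ) (x : Fin n → ℂ) : ℂ := Complex.exp (Complex.I * ∑ j, (κ j : ℂ) * x j)

lemma ex_zero (x : Fin n → ℂ) : ex 0 x = 1 := by simp [ex]

lemma ex_add (κ κ' : Fin n → ℤ) (x : Fin n → ℂ) : ex (κ + κ') x = ex κ x * ex κ' x := by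
  simp only [ex, ← Complex.exp_add, ← mul_add, ← Finset.sum_add_distrib, Pi.add_apply,
    Int.cast_add, add_mul]

lemma ex_apply_add (κ : Fin n → ℤ) (x y : Fin n → ℂ) : ex κ (x + y) = ex κ x * ex κ y := by
  simp only [ex, ← Complex.exp_add, ← mul_add, ← Finset.sum_add_distrib, Pi.add_apply]

lemma analyticOnNhd_ex (κ : Fin n → ℤ) : AnalyticOnNhd ℂ (ex κ) Set.univ := by
  have h : AnalyticOnNhd ℂ (fun x : Fin n → ℂ => Complex.I * ∑ j, (κ j : ℂ) * x j) Set.univ := by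
    refine analyticOnNhd_const.mul (Finset.analyticOnNhd_fun_sum _ fun j _ => ?_)
    refine analyticOnNhd_const.mul ?_
    exact (ContinuousLinearMap.proj (R := ℂ) (φ := fun _ : Fin n => ℂ) j).analyticOnNhd _
  exact h.cexp

lemma span_ex_mul {F G : (Fin n → ℂ) → ℂ} (hF : F ∈ Submodule.span ℂ (Set.range (ex (n := n))))
    (hG : G ∈ Submodule.span ℂ (Set.range (ex (n := n)))) :
    F * G ∈ Submodule.span ℂ (Set.range (ex (n := n))) := by
  have := Submodule.mul_mem_mul hF hG
  rw [Submodule.span_mul_span] at this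
  refine Submodule.span_mono ?_ this
  rintro _ ⟨_, ⟨κ, rfl⟩, _, ⟨κ', rfl⟩, rfl⟩
  exact ⟨κ + κ', funext fun x => ex_add _ _ _⟩

/-- The algebra of exponential polynomials. -/
def expPoly (n : ℕ) : Subalgebra ℂ ((Fin n → ℂ) → ℂ) :=
  (Submodule.span ℂ (Set.range (ex (n := n)))).toSubalgebra
    (Submodule.subset_span ⟨0, funext fun x => by simp [ex_zero]⟩)
    fun _ _ => span_ex_mul

lemma ex_mem (κ : Fin n → ℤ) : ex κ ∈ expPoly n := Submodule.subset_span ⟨κ, rfl⟩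

lemma expPoly_induction {p : ((Fin n → ℂ) → ℂ) → Prop} (hex : ∀ κ, p (ex κ)) (h0 : p 0)
    (hadd : ∀ F G, p F → p G → p (F + G)) (hsmul : ∀ (c : ℂ) F, p F → p (c • F))
    {F : (Fin n → ℂ) → ℂ} (hF : F ∈ expPoly n) : p F := by
  have hF' : F ∈ Submodule.span ℂ (Set.range (ex (n := n))) := hF
  induction hF' using Submodule.span_induction with
  | mem x h => obtain ⟨κ, rfl⟩ := h; exact hex κ
  | zero => exact h0
  | add x y hx hy ihx ihy => exact hadd _ _ (ihx hx) (ihy hy)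
  | smul a x hx ih => exact hsmul _ _ (ih hx)

/-- The exponential polynomial with given coefficients. -/
def evalEx (f : (Fin n → ℤ) →₀ ℂ) (x : Fin n → ℂ) : ℂ := f.sum fun κ a => a * ex κ x

lemma mem_expPoly_iff {F : (Fin n → ℂ) → ℂ} :
    F ∈ expPoly n ↔ ∃ f : (Fin n → ℤ) →₀ ℂ, F = evalEx f := by
  have : F ∈ expPoly n ↔ F ∈ Submodule.span ℂ (Set.range (ex (n := n))) := Iff.rfl
  rw [this, Finsupp.mem_span_range_iff_exists_finsupp]
  refine exists_congr fun f => ?_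
  have : (f.sum fun i a => a • ex i) = evalEx f := by
    ext x
    simp [evalEx, Finsupp.sum, Finset.sum_apply]
  rw [this, eq_comm]

lemma evalEx_mem (f : (Fin n → ℤ) →₀ ℂ) : evalEx f ∈ expPoly n := mem_expPoly_iff.2 ⟨f, rfl⟩

lemma analyticOnNhd_expPoly {F : (Fin n → ℂ) → ℂ} (hF : F ∈ expPoly n) :
    AnalyticOnNhd ℂ F Set.univ :=
  expPoly_induction (p := fun F => AnalyticOnNhd ℂ F Set.univ) analyticOnNhd_ex
    analyticOnNhd_const (fun _ _ hF hG => hF.add hG)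
    (fun _ _ hF => hF.const_smul) hF

lemma differentiable_expPoly {F : (Fin n → ℂ) → ℂ} (hF : F ∈ expPoly n) : Differentiable ℂ F :=
  fun x => (analyticOnNhd_expPoly hF x trivial).differentiableAt

lemma continuous_expPoly {F : (Fin n → ℂ) → ℂ} (hF : F ∈ expPoly n) : Continuous F :=
  (differentiable_expPoly hF).continuous

lemma isOpen_dense_ne_zero {F : (Fin n → ℂ) → ℂ} (hF : F ∈ expPoly n) (h : F ≠ 0) :
    IsOpen {x | F x ≠ 0} ∧ Dense {x | F x ≠ 0} := by
  refine ⟨isOpen_ne_fun (continuous_expPoly hF) continuous_const, ?_⟩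
  rw [dense_iff_inter_open]
  intro U hU ⟨x, hx⟩
  by_contra hne
  apply h
  have h0 : F =ᶠ[𝓝 x] 0 := by
    filter_upwards [hU.mem_nhds hx] with y hy
    by_contra hy'
    exact hne ⟨y, hy, hy'⟩
  ext y
  exact (analyticOnNhd_expPoly hF).eqOn_zero_of_preconnected_of_eventuallyEq_zero
    isPreconnected_univ (Set.mem_univ x) h0 (Set.mem_univ y)

lemma expPoly_mul_eq_zero {F G : (Fin n → ℂ) → ℂ} (hF : F ∈ expPoly n) (hG : G ∈ expPoly n)
    (h : ∀ x, F x * G x = 0) (hF0 : F ≠ 0) : G = 0 := by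
  obtain ⟨-, hd⟩ := isOpen_dense_ne_zero hF hF0
  refine Continuous.ext_on hd (continuous_expPoly hG) continuous_const fun x hx => ?_
  exact (mul_eq_zero.1 (h x)).resolve_left hx

lemma expPoly_prod_ne_zero {ι : Type*} (s : Finset ι) {F : ι → (Fin n → ℂ) → ℂ}
    (hF : ∀ i ∈ s, F i ∈ expPoly n) (h : ∀ i ∈ s, F i ≠ 0) : (∏ i ∈ s, F i) ≠ 0 := by
  classical
  induction s using Finset.induction_on with
  | empty => simp
  | insert a s ha ih =>
    rw [Finset.prod_insert ha]
    intro h0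
    have hs : ∏ i ∈ s, F i ∈ expPoly n :=
      Subalgebra.prod_mem _ fun i hi => hF i (Finset.mem_insert_of_mem hi)
    exact ih (fun i hi => hF i (Finset.mem_insert_of_mem hi))
      (fun i hi => h i (Finset.mem_insert_of_mem hi))
      (expPoly_mul_eq_zero (hF a (Finset.mem_insert_self _ _)) hs (fun x => congrFun h0 x)
        (h a (Finset.mem_insert_self _ _)))

lemma expPoly_comp {σ : (Fin n → ℂ) → (Fin n → ℂ)} (hσ : ∀ κ, ex κ ∘ σ ∈ expPoly n)
    {F : (Fin n → ℂ) → ℂ} (hF : F ∈ expPoly n) : F ∘ σ ∈ expPoly n :=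
  expPoly_induction (p := fun F => F ∘ σ ∈ expPoly n) hσ (zero_mem (expPoly n))
    (fun _ _ hF hG => add_mem hF hG) (fun c _ hF => (expPoly n).smul_mem hF c) hF

lemma const_mem (c : ℂ) : (fun _ => c) ∈ expPoly n := (expPoly n).algebraMap_mem c

lemma expPoly_translate (a : Fin n → ℂ) {F : (Fin n → ℂ) → ℂ} (hF : F ∈ expPoly n) :
    (fun x => F (x + a)) ∈ expPoly n := by
  refine expPoly_comp (σ := fun x => x + a) (fun κ => ?_) hF
  have : ex κ ∘ (fun x => x + a) = ex κ * fun _ => ex κ a := funext fun x => ex_apply_add _ _ _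
  rw [this]
  exact mul_mem (ex_mem κ) (const_mem _)

/-- The exponentials restricted to real arguments are linearly independent. -/
lemma evalEx_real_injective {f : (Fin n → ℤ) →₀ ℂ}
    (h : ∀ x : Fin n → ℝ, evalEx f (fun j => (x j : ℂ)) = 0) : f = 0 := by
  let χ : (Fin n → ℤ) → (Multiplicative (Fin n → ℝ) →* ℂ) := fun κ =>
    { toFun := fun x => ex κ (fun j => ((Multiplicative.toAdd x) j : ℂ))
      map_one' := by simp [ex]
      map_mul' := fun x y => by
        rw [← ex_apply_add]
        congr 1
        ext j
        simp }
  have hχ : Function.Injective χ := by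
    intro κ κ' hκ
    ext j
    by_contra hne
    have hne' : ((κ j : ℂ) - κ' j) ≠ 0 := by
      rw [sub_ne_zero]; exact_mod_cast hne
    have h1 := DFunLike.congr_fun hκ
      (Multiplicative.ofAdd (Pi.single j (Real.pi / ((κ j : ℝ) - κ' j))))
    have h2 : ∀ κ : Fin n → ℤ, ∑ i, (κ i : ℂ) *
        (((Pi.single j (Real.pi / ((κ j : ℝ) - κ' j)) : Fin n → ℝ) i : ℝ) : ℂ) = (κ j : ℂ) *
        ((Real.pi / ((κ j : ℝ) - κ' j) : ℝ) : ℂ) := by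
      intro κ
      rw [Finset.sum_eq_single j]
      · simp
      · intro i _ hi; simp [hi]
      · simp
    have h3 : ∀ (κ : Fin n → ℤ) (r : ℝ), ∑ i, (κ i : ℂ) *
        (((Pi.single j r : Fin n → ℝ) i : ℝ) : ℂ) = (κ j : ℂ) * (r : ℂ) := by
      intro κ r
      rw [Finset.sum_eq_single j]
      · simp
      · intro i _ hi; simp [hi]
      · simp
    simp only [χ, ex, MonoidHom.coe_mk, OneHom.coe_mk, toAdd_ofAdd, h3] at h1
    have h4 : Complex.exp (Complex.I * ((κ j : ℂ) * ((Real.pi / ((κ j : ℝ) - κ' j) : ℝ) : ℂ)) -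
        Complex.I * ((κ' j : ℂ) * ((Real.pi / ((κ j : ℝ) - κ' j) : ℝ) : ℂ))) = 1 := by
      rw [Complex.exp_sub, h1, div_self (Complex.exp_ne_zero _)]
    have h5 : Complex.I * ((κ j : ℂ) * ((Real.pi / ((κ j : ℝ) - κ' j) : ℝ) : ℂ)) -
        Complex.I * ((κ' j : ℂ) * ((Real.pi / ((κ j : ℝ) - κ' j) : ℝ) : ℂ)) =
        Real.pi * Complex.I := by
      push_cast
      field_simp
    rw [h5, Complex.exp_pi_mul_I] at h4
    norm_num at h4
  have hli := (linearIndependent_monoidHom (Multiplicative (Fin n → ℝ)) ℂ).comp χ hχ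
  rw [linearIndependent_iff] at hli
  apply hli
  ext x
  have := h (Multiplicative.toAdd x)
  rw [Finsupp.linearCombination_apply, Finsupp.sum, Finset.sum_apply]
  exact this

lemma evalEx_injective {f g : (Fin n → ℤ) →₀ ℂ} (h : evalEx f = evalEx g) : f = g := by
  rw [← sub_eq_zero]
  refine evalEx_real_injective fun x => ?_
  have h1 := congrFun h (fun j => (x j : ℂ))
  rw [evalEx, Finsupp.sum_sub_index (fun κ a b => by ring)]
  exact sub_eq_zero.2 h1

lemma expPoly_eq_of_real {F G : (Fin n → ℂ) → ℂ} (hF : F ∈ expPoly n) (hG : G ∈ expPoly n)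
    (h : ∀ x : Fin n → ℝ, F (fun j => (x j : ℂ)) = G (fun j => (x j : ℂ))) : F = G := by
  obtain ⟨f, hf⟩ := mem_expPoly_iff.1 (sub_mem hF hG)
  have : f = 0 := evalEx_real_injective fun x => by
    rw [← hf, Pi.sub_apply, h, sub_self]
  rw [this] at hf
  rw [← sub_eq_zero, hf]
  ext x
  simp [evalEx]

/-! ### Divisibility -/

/-- The affine function `α·x + c`. -/
def aff (α : Fin n → ℤ) (c : ℂ) (x : Fin n → ℂ) : ℂ := ∑ j, (α j : ℂ) * x j + c

/-- The divisor `1 - exp (i (α·x + c))`. -/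
def dv (α : Fin n → ℤ) (c : ℂ) (x : Fin n → ℂ) : ℂ := 1 - Complex.exp (Complex.I * aff α c x)

lemma exp_aff (α : Fin n → ℤ) (c : ℂ) (x : Fin n → ℂ) :
    Complex.exp (Complex.I * aff α c x) = ex α x * Complex.exp (Complex.I * c) := by
  rw [aff, ex, ← Complex.exp_add, mul_add]

lemma exp_aff_mem (α : Fin n → ℤ) (c : ℂ) :
    (fun x => Complex.exp (Complex.I * aff α c x)) ∈ expPoly n := by
  simp only [exp_aff]
  exact mul_mem (ex_mem α) (const_mem _)

lemma dv_mem (α : Fin n → ℤ) (c : ℂ) : dv α c ∈ expPoly n :=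
  sub_mem (one_mem _) (exp_aff_mem α c)

/-- The projection onto the hyperplane `α·x + c = 0` along the `j`-th axis, where `α j = ±1`. -/
def proj (α : Fin n → ℤ) (c : ℂ) (j : Fin n) (x : Fin n → ℂ) : Fin n → ℂ :=
  x - Pi.single j ((α j : ℂ) * aff α c x)

lemma sum_mul_single (κ : Fin n → ℤ) (j : Fin n) (z : ℂ) :
    ∑ i, (κ i : ℂ) * (Pi.single j z : Fin n → ℂ) i = κ j * z := by
  rw [Finset.sum_eq_single j]
  · simp
  · intro i _ hi; simp [hi]
  · simp

lemma aff_add (α : Fin n → ℤ) (c : ℂ) (x y : Fin n → ℂ) :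
    aff α c (x + y) = aff α c x + ∑ j, (α j : ℂ) * y j := by
  simp only [aff, Pi.add_apply, mul_add, Finset.sum_add_distrib]; ring

lemma aff_sub_single (α : Fin n → ℤ) (c : ℂ) (x : Fin n → ℂ) (j : Fin n) (z : ℂ) :
    aff α c (x - Pi.single j z) = aff α c x - α j * z := by
  have h := sum_mul_single α j z
  simp only [aff, Pi.sub_apply, mul_sub, Finset.sum_sub_distrib, h]; ring

lemma aff_proj (α : Fin n → ℤ) (c : ℂ) {j : Fin n} (hj : α j * α j = 1) (x : Fin n → ℂ) :
    aff α c (proj α c j x) = 0 := by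
  have h : (α j : ℂ) * α j = 1 := by exact_mod_cast hj
  rw [proj, aff_sub_single, ← mul_assoc, h]; ring

lemma proj_of_aff_eq_zero (α : Fin n → ℤ) (c : ℂ) (j : Fin n) {x : Fin n → ℂ}
    (h : aff α c x = 0) : proj α c j x = x := by
  simp [proj, h]

lemma ex_proj (κ α : Fin n → ℤ) (c : ℂ) (j : Fin n) (x : Fin n → ℂ) :
    ex κ (proj α c j x) = ex κ x * Complex.exp (Complex.I * aff α c x) ^ (-(κ j * α j)) := by
  have h := sum_mul_single κ j ((α j : ℂ) * aff α c x)
  rw [← Complex.exp_int_mul, ex, ex, ← Complex.exp_add]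
  congr 1
  simp only [proj, Pi.sub_apply, mul_sub, Finset.sum_sub_distrib, h]
  push_cast; ring

lemma exp_aff_zpow_mem (α : Fin n → ℤ) (c : ℂ) (m : ℤ) :
    (fun x => Complex.exp (Complex.I * aff α c x) ^ m) ∈ expPoly n := by
  have : (fun x => Complex.exp (Complex.I * aff α c x) ^ m) =
      fun x => Complex.exp (Complex.I * aff (m • α) (m * c) x) := by
    ext x
    rw [← Complex.exp_int_mul]
    congr 1
    simp only [aff, Pi.smul_apply, smul_eq_mul, Int.cast_mul, mul_assoc, ← Finset.mul_sum]
    ring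
  rw [this]
  exact exp_aff_mem _ _

lemma proj_mem (α : Fin n → ℤ) (c : ℂ) (j : Fin n) {F : (Fin n → ℂ) → ℂ} (hF : F ∈ expPoly n) :
    F ∘ proj α c j ∈ expPoly n := by
  refine expPoly_comp (fun κ => ?_) hF
  have : ex κ ∘ proj α c j =
      ex κ * fun x => Complex.exp (Complex.I * aff α c x) ^ (-(κ j * α j)) :=
    funext fun x => ex_proj _ _ _ _ _
  rw [this]
  exact mul_mem (ex_mem _) (exp_aff_zpow_mem _ _ _)

lemma one_sub_zpow_dvd (α : Fin n → ℤ) (c : ℂ) (m : ℤ) :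
    ∃ Q ∈ expPoly n, ∀ x, 1 - Complex.exp (Complex.I * aff α c x) ^ m = dv α c x * Q x := by
  have hnat : ∀ k : ℕ, ∃ Q ∈ expPoly n, ∀ x,
      1 - Complex.exp (Complex.I * aff α c x) ^ k = dv α c x * Q x := by
    intro k
    refine ⟨∑ i ∈ Finset.range k, (fun x => Complex.exp (Complex.I * aff α c x)) ^ i,
      sum_mem fun i _ => pow_mem (exp_aff_mem _ _) _, fun x => ?_⟩
    have := mul_neg_geom_sum (Complex.exp (Complex.I * aff α c x)) k
    rw [Finset.sum_apply]
    simp only [Pi.pow_apply, dv]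
    exact this.symm
  obtain ⟨k, rfl | rfl⟩ := m.eq_nat_or_neg
  · simpa using hnat k
  · obtain ⟨Q, hQ, h⟩ := hnat k
    refine ⟨-(fun x => Complex.exp (Complex.I * aff α c x) ^ (-(k : ℤ))) * Q,
      mul_mem (neg_mem (exp_aff_zpow_mem _ _ _)) hQ, fun x => ?_⟩
    have h0 := Complex.exp_ne_zero (Complex.I * aff α c x)
    have := h x
    simp only [Pi.mul_apply, Pi.neg_apply, zpow_neg, zpow_natCast]
    rw [mul_left_comm, ← this]
    field_simp
    ring

lemma sub_proj_dvd (α : Fin n → ℤ) (c : ℂ) (j : Fin n) {F : (Fin n → ℂ) → ℂ}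
    (hF : F ∈ expPoly n) :
    ∃ Q ∈ expPoly n, ∀ x, F x - F (proj α c j x) = dv α c x * Q x := by
  refine expPoly_induction (p := fun F => ∃ Q ∈ expPoly n, ∀ x,
    F x - F (proj α c j x) = dv α c x * Q x) (fun κ => ?_) ⟨0, zero_mem _, by simp⟩ ?_ ?_ hF
  · obtain ⟨Q, hQ, h⟩ := one_sub_zpow_dvd α c (-(κ j * α j))
    refine ⟨ex κ * Q, mul_mem (ex_mem _) hQ, fun x => ?_⟩
    rw [ex_proj, Pi.mul_apply, mul_left_comm, ← h]; ring
  · rintro F G ⟨Q, hQ, h⟩ ⟨R, hR, h'⟩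
    refine ⟨Q + R, add_mem hQ hR, fun x => ?_⟩
    simp only [Pi.add_apply, mul_add, ← h, ← h']; ring
  · rintro a F ⟨Q, hQ, h⟩
    refine ⟨a • Q, (expPoly n).smul_mem hQ a, fun x => ?_⟩
    simp only [Pi.smul_apply, smul_eq_mul, mul_left_comm _ a, ← h]; ring

/-- An exponential polynomial that vanishes on the hyperplane `α·x + c = 0` is divisible by
`1 - exp (i (α·x + c))`. -/
lemma dv_dvd (α : Fin n → ℤ) (c : ℂ) {j : Fin n} (hj : α j * α j = 1) {F : (Fin n → ℂ) → ℂ}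
    (hF : F ∈ expPoly n) (h : ∀ x, aff α c x = 0 → F x = 0) :
    ∃ Q ∈ expPoly n, ∀ x, F x = dv α c x * Q x := by
  obtain ⟨Q, hQ, hd⟩ := sub_proj_dvd α c j hF
  refine ⟨Q, hQ, fun x => ?_⟩
  rw [← hd, h _ (aff_proj α c hj x), sub_zero]

end

end Koornwinder

namespace Koornwinder

open Filter Topology

noncomputable section

variable {n : ℕ}

/-! ### Permutations and sign changes -/

/-- A permutation of the coordinates together with a choice of signs. -/
abbrev SP (n : ℕ) : Type := Equiv.Perm (Fin n) × (Fin n → ℤˣ)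

/-- The action of a signed permutation on vectors. -/
def act {R : Type*} [Ring R] (w : SP n) (x : Fin n → R) : Fin n → R :=
  fun j => ((w.2 j : ℤ) : R) * x (w.1 j)

/-- The inverse of a signed permutation. -/
def invSP (w : SP n) : SP n := (w.1⁻¹, fun j => w.2 (w.1⁻¹ j))

/-- The signed permutation that acts as `w` after `w'`. -/
def compSP (w w' : SP n) : SP n := (w'.1 * w.1, fun j => w.2 j * w'.2 (w.1 j))

lemma units_int_mul_self {R : Type*} [Ring R] (u : ℤˣ) : ((u : ℤ) : R) * ((u : ℤ) : R) = 1 := by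
  rw [← Int.cast_mul]
  have : (u : ℤ) * u = 1 := by rw [← Units.val_mul, Int.units_mul_self]; rfl
  simp [this]

section act

variable {R : Type*} [CommRing R]

lemma act_act (w w' : SP n) (x : Fin n → R) : act w (act w' x) = act (compSP w w') x := by
  ext j
  simp [act, compSP, mul_assoc]

lemma act_invSP (w : SP n) (x : Fin n → R) : act w (act (invSP w) x) = x := by
  ext j
  simp [act, invSP, ← mul_assoc, units_int_mul_self]

lemma invSP_act (w : SP n) (x : Fin n → R) : act (invSP w) (act w x) = x := by
  ext j
  simp [act, invSP, ← mul_assoc, units_int_mul_self]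

lemma act_add (w : SP n) (x y : Fin n → R) : act w (x + y) = act w x + act w y := by
  ext j; simp [act, mul_add]

lemma act_smul (w : SP n) (c : R) (x : Fin n → R) : act w (c • x) = c • act w x := by
  ext j; simp [act, mul_left_comm]

lemma act_intCast (w : SP n) (κ : Fin n → ℤ) :
    act w (fun j => (κ j : R)) = fun j => ((act w κ j : ℤ) : R) := by
  ext j; simp [act]

lemma sum_mul_act (w : SP n) (x y : Fin n → R) :
    ∑ j, x j * act w y j = ∑ j, act (invSP w) x j * y j := by
  rw [← Equiv.sum_comp w.1 fun j => act (invSP w) x j * y j]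
  refine Finset.sum_congr rfl fun j _ => ?_
  simp [act, invSP]; ring

end act

lemma ex_act (w : SP n) (κ : Fin n → ℤ) (x : Fin n → ℂ) :
    ex κ (act w x) = ex (act (invSP w) κ) x := by
  rw [ex, ex, sum_mul_act, act_intCast]

lemma mem_orbit {l κ : Fin n → ℤ} : κ ∈ orbit l ↔ ∃ w : SP n, act w l = κ := by
  simp only [orbit, Finset.mem_image, Finset.mem_univ, true_and]
  rfl

lemma self_mem_orbit (l : Fin n → ℤ) : l ∈ orbit l :=
  mem_orbit.2 ⟨(1, 1), by ext j; simp [act]⟩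

lemma act_mem_orbit {l κ : Fin n → ℤ} (w : SP n) (h : κ ∈ orbit l) : act w κ ∈ orbit l := by
  obtain ⟨w', rfl⟩ := mem_orbit.1 h
  exact mem_orbit.2 ⟨compSP w w', (act_act w w' l).symm⟩

lemma orbit_eq_of_mem {l κ : Fin n → ℤ} (h : κ ∈ orbit l) : orbit κ = orbit l := by
  obtain ⟨w, rfl⟩ := mem_orbit.1 h
  ext μ
  constructor
  · intro hμ
    obtain ⟨w', rfl⟩ := mem_orbit.1 hμ
    exact act_mem_orbit _ h
  · intro hμ
    obtain ⟨w', rfl⟩ := mem_orbit.1 hμ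
    have := act_mem_orbit (compSP w' (invSP w)) (self_mem_orbit (act w l))
    rwa [← act_act, invSP_act] at this

/-- Invariance under permutations and sign changes. -/
def Inv (F : (Fin n → ℂ) → ℂ) : Prop := ∀ (w : SP n) x, F (act w x) = F x

lemma monomial_eq_sum_ex (l : Fin n → ℤ) (x : Fin n → ℂ) :
    monomial l x = ∑ κ ∈ orbit l, ex κ x := rfl

lemma monomial_mem (l : Fin n → ℤ) : monomial l ∈ expPoly n := by
  have : monomial l = ∑ κ ∈ orbit l, ex κ := by
    ext x; simp [monomial_eq_sum_ex]
  rw [this]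
  exact sum_mem fun κ _ => ex_mem κ

lemma monomial_inv (l : Fin n → ℤ) : Inv (monomial l) := by
  intro w x
  simp only [monomial_eq_sum_ex, ex_act]
  refine Finset.sum_nbij' (act (invSP w)) (act w) (fun κ h => act_mem_orbit _ h)
    (fun κ h => act_mem_orbit _ h) (fun κ _ => act_invSP w κ) (fun κ _ => invSP_act w κ)
    fun κ _ => rfl

lemma exists_dominant (κ : Fin n → ℤ) : ∃ w : SP n, Dominant (act w κ) := by
  let σ := Tuple.sort fun j => -|κ j|
  have hσ : Monotone ((fun j => -|κ j|) ∘ σ) := Tuple.monotone_sort _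
  have key : ∀ j, ∃ u : ℤˣ, (u : ℤ) * κ (σ j) = |κ (σ j)| := by
    intro j
    rcases le_total 0 (κ (σ j)) with h | h
    · exact ⟨1, by simp [abs_of_nonneg h]⟩
    · exact ⟨-1, by simp [abs_of_nonpos h]⟩
  choose u hu using key
  have : act (σ, u) κ = fun j => |κ (σ j)| := by
    ext j; simp [act, hu]
  refine ⟨(σ, u), ?_⟩
  rw [this]
  exact ⟨fun i j hij => neg_le_neg_iff.1 (hσ hij), fun j => abs_nonneg _⟩

lemma sum_act_le {l : Fin n → ℤ} (hl : Dominant l) (w : SP n) (k : Fin n) :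
    ∑ j ∈ Finset.Iic k, act w l j ≤ ∑ j ∈ Finset.Iic k, l j := by
  classical
  have h1 : ∑ j ∈ Finset.Iic k, act w l j ≤ ∑ j ∈ Finset.Iic k, l (w.1 j) := by
    refine Finset.sum_le_sum fun j _ => ?_
    have := hl.2 (w.1 j)
    rcases Int.units_eq_one_or (w.2 j) with h | h
    · simp [act, h]
    · simp [act, h]; omega
  refine h1.trans ?_
  have h2 : ∑ j ∈ Finset.Iic k, (l (w.1 j) - l k) ≤ ∑ j ∈ Finset.Iic k, (l j - l k) := by
    rw [← Finset.sum_image (f := fun j => l j - l k) (g := w.1) (s := Finset.Iic k)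
      (fun a _ b _ h => w.1.injective h)]
    refine le_trans ?_ (Finset.sum_le_sum_of_subset_of_nonneg
      (s := ((Finset.Iic k).image w.1).filter (· ∈ Finset.Iic k)) ?_ ?_)
    · rw [Finset.sum_filter]
      refine Finset.sum_le_sum fun j _ => ?_
      split_ifs with h
      · exact le_rfl
      · have := hl.1 (le_of_lt (not_le.1 (fun h' => h (Finset.mem_Iic.2 h'))))
        linarith
    · intro j hj; exact (Finset.mem_filter.1 hj).2
    · intro j hj _
      exact sub_nonneg.2 (hl.1 (Finset.mem_Iic.1 hj))
  simp only [Finset.sum_sub_distrib] at h2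
  linarith

/-! ### Coefficients of exponential polynomials -/

lemma evalEx_add (f g : (Fin n → ℤ) →₀ ℂ) : evalEx (f + g) = evalEx f + evalEx g := by
  ext x
  exact Finsupp.sum_add_index' (fun _ => by simp) fun _ _ _ => by ring

lemma evalEx_smul (c : ℂ) (f : (Fin n → ℤ) →₀ ℂ) : evalEx (c • f) = c • evalEx f := by
  ext x
  rw [evalEx, Finsupp.sum_smul_index' (by simp), Pi.smul_apply, evalEx, Finsupp.sum,
    Finsupp.sum, Finset.smul_sum]
  exact Finset.sum_congr rfl fun _ _ => by simp [mul_assoc]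

lemma evalEx_eq_sum (f : (Fin n → ℤ) →₀ ℂ) (x : Fin n → ℂ) :
    evalEx f x = ∑ κ ∈ f.support, f κ * ex κ x := rfl

open Classical in
/-- The coefficients of `m_l`. -/
def monoCoeff (l : Fin n → ℤ) : (Fin n → ℤ) →₀ ℂ :=
  Finsupp.onFinset (orbit l) (fun κ => if κ ∈ orbit l then 1 else 0) fun κ h => by
    by_contra h'; simp [h'] at h

lemma monoCoeff_apply (l κ : Fin n → ℤ) [Decidable (κ ∈ orbit l)] :
    monoCoeff l κ = if κ ∈ orbit l then 1 else 0 := by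
  simp only [monoCoeff, Finsupp.onFinset_apply]
  congr

lemma evalEx_monoCoeff (l : Fin n → ℤ) : evalEx (monoCoeff l) = monomial l := by
  classical
  ext x
  rw [evalEx, monoCoeff, Finsupp.onFinset_sum _ (by simp), monomial_eq_sum_ex]
  exact Finset.sum_congr rfl fun κ h => by simp [h]

lemma coeff_inv {f : (Fin n → ℤ) →₀ ℂ} (hf : Inv (evalEx f)) (w : SP n) (κ : Fin n → ℤ) :
    f (act w κ) = f κ := by
  let e : (Fin n → ℤ) ≃ (Fin n → ℤ) := ⟨act w, act (invSP w), invSP_act w, act_invSP w⟩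
  have h : evalEx (f.equivMapDomain e) = evalEx f := by
    ext x
    rw [← hf (invSP w) x, evalEx, Finsupp.equivMapDomain_eq_mapDomain,
      Finsupp.sum_mapDomain_index (fun _ => by simp) (fun _ _ _ => by ring), evalEx]
    refine Finset.sum_congr rfl fun κ _ => ?_
    have : invSP (invSP w) = w := by
      ext j <;> simp [invSP]
    simp only
    rw [ex_act, this]; rfl
  have := DFunLike.congr_fun (evalEx_injective h) (act w κ)
  rw [← this, Finsupp.equivMapDomain_apply]
  simp [e, invSP_act]

/-- An invariant exponential polynomial is a combination of the `m_μ` with dominant `μ` in its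
support. -/
lemma inv_mem_span (f : (Fin n → ℤ) →₀ ℂ) (hf : Inv (evalEx f)) :
    evalEx f ∈ Submodule.span ℂ (monomial '' {μ | Dominant μ ∧ f μ ≠ 0}) := by
  classical
  induction hN : f.support.card using Nat.strong_induction_on generalizing f with
  | _ N ih =>
    by_cases h0 : f = 0
    · subst h0
      have : evalEx (0 : (Fin n → ℤ) →₀ ℂ) = 0 := by ext x; simp [evalEx]
      rw [this]; exact zero_mem _
    obtain ⟨κ, hκ⟩ := Finsupp.ne_iff.1 h0
    obtain ⟨w, hw⟩ := exists_dominant κ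
    set μ := act w κ with hμ
    have hfμ : f μ ≠ 0 := by rw [hμ, coeff_inv hf]; exact hκ
    let f' := f + (-f μ) • monoCoeff μ
    have hev : evalEx f' = evalEx f + (-f μ) • monomial μ := by
      rw [evalEx_add, evalEx_smul, evalEx_monoCoeff]
    have hf' : Inv (evalEx f') := by
      intro w x
      rw [hev]
      simp only [Pi.add_apply, Pi.smul_apply, hf w x, monomial_inv μ w x]
    have hval : ∀ ν, f' ν = if ν ∈ orbit μ then 0 else f ν := by
      intro ν
      simp only [f', Finsupp.add_apply, Finsupp.smul_apply, monoCoeff_apply, smul_eq_mul]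
      split_ifs with h
      · obtain ⟨w', rfl⟩ := mem_orbit.1 h
        rw [coeff_inv hf]; ring
      · ring
    have hsub : f'.support ⊂ f.support := by
      rw [Finset.ssubset_iff_of_subset]
      · refine ⟨μ, Finsupp.mem_support_iff.2 hfμ, ?_⟩
        rw [Finsupp.notMem_support_iff, hval, if_pos (self_mem_orbit μ)]
      · intro ν hν
        rw [Finsupp.mem_support_iff, hval] at hν
        rw [Finsupp.mem_support_iff]
        intro h; simp [h] at hν
    have h1 := ih _ (hN ▸ Finset.card_lt_card hsub) f' hf' rfl
    have h2 : evalEx f = evalEx f' + f μ • monomial μ := by rw [hev]; ext x; simp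
    rw [h2]
    refine add_mem (Submodule.span_mono ?_ h1)
      (Submodule.smul_mem _ _ (Submodule.subset_span ⟨μ, ⟨hw, hfμ⟩, rfl⟩))
    refine Set.image_mono ?_
    rintro ν ⟨hν, hν'⟩
    refine ⟨hν, fun h => hν' ?_⟩
    rw [hval, h, ite_self]

/-! ### Growth -/

/-- The point `x - iτω`. -/
def ray (x : Fin n → ℂ) (ω : Fin n → ℤ) (τ : ℝ) : Fin n → ℂ :=
  x + fun j => -(Complex.I * τ * ω j)

lemma aff_ray (α ω : Fin n → ℤ) (c : ℂ) (x : Fin n → ℂ) (τ : ℝ) :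
    aff α c (ray x ω τ) = aff α c x - Complex.I * τ * ((∑ j, α j * ω j : ℤ) : ℂ) := by
  rw [ray, aff_add]
  push_cast
  rw [Finset.mul_sum, sub_eq_add_neg, ← Finset.sum_neg_distrib]
  congr 1
  exact Finset.sum_congr rfl fun j _ => by ring

lemma ex_ray (κ ω : Fin n → ℤ) (x : Fin n → ℂ) (τ : ℝ) :
    ex κ (ray x ω τ) = ex κ x * (Real.exp (τ * (∑ j, κ j * ω j : ℤ)) : ℂ) := by
  have h := aff_ray κ ω 0 x τ
  simp only [aff, add_zero] at h
  rw [ex, h, ex, mul_sub, sub_eq_add_neg, Complex.exp_add, Complex.ofReal_exp]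
  congr 2
  push_cast
  linear_combination (-(τ : ℂ) * (∑ j, (κ j : ℂ) * ω j)) * Complex.I_sq

lemma tendsto_exp_mul_int {m : ℤ} (hm : m < 0) :
    Tendsto (fun τ : ℝ => (Real.exp (τ * m) : ℂ)) atTop (𝓝 0) := by
  rw [← Complex.ofReal_zero]
  refine (Complex.continuous_ofReal.tendsto 0).comp (Real.tendsto_exp_atBot.comp ?_)
  exact tendsto_id.atTop_mul_const_of_neg (by exact_mod_cast hm)

open Classical in
/-- The leading part of an exponential polynomial along a ray. -/
lemma tendsto_evalEx_ray (f : (Fin n → ℤ) →₀ ℂ) (ω : Fin n → ℤ) (M : ℤ)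
    (hM : ∀ κ, f κ ≠ 0 → ∑ j, κ j * ω j ≤ M) (x : Fin n → ℂ) :
    Tendsto (fun τ : ℝ => evalEx f (ray x ω τ) * (Real.exp (τ * (-M : ℤ)) : ℂ)) atTop
      (𝓝 (evalEx (f.filter fun κ => ∑ j, κ j * ω j = M) x)) := by
  have h : evalEx (f.filter fun κ => ∑ j, κ j * ω j = M) x =
      ∑ κ ∈ f.support, if ∑ j, κ j * ω j = M then f κ * ex κ x else 0 := by
    rw [evalEx_eq_sum, Finsupp.support_filter, Finset.sum_filter]
    refine Finset.sum_congr rfl fun κ _ => ?_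
    split_ifs with h
    · rw [Finsupp.filter_apply_pos (fun κ => ∑ j, κ j * ω j = M) f h]
    · rfl
  rw [h]
  simp only [evalEx_eq_sum, Finset.sum_mul]
  refine tendsto_finsetSum _ fun κ hκ => ?_
  have h1 : ∀ τ : ℝ, f κ * ex κ (ray x ω τ) * (Real.exp (τ * (-M : ℤ)) : ℂ) =
      f κ * ex κ x * (Real.exp (τ * ((∑ j, κ j * ω j) - M : ℤ)) : ℂ) := by
    intro τ
    rw [ex_ray, mul_assoc, mul_assoc, mul_assoc, ← Complex.ofReal_mul, ← Real.exp_add]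
    congr 5
    push_cast; ring
  simp only [h1]
  split_ifs with h2
  · rw [h2]; simp
  · rw [← mul_zero (f κ * ex κ x)]
    refine tendsto_const_nhds.mul (tendsto_exp_mul_int ?_)
    have := hM κ (Finsupp.mem_support_iff.1 hκ)
    omega

/-- An exponential polynomial that grows along generic rays in the direction `ω` at most as
`exp (Mτ)` has no exponents `κ` with `κ·ω > M`. -/
lemma coeff_eq_zero_of_growth (f : (Fin n → ℤ) →₀ ℂ) (ω : Fin n → ℤ) (M : ℤ)
    {s : Set (Fin n → ℂ)} (hs : Dense s)
    (h : ∀ x ∈ s, ∃ L, Tendsto (fun τ : ℝ => evalEx f (ray x ω τ) * (Real.exp (τ * (-M : ℤ)) : ℂ))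
      atTop (𝓝 L))
    {κ : Fin n → ℤ} (hκ : M < ∑ j, κ j * ω j) : f κ = 0 := by
  classical
  by_contra hne
  obtain ⟨κ₀, hκ₀, hmax⟩ := Finset.exists_max_image f.support (fun κ => ∑ j, κ j * ω j)
    ⟨κ, Finsupp.mem_support_iff.2 hne⟩
  set M' := ∑ j, κ₀ j * ω j with hM'
  have hMM' : M < M' := hκ.trans_le (hmax κ (Finsupp.mem_support_iff.2 hne))
  have h0 : evalEx (f.filter fun κ => ∑ j, κ j * ω j = M') = evalEx 0 := by
    refine Continuous.ext_on hs (continuous_expPoly (evalEx_mem _))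
      (continuous_expPoly (evalEx_mem _)) fun x hx => ?_
    obtain ⟨L, hL⟩ := h x hx
    have h1 := tendsto_evalEx_ray f ω M'
      (fun κ hκ => hmax κ (Finsupp.mem_support_iff.2 hκ)) x
    have h2 := hL.mul (tendsto_exp_mul_int (m := M - M') (by omega))
    rw [mul_zero] at h2
    have h3 : (evalEx 0 x : ℂ) = 0 := by simp [evalEx]
    rw [h3]
    refine tendsto_nhds_unique h1 (h2.congr fun τ => ?_)
    rw [mul_assoc, ← Complex.ofReal_mul, ← Real.exp_add]
    congr 3
    push_cast; ring
  have := DFunLike.congr_fun (evalEx_injective h0) κ₀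
  rw [Finsupp.filter_apply_pos (fun κ => ∑ j, κ j * ω j = M') f hM'.symm] at this
  exact Finsupp.mem_support_iff.1 hκ₀ this

end

end Koornwinder

namespace Koornwinder

open Filter Topology

noncomputable section

variable {n : ℕ}

/-! ### Products over pairs -/

section pairProd

variable {M : Type*} [CommMonoid M]

/-- The product over the pairs `j < k` in `J`. -/
def pairProd (J : Finset (Fin n)) (s : Fin n → Fin n → M) : M := ∏ j ∈ J, ∏ k ∈ J with j < k, s j k

lemma pairProd_insert {J : Finset (Fin n)} {a : Fin n} (ha : a ∉ J) {s : Fin n → Fin n → M}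
    (hs : ∀ j k, s j k = s k j) :
    pairProd (insert a J) s = pairProd J s * ∏ j ∈ J, s a j := by
  have h1 : ∀ j ∈ J, ∏ k ∈ insert a J with j < k, s j k =
      (if j < a then s j a else 1) * ∏ k ∈ J with j < k, s j k := by
    intro j _
    rw [Finset.prod_filter, Finset.prod_insert ha, Finset.prod_filter]
  have h2 : ∏ k ∈ insert a J with a < k, s a k = ∏ k ∈ J, if a < k then s a k else 1 := by
    rw [Finset.prod_filter, Finset.prod_insert ha, if_neg (lt_irrefl a), one_mul]
  rw [pairProd, Finset.prod_insert ha, Finset.prod_congr rfl h1, Finset.prod_mul_distrib, h2,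
    ← mul_assoc, ← Finset.prod_mul_distrib, mul_comm, pairProd]
  congr 1
  refine Finset.prod_congr rfl fun j hj => ?_
  rcases lt_trichotomy a j with h | h | h
  · simp [h, h.not_gt]
  · exact absurd (h ▸ hj) ha
  · simp [h, h.not_gt, hs j a]

lemma pairProd_empty (s : Fin n → Fin n → M) : pairProd ∅ s = 1 := by simp [pairProd]

lemma pairProd_congr {J : Finset (Fin n)} {s s' : Fin n → Fin n → M}
    (h : ∀ j ∈ J, ∀ k ∈ J, j ≠ k → s j k = s' j k) : pairProd J s = pairProd J s' := by
  refine Finset.prod_congr rfl fun j hj => Finset.prod_congr rfl fun k hk => ?_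
  rw [Finset.mem_filter] at hk
  exact h j hj k hk.1 hk.2.ne

lemma pairProd_mul (J : Finset (Fin n)) (s s' : Fin n → Fin n → M) :
    (pairProd J fun j k => s j k * s' j k) = pairProd J s * pairProd J s' := by
  simp only [pairProd, Finset.prod_mul_distrib]

lemma pairProd_union {J K : Finset (Fin n)} (h : Disjoint J K) {s : Fin n → Fin n → M}
    (hs : ∀ j k, s j k = s k j) :
    pairProd (J ∪ K) s = pairProd J s * pairProd K s * ∏ j ∈ J, ∏ k ∈ K, s j k := by
  induction J using Finset.induction_on with
  | empty => simp [pairProd_empty]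
  | insert a J ha ih =>
    rw [Finset.disjoint_insert_left] at h
    rw [Finset.insert_union, pairProd_insert (by simp [ha, h.1]) hs, ih h.2,
      pairProd_insert ha hs, Finset.prod_union h.2, Finset.prod_insert ha]
    ac_rfl

lemma pairProd_map (e : Equiv.Perm (Fin n)) (J : Finset (Fin n)) {s : Fin n → Fin n → M}
    (hs : ∀ j k, s j k = s k j) :
    pairProd (J.map e.toEmbedding) s = pairProd J fun j k => s (e j) (e k) := by
  induction J using Finset.induction_on with
  | empty => simp [pairProd_empty]
  | insert a J ha ih =>
    rw [Finset.map_insert, pairProd_insert (by simpa using ha) hs, ih,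
      pairProd_insert ha fun j k => hs _ _, Finset.prod_map]
    rfl

end pairProd

/-! ### The coefficients in exponential form -/

variable (P : Params)

/-- The elementary quotient `exp (βs/2) (1 - exp (-βs) exp (iz)) / (1 - exp (iz))`. -/
def qt (s : ℝ) (z : ℂ) : ℂ :=
  Complex.exp (P.β * s / 2) * ((1 - Complex.exp (-(P.β * s)) * Complex.exp (Complex.I * z)) /
    (1 - Complex.exp (Complex.I * z)))

lemma sin_eq_exp (w : ℂ) : Complex.sin w =
    Complex.I / 2 * (Complex.exp (-(Complex.I * w)) * (1 - Complex.exp (Complex.I * (2 * w)))) := by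
  have h1 : Complex.exp (Complex.I * (2 * w)) =
      Complex.exp (Complex.I * w) * Complex.exp (Complex.I * w) := by
    rw [← Complex.exp_add]; ring_nf
  have h2 : Complex.exp (-(Complex.I * w)) * Complex.exp (Complex.I * w) = 1 := by
    rw [← Complex.exp_add]; simp
  rw [Complex.sin, h1, show -w * Complex.I = -(Complex.I * w) by ring,
    show w * Complex.I = Complex.I * w by ring]
  linear_combination (Complex.I / 2 * Complex.exp (Complex.I * w)) * h2

lemma sin_div_sin (s : ℝ) (z : ℂ) :
    Complex.sin ((Complex.I * P.β * s + z) / 2) / Complex.sin (z / 2) = qt P s z := by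
  have hI : (Complex.I / 2 : ℂ) ≠ 0 := by simp
  rw [sin_eq_exp, sin_eq_exp, mul_div_mul_left _ _ hI, mul_div_mul_comm, qt, ← Complex.exp_sub,
    ← Complex.exp_add]
  congr 2
  · linear_combination (-(P.β : ℂ) * s / 2) * Complex.I_sq
  · congr 2
    linear_combination ((P.β : ℂ) * s) * Complex.I_sq
  · congr 3; ring

lemma cos_div_cos (s : ℝ) (z : ℂ) :
    Complex.cos ((Complex.I * P.β * s + z) / 2) / Complex.cos (z / 2) =
      qt P s (z + Real.pi) := by
  rw [← sin_div_sin, ← Complex.sin_add_pi_div_two, ← Complex.sin_add_pi_div_two]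
  congr 2 <;> ring

lemma va_eq (z : ℂ) : va P z = qt P P.g z := sin_div_sin P _ z

lemma vb_eq (z : ℂ) : vb P z = qt P P.g₀ z * qt P P.g₁ (z + Real.pi) *
    qt P P.g₀' (z + Complex.I * P.β / 2) * qt P P.g₁' (z + (Complex.I * P.β / 2 + Real.pi)) := by
  rw [vb]
  simp only [sin_div_sin, cos_div_cos, add_assoc, add_comm (Complex.I * P.β / 2) z]

lemma qt_congr (s : ℝ) {z w : ℂ} (h : Complex.exp (Complex.I * z) = Complex.exp (Complex.I * w)) :
    qt P s z = qt P s w := by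
  rw [qt, qt, h]

lemma exp_I_add_two_pi (z : ℂ) (m : ℤ) :
    Complex.exp (Complex.I * (z + 2 * Real.pi * m)) = Complex.exp (Complex.I * z) := by
  rw [mul_add, Complex.exp_add, show Complex.I * (2 * Real.pi * m) = m * (2 * Real.pi * Complex.I)
    by ring, Complex.exp_int_mul_two_pi_mul_I, mul_one]

lemma va_add_two_pi (z : ℂ) (m : ℤ) : va P (z + 2 * Real.pi * m) = va P z := by
  rw [va_eq, va_eq, qt_congr P _ (exp_I_add_two_pi z m)]

lemma vb_add_two_pi (z : ℂ) (m : ℤ) : vb P (z + 2 * Real.pi * m) = vb P z := by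
  simp only [vb_eq, add_right_comm z (2 * (Real.pi : ℂ) * m)]
  rw [qt_congr P _ (exp_I_add_two_pi _ m), qt_congr P _ (exp_I_add_two_pi _ m),
    qt_congr P _ (exp_I_add_two_pi _ m), qt_congr P _ (exp_I_add_two_pi _ m)]

/-- The factor of `V` belonging to a pair of indices that are both shifted. -/
def inner2 (κ : Fin n → ℤ) (x : Fin n → ℂ) (j k : Fin n) : ℂ :=
  va P (κ j * x j + κ k * x k) * va P (κ j * x j + κ k * x k + Complex.I * P.β)

/-- The factor of `V` belonging to a pair of indices only the first of which is shifted. -/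
def cross (κ : Fin n → ℤ) (x : Fin n → ℂ) (j k : Fin n) : ℂ :=
  va P (κ j * x j + x k) * va P (κ j * x j - x k)

lemma inner2_comm (κ : Fin n → ℤ) (x : Fin n → ℂ) (j k : Fin n) :
    inner2 P κ x j k = inner2 P κ x k j := by
  simp only [inner2, add_comm ((κ j : ℂ) * x j)]

lemma V_eq (κ : Fin n → ℤ) (J K : Finset (Fin n)) (x : Fin n → ℂ) :
    V P κ J K x = (∏ j ∈ J, vb P (κ j * x j)) * pairProd J (inner2 P κ x) *
      ∏ j ∈ J, ∏ k ∈ K, cross P κ x j k := rfl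

lemma V_congr {κ κ' : Fin n → ℤ} {J K : Finset (Fin n)} (h : ∀ j ∈ J, κ j = κ' j)
    (x : Fin n → ℂ) : V P κ J K x = V P κ' J K x := by
  rw [V_eq, V_eq]
  congr 1
  · congr 1
    · exact Finset.prod_congr rfl fun j hj => by rw [h j hj]
    · exact pairProd_congr fun j hj k hk _ => by rw [inner2, inner2, h j hj, h k hk]
  · exact Finset.prod_congr rfl fun j hj => Finset.prod_congr rfl fun k hk => by
      rw [cross, cross, h j hj]

/-- The coefficient of a step in two disjoint sets of coordinates. -/
lemma V_union (κ : Fin n → ℤ) {M S R : Finset (Fin n)} (h : Disjoint M S) (x : Fin n → ℂ) :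
    V P κ (M ∪ S) R x = V P κ M R x * V P κ S R x * ∏ l ∈ M, ∏ j ∈ S, inner2 P κ x l j := by
  simp only [V_eq]
  rw [Finset.prod_union h, pairProd_union h (inner2_comm P κ x), Finset.prod_union h]
  ring

lemma V_union_right (κ : Fin n → ℤ) {M S R : Finset (Fin n)} (h : Disjoint S R) (x : Fin n → ℂ) :
    V P κ M (S ∪ R) x = V P κ M R x * ∏ l ∈ M, ∏ j ∈ S, cross P κ x l j := by
  simp only [V_eq]
  have : ∏ j ∈ M, ∏ k ∈ S ∪ R, cross P κ x j k =
      (∏ j ∈ M, ∏ k ∈ S, cross P κ x j k) * ∏ j ∈ M, ∏ k ∈ R, cross P κ x j k := by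
    rw [← Finset.prod_mul_distrib]
    exact Finset.prod_congr rfl fun j _ => Finset.prod_union h
  rw [this]
  ring

/-! ### Steps -/

/-- The support of a step. -/
def supp (κ : Fin n → ℤ) : Finset (Fin n) := Finset.univ.filter fun j => κ j ≠ 0

lemma mem_supp {κ : Fin n → ℤ} {j : Fin n} : j ∈ supp κ ↔ κ j ≠ 0 := by simp [supp]

lemma supp_zero : supp (0 : Fin n → ℤ) = ∅ := by simp [supp]

lemma supp_eq_empty {κ : Fin n → ℤ} : supp κ = ∅ ↔ κ = 0 := by
  constructor
  · intro h
    ext j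
    by_contra hj
    have := mem_supp.2 hj
    rw [h] at this
    simp at this
  · rintro rfl; exact supp_zero

lemma card_supp_pos {κ : Fin n → ℤ} (h : κ ≠ 0) : 0 < (supp κ).card :=
  Finset.card_pos.2 (Finset.nonempty_iff_ne_empty.2 fun h' => h (supp_eq_empty.1 h'))

/-- The vectors with entries `0, ±1` supported in `K`. -/
def steps (K : Finset (Fin n)) : Finset (Fin n → ℤ) :=
  Fintype.piFinset fun j => if j ∈ K then {0, 1, -1} else {0}

lemma mem_steps {K : Finset (Fin n)} {κ : Fin n → ℤ} :
    κ ∈ steps K ↔ (∀ j, κ j = 0 ∨ κ j = 1 ∨ κ j = -1) ∧ supp κ ⊆ K := by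
  simp only [steps, Fintype.mem_piFinset]
  constructor
  · intro h
    refine ⟨fun j => ?_, fun j hj => ?_⟩
    · have := h j
      split_ifs at this
      · simpa using this
      · left; simpa using this
    · by_contra hK
      have := h j
      rw [if_neg hK] at this
      exact mem_supp.1 hj (by simpa using this)
  · rintro ⟨h1, h2⟩ j
    split_ifs with hK
    · simpa using h1 j
    · have : j ∉ supp κ := fun h => hK (h2 h)
      rw [mem_supp, not_not] at this
      simp [this]

lemma steps_mono {K L : Finset (Fin n)} (h : K ⊆ L) : steps K ⊆ steps L := fun _ hκ =>
  mem_steps.2 ⟨(mem_steps.1 hκ).1, (mem_steps.1 hκ).2.trans h⟩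

lemma zero_mem_steps (K : Finset (Fin n)) : (0 : Fin n → ℤ) ∈ steps K :=
  mem_steps.2 ⟨fun _ => Or.inl rfl, by simp [supp_zero]⟩

lemma supp_act (w : SP n) (κ : Fin n → ℤ) :
    supp (act (invSP w) κ) = (supp κ).map w.1.toEmbedding := by
  ext j
  rw [mem_supp, Finset.mem_map_equiv, mem_supp]
  simp [act, invSP]

lemma act_mem_steps {w : SP n} {κ : Fin n → ℤ} {K : Finset (Fin n)} :
    act (invSP w) κ ∈ steps (K.map w.1.toEmbedding) ↔ κ ∈ steps K := by
  rw [mem_steps, mem_steps, supp_act, Finset.map_subset_map]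
  refine and_congr_left fun _ => ⟨fun h j => ?_, fun h j => ?_⟩
  · have h1 := h (w.1 j)
    have e : act (invSP w) κ (w.1 j) = w.2 j * κ j := by simp [act, invSP]
    rw [e] at h1
    rcases Int.units_eq_one_or (w.2 j) with h' | h' <;> simp [h'] at h1 <;> omega
  · have h1 := h (w.1.symm j)
    have e : act (invSP w) κ j = w.2 (w.1.symm j) * κ (w.1.symm j) := by simp [act, invSP]
    rw [e]
    rcases Int.units_eq_one_or (w.2 (w.1.symm j)) with h' | h' <;> simp [h'] <;> omega

/-- The nonzero steps in `K` with support of size at most `p`. -/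
def steps' (K : Finset (Fin n)) (p : ℕ) : Finset (Fin n → ℤ) :=
  (steps K).filter fun κ => κ ≠ 0 ∧ (supp κ).card ≤ p

lemma mem_steps' {K : Finset (Fin n)} {p : ℕ} {κ : Fin n → ℤ} :
    κ ∈ steps' K p ↔ κ ∈ steps K ∧ κ ≠ 0 ∧ (supp κ).card ≤ p := Finset.mem_filter

/-- The sum over the chains with `s` blocks of total size `p` in `K`. -/
def blocks : ℕ → Finset (Fin n) → ℕ → (Fin n → ℂ) → ℂ
  | 0, _, p, _ => if p = 0 then 1 else 0
  | s + 1, K, p, x => -∑ κ ∈ steps' K p, V P κ (supp κ) (K \ supp κ) x *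
      blocks s (K \ supp κ) (p - (supp κ).card) x

/-- The potential `U_{K,p}`: the sum over all chains of total size `p` in `K`. -/
def U (K : Finset (Fin n)) (p : ℕ) (x : Fin n → ℂ) : ℂ := ∑ s ∈ Finset.range (p + 1), blocks P s K p x

lemma blocks_eq_zero (s : ℕ) (K : Finset (Fin n)) (p : ℕ) (x : Fin n → ℂ) (h : p < s) :
    blocks P s K p x = 0 := by
  induction s generalizing K p with
  | zero => omega
  | succ s ih =>
    rw [blocks, neg_eq_zero]
    refine Finset.sum_eq_zero fun κ hκ => ?_
    rw [mem_steps'] at hκ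
    have := card_supp_pos hκ.2.1
    rw [ih _ _ (by omega), mul_zero]

lemma U_zero (K : Finset (Fin n)) (x : Fin n → ℂ) : U P K 0 x = 1 := by simp [U, blocks]

lemma U_rec (K : Finset (Fin n)) {p : ℕ} (hp : p ≠ 0) (x : Fin n → ℂ) :
    U P K p x = -∑ κ ∈ steps' K p, V P κ (supp κ) (K \ supp κ) x *
      U P (K \ supp κ) (p - (supp κ).card) x := by
  rw [U, Finset.sum_range_succ', blocks, if_neg hp, add_zero]
  simp only [blocks, Finset.sum_neg_distrib]
  rw [Finset.sum_comm]
  congr 1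
  refine Finset.sum_congr rfl fun κ hκ => ?_
  rw [← Finset.mul_sum]
  congr 1
  rw [mem_steps'] at hκ
  have := card_supp_pos hκ.2.1
  refine (Finset.sum_subset (Finset.range_subset_range.2 (by omega)) fun s _ hs => ?_).symm
  exact blocks_eq_zero P _ _ _ _ (by simpa using hs)

/-- The difference operator in the form `∑_κ V U T_κ`, acting on honest functions. -/
def Hop (r : ℕ) (f : (Fin n → ℂ) → ℂ) (x : Fin n → ℂ) : ℂ :=
  ∑ κ ∈ (steps Finset.univ).filter fun κ => (supp κ).card ≤ r,
    V P κ (supp κ) (Finset.univ \ supp κ) x *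
      U P (Finset.univ \ supp κ) (r - (supp κ).card) x *
      f (x + fun j => Complex.I * P.β * κ j)

/-! ### Invariance -/

lemma V_act (w : SP n) (κ : Fin n → ℤ) (J K : Finset (Fin n)) (x : Fin n → ℂ) :
    V P κ J K (act w x) =
      V P (act (invSP w) κ) (J.map w.1.toEmbedding) (K.map w.1.toEmbedding) x := by
  have hκ : ∀ j, ((act (invSP w) κ (w.1 j) : ℤ) : ℂ) * x (w.1 j) = κ j * act w x j := by
    intro j
    simp [act, invSP]; ring
  rw [V_eq, V_eq, Finset.prod_map, Finset.prod_map, pairProd_map _ _ (inner2_comm P _ x)]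
  simp only [Equiv.coe_toEmbedding, Finset.prod_map, inner2, cross, hκ]
  congr 1
  refine Finset.prod_congr rfl fun j _ => Finset.prod_congr rfl fun k _ => ?_
  rcases Int.units_eq_one_or (w.2 k) with h | h
  · simp [act, h]
  · simp only [act, h]
    simp
    rw [mul_comm, ← sub_eq_add_neg]

lemma U_act (w : SP n) (K : Finset (Fin n)) (p : ℕ) (x : Fin n → ℂ) :
    U P K p (act w x) = U P (K.map w.1.toEmbedding) p x := by
  induction p using Nat.strong_induction_on generalizing K with
  | _ p ih =>
    rcases eq_or_ne p 0 with rfl | hp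
    · rw [U_zero, U_zero]
    rw [U_rec P K hp, U_rec P _ hp, neg_inj]
    refine Finset.sum_nbij' (act (invSP w)) (act w) ?_ ?_ (fun κ _ => act_invSP w κ)
      (fun κ _ => invSP_act w κ) ?_
    · intro κ hκ
      rw [mem_steps'] at hκ ⊢
      refine ⟨act_mem_steps.2 hκ.1, fun h => hκ.2.1 ?_, by rw [supp_act]; simpa using hκ.2.2⟩
      rw [← act_invSP w κ, h]; ext j; simp [act]
    · intro κ hκ
      rw [mem_steps'] at hκ ⊢
      rw [← invSP_act w κ] at hκ
      refine ⟨act_mem_steps.1 hκ.1, fun h => hκ.2.1 ?_, ?_⟩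
      · rw [h]; ext j; simp [act]
      · have := hκ.2.2
        rw [supp_act] at this; simpa using this
    · intro κ hκ
      rw [mem_steps'] at hκ
      have := card_supp_pos hκ.2.1
      rw [V_act, ih _ (by omega), supp_act, Finset.card_map, Finset.map_sdiff]

lemma Hop_inv (r : ℕ) {f : (Fin n → ℂ) → ℂ} (hf : Inv f) : Inv (Hop P r f) := by
  intro w x
  rw [Hop, Hop]
  have hu : (Finset.univ : Finset (Fin n)).map w.1.toEmbedding = Finset.univ := by simp
  refine Finset.sum_nbij' (act (invSP w)) (act w) ?_ ?_ (fun κ _ => act_invSP w κ)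
    (fun κ _ => invSP_act w κ) ?_
  · intro κ hκ
    rw [Finset.mem_filter] at hκ ⊢
    refine ⟨hu ▸ act_mem_steps.2 hκ.1, by rw [supp_act]; simpa using hκ.2⟩
  · intro κ hκ
    rw [Finset.mem_filter] at hκ ⊢
    rw [← invSP_act w κ, ← hu] at hκ
    refine ⟨act_mem_steps.1 hκ.1, ?_⟩
    have := hκ.2
    rw [supp_act] at this; simpa using this
  · intro κ hκ
    rw [V_act, U_act, supp_act, Finset.card_map, Finset.map_sdiff, hu]
    congr 1
    have h1 : (fun j => Complex.I * P.β * ((act (invSP w) κ j : ℤ) : ℂ)) =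
        (Complex.I * P.β) • act (invSP w) fun j => (κ j : ℂ) := by
      rw [act_intCast]; rfl
    rw [h1, ← hf w (x + _), act_add, act_smul, act_invSP]
    rfl

lemma V_add_two_pi (κ m : Fin n → ℤ) (J K : Finset (Fin n)) (x : Fin n → ℂ) :
    V P κ J K (x + fun j => 2 * (Real.pi : ℂ) * m j) = V P κ J K x := by
  have h1 : ∀ j k, (κ j : ℂ) * (x j + 2 * Real.pi * m j) + κ k * (x k + 2 * Real.pi * m k) =
      (κ j * x j + κ k * x k) + 2 * Real.pi * (κ j * m j + κ k * m k : ℤ) := by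
    intro j k; push_cast; ring
  have h2 : ∀ j k, (κ j : ℂ) * (x j + 2 * Real.pi * m j) + (x k + 2 * Real.pi * m k) =
      (κ j * x j + x k) + 2 * Real.pi * (κ j * m j + m k : ℤ) := by
    intro j k; push_cast; ring
  have h3 : ∀ j k, (κ j : ℂ) * (x j + 2 * Real.pi * m j) - (x k + 2 * Real.pi * m k) =
      (κ j * x j - x k) + 2 * Real.pi * (κ j * m j - m k : ℤ) := by
    intro j k; push_cast; ring
  have h4 : ∀ j, (κ j : ℂ) * (x j + 2 * Real.pi * m j) =
      κ j * x j + 2 * Real.pi * (κ j * m j : ℤ) := by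
    intro j; push_cast; ring
  rw [V, V]
  simp only [Pi.add_apply, h1, h2, h3, va_add_two_pi]
  simp only [h4, vb_add_two_pi, add_right_comm _ (2 * (Real.pi : ℂ) * _), va_add_two_pi]

lemma U_add_two_pi (m : Fin n → ℤ) (K : Finset (Fin n)) (p : ℕ) (x : Fin n → ℂ) :
    U P K p (x + fun j => 2 * (Real.pi : ℂ) * m j) = U P K p x := by
  induction p using Nat.strong_induction_on generalizing K with
  | _ p ih =>
    rcases eq_or_ne p 0 with rfl | hp
    · rw [U_zero, U_zero]
    rw [U_rec P K hp, U_rec P _ hp, neg_inj]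
    refine Finset.sum_congr rfl fun κ hκ => ?_
    rw [mem_steps'] at hκ
    have := card_supp_pos hκ.2.1
    rw [V_add_two_pi, ih _ (by omega)]

lemma ex_add_two_pi (κ m : Fin n → ℤ) (x : Fin n → ℂ) :
    ex κ (x + fun j => 2 * (Real.pi : ℂ) * m j) = ex κ x := by
  have h := aff_add κ 0 x (fun j => 2 * (Real.pi : ℂ) * m j)
  have h' : ∑ j, (κ j : ℂ) * (2 * Real.pi * m j) = 2 * Real.pi * (∑ j, κ j * m j : ℤ) := by
    push_cast; rw [Finset.mul_sum]; exact Finset.sum_congr rfl fun j _ => by ring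
  simp only [aff, add_zero] at h
  rw [ex, h, h', exp_I_add_two_pi, ex]

lemma expPoly_add_two_pi {F : (Fin n → ℂ) → ℂ} (hF : F ∈ expPoly n) (m : Fin n → ℤ)
    (x : Fin n → ℂ) : F (x + fun j => 2 * (Real.pi : ℂ) * m j) = F x :=
  expPoly_induction (p := fun F => F (x + fun j => 2 * (Real.pi : ℂ) * m j) = F x)
    (fun κ => ex_add_two_pi κ m x) rfl (fun F G hF hG => by simp only [Pi.add_apply, hF, hG])
    (fun c F hF => by simp only [Pi.smul_apply, hF]) hF

lemma Hop_add_two_pi (r : ℕ) {f : (Fin n → ℂ) → ℂ} (hf : f ∈ expPoly n) (m : Fin n → ℤ)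
    (x : Fin n → ℂ) : Hop P r f (x + fun j => 2 * (Real.pi : ℂ) * m j) = Hop P r f x := by
  rw [Hop, Hop]
  refine Finset.sum_congr rfl fun κ hκ => ?_
  rw [V_add_two_pi, U_add_two_pi, add_right_comm, expPoly_add_two_pi hf]

end

end Koornwinder

namespace Koornwinder

open Filter Topology

noncomputable section

variable {n : ℕ}

/-! ### Simple poles along a punctured line -/

/-- The function has a limit at the puncture. -/
def Reg (φ : ℂ → ℂ) : Prop := ∃ L, Tendsto φ (𝓝[≠] 0) (𝓝 L)

/-- The function has at most a simple pole at the puncture. -/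
def Simple (φ : ℂ → ℂ) : Prop := Reg fun t => t * φ t

/-- The function has at most a simple pole at the puncture, with vanishing residue. -/
def Null (φ : ℂ → ℂ) : Prop := Tendsto (fun t => t * φ t) (𝓝[≠] 0) (𝓝 0)

lemma tendsto_id_puncture : Tendsto (fun t : ℂ => t) (𝓝[≠] 0) (𝓝 0) :=
  tendsto_id.mono_left nhdsWithin_le_nhds

lemma Reg.const (c : ℂ) : Reg fun _ => c := ⟨c, tendsto_const_nhds⟩

lemma Reg.mul {φ ψ : ℂ → ℂ} (hφ : Reg φ) (hψ : Reg ψ) : Reg fun t => φ t * ψ t := by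
  obtain ⟨a, ha⟩ := hφ
  obtain ⟨b, hb⟩ := hψ
  exact ⟨_, ha.mul hb⟩

lemma Reg.neg {φ : ℂ → ℂ} (hφ : Reg φ) : Reg fun t => -φ t := by
  obtain ⟨a, ha⟩ := hφ
  exact ⟨_, ha.neg⟩

lemma Reg.sum {ι : Type*} {s : Finset ι} {φ : ι → ℂ → ℂ} (h : ∀ i ∈ s, Reg (φ i)) :
    Reg fun t => ∑ i ∈ s, φ i t := by
  classical
  choose! L hL using h
  exact ⟨_, tendsto_finsetSum s hL⟩

lemma Reg.prod {ι : Type*} {s : Finset ι} {φ : ι → ℂ → ℂ} (h : ∀ i ∈ s, Reg (φ i)) :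
    Reg fun t => ∏ i ∈ s, φ i t := by
  classical
  choose! L hL using h
  exact ⟨_, tendsto_finsetProd s hL⟩

lemma Reg.null {φ : ℂ → ℂ} (h : Reg φ) : Null φ := by
  obtain ⟨a, ha⟩ := h
  have := tendsto_id_puncture.mul ha
  rwa [zero_mul] at this

lemma Null.simple {φ : ℂ → ℂ} (h : Null φ) : Simple φ := ⟨0, h⟩

lemma Reg.simple {φ : ℂ → ℂ} (h : Reg φ) : Simple φ := h.null.simple

lemma Simple.mul_reg {φ ψ : ℂ → ℂ} (hφ : Simple φ) (hψ : Reg ψ) : Simple fun t => φ t * ψ t := by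
  have := Reg.mul hφ hψ
  simpa only [Simple, mul_assoc] using this

lemma Reg.mul_simple {φ ψ : ℂ → ℂ} (hφ : Reg φ) (hψ : Simple ψ) : Simple fun t => φ t * ψ t := by
  simpa only [mul_comm] using hψ.mul_reg hφ

lemma Simple.neg {φ : ℂ → ℂ} (hφ : Simple φ) : Simple fun t => -φ t := by
  simpa only [Simple, mul_neg] using Reg.neg hφ

lemma Simple.sum {ι : Type*} {s : Finset ι} {φ : ι → ℂ → ℂ} (h : ∀ i ∈ s, Simple (φ i)) :
    Simple fun t => ∑ i ∈ s, φ i t := by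
  simpa only [Simple, Finset.mul_sum] using Reg.sum h

lemma Simple.mul_tendsto {φ ψ : ℂ → ℂ} (hφ : Simple φ) (hψ : Tendsto ψ (𝓝[≠] 0) (𝓝 0)) :
    Null fun t => φ t * ψ t := by
  obtain ⟨a, ha⟩ := hφ
  have := ha.mul hψ
  rw [mul_zero] at this
  simpa only [Null, mul_assoc] using this

lemma Null.mul_reg {φ ψ : ℂ → ℂ} (hφ : Null φ) (hψ : Reg ψ) : Null fun t => φ t * ψ t := by
  obtain ⟨a, ha⟩ := hψ
  have := Tendsto.mul hφ ha
  rw [zero_mul] at this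
  simpa only [Null, mul_assoc] using this

lemma Reg.mul_null {φ ψ : ℂ → ℂ} (hφ : Reg φ) (hψ : Null ψ) : Null fun t => φ t * ψ t := by
  simpa only [mul_comm] using hψ.mul_reg hφ

lemma Null.add {φ ψ : ℂ → ℂ} (hφ : Null φ) (hψ : Null ψ) : Null fun t => φ t + ψ t := by
  have := Tendsto.add hφ hψ
  rw [add_zero] at this
  simpa only [Null, mul_add] using this

lemma Null.neg {φ : ℂ → ℂ} (hφ : Null φ) : Null fun t => -φ t := by
  have := Tendsto.neg hφ
  rw [neg_zero] at this
  simpa only [Null, mul_neg] using this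

lemma Null.sum {ι : Type*} {s : Finset ι} {φ : ι → ℂ → ℂ} (h : ∀ i ∈ s, Null (φ i)) :
    Null fun t => ∑ i ∈ s, φ i t := by
  have := tendsto_finsetSum s h
  rw [Finset.sum_const_zero] at this
  simpa only [Null, Finset.mul_sum] using this

/-- A product of functions with simple poles, at most one of which is singular. -/
lemma reg_or_simple_prod {ι : Type*} {s : Finset ι} {φ : ι → ℂ → ℂ}
    (h1 : ∀ i ∈ s, Simple (φ i))
    (h2 : ∀ i ∈ s, ∀ j ∈ s, ¬ Reg (φ i) → ¬ Reg (φ j) → i = j) :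
    Simple (fun t => ∏ i ∈ s, φ i t) ∧
      (Reg (fun t => ∏ i ∈ s, φ i t) ∨ ∃ i ∈ s, ¬ Reg (φ i)) := by
  classical
  by_cases h : ∀ i ∈ s, Reg (φ i)
  · exact ⟨(Reg.prod h).simple, Or.inl (Reg.prod h)⟩
  · push Not at h
    obtain ⟨i, hi, hni⟩ := h
    refine ⟨?_, Or.inr ⟨i, hi, hni⟩⟩
    simp only [← Finset.mul_prod_erase s _ hi]
    refine (h1 i hi).mul_reg (Reg.prod fun j hj => ?_)
    by_contra hnj
    exact Finset.ne_of_mem_erase hj (h2 j (Finset.mem_of_mem_erase hj) i hi hnj hni)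

/-! ### Generic points of the singular hyperplanes -/

variable (P : Params)

/-- The constant terms of the affine functions whose zeros are the singularities. -/
def consts : Finset ℂ :=
  {0, (Real.pi : ℂ), Complex.I * P.β, Complex.I * P.β / 2, Complex.I * P.β / 2 + Real.pi}

/-- A point of the hyperplane `α₀·x + c₀ = 0` that lies on no other singular hyperplane. -/
structure Generic (α₀ : Fin n → ℤ) (c₀ : ℂ) (x₀ : Fin n → ℂ) : Prop where
  mem : α₀ ∈ steps Finset.univ
  ne : α₀ ≠ 0
  zero : aff α₀ c₀ x₀ = 0
  sep : ∀ α ∈ steps (Finset.univ : Finset (Fin n)), α ≠ 0 → ∀ c ∈ consts P, dv α c x₀ = 0 →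
    ∃ m : ℤ, (m = 1 ∨ m = -1) ∧ α = m • α₀ ∧
      Complex.exp (Complex.I * c) = Complex.exp (Complex.I * (m * c₀))

lemma dv_comp_proj_ne_zero {α α₀ : Fin n → ℤ} (c c₀ : ℂ) {j : Fin n}
    (hα : α ∈ steps Finset.univ) (hα0 : α ≠ 0) (hα₀ : α₀ ∈ steps Finset.univ)
    (hrel : ¬ ∃ m : ℤ, (m = 1 ∨ m = -1) ∧ α = m • α₀ ∧
      Complex.exp (Complex.I * c) = Complex.exp (Complex.I * (m * c₀))) :
    dv α c ∘ proj α₀ c₀ j ≠ 0 := by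
  intro h
  set m := α j * α₀ j with hm
  have h1 : ∀ x, Complex.exp (Complex.I * aff α c (proj α₀ c₀ j x)) = 1 := fun x => by
    have := congrFun h x
    simp only [Function.comp_apply, dv, Pi.zero_apply] at this
    exact (sub_eq_zero.1 this).symm
  have h2 : ∀ x, ex α x * Complex.exp (Complex.I * c) =
      ex (m • α₀) x * Complex.exp (Complex.I * (m * c₀)) := by
    intro x
    have h3 := h1 x
    rw [exp_aff, ex_proj, zpow_neg, ← Complex.exp_int_mul, ← hm] at h3
    have h4 : Complex.exp (m * (Complex.I * aff α₀ c₀ x)) =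
        ex (m • α₀) x * Complex.exp (Complex.I * (m * c₀)) := by
      rw [ex, ← Complex.exp_add, aff]
      congr 1
      simp only [Pi.smul_apply, smul_eq_mul, Int.cast_mul, mul_assoc, ← Finset.mul_sum]
      ring
    rw [← h4]
    field_simp at h3
    rw [h3, mul_assoc]
  have h0 : Complex.exp (Complex.I * c) = Complex.exp (Complex.I * (m * c₀)) := by
    have := h2 0
    simpa [ex] using this
  have h5 : α = m • α₀ := by
    have : evalEx (Finsupp.single α 1) = evalEx (Finsupp.single (m • α₀) 1) := by
      ext x
      have := h2 x
      rw [h0] at this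
      simpa [evalEx, Complex.exp_ne_zero] using this
    exact Finsupp.single_left_injective one_ne_zero (evalEx_injective this)
  refine hrel ⟨m, ?_, h5, h0⟩
  have hm0 : m ≠ 0 := by
    intro hm0
    rw [hm0, zero_smul] at h5
    exact hα0 h5
  rcases (mem_steps.1 hα).1 j with h | h | h <;> rcases (mem_steps.1 hα₀).1 j with h' | h' | h' <;>
    simp [hm, h, h'] at hm0 ⊢

/-- An exponential polynomial that vanishes at the generic points of a hyperplane vanishes on the
hyperplane. -/
lemma eq_zero_of_generic {α₀ : Fin n → ℤ} {c₀ : ℂ} (hα₀ : α₀ ∈ steps Finset.univ) (h0 : α₀ ≠ 0)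
    {N : (Fin n → ℂ) → ℂ} (hN : N ∈ expPoly n) (h : ∀ x, Generic P α₀ c₀ x → N x = 0)
    {x : Fin n → ℂ} (hx : aff α₀ c₀ x = 0) : N x = 0 := by
  classical
  obtain ⟨j, hj⟩ := Function.ne_iff.1 h0
  have hj1 : α₀ j * α₀ j = 1 := by
    rcases (mem_steps.1 hα₀).1 j with h | h | h
    · exact absurd h hj
    · simp [h]
    · simp [h]
  let B := ((steps (Finset.univ : Finset (Fin n))).filter (· ≠ 0) ×ˢ consts P).filter fun q =>
    ¬ ∃ m : ℤ, (m = 1 ∨ m = -1) ∧ q.1 = m • α₀ ∧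
      Complex.exp (Complex.I * q.2) = Complex.exp (Complex.I * (m * c₀))
  have hB : ∀ q ∈ B, dv q.1 q.2 ∘ proj α₀ c₀ j ≠ 0 := by
    intro q hq
    simp only [B, Finset.mem_filter, Finset.mem_product] at hq
    exact dv_comp_proj_ne_zero q.2 c₀ hq.1.1.1 hq.1.1.2 hα₀ hq.2
  have hG := expPoly_prod_ne_zero B (fun q _ => proj_mem α₀ c₀ j (dv_mem q.1 q.2)) hB
  have hmem : ∏ q ∈ B, dv q.1 q.2 ∘ proj α₀ c₀ j ∈ expPoly n :=
    Subalgebra.prod_mem _ fun q _ => proj_mem α₀ c₀ j (dv_mem q.1 q.2)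
  have hz : N ∘ proj α₀ c₀ j = 0 := by
    refine expPoly_mul_eq_zero hmem (proj_mem α₀ c₀ j hN) (fun x => ?_) hG
    by_cases hx : (∏ q ∈ B, dv q.1 q.2 ∘ proj α₀ c₀ j) x = 0
    · rw [hx, zero_mul]
    · rw [Function.comp_apply, h, mul_zero]
      refine ⟨hα₀, h0, aff_proj α₀ c₀ hj1 x, fun α hα hα0 c hc hd => ?_⟩
      by_contra hcon
      refine hx ?_
      rw [Finset.prod_apply]
      refine Finset.prod_eq_zero (i := (α, c)) ?_ hd
      simp only [B, Finset.mem_filter, Finset.mem_product]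
      exact ⟨⟨⟨hα, hα0⟩, hc⟩, hcon⟩
  have := congrFun hz x
  rwa [Function.comp_apply, proj_of_aff_eq_zero _ _ _ hx] at this

/-- The line through `x₀` in the direction `α₀`. -/
def line (x₀ : Fin n → ℂ) (α₀ : Fin n → ℤ) (t : ℂ) : Fin n → ℂ := x₀ + fun j => t * α₀ j

lemma aff_line (α α₀ : Fin n → ℤ) (c : ℂ) (x₀ : Fin n → ℂ) (t : ℂ) :
    aff α c (line x₀ α₀ t) = aff α c x₀ + t * (∑ j, α j * α₀ j : ℤ) := by
  rw [line, aff_add]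
  push_cast
  rw [Finset.mul_sum]
  congr 1
  exact Finset.sum_congr rfl fun j _ => by ring

lemma continuous_line (x₀ : Fin n → ℂ) (α₀ : Fin n → ℤ) : Continuous (line x₀ α₀) := by
  unfold line; fun_prop

lemma line_zero (x₀ : Fin n → ℂ) (α₀ : Fin n → ℤ) : line x₀ α₀ 0 = x₀ := by
  ext j; simp [line]

lemma tendsto_line (x₀ : Fin n → ℂ) (α₀ : Fin n → ℤ) :
    Tendsto (line x₀ α₀) (𝓝[≠] 0) (𝓝 x₀) := by
  have := (continuous_line x₀ α₀).tendsto 0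
  rw [line_zero] at this
  exact this.mono_left nhdsWithin_le_nhds

lemma reg_of_continuous {F : (Fin n → ℂ) → ℂ} (hF : Continuous F) (x₀ : Fin n → ℂ)
    (α₀ : Fin n → ℤ) : Reg fun t => F (line x₀ α₀ t) :=
  ⟨_, (hF.tendsto x₀).comp (tendsto_line x₀ α₀)⟩

lemma continuous_aff (α : Fin n → ℤ) (c : ℂ) : Continuous (aff α c) := by
  unfold aff; fun_prop

lemma tendsto_qt (s : ℝ) {α : Fin n → ℤ} {c : ℂ} {x₀ : Fin n → ℂ} (α₀ : Fin n → ℤ)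
    (h : dv α c x₀ ≠ 0) :
    Tendsto (fun t => qt P s (aff α c (line x₀ α₀ t))) (𝓝[≠] 0) (𝓝 (qt P s (aff α c x₀))) := by
  have h1 : Tendsto (fun t => aff α c (line x₀ α₀ t)) (𝓝[≠] 0) (𝓝 (aff α c x₀)) :=
    ((continuous_aff α c).tendsto x₀).comp (tendsto_line x₀ α₀)
  have h2 := (Complex.continuous_exp.tendsto _).comp (h1.const_mul Complex.I)
  exact tendsto_const_nhds.mul ((tendsto_const_nhds.sub (tendsto_const_nhds.mul h2)).div
    (tendsto_const_nhds.sub h2) h)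

lemma reg_qt (s : ℝ) {α : Fin n → ℤ} {c : ℂ} {x₀ : Fin n → ℂ} (α₀ : Fin n → ℤ)
    (h : dv α c x₀ ≠ 0) : Reg fun t => qt P s (aff α c (line x₀ α₀ t)) := ⟨_, tendsto_qt P s α₀ h⟩

variable {P}

lemma sum_mul_self_pos {α : Fin n → ℤ} (h : α ≠ 0) : 0 < ∑ j, α j * α j := by
  obtain ⟨j, hj⟩ := Function.ne_iff.1 h
  refine Finset.sum_pos' (fun i _ => mul_self_nonneg _) ⟨j, Finset.mem_univ j, ?_⟩
  exact mul_self_pos.2 hj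

lemma tendsto_div_exp {a : ℂ} (ha : a ≠ 0) :
    Tendsto (fun t : ℂ => t / (1 - Complex.exp (Complex.I * (t * a)))) (𝓝[≠] 0)
      (𝓝 (-(Complex.I * a))⁻¹) := by
  have hd : HasDerivAt (fun t : ℂ => 1 - Complex.exp (Complex.I * (t * a))) (-(Complex.I * a)) 0 := by
    have h1 : HasDerivAt (fun t : ℂ => Complex.I * (t * a)) (Complex.I * (1 * a)) 0 :=
      ((hasDerivAt_id (0 : ℂ)).mul_const a).const_mul _
    have := (h1.cexp).const_sub 1
    simpa using this
  have := (hasDerivAt_iff_tendsto_slope.1 hd).inv₀ (by simp [ha])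
  refine this.congr fun t => ?_
  simp [slope_def_field]

lemma Generic.simple_qt {α₀ : Fin n → ℤ} {c₀ : ℂ} {x₀ : Fin n → ℂ} (hx : Generic P α₀ c₀ x₀)
    (s : ℝ) {α : Fin n → ℤ} (hα : α ∈ steps Finset.univ) (hα0 : α ≠ 0) {c : ℂ}
    (hc : c ∈ consts P) : Simple fun t => qt P s (aff α c (line x₀ α₀ t)) := by
  by_cases hd : dv α c x₀ = 0
  swap
  · exact (reg_qt P s α₀ hd).simple
  obtain ⟨m, hm, rfl, -⟩ := hx.sep α hα hα0 c hc hd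
  have hexp : Complex.exp (Complex.I * aff (m • α₀) c x₀) = 1 := (sub_eq_zero.1 hd).symm
  set a : ℂ := ((∑ j, (m • α₀) j * α₀ j : ℤ) : ℂ) with ha
  have ha0 : a ≠ 0 := by
    rw [ha, Int.cast_ne_zero]
    simp only [Pi.smul_apply, smul_eq_mul, mul_assoc, ← Finset.mul_sum]
    exact mul_ne_zero (by omega) (sum_mul_self_pos hx.ne).ne'
  have h1 : ∀ t, Complex.exp (Complex.I * aff (m • α₀) c (line x₀ α₀ t)) =
      Complex.exp (Complex.I * (t * a)) := by
    intro t
    rw [aff_line, mul_add, Complex.exp_add, hexp, one_mul]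
  have h2 : Tendsto (fun t : ℂ => Complex.exp (Complex.I * (t * a))) (𝓝[≠] 0) (𝓝 1) := by
    have : Continuous fun t : ℂ => Complex.exp (Complex.I * (t * a)) := by fun_prop
    have := this.tendsto 0
    simp only [zero_mul, mul_zero, Complex.exp_zero] at this
    exact this.mono_left nhdsWithin_le_nhds
  have h3 := ((tendsto_const_nhds (x := Complex.exp (P.β * s / 2))).mul
    ((tendsto_const_nhds (x := (1 : ℂ))).sub
      ((tendsto_const_nhds (x := Complex.exp (-(P.β * s)))).mul h2))).mul (tendsto_div_exp ha0)
  refine ⟨_, h3.congr fun t => ?_⟩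
  simp only [qt, h1]
  ring

/-! ### The factors of the coefficients -/

/-- The vector with entries `a` at `j` and `b` at `k`. -/
def pr (j : Fin n) (a : ℤ) (k : Fin n) (b : ℤ) : Fin n → ℤ := Pi.single j a + Pi.single k b

lemma aff_pr (j : Fin n) (a : ℤ) (k : Fin n) (b : ℤ) (c : ℂ) (x : Fin n → ℂ) :
    aff (pr j a k b) c x = a * x j + b * x k + c := by
  have h : ∀ (j : Fin n) (a : ℤ), ∑ i, ((Pi.single j a : Fin n → ℤ) i : ℂ) * x i = a * x j := by
    intro j a
    rw [Finset.sum_eq_single j]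
    · simp
    · intro i _ hi; simp [hi]
    · simp
  simp only [aff, pr, Pi.add_apply, Int.cast_add, add_mul, Finset.sum_add_distrib, h]

lemma aff_single (j : Fin n) (a : ℤ) (c : ℂ) (x : Fin n → ℂ) :
    aff (Pi.single j a) c x = a * x j + c := by
  have := aff_pr j a j 0 c x
  simpa [pr] using this

lemma pr_left {j k : Fin n} (h : j ≠ k) (a b : ℤ) : pr j a k b j = a := by simp [pr, h]

lemma pr_right {j k : Fin n} (h : j ≠ k) (a b : ℤ) : pr j a k b k = b := by simp [pr, h.symm]

lemma pr_other {i j k : Fin n} (h : i ≠ j) (h' : i ≠ k) (a b : ℤ) : pr j a k b i = 0 := by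
  simp [pr, h, h']

lemma pr_mem {j k : Fin n} (h : j ≠ k) {a b : ℤ} (ha : a = 1 ∨ a = -1) (hb : b = 1 ∨ b = -1) :
    pr j a k b ∈ steps Finset.univ := by
  refine mem_steps.2 ⟨fun i => ?_, Finset.subset_univ _⟩
  by_cases h1 : i = j
  · subst h1; rw [pr_left h]; exact Or.inr ha
  by_cases h2 : i = k
  · subst h2; rw [pr_right h]; exact Or.inr hb
  exact Or.inl (pr_other h1 h2 a b)

lemma pr_ne_zero {j k : Fin n} (h : j ≠ k) {a : ℤ} (b : ℤ) (ha : a = 1 ∨ a = -1) :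
    pr j a k b ≠ 0 := by
  intro h0
  have := congrFun h0 j
  rw [pr_left h] at this
  simp at this; omega

lemma supp_pr {j k : Fin n} (h : j ≠ k) {a b : ℤ} (ha : a = 1 ∨ a = -1) (hb : b = 1 ∨ b = -1) :
    supp (pr j a k b) = {j, k} := by
  ext i
  rw [mem_supp, Finset.mem_insert, Finset.mem_singleton]
  by_cases h1 : i = j
  · subst h1; rw [pr_left h]; simp; omega
  by_cases h2 : i = k
  · subst h2; rw [pr_right h]; simp; omega
  simp [pr_other h1 h2, h1, h2]

lemma single_mem {j : Fin n} {a : ℤ} (ha : a = 1 ∨ a = -1) :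
    (Pi.single j a : Fin n → ℤ) ∈ steps Finset.univ := by
  refine mem_steps.2 ⟨fun i => ?_, Finset.subset_univ _⟩
  by_cases h1 : i = j
  · subst h1; simp; omega
  · simp [h1]

lemma single_ne_zero' {j : Fin n} {a : ℤ} (ha : a = 1 ∨ a = -1) :
    (Pi.single j a : Fin n → ℤ) ≠ 0 := by
  simp; omega

lemma supp_single {j : Fin n} {a : ℤ} (ha : a = 1 ∨ a = -1) :
    supp (Pi.single j a : Fin n → ℤ) = {j} := by
  ext i
  rw [mem_supp, Finset.mem_singleton]
  by_cases h1 : i = j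
  · subst h1; simp; omega
  · simp [h1]

lemma supp_smul {m : ℤ} (hm : m = 1 ∨ m = -1) (α : Fin n → ℤ) : supp (m • α) = supp α := by
  ext i
  rw [mem_supp, mem_supp, Pi.smul_apply, smul_eq_mul]
  rcases hm with rfl | rfl <;> simp

/-- The constants in the denominators of `v_b`. -/
def vbConsts (P : Params) : Finset ℂ :=
  {0, (Real.pi : ℂ), Complex.I * P.β / 2, Complex.I * P.β / 2 + Real.pi}

lemma vbConsts_subset : vbConsts P ⊆ consts P := by
  intro c hc
  simp only [vbConsts, consts, Finset.mem_insert, Finset.mem_singleton] at hc ⊢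
  tauto

lemma exp_vbConst_inj (hβ : 0 < P.β) {c c' : ℂ} (hc : c ∈ vbConsts P) (hc' : c' ∈ vbConsts P)
    (h : Complex.exp (Complex.I * c) = Complex.exp (Complex.I * c')) : c = c' := by
  have e1 : Complex.exp (Complex.I * Real.pi) = -1 := by
    rw [mul_comm, Complex.exp_pi_mul_I]
  have e2 : Complex.exp (Complex.I * (Complex.I * P.β / 2)) = (Real.exp (-(P.β / 2)) : ℂ) := by
    rw [Complex.ofReal_exp]
    congr 1
    push_cast
    linear_combination ((P.β : ℂ) / 2) * Complex.I_sq
  have e3 : Complex.exp (Complex.I * (Complex.I * P.β / 2 + Real.pi)) =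
      ((-Real.exp (-(P.β / 2)) : ℝ) : ℂ) := by
    rw [mul_add, Complex.exp_add, e1, e2]; push_cast; ring
  have e4 : (-1 : ℂ) = ((-1 : ℝ) : ℂ) := by norm_num
  have e5 : (1 : ℂ) = ((1 : ℝ) : ℂ) := by norm_num
  have hlt : Real.exp (-(P.β / 2)) < 1 := Real.exp_lt_one_iff.2 (by linarith)
  have hpos := Real.exp_pos (-(P.β / 2))
  simp only [vbConsts, Finset.mem_insert, Finset.mem_singleton] at hc hc'
  rcases hc with rfl | rfl | rfl | rfl <;> rcases hc' with rfl | rfl | rfl | rfl <;>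
    first
    | rfl
    | (exfalso
       simp only [mul_zero, Complex.exp_zero, e1, e2, e3] at h
       try rw [e4] at h
       try rw [e5] at h
       rw [Complex.ofReal_inj] at h
       linarith)

section factors

variable {α₀ : Fin n → ℤ} {c₀ : ℂ} {x₀ : Fin n → ℂ}

lemma va_aff (j : Fin n) (a : ℤ) (k : Fin n) (b : ℤ) (c : ℂ) (x : Fin n → ℂ) :
    va P (a * x j + b * x k + c) = qt P P.g (aff (pr j a k b) c x) := by
  rw [va_eq, aff_pr]

lemma vb_aff (j : Fin n) (a : ℤ) (x : Fin n → ℂ) :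
    vb P (a * x j) = qt P P.g₀ (aff (Pi.single j a) 0 x) *
      qt P P.g₁ (aff (Pi.single j a) Real.pi x) *
      qt P P.g₀' (aff (Pi.single j a) (Complex.I * P.β / 2) x) *
      qt P P.g₁' (aff (Pi.single j a) (Complex.I * P.β / 2 + Real.pi) x) := by
  rw [vb_eq]
  simp only [aff_single, add_zero]

lemma Generic.simple_vb (hβ : 0 < P.β) (hx : Generic P α₀ c₀ x₀) {j : Fin n} {a : ℤ}
    (ha : a = 1 ∨ a = -1) :
    (Simple fun t => vb P (a * line x₀ α₀ t j)) ∧ ((Reg fun t => vb P (a * line x₀ α₀ t j)) ∨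
      ∃ c ∈ vbConsts P, dv (Pi.single j a) c x₀ = 0) := by
  let gs : Fin 4 → ℝ := ![P.g₀, P.g₁, P.g₀', P.g₁']
  let cs : Fin 4 → ℂ :=
    ![0, (Real.pi : ℂ), Complex.I * P.β / 2, Complex.I * P.β / 2 + Real.pi]
  have hcs : ∀ i, cs i ∈ vbConsts P := by
    intro i; fin_cases i <;> simp [cs, vbConsts]
  have hinj : ∀ i i', cs i = cs i' → i = i' := by
    have hb : (P.β : ℂ) ≠ 0 := by exact_mod_cast hβ.ne'
    have hp : (Real.pi : ℂ) ≠ 0 := by exact_mod_cast Real.pi_ne_zero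
    intro i i' h
    have h1 := congrArg Complex.re h
    have h2 := congrArg Complex.im h
    have hpi := Real.pi_pos
    fin_cases i <;> fin_cases i' <;> simp [cs] at h1 h2 ⊢ <;> linarith
  have hprod : ∀ t, vb P (a * line x₀ α₀ t j) =
      ∏ i, qt P (gs i) (aff (Pi.single j a) (cs i) (line x₀ α₀ t)) := by
    intro t
    rw [vb_aff, Fin.prod_univ_four]
    rfl
  have hsing : ∀ i, ¬ (Reg fun t => qt P (gs i) (aff (Pi.single j a) (cs i) (line x₀ α₀ t))) →
      dv (Pi.single j a) (cs i) x₀ = 0 := by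
    intro i hi
    by_contra h
    exact hi (reg_qt P _ α₀ h)
  simp only [hprod]
  obtain ⟨h1, h2⟩ := reg_or_simple_prod (s := Finset.univ)
    (φ := fun i t => qt P (gs i) (aff (Pi.single j a) (cs i) (line x₀ α₀ t)))
    (fun i _ => hx.simple_qt _ (single_mem ha) (single_ne_zero' ha) (vbConsts_subset (hcs i)))
    (fun i _ i' _ hi hi' => by
      obtain ⟨m, hm, e, he⟩ := hx.sep _ (single_mem ha) (single_ne_zero' ha) _
        (vbConsts_subset (hcs i)) (hsing i hi)
      obtain ⟨m', hm', e', he'⟩ := hx.sep _ (single_mem ha) (single_ne_zero' ha) _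
        (vbConsts_subset (hcs i')) (hsing i' hi')
      have hmm : m = m' := by
        rw [e] at e'
        obtain ⟨k, hk⟩ := Function.ne_iff.1 hx.ne
        have := congrFun e' k
        simp only [Pi.smul_apply, smul_eq_mul] at this
        exact mul_right_cancel₀ hk this
      rw [← hmm, ← he] at he'
      exact hinj _ _ (exp_vbConst_inj hβ (hcs i) (hcs i') he'.symm))
  refine ⟨h1, h2.imp id ?_⟩
  rintro ⟨i, -, hi⟩
  exact ⟨cs i, hcs i, hsing i hi⟩

lemma zero_mem_consts : (0 : ℂ) ∈ consts P := by simp [consts]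

lemma Ibeta_mem_consts : Complex.I * (P.β : ℂ) ∈ consts P := by simp [consts]

lemma exp_I_mul_Ibeta (hβ : 0 < P.β) : ‖Complex.exp (Complex.I * (Complex.I * P.β))‖ < 1 := by
  rw [Complex.norm_exp, Real.exp_lt_one_iff]
  simpa using hβ

lemma norm_exp_smul_eq {m : ℤ} (hm : m = 1 ∨ m = -1)
    (h : Complex.exp (Complex.I * 0) = Complex.exp (Complex.I * (m * c₀))) :
    Complex.exp (Complex.I * c₀) = 1 := by
  rcases hm with rfl | rfl
  · simpa using h.symm
  · have : Complex.exp (Complex.I * c₀) * Complex.exp (Complex.I * ((-1 : ℤ) * c₀)) = 1 := by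
      rw [← Complex.exp_add]; simp
    rw [← h] at this
    simpa using this

lemma Generic.simple_inner2 (hβ : 0 < P.β) (hx : Generic P α₀ c₀ x₀) {κ : Fin n → ℤ} {j k : Fin n}
    (hjk : j ≠ k) (hj : κ j = 1 ∨ κ j = -1) (hk : κ k = 1 ∨ κ k = -1) :
    (Simple fun t => inner2 P κ (line x₀ α₀ t) j k) ∧
      ((Reg fun t => inner2 P κ (line x₀ α₀ t) j k) ∨
      dv (pr j (κ j) k (κ k)) 0 x₀ = 0 ∨ dv (pr j (κ j) k (κ k)) (Complex.I * P.β) x₀ = 0) := by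
  have hm := pr_mem hjk hj hk
  have h0 := pr_ne_zero hjk (κ k) hj
  have e : ∀ x, inner2 P κ x j k = qt P P.g (aff (pr j (κ j) k (κ k)) 0 x) *
      qt P P.g (aff (pr j (κ j) k (κ k)) (Complex.I * P.β) x) := by
    intro x
    rw [inner2, ← va_aff, ← va_aff, add_zero]
  simp only [e]
  have s1 := hx.simple_qt P.g hm h0 zero_mem_consts
  have s2 := hx.simple_qt P.g hm h0 Ibeta_mem_consts
  by_cases d1 : dv (pr j (κ j) k (κ k)) 0 x₀ = 0
  · refine ⟨s1.mul_reg (reg_qt P _ _ fun d2 => ?_), Or.inr (Or.inl d1)⟩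
    obtain ⟨m, hm1, -, he⟩ := hx.sep _ hm h0 _ zero_mem_consts d1
    obtain ⟨m', hm1', -, he'⟩ := hx.sep _ hm h0 _ Ibeta_mem_consts d2
    have h3 := norm_exp_smul_eq hm1 he
    have h4 : Complex.exp (Complex.I * (m' * c₀)) = Complex.exp (Complex.I * c₀) ^ m' := by
      rw [← Complex.exp_int_mul]; ring_nf
    rw [h4, h3, one_zpow] at he'
    have := exp_I_mul_Ibeta hβ
    rw [he'] at this
    simp at this
  · have r1 := reg_qt P P.g α₀ d1
    refine ⟨r1.mul_simple s2, ?_⟩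
    by_cases d2 : dv (pr j (κ j) k (κ k)) (Complex.I * P.β) x₀ = 0
    · exact Or.inr (Or.inr d2)
    · exact Or.inl (r1.mul (reg_qt P _ _ d2))

lemma cross_eq (κ : Fin n → ℤ) (j k : Fin n) (x : Fin n → ℂ) :
    cross P κ x j k = qt P P.g (aff (pr j (κ j) k 1) 0 x) *
      qt P P.g (aff (pr j (κ j) k (-1)) 0 x) := by
  rw [cross, ← va_aff, ← va_aff]
  simp [sub_eq_add_neg]

lemma Generic.simple_cross (hx : Generic P α₀ c₀ x₀) {κ : Fin n → ℤ} {j k : Fin n}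
    (hjk : j ≠ k) (hj : κ j = 1 ∨ κ j = -1) :
    (Simple fun t => cross P κ (line x₀ α₀ t) j k) ∧
      ((Reg fun t => cross P κ (line x₀ α₀ t) j k) ∨
      ∃ b : ℤ, (b = 1 ∨ b = -1) ∧ dv (pr j (κ j) k b) 0 x₀ = 0) := by
  have hm1 := pr_mem hjk hj (b := 1) (Or.inl rfl)
  have hm2 := pr_mem hjk hj (b := -1) (Or.inr rfl)
  have h1 := pr_ne_zero hjk 1 hj
  have h2 := pr_ne_zero hjk (-1) hj
  simp only [cross_eq]
  have s1 := hx.simple_qt P.g hm1 h1 zero_mem_consts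
  have s2 := hx.simple_qt P.g hm2 h2 zero_mem_consts
  by_cases d1 : dv (pr j (κ j) k 1) 0 x₀ = 0
  · refine ⟨s1.mul_reg (reg_qt P _ _ fun d2 => ?_), Or.inr ⟨1, Or.inl rfl, d1⟩⟩
    obtain ⟨m, hm, e, -⟩ := hx.sep _ hm1 h1 _ zero_mem_consts d1
    obtain ⟨m', hm', e', -⟩ := hx.sep _ hm2 h2 _ zero_mem_consts d2
    have a1 := congrFun e j
    have a2 := congrFun e' j
    have a3 := congrFun e k
    have a4 := congrFun e' k
    simp only [pr_left hjk, pr_right hjk, Pi.smul_apply, smul_eq_mul] at a1 a2 a3 a4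
    rcases hm with rfl | rfl <;> rcases hm' with rfl | rfl <;> omega
  · have r1 := reg_qt P P.g α₀ d1
    refine ⟨r1.mul_simple s2, ?_⟩
    by_cases d2 : dv (pr j (κ j) k (-1)) 0 x₀ = 0
    · exact Or.inr ⟨-1, Or.inr rfl, d2⟩
    · exact Or.inl (r1.mul (reg_qt P _ _ d2))

/-- The ways in which a coefficient can be singular at `x₀`. -/
inductive Sing (P : Params) (κ : Fin n → ℤ) (J K : Finset (Fin n)) (x₀ : Fin n → ℂ) : Prop
  | single (j : Fin n) (hj : j ∈ J) (c : ℂ) (hc : c ∈ vbConsts P)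
      (h : dv (Pi.single j (κ j)) c x₀ = 0)
  | inner (j k : Fin n) (hj : j ∈ J) (hk : k ∈ J) (hjk : j ≠ k) (c : ℂ)
      (hc : c = 0 ∨ c = Complex.I * P.β) (h : dv (pr j (κ j) k (κ k)) c x₀ = 0)
  | cross (j k : Fin n) (hj : j ∈ J) (hk : k ∈ K) (hjk : j ≠ k) (b : ℤ) (hb : b = 1 ∨ b = -1)
      (h : dv (pr j (κ j) k b) 0 x₀ = 0)

lemma pairProd_eq_prod (J : Finset (Fin n)) (s : Fin n → Fin n → ℂ) :
    pairProd J s = ∏ q ∈ (J ×ˢ J).filter (fun q => q.1 < q.2), s q.1 q.2 := by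
  rw [Finset.prod_filter, Finset.prod_product, pairProd]
  exact Finset.prod_congr rfl fun j _ => Finset.prod_filter _ _

lemma Generic.supp_eq (hx : Generic P α₀ c₀ x₀) {α : Fin n → ℤ} (hα : α ∈ steps Finset.univ)
    (h0 : α ≠ 0) {c : ℂ} (hc : c ∈ consts P) (hd : dv α c x₀ = 0) : supp α = supp α₀ := by
  obtain ⟨m, hm, rfl, -⟩ := hx.sep α hα h0 c hc hd
  exact supp_smul hm α₀

/-- A coefficient has at most a simple pole at a generic point. -/
lemma Generic.simple_V (hβ : 0 < P.β) (hx : Generic P α₀ c₀ x₀) {κ : Fin n → ℤ}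
    {J K : Finset (Fin n)} (hκ : ∀ j ∈ J, κ j = 1 ∨ κ j = -1) (hJK : Disjoint J K) :
    (Simple fun t => V P κ J K (line x₀ α₀ t)) ∧
      ((Reg fun t => V P κ J K (line x₀ α₀ t)) ∨ Sing P κ J K x₀) := by
  have hA : (Simple fun t => ∏ j ∈ J, vb P (κ j * line x₀ α₀ t j)) ∧
      ((Reg fun t => ∏ j ∈ J, vb P (κ j * line x₀ α₀ t j)) ∨
        ∃ j ∈ J, ∃ c ∈ vbConsts P, dv (Pi.single j (κ j)) c x₀ = 0) := by
    have key : ∀ j ∈ J, ¬ (Reg fun t => vb P (κ j * line x₀ α₀ t j)) →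
        ∃ c ∈ vbConsts P, dv (Pi.single j (κ j)) c x₀ = 0 := fun j hj h =>
      (hx.simple_vb hβ (hκ j hj)).2.resolve_left h
    obtain ⟨h1, h2⟩ := reg_or_simple_prod (s := J) (φ := fun j t => vb P (κ j * line x₀ α₀ t j))
      (fun j hj => (hx.simple_vb hβ (hκ j hj)).1) (fun j hj k hk h h' => by
        obtain ⟨c, hc, hd⟩ := key j hj h
        obtain ⟨c', hc', hd'⟩ := key k hk h'
        have e := hx.supp_eq (single_mem (hκ j hj)) (single_ne_zero' (hκ j hj))
          (vbConsts_subset hc) hd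
        have e' := hx.supp_eq (single_mem (hκ k hk)) (single_ne_zero' (hκ k hk))
          (vbConsts_subset hc') hd'
        rw [supp_single (hκ j hj)] at e
        rw [supp_single (hκ k hk), ← e] at e'
        exact (Finset.singleton_injective e').symm)
    refine ⟨h1, h2.imp id ?_⟩
    rintro ⟨j, hj, h⟩
    exact ⟨j, hj, key j hj h⟩
  have hB : (Simple fun t => pairProd J (inner2 P κ (line x₀ α₀ t))) ∧
      ((Reg fun t => pairProd J (inner2 P κ (line x₀ α₀ t))) ∨
        ∃ j ∈ J, ∃ k ∈ J, j ≠ k ∧ ∃ c, (c = 0 ∨ c = Complex.I * P.β) ∧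
          dv (pr j (κ j) k (κ k)) c x₀ = 0) := by
    have key : ∀ q ∈ (J ×ˢ J).filter (fun q => q.1 < q.2),
        ¬ (Reg fun t => inner2 P κ (line x₀ α₀ t) q.1 q.2) →
        ∃ c, (c = 0 ∨ c = Complex.I * P.β) ∧ dv (pr q.1 (κ q.1) q.2 (κ q.2)) c x₀ = 0 := by
      intro q hq h
      rw [Finset.mem_filter, Finset.mem_product] at hq
      rcases (hx.simple_inner2 hβ hq.2.ne (hκ _ hq.1.1) (hκ _ hq.1.2)).2.resolve_left h with h | h
      · exact ⟨0, Or.inl rfl, h⟩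
      · exact ⟨_, Or.inr rfl, h⟩
    have hc' : ∀ c, (c = 0 ∨ c = Complex.I * P.β) → c ∈ consts P := by
      rintro c (rfl | rfl)
      · exact zero_mem_consts
      · exact Ibeta_mem_consts
    simp only [pairProd_eq_prod]
    obtain ⟨h1, h2⟩ := reg_or_simple_prod (s := (J ×ˢ J).filter (fun q => q.1 < q.2))
      (φ := fun q t => inner2 P κ (line x₀ α₀ t) q.1 q.2)
      (fun q hq => by
        rw [Finset.mem_filter, Finset.mem_product] at hq
        exact (hx.simple_inner2 hβ hq.2.ne (hκ _ hq.1.1) (hκ _ hq.1.2)).1)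
      (fun q hq q' hq' h h' => by
        obtain ⟨c, hc, hd⟩ := key q hq h
        obtain ⟨c', hcc', hd'⟩ := key q' hq' h'
        rw [Finset.mem_filter, Finset.mem_product] at hq hq'
        have e := hx.supp_eq (pr_mem hq.2.ne (hκ _ hq.1.1) (hκ _ hq.1.2))
          (pr_ne_zero hq.2.ne _ (hκ _ hq.1.1)) (hc' _ hc) hd
        have e' := hx.supp_eq (pr_mem hq'.2.ne (hκ _ hq'.1.1) (hκ _ hq'.1.2))
          (pr_ne_zero hq'.2.ne _ (hκ _ hq'.1.1)) (hc' _ hcc') hd'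
        rw [supp_pr hq.2.ne (hκ _ hq.1.1) (hκ _ hq.1.2)] at e
        rw [supp_pr hq'.2.ne (hκ _ hq'.1.1) (hκ _ hq'.1.2), ← e] at e'
        obtain ⟨a, b⟩ := q
        obtain ⟨a', b'⟩ := q'
        have h1 : a' ∈ ({a, b} : Finset (Fin n)) := e' ▸ (by simp)
        have h2 : b' ∈ ({a, b} : Finset (Fin n)) := e' ▸ (by simp)
        have l1 := hq.2
        have l2 := hq'.2
        simp only [Finset.mem_insert, Finset.mem_singleton] at h1 h2 l1 l2
        ext <;> simp only <;> grind)
    refine ⟨h1, h2.imp id ?_⟩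
    rintro ⟨q, hq, h⟩
    obtain ⟨c, hc, hd⟩ := key q hq h
    rw [Finset.mem_filter, Finset.mem_product] at hq
    exact ⟨q.1, hq.1.1, q.2, hq.1.2, hq.2.ne, c, hc, hd⟩
  have hC : (Simple fun t => ∏ j ∈ J, ∏ k ∈ K, cross P κ (line x₀ α₀ t) j k) ∧
      ((Reg fun t => ∏ j ∈ J, ∏ k ∈ K, cross P κ (line x₀ α₀ t) j k) ∨
        ∃ j ∈ J, ∃ k ∈ K, j ≠ k ∧ ∃ b : ℤ, (b = 1 ∨ b = -1) ∧ dv (pr j (κ j) k b) 0 x₀ = 0) := by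
    have hne : ∀ q ∈ J ×ˢ K, q.1 ≠ q.2 := fun q hq h => by
      rw [Finset.mem_product] at hq
      exact Finset.disjoint_left.1 hJK hq.1 (h ▸ hq.2)
    have key : ∀ q ∈ J ×ˢ K, ¬ (Reg fun t => cross P κ (line x₀ α₀ t) q.1 q.2) →
        ∃ b : ℤ, (b = 1 ∨ b = -1) ∧ dv (pr q.1 (κ q.1) q.2 b) 0 x₀ = 0 := by
      intro q hq h
      exact (hx.simple_cross (hne q hq) (hκ _ (Finset.mem_product.1 hq).1)).2.resolve_left h
    simp only [← Finset.prod_product']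
    obtain ⟨h1, h2⟩ := reg_or_simple_prod (s := J ×ˢ K)
      (φ := fun q t => cross P κ (line x₀ α₀ t) q.1 q.2)
      (fun q hq => (hx.simple_cross (hne q hq) (hκ _ (Finset.mem_product.1 hq).1)).1)
      (fun q hq q' hq' h h' => by
        obtain ⟨b, hb, hd⟩ := key q hq h
        obtain ⟨b', hb', hd'⟩ := key q' hq' h'
        have n1 := hne q hq
        have n2 := hne q' hq'
        rw [Finset.mem_product] at hq hq'
        have e := hx.supp_eq (pr_mem n1 (hκ _ hq.1) hb) (pr_ne_zero n1 _ (hκ _ hq.1))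
          zero_mem_consts hd
        have e' := hx.supp_eq (pr_mem n2 (hκ _ hq'.1) hb') (pr_ne_zero n2 _ (hκ _ hq'.1))
          zero_mem_consts hd'
        rw [supp_pr n1 (hκ _ hq.1) hb] at e
        rw [supp_pr n2 (hκ _ hq'.1) hb', ← e] at e'
        obtain ⟨a, b⟩ := q
        obtain ⟨a', b'⟩ := q'
        have h1 : a' ∈ ({a, b} : Finset (Fin n)) := e' ▸ (by simp)
        have h2 : b' ∈ ({a, b} : Finset (Fin n)) := e' ▸ (by simp)
        have l1 := Finset.disjoint_left.1 hJK hq.1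
        have l2 := Finset.disjoint_left.1 hJK hq'.1
        simp only [Finset.mem_insert, Finset.mem_singleton] at h1 h2 hq hq' l1 l2
        ext <;> simp only <;> grind)
    refine ⟨h1, h2.imp id ?_⟩
    rintro ⟨q, hq, h⟩
    obtain ⟨b, hb, hd⟩ := key q hq h
    have n1 := hne q hq
    rw [Finset.mem_product] at hq
    exact ⟨q.1, hq.1, q.2, hq.2, n1, b, hb, hd⟩
  have hcard1 : ∀ {j : Fin n} {a : ℤ} {c : ℂ}, (a = 1 ∨ a = -1) → c ∈ vbConsts P →
      dv (Pi.single j a) c x₀ = 0 → (supp α₀).card = 1 := by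
    intro j a c ha hc hd
    rw [← hx.supp_eq (single_mem ha) (single_ne_zero' ha) (vbConsts_subset hc) hd, supp_single ha]
    simp
  have hsupp2 : ∀ {j k : Fin n} {a b : ℤ} {c : ℂ}, j ≠ k → (a = 1 ∨ a = -1) →
      (b = 1 ∨ b = -1) → (c = 0 ∨ c = Complex.I * P.β) → dv (pr j a k b) c x₀ = 0 →
      supp α₀ = {j, k} := by
    intro j k a b c hjk ha hb hc hd
    have hc' : c ∈ consts P := by
      rcases hc with rfl | rfl
      · exact zero_mem_consts
      · exact Ibeta_mem_consts
    rw [← hx.supp_eq (pr_mem hjk ha hb) (pr_ne_zero hjk _ ha) hc' hd, supp_pr hjk ha hb]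
  simp only [V_eq]
  rcases hA.2 with rA | ⟨j, hj, c, hc, hd⟩
  · rcases hB.2 with rB | ⟨j, hj, k, hk, hjk, c, hc, hd⟩
    · refine ⟨(rA.mul rB).mul_simple hC.1, ?_⟩
      rcases hC.2 with rC | ⟨j, hj, k, hk, hjk, b, hb, hd⟩
      · exact Or.inl ((rA.mul rB).mul rC)
      · exact Or.inr (Sing.cross j k hj hk hjk b hb hd)
    · have rC := hC.2.resolve_right (by
        rintro ⟨j', hj', k', hk', hjk', b, hb, hd'⟩
        have e := hsupp2 hjk (hκ _ hj) (hκ _ hk) hc hd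
        rw [hsupp2 hjk' (hκ _ hj') hb (Or.inl rfl) hd'] at e
        have : k' ∈ ({j, k} : Finset (Fin n)) := e ▸ (by simp)
        rw [Finset.mem_insert, Finset.mem_singleton] at this
        rcases this with rfl | rfl
        · exact Finset.disjoint_left.1 hJK hj hk'
        · exact Finset.disjoint_left.1 hJK hk hk')
      exact ⟨(rA.mul_simple hB.1).mul_reg rC, Or.inr (Sing.inner j k hj hk hjk c hc hd)⟩
  · have h1 := hcard1 (hκ j hj) hc hd
    have rB := hB.2.resolve_right (by
      rintro ⟨j', hj', k', hk', hjk', c, hc, hd'⟩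
      rw [hsupp2 hjk' (hκ _ hj') (hκ _ hk') hc hd', Finset.card_pair hjk'] at h1
      omega)
    have rC := hC.2.resolve_right (by
      rintro ⟨j', hj', k', hk', hjk', b, hb, hd'⟩
      rw [hsupp2 hjk' (hκ _ hj') hb (Or.inl rfl) hd', Finset.card_pair hjk'] at h1
      omega)
    exact ⟨(hA.1.mul_reg rB).mul_reg rC, Or.inr (Sing.single j hj c hc hd)⟩

end factors

end

end Koornwinder

namespace Koornwinder

open Filter Topology

noncomputable section

variable {n : ℕ} {P : Params} {α₀ : Fin n → ℤ} {c₀ : ℂ} {x₀ : Fin n → ℂ}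

lemma Sing.supp_subset {κ : Fin n → ℤ} {J K : Finset (Fin n)}
    (hκ : ∀ j ∈ J, κ j = 1 ∨ κ j = -1) (hx : Generic P α₀ c₀ x₀) (h : Sing P κ J K x₀) :
    supp α₀ ⊆ J ∪ K ∧ ∃ j ∈ J, j ∈ supp α₀ := by
  cases h with
  | single j hj c hc h =>
    rw [← hx.supp_eq (single_mem (hκ j hj)) (single_ne_zero' (hκ j hj)) (vbConsts_subset hc) h,
      supp_single (hκ j hj)]
    exact ⟨by simp [hj], j, hj, by simp⟩
  | inner j k hj hk hjk c hc h =>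
    have hc' : c ∈ consts P := by
      rcases hc with rfl | rfl
      · exact zero_mem_consts
      · exact Ibeta_mem_consts
    rw [← hx.supp_eq (pr_mem hjk (hκ j hj) (hκ k hk)) (pr_ne_zero hjk _ (hκ j hj)) hc' h,
      supp_pr hjk (hκ j hj) (hκ k hk)]
    exact ⟨by simp [Finset.insert_subset_iff, hj, hk], j, hj, by simp⟩
  | cross j k hj hk hjk b hb h =>
    rw [← hx.supp_eq (pr_mem hjk (hκ j hj) hb) (pr_ne_zero hjk _ (hκ j hj)) zero_mem_consts h,
      supp_pr hjk (hκ j hj) hb]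
    exact ⟨by simp [Finset.insert_subset_iff, hj, hk], j, hj, by simp⟩

lemma step_pm {K : Finset (Fin n)} {κ : Fin n → ℤ} (h : κ ∈ steps K) :
    ∀ j ∈ supp κ, κ j = 1 ∨ κ j = -1 := fun j hj =>
  ((mem_steps.1 h).1 j).resolve_left (mem_supp.1 hj)

lemma Generic.simple_U (hβ : 0 < P.β) (hx : Generic P α₀ c₀ x₀) (K : Finset (Fin n)) (p : ℕ) :
    (Simple fun t => U P K p (line x₀ α₀ t)) ∧
      (¬ supp α₀ ⊆ K → Reg fun t => U P K p (line x₀ α₀ t)) := by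
  induction p using Nat.strong_induction_on generalizing K with
  | _ p ih =>
    rcases eq_or_ne p 0 with rfl | hp
    · simp only [U_zero]
      exact ⟨(Reg.const 1).simple, fun _ => Reg.const 1⟩
    have hdisj : ∀ κ : Fin n → ℤ, Disjoint (supp κ) (K \ supp κ) := fun κ => Finset.disjoint_sdiff
    have hun : ∀ κ ∈ steps' K p, supp κ ∪ (K \ supp κ) = K := fun κ hκ =>
      Finset.union_sdiff_of_subset (mem_steps.1 (mem_steps'.1 hκ).1).2
    have hlt : ∀ κ ∈ steps' K p, p - (supp κ).card < p := fun κ hκ => by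
      have := card_supp_pos (mem_steps'.1 hκ).2.1
      omega
    simp only [U_rec P K hp]
    constructor
    · refine (Simple.sum fun κ hκ => ?_).neg
      have hpm := step_pm (mem_steps'.1 hκ).1
      have hV := hx.simple_V hβ hpm (hdisj κ)
      have hU := ih _ (hlt κ hκ) (K \ supp κ)
      rcases hV.2 with hr | hs
      · exact hr.mul_simple hU.1
      · obtain ⟨-, j, hj, hj'⟩ := hs.supp_subset hpm hx
        refine hV.1.mul_reg (hU.2 fun hsub => ?_)
        exact (Finset.mem_sdiff.1 (hsub hj')).2 hj
    · intro hK
      refine (Reg.sum fun κ hκ => ?_).neg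
      have hpm := step_pm (mem_steps'.1 hκ).1
      have hV := hx.simple_V hβ hpm (hdisj κ)
      have hU := ih _ (hlt κ hκ) (K \ supp κ)
      refine Reg.mul (hV.2.resolve_right fun hs => hK ?_)
        (hU.2 fun hsub => hK (hsub.trans Finset.sdiff_subset))
      rw [← hun κ hκ]
      exact (hs.supp_subset hpm hx).1

lemma Generic.simple_Hop (hβ : 0 < P.β) (hx : Generic P α₀ c₀ x₀) (r : ℕ) {f : (Fin n → ℂ) → ℂ}
    (hf : Continuous f) : Simple fun t => Hop P r f (line x₀ α₀ t) := by
  refine Simple.sum fun κ hκ => ?_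
  have hpm := step_pm (Finset.mem_filter.1 hκ).1
  have hV := hx.simple_V hβ hpm (Finset.disjoint_sdiff (s := supp κ) (t := Finset.univ))
  have hU := hx.simple_U hβ (Finset.univ \ supp κ) (r - (supp κ).card)
  refine Simple.mul_reg ?_ (reg_of_continuous
    (hf.comp (continuous_id.add continuous_const)) x₀ α₀)
  rcases hV.2 with hr | hs
  · exact hr.mul_simple hU.1
  · obtain ⟨-, j, hj, hj'⟩ := hs.supp_subset hpm hx
    refine hV.1.mul_reg (hU.2 fun hsub => ?_)
    exact (Finset.mem_sdiff.1 (hsub hj')).2 hj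

/-! ### Reflections -/

/-- The affine functions occurring in the denominators of the coefficients. -/
def IsForm (P : Params) (α : Fin n → ℤ) (c : ℂ) : Prop :=
  (∃ j k : Fin n, ∃ a b : ℤ, j ≠ k ∧ (a = 1 ∨ a = -1) ∧ (b = 1 ∨ b = -1) ∧ α = pr j a k b ∧
    (c = 0 ∨ c = Complex.I * P.β)) ∨
  ∃ j : Fin n, ∃ a : ℤ, (a = 1 ∨ a = -1) ∧ α = Pi.single j a ∧ c ∈ vbConsts P

lemma IsForm.mem {α : Fin n → ℤ} {c : ℂ} (h : IsForm P α c) :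
    α ∈ steps Finset.univ ∧ α ≠ 0 ∧ c ∈ consts P := by
  rcases h with ⟨j, k, a, b, hjk, ha, hb, rfl, hc⟩ | ⟨j, a, ha, rfl, hc⟩
  · refine ⟨pr_mem hjk ha hb, pr_ne_zero hjk b ha, ?_⟩
    rcases hc with rfl | rfl
    · exact zero_mem_consts
    · exact Ibeta_mem_consts
  · exact ⟨single_mem ha, single_ne_zero' ha, vbConsts_subset hc⟩

/-- `w` acts as the reflection in the hyperplane orthogonal to `α`, whose coroot is `N α`. -/
def IsReflection (w : SP n) (α : Fin n → ℤ) (N : ℤ) : Prop :=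
  (∀ x : Fin n → ℂ, act w x = x - fun j => (N * ∑ i, (α i : ℂ) * x i) * α j) ∧
    N * ∑ j, α j * α j = 2

lemma exists_reflection_pr {j k : Fin n} {a b : ℤ} (hjk : j ≠ k) (ha : a = 1 ∨ a = -1)
    (hb : b = 1 ∨ b = -1) : ∃ w : SP n, IsReflection w (pr j a k b) 1 := by
  have hsum : ∀ x : Fin n → ℂ, ∑ i, (pr j a k b i : ℂ) * x i = a * x j + b * x k := fun x => by
    simpa [aff] using aff_pr j a k b 0 x
  obtain ⟨u, hu⟩ : ∃ u : ℤˣ, (u : ℤ) = -(a * b) := by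
    rcases ha with rfl | rfl <;> rcases hb with rfl | rfl
    · exact ⟨-1, by simp⟩
    · exact ⟨1, by simp⟩
    · exact ⟨1, by simp⟩
    · exact ⟨-1, by simp⟩
  have haa : (a : ℂ) * a = 1 := by rcases ha with rfl | rfl <;> simp
  have hbb : (b : ℂ) * b = 1 := by rcases hb with rfl | rfl <;> simp
  refine ⟨(Equiv.swap j k, fun i => if i = j ∨ i = k then u else 1), fun x => ?_, ?_⟩
  · ext i
    simp only [act, Pi.sub_apply, hsum]
    by_cases h1 : i = j
    · subst h1
      simp [pr_left hjk, hu]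
      linear_combination (x i) * haa
    by_cases h2 : i = k
    · subst h2
      simp [pr_right hjk, hu]
      linear_combination (x i) * hbb
    simp [pr_other h1 h2, h1, h2, Equiv.swap_apply_of_ne_of_ne h1 h2]
  · rw [one_mul]
    have e : ∑ i, pr j a k b i * pr j a k b i = a * a + b * b := by
      have h1 := hsum fun i => (pr j a k b i : ℂ)
      rw [pr_left hjk, pr_right hjk] at h1
      exact_mod_cast h1
    rw [e]
    rcases ha with rfl | rfl <;> rcases hb with rfl | rfl <;> norm_num

lemma exists_reflection_single {j : Fin n} {a : ℤ} (ha : a = 1 ∨ a = -1) :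
    ∃ w : SP n, IsReflection w (Pi.single j a) 2 := by
  have hsum : ∀ x : Fin n → ℂ, ∑ i, ((Pi.single j a : Fin n → ℤ) i : ℂ) * x i = a * x j :=
    fun x => by simpa [aff] using aff_single j a 0 x
  have haa : (a : ℂ) * a = 1 := by rcases ha with rfl | rfl <;> simp
  refine ⟨(1, fun i => if i = j then -1 else 1), fun x => ?_, ?_⟩
  · ext i
    simp only [act, Pi.sub_apply, hsum]
    by_cases h1 : i = j
    · subst h1
      simp
      linear_combination (2 * x i) * haa
    simp [h1]
  · have e : ∑ i, (Pi.single j a : Fin n → ℤ) i * (Pi.single j a : Fin n → ℤ) i = a * a := by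
      have h1 := hsum fun i => ((Pi.single j a : Fin n → ℤ) i : ℂ)
      rw [Pi.single_eq_same] at h1
      exact_mod_cast h1
    rw [e]
    rcases ha with rfl | rfl <;> norm_num

/-- The two kinds of singular hyperplanes: fixed by a reflection of the affine Weyl group with
translations `2πℤⁿ`, or mapped by such a reflection to their translate by `iβα`. -/
lemma IsForm.cases (h : IsForm P α₀ c₀) : ∃ w N, IsReflection w α₀ N ∧ ∃ m : ℤ,
    (N * c₀ = 2 * Real.pi * m ∨ N * c₀ = Complex.I * P.β + 2 * Real.pi * m) := by
  rcases h with ⟨j, k, a, b, hjk, ha, hb, rfl, hc⟩ | ⟨j, a, ha, rfl, hc⟩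
  · obtain ⟨w, hw⟩ := exists_reflection_pr hjk ha hb
    refine ⟨w, 1, hw, 0, ?_⟩
    rcases hc with rfl | rfl <;> simp
  · obtain ⟨w, hw⟩ := exists_reflection_single (j := j) ha
    simp only [vbConsts, Finset.mem_insert, Finset.mem_singleton] at hc
    rcases hc with rfl | rfl | rfl | rfl
    · exact ⟨w, 2, hw, 0, Or.inl (by simp)⟩
    · exact ⟨w, 2, hw, 1, Or.inl (by simp)⟩
    · exact ⟨w, 2, hw, 0, Or.inr (by push_cast; ring)⟩
    · exact ⟨w, 2, hw, 1, Or.inr (by push_cast; ring)⟩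

lemma sum_eq_of_aff {α : Fin n → ℤ} {c : ℂ} {x : Fin n → ℂ} (h : aff α c x = 0) :
    ∑ j, (α j : ℂ) * x j = -c := eq_neg_of_add_eq_zero_left h

/-- On the hyperplanes fixed by an affine reflection the poles cancel by symmetry. -/
lemma Generic.null_Hop_of_symm (hβ : 0 < P.β) (hx : Generic P α₀ c₀ x₀) {w : SP n} {N m : ℤ}
    (hw : IsReflection w α₀ N) (hm : N * c₀ = 2 * Real.pi * m) (r : ℕ) {f : (Fin n → ℂ) → ℂ}
    (hf : f ∈ expPoly n) (hfi : Inv f) : Null fun t => Hop P r f (line x₀ α₀ t) := by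
  obtain ⟨L, hL⟩ := hx.simple_Hop hβ r (continuous_expPoly hf)
  have hsymm : ∀ t, Hop P r f (line x₀ α₀ (-t)) = Hop P r f (line x₀ α₀ t) := by
    intro t
    rw [← Hop_inv P r hfi w (line x₀ α₀ t), ← Hop_add_two_pi P r hf (m • α₀) (line x₀ α₀ (-t)),
      hw.1]
    congr 1
    have h1 : ∑ i, (α₀ i : ℂ) * line x₀ α₀ t i = -c₀ + t * (∑ j, α₀ j * α₀ j : ℤ) := by
      have := aff_line α₀ α₀ 0 x₀ t
      simp only [aff, add_zero] at this
      rw [this, sum_eq_of_aff hx.zero]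
    have h2 : (N : ℂ) * ((∑ j, α₀ j * α₀ j : ℤ) : ℂ) = 2 := by exact_mod_cast hw.2
    ext j
    rw [h1]
    simp only [line, Pi.add_apply, Pi.sub_apply, Pi.smul_apply, smul_eq_mul, Int.cast_mul]
    linear_combination (-(α₀ j : ℂ)) * hm + t * α₀ j * h2
  have hneg : Tendsto (fun t : ℂ => -t) (𝓝[≠] 0) (𝓝[≠] 0) := by
    refine tendsto_nhdsWithin_iff.2 ⟨?_, ?_⟩
    · simpa using tendsto_id_puncture.neg
    · filter_upwards [self_mem_nhdsWithin] with t ht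
      simpa using ht
  have h2 := hL.comp hneg
  simp only [Function.comp_def, hsymm] at h2
  have h3 := hL.add h2
  have h4 : L + L = 0 := by
    refine tendsto_nhds_unique h3 (tendsto_const_nhds.congr fun t => ?_)
    ring
  have h5 : L = 0 := by
    have : (2 : ℂ) * L = 0 := by rw [two_mul]; exact h4
    simpa using this
  rwa [h5] at hL

/-! ### The shifted hyperplanes -/

lemma consts_im_nonneg (hβ : 0 < P.β) {c : ℂ} (hc : c ∈ consts P) : 0 ≤ c.im := by
  simp only [consts, Finset.mem_insert, Finset.mem_singleton] at hc
  rcases hc with rfl | rfl | rfl | rfl | rfl <;> simp <;> positivity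

lemma Generic.eq_of_im_pos (hβ : 0 < P.β) (hx : Generic P α₀ c₀ x₀) (hc₀ : 0 < c₀.im)
    {α : Fin n → ℤ} (hα : α ∈ steps Finset.univ) (h0 : α ≠ 0) {c : ℂ} (hc : c ∈ consts P)
    (hd : dv α c x₀ = 0) : α = α₀ ∧ 0 < c.im := by
  obtain ⟨m, hm, h1, h2⟩ := hx.sep α hα h0 c hc hd
  have h3 := congrArg norm h2
  rw [Complex.norm_exp, Complex.norm_exp, Real.exp_eq_exp] at h3
  simp at h3
  have h4 := consts_im_nonneg hβ hc
  rcases hm with rfl | rfl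
  · simp at h1 h3
    exact ⟨h1, by linarith⟩
  · simp at h3; linarith

lemma Sing.match_of_im_pos (hβ : 0 < P.β) {κ : Fin n → ℤ} {J K : Finset (Fin n)}
    (hκ : ∀ j ∈ J, κ j = 1 ∨ κ j = -1) (hx : Generic P α₀ c₀ x₀) (hc₀ : 0 < c₀.im)
    (h : Sing P κ J K x₀) : ∀ j ∈ supp α₀, j ∈ J ∧ κ j = α₀ j := by
  intro i hi
  cases h with
  | single j hj c hc h =>
    obtain ⟨e, -⟩ := hx.eq_of_im_pos hβ hc₀ (single_mem (hκ j hj)) (single_ne_zero' (hκ j hj))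
      (vbConsts_subset hc) h
    rw [← e, supp_single (hκ j hj), Finset.mem_singleton] at hi
    subst hi
    exact ⟨hj, by rw [← e]; simp⟩
  | inner j k hj hk hjk c hc h =>
    have hc' : c ∈ consts P := by
      rcases hc with rfl | rfl
      · exact zero_mem_consts
      · exact Ibeta_mem_consts
    obtain ⟨e, -⟩ := hx.eq_of_im_pos hβ hc₀ (pr_mem hjk (hκ j hj) (hκ k hk))
      (pr_ne_zero hjk _ (hκ j hj)) hc' h
    rw [← e, supp_pr hjk (hκ j hj) (hκ k hk), Finset.mem_insert, Finset.mem_singleton] at hi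
    rcases hi with rfl | rfl
    · exact ⟨hj, by rw [← e, pr_left hjk]⟩
    · exact ⟨hk, by rw [← e, pr_right hjk]⟩
  | cross j k hj hk hjk b hb h =>
    obtain ⟨-, e⟩ := hx.eq_of_im_pos hβ hc₀ (pr_mem hjk (hκ j hj) hb)
      (pr_ne_zero hjk _ (hκ j hj)) zero_mem_consts h
    simp at e

/-- On a shifted hyperplane a step may be composed with `α₀`. -/
lemma IsForm.prod_va (h : IsForm P α₀ c₀) (hc₀ : 0 < c₀.im) (hx : aff α₀ c₀ x₀ = 0) (A : ℂ) :
    ∏ j ∈ supp α₀, (va P (A + α₀ j * x₀ j) * va P (A + α₀ j * x₀ j + Complex.I * P.β)) =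
      ∏ j ∈ supp α₀, (va P (A + x₀ j) * va P (A - x₀ j)) := by
  have hpm : ∀ (a : ℤ) (z : ℂ), (a = 1 ∨ a = -1) →
      va P (A + z) * va P (A - z) = va P (A + a * z) * va P (A - a * z) := by
    rintro a z (rfl | rfl)
    · simp
    · simp [sub_eq_add_neg, mul_comm]
  rcases h with ⟨j, k, a, b, hjk, ha, hb, rfl, hc⟩ | ⟨j, a, ha, rfl, hc⟩
  · have hc' : c₀ = Complex.I * P.β := hc.resolve_left (by rintro rfl; simp at hc₀)
    rw [supp_pr hjk ha hb, Finset.prod_pair hjk, Finset.prod_pair hjk, pr_left hjk, pr_right hjk,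
      hpm a (x₀ j) ha, hpm b (x₀ k) hb]
    rw [aff_pr, hc'] at hx
    have e1 : A + a * x₀ j + Complex.I * P.β = A - b * x₀ k := by linear_combination hx
    have e2 : A + b * x₀ k + Complex.I * P.β = A - a * x₀ j := by linear_combination hx
    rw [e1, e2]
    ring
  · rw [supp_single ha, Finset.prod_singleton, Finset.prod_singleton, Pi.single_eq_same,
      hpm a _ ha]
    rw [aff_single] at hx
    congr 1
    simp only [vbConsts, Finset.mem_insert, Finset.mem_singleton] at hc
    rcases hc with rfl | rfl | rfl | rfl
    · simp at hc₀
    · simp at hc₀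
    · congr 1
      linear_combination 2 * hx
    · rw [← va_add_two_pi P _ 1]
      congr 1
      push_cast
      linear_combination 2 * hx

lemma prod_disjoint_ne {κ : Fin n → ℤ} {S : Finset (Fin n)} (h : Disjoint (supp κ) S) {l j : Fin n}
    (hl : l ∈ supp κ) (hj : j ∈ S) : l ≠ j := fun e =>
  Finset.disjoint_left.1 h hl (e ▸ hj)

/-- The coefficient of a composed step agrees with the product of the coefficients, up to terms
without residue. -/
lemma Generic.null_V_add (hβ : 0 < P.β) (hx : Generic P α₀ c₀ x₀) (hform : IsForm P α₀ c₀)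
    (hc₀ : 0 < c₀.im) {K : Finset (Fin n)} {κ : Fin n → ℤ} (hκ : κ ∈ steps K)
    (hS : supp α₀ ⊆ K) (hd : Disjoint (supp κ) (supp α₀)) :
    Null fun t => V P (κ + α₀) (supp κ ∪ supp α₀) (K \ (supp κ ∪ supp α₀)) (line x₀ α₀ t) -
      V P κ (supp κ) (K \ supp κ) (line x₀ α₀ t) *
        V P α₀ (supp α₀) ((K \ supp κ) \ supp α₀) (line x₀ α₀ t) := by
  set M := supp κ
  set S := supp α₀ with hSdef
  have hκpm := step_pm hκ
  have hαpm := step_pm hx.mem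
  have hR : (K \ M) \ S = K \ (M ∪ S) := by exact sdiff_sdiff_left
  have hMκ : ∀ j ∈ M, (κ + α₀) j = κ j := fun j hj => by
    have : j ∉ S := Finset.disjoint_left.1 hd hj
    rw [hSdef, mem_supp, not_not] at this
    simp [this]
  have hSκ : ∀ j ∈ S, (κ + α₀) j = α₀ j := fun j hj => by
    have : j ∉ M := Finset.disjoint_right.1 hd hj
    rw [mem_supp, not_not] at this
    simp [this]
  have hKM : K \ M = S ∪ K \ (M ∪ S) := by
    rw [← hR, Finset.union_sdiff_of_subset]
    exact fun j hj => Finset.mem_sdiff.2 ⟨hS hj, Finset.disjoint_right.1 hd hj⟩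
  have hdR : Disjoint S (K \ (M ∪ S)) := by
    rw [← hR]; exact Finset.disjoint_sdiff
  rw [hR, hKM]
  have e : ∀ t, V P (κ + α₀) (M ∪ S) (K \ (M ∪ S)) (line x₀ α₀ t) -
      V P κ M (S ∪ K \ (M ∪ S)) (line x₀ α₀ t) * V P α₀ S (K \ (M ∪ S)) (line x₀ α₀ t) =
      V P κ M (K \ (M ∪ S)) (line x₀ α₀ t) * V P α₀ S (K \ (M ∪ S)) (line x₀ α₀ t) *
        (∏ l ∈ M, ∏ j ∈ S, inner2 P (κ + α₀) (line x₀ α₀ t) l j -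
          ∏ l ∈ M, ∏ j ∈ S, cross P κ (line x₀ α₀ t) l j) := by
    intro t
    rw [V_union P _ hd, V_union_right P _ hdR, V_congr P hMκ, V_congr P hSκ]
    ring
  simp only [e]
  refine Simple.mul_tendsto ?_ ?_
  · have hdM : Disjoint M (K \ (M ∪ S)) := by
      rw [← hR]
      exact Finset.disjoint_sdiff.mono_right Finset.sdiff_subset
    have h1 := hx.simple_V hβ hκpm hdM
    have h2 := hx.simple_V hβ hαpm hdR
    refine Reg.mul_simple (h1.2.resolve_right fun hs => ?_) h2.1
    obtain ⟨-, j, hj, hj'⟩ := hs.supp_subset hκpm hx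
    exact Finset.disjoint_left.1 hd hj hj'
  · have hne : ∀ l ∈ M, ∀ b : ℤ, (b = 1 ∨ b = -1) → ∀ j ∈ S, ∀ c ∈ consts P,
        dv (pr l (κ l) j b) c x₀ ≠ 0 := by
      intro l hl b hb j hj c hc h0
      have hlj := prod_disjoint_ne hd hl hj
      have := hx.supp_eq (pr_mem hlj (hκpm l hl) hb) (pr_ne_zero hlj _ (hκpm l hl)) hc h0
      rw [supp_pr hlj (hκpm l hl) hb] at this
      refine Finset.disjoint_left.1 hd hl ?_
      rw [hSdef, ← this]; simp
    have t1 : Tendsto (fun t => ∏ l ∈ M, ∏ j ∈ S, inner2 P (κ + α₀) (line x₀ α₀ t) l j) (𝓝[≠] 0)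
        (𝓝 (∏ l ∈ M, ∏ j ∈ S, inner2 P (κ + α₀) x₀ l j)) := by
      refine tendsto_finsetProd _ fun l hl => tendsto_finsetProd _ fun j hj => ?_
      have e : ∀ x, inner2 P (κ + α₀) x l j = qt P P.g (aff (pr l (κ l) j (α₀ j)) 0 x) *
          qt P P.g (aff (pr l (κ l) j (α₀ j)) (Complex.I * P.β) x) := by
        intro x
        rw [inner2, ← va_aff, ← va_aff, add_zero, hMκ l hl, hSκ j hj]
      simp only [e]
      exact (tendsto_qt P _ _ (hne l hl _ (hαpm j hj) j hj _ zero_mem_consts)).mul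
        (tendsto_qt P _ _ (hne l hl _ (hαpm j hj) j hj _ Ibeta_mem_consts))
    have t2 : Tendsto (fun t => ∏ l ∈ M, ∏ j ∈ S, cross P κ (line x₀ α₀ t) l j) (𝓝[≠] 0)
        (𝓝 (∏ l ∈ M, ∏ j ∈ S, cross P κ x₀ l j)) := by
      refine tendsto_finsetProd _ fun l hl => tendsto_finsetProd _ fun j hj => ?_
      simp only [cross_eq]
      exact (tendsto_qt P _ _ (hne l hl _ (Or.inl rfl) j hj _ zero_mem_consts)).mul
        (tendsto_qt P _ _ (hne l hl _ (Or.inr rfl) j hj _ zero_mem_consts))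
    have := t1.sub t2
    have e0 : ∏ l ∈ M, ∏ j ∈ S, inner2 P (κ + α₀) x₀ l j = ∏ l ∈ M, ∏ j ∈ S, cross P κ x₀ l j := by
      refine Finset.prod_congr rfl fun l hl => ?_
      simp only [cross]
      rw [← hform.prod_va hc₀ hx.zero]
      exact Finset.prod_congr rfl fun j hj => by rw [inner2, hMκ l hl, hSκ j hj]
    rwa [e0, sub_self] at this

/-- The proxy of the singular part of `U` at a shifted hyperplane. -/
def polar (P : Params) (α₀ : Fin n → ℤ) (K : Finset (Fin n)) (p : ℕ) (x : Fin n → ℂ) : ℂ :=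
  if (supp α₀).card ≤ p then
    V P α₀ (supp α₀) (K \ supp α₀) x * U P (K \ supp α₀) (p - (supp α₀).card) x else 0

lemma supp_add_of_disjoint {κ α : Fin n → ℤ} (h : Disjoint (supp κ) (supp α)) :
    supp (κ + α) = supp κ ∪ supp α := by
  ext j
  rw [Finset.mem_union, mem_supp, mem_supp, mem_supp, Pi.add_apply]
  by_cases hj : κ j = 0
  · simp [hj]
  · have : j ∉ supp α := Finset.disjoint_left.1 h (mem_supp.2 hj)
    rw [mem_supp, not_not] at this
    simp [this]

lemma add_mem_steps {K : Finset (Fin n)} {κ α : Fin n → ℤ} (hκ : κ ∈ steps K) (hα : α ∈ steps K)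
    (h : Disjoint (supp κ) (supp α)) : κ + α ∈ steps K := by
  refine mem_steps.2 ⟨fun j => ?_, ?_⟩
  · by_cases hj : κ j = 0
    · rw [Pi.add_apply, hj, zero_add]; exact (mem_steps.1 hα).1 j
    · have : j ∉ supp α := Finset.disjoint_left.1 h (mem_supp.2 hj)
      rw [mem_supp, not_not] at this
      rw [Pi.add_apply, this, add_zero]; exact (mem_steps.1 hκ).1 j
  · rw [supp_add_of_disjoint h]
    exact Finset.union_subset (mem_steps.1 hκ).2 (mem_steps.1 hα).2

/-- Cancellation of the poles at a shifted hyperplane. -/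
lemma Generic.null_sum (hβ : 0 < P.β) (hx : Generic P α₀ c₀ x₀) (hform : IsForm P α₀ c₀)
    (hc₀ : 0 < c₀.im) {K : Finset (Fin n)} (hS : supp α₀ ⊆ K) (p : ℕ)
    (u h : (Fin n → ℤ) → ℂ → ℂ) (hh : (Fin n → ℤ) → ℂ)
    (hlim : ∀ κ, Tendsto (h κ) (𝓝[≠] 0) (𝓝 (hh κ)))
    (hadd : ∀ κ, Disjoint (supp κ) (supp α₀) → hh (κ + α₀) = hh κ)
    (hu1 : ∀ κ ∈ steps K, (supp κ).card ≤ p → Disjoint (supp κ) (supp α₀) →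
      Null fun t => u κ t + polar P α₀ (K \ supp κ) (p - (supp κ).card) (line x₀ α₀ t))
    (hu2 : ∀ κ ∈ steps K, (supp κ).card ≤ p → ¬ Disjoint (supp κ) (supp α₀) →
      u κ = fun t => U P (K \ supp κ) (p - (supp κ).card) (line x₀ α₀ t)) :
    Null fun t => ∑ κ ∈ (steps K).filter (fun κ => (supp κ).card ≤ p),
      V P κ (supp κ) (K \ supp κ) (line x₀ α₀ t) * u κ t * h κ t := by
  classical
  set T := (steps K).filter (fun κ => (supp κ).card ≤ p) with hT
  set S := supp α₀ with hSdef
  have hαK : α₀ ∈ steps K := mem_steps.2 ⟨(mem_steps.1 hx.mem).1, hS⟩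
  have hreg : ∀ κ, Reg (h κ) := fun κ => ⟨_, hlim κ⟩
  set Ta := T.filter fun κ => Disjoint (supp κ) S with hTa
  set Tb := T.filter fun κ => ∀ j ∈ S, κ j = α₀ j with hTb
  set Ta' := Ta.filter fun κ => (supp κ).card + S.card ≤ p with hTa'
  let F : (Fin n → ℤ) → ℂ → ℂ := fun κ t =>
    V P κ (supp κ) (K \ supp κ) (line x₀ α₀ t) * u κ t * h κ t
  let G : (Fin n → ℤ) → ℂ → ℂ := fun κ t =>
    V P κ (supp κ) (K \ supp κ) (line x₀ α₀ t) *
      (u κ t + polar P α₀ (K \ supp κ) (p - (supp κ).card) (line x₀ α₀ t)) * h κ t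
  have hVreg : ∀ κ ∈ T, (¬ ∀ j ∈ S, κ j = α₀ j) →
      Reg fun t => V P κ (supp κ) (K \ supp κ) (line x₀ α₀ t) := by
    intro κ hκ hnot
    have hpm := step_pm (Finset.mem_filter.1 hκ).1
    refine (hx.simple_V hβ hpm Finset.disjoint_sdiff).2.resolve_right fun hs => hnot fun j hj => ?_
    exact (hs.match_of_im_pos hβ hpm hx hc₀ j hj).2
  obtain ⟨j₀, hj₀⟩ : S.Nonempty := Finset.card_pos.1 (card_supp_pos hx.ne)
  have hab : ∀ κ, Disjoint (supp κ) S → ¬ ∀ j ∈ S, κ j = α₀ j := by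
    intro κ hd hm
    have h1 := hm j₀ hj₀
    have h2 : j₀ ∉ supp κ := Finset.disjoint_right.1 hd hj₀
    rw [mem_supp, not_not] at h2
    exact mem_supp.1 hj₀ (h1 ▸ h2)
  have hsplit : ∀ t, ∑ κ ∈ T, F κ t = (∑ κ ∈ Ta, F κ t + ∑ κ ∈ Tb, F κ t) +
      ∑ κ ∈ T.filter (fun κ => ¬ Disjoint (supp κ) S ∧ ¬ ∀ j ∈ S, κ j = α₀ j), F κ t := by
    intro t
    rw [← Finset.sum_filter_add_sum_filter_not T (fun κ => Disjoint (supp κ) S), add_assoc]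
    congr 1
    rw [← Finset.sum_filter_add_sum_filter_not (T.filter fun κ => ¬ Disjoint (supp κ) S)
      (fun κ => ∀ j ∈ S, κ j = α₀ j)]
    congr 1
    · refine Finset.sum_congr ?_ fun _ _ => rfl
      ext κ
      have := hab κ
      simp only [hTb, Finset.mem_filter]
      tauto
    · refine Finset.sum_congr ?_ fun _ _ => rfl
      ext κ
      simp only [Finset.mem_filter]
      tauto
  have hbij : ∀ t, ∑ κ ∈ Tb, F κ t = ∑ κ ∈ Ta', F (κ + α₀) t := by
    intro t
    symm
    refine Finset.sum_bij' (fun κ _ => κ + α₀) (fun κ _ => κ - α₀) ?_ ?_ ?_ ?_ ?_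
    · intro κ hκ
      simp only [hTa', hTa, hT, Finset.mem_filter] at hκ
      obtain ⟨⟨⟨h1, h2⟩, h3⟩, h4⟩ := hκ
      simp only [hTb, hT, Finset.mem_filter]
      refine ⟨⟨add_mem_steps h1 hαK h3, ?_⟩, fun j hj => ?_⟩
      · rw [supp_add_of_disjoint h3, Finset.card_union_of_disjoint h3]; exact h4
      · have : j ∉ supp κ := Finset.disjoint_right.1 h3 hj
        rw [mem_supp, not_not] at this
        simp [this]
    · intro κ hκ
      simp only [hTb, hT, Finset.mem_filter] at hκ
      obtain ⟨⟨h1, h2⟩, h3⟩ := hκ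
      have hval : ∀ j, (κ - α₀) j = if j ∈ S then 0 else κ j := by
        intro j
        split_ifs with hj
        · simp [h3 j hj]
        · rw [hSdef, mem_supp, not_not] at hj
          simp [hj]
      have hsupp : supp (κ - α₀) = supp κ \ S := by
        ext j
        rw [mem_supp (κ := κ - α₀), hval, Finset.mem_sdiff, mem_supp (κ := κ)]
        by_cases hj : j ∈ S <;> simp [hj]
      have hsub : S ⊆ supp κ := fun j hj => by
        rw [mem_supp, h3 j hj]; exact mem_supp.1 hj
      have hdis : Disjoint (supp (κ - α₀)) S := by rw [hsupp]; exact Finset.sdiff_disjoint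
      have hcard := Finset.card_sdiff_add_card_eq_card hsub
      simp only [hTa', hTa, hT, Finset.mem_filter]
      refine ⟨⟨⟨mem_steps.2 ⟨fun j => ?_, ?_⟩, ?_⟩, hdis⟩, ?_⟩
      · rw [hval]
        split_ifs
        · exact Or.inl rfl
        · exact (mem_steps.1 h1).1 j
      · rw [hsupp]; exact Finset.sdiff_subset.trans (mem_steps.1 h1).2
      · rw [hsupp]; omega
      · rw [hsupp]; omega
    · intro κ _; simp
    · intro κ _; simp
    · intro κ _; rfl
  have hpair : ∀ t, ∑ κ ∈ Ta, F κ t + ∑ κ ∈ Tb, F κ t = ∑ κ ∈ Ta, G κ t +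
      ∑ κ ∈ Ta', (F (κ + α₀) t - V P κ (supp κ) (K \ supp κ) (line x₀ α₀ t) *
        (V P α₀ S ((K \ supp κ) \ S) (line x₀ α₀ t) *
          U P ((K \ supp κ) \ S) (p - (supp κ).card - S.card) (line x₀ α₀ t)) * h κ t) := by
    intro t
    rw [hbij, Finset.sum_sub_distrib, add_sub_left_comm, add_comm, add_right_inj,
      eq_sub_iff_add_eq]
    have : ∑ κ ∈ Ta', V P κ (supp κ) (K \ supp κ) (line x₀ α₀ t) *
        (V P α₀ S ((K \ supp κ) \ S) (line x₀ α₀ t) *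
          U P ((K \ supp κ) \ S) (p - (supp κ).card - S.card) (line x₀ α₀ t)) * h κ t =
        ∑ κ ∈ Ta, V P κ (supp κ) (K \ supp κ) (line x₀ α₀ t) *
          polar P α₀ (K \ supp κ) (p - (supp κ).card) (line x₀ α₀ t) * h κ t := by
      rw [hTa', Finset.sum_filter]
      refine Finset.sum_congr rfl fun κ hκ => ?_
      simp only [hTa, hT, Finset.mem_filter] at hκ
      simp only [polar, ← hSdef]
      by_cases h1 : (supp κ).card + S.card ≤ p
      · rw [if_pos h1, if_pos (by omega)]
      · rw [if_neg h1, if_neg (by omega)]; ring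
    rw [this, ← Finset.sum_add_distrib]
    exact Finset.sum_congr rfl fun κ _ => by simp only [F, G]; ring
  have hfinal : (fun t => ∑ κ ∈ T, F κ t) = fun t => (∑ κ ∈ Ta, G κ t +
      ∑ κ ∈ Ta', (F (κ + α₀) t - V P κ (supp κ) (K \ supp κ) (line x₀ α₀ t) *
        (V P α₀ S ((K \ supp κ) \ S) (line x₀ α₀ t) *
          U P ((K \ supp κ) \ S) (p - (supp κ).card - S.card) (line x₀ α₀ t)) * h κ t)) +
      ∑ κ ∈ T.filter (fun κ => ¬ Disjoint (supp κ) S ∧ ¬ ∀ j ∈ S, κ j = α₀ j), F κ t := by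
    ext t
    rw [hsplit, hpair]
  show Null fun t => ∑ κ ∈ T, F κ t
  rw [hfinal]
  refine ((Null.sum fun κ hκ => ?_).add (Null.sum fun κ hκ => ?_)).add (Null.sum fun κ hκ => ?_)
  · simp only [hTa, Finset.mem_filter] at hκ
    have hκT := hκ.1
    simp only [hT, Finset.mem_filter] at hκT
    exact ((hVreg κ hκ.1 (hab κ hκ.2)).mul_null (hu1 κ hκT.1 hκT.2 hκ.2)).mul_reg (hreg κ)
  · simp only [hTa', hTa, Finset.mem_filter] at hκ
    obtain ⟨⟨hκT, hd⟩, hcard⟩ := hκ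
    have hVκ := hVreg κ hκT (hab κ hd)
    simp only [hT, Finset.mem_filter] at hκT
    have hsupp := supp_add_of_disjoint hd
    have hnd : ¬ Disjoint (supp (κ + α₀)) S := by
      rw [hsupp]
      intro hdd
      exact Finset.disjoint_left.1 hdd (Finset.mem_union_right _ hj₀) hj₀
    have hcard' : (supp (κ + α₀)).card = (supp κ).card + S.card := by
      rw [hsupp, Finset.card_union_of_disjoint hd]
    have hu := hu2 (κ + α₀) (add_mem_steps hκT.1 hαK hd) (by omega) hnd
    have hKK : (K \ supp κ) \ S = K \ supp (κ + α₀) := by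
      rw [hsupp]; exact sdiff_sdiff_left
    have hpp : p - (supp κ).card - S.card = p - (supp (κ + α₀)).card := by omega
    have hUreg : Reg fun t => U P (K \ supp (κ + α₀)) (p - (supp (κ + α₀)).card) (line x₀ α₀ t) := by
      refine (hx.simple_U hβ _ _).2 fun hsub => ?_
      have := hsub hj₀
      rw [Finset.mem_sdiff, hsupp] at this
      exact this.2 (Finset.mem_union_right _ hj₀)
    have hVS : Simple fun t => V P α₀ S ((K \ supp κ) \ S) (line x₀ α₀ t) :=
      (hx.simple_V hβ (step_pm hx.mem) Finset.disjoint_sdiff).1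
    have hVadd := hx.null_V_add hβ hform hc₀ hκT.1 hS hd
    have hdiff : Tendsto (fun t => h (κ + α₀) t - h κ t) (𝓝[≠] 0) (𝓝 0) := by
      have := (hlim (κ + α₀)).sub (hlim κ)
      rwa [hadd κ hd, sub_self] at this
    have e : (fun t => F (κ + α₀) t - V P κ (supp κ) (K \ supp κ) (line x₀ α₀ t) *
        (V P α₀ S ((K \ supp κ) \ S) (line x₀ α₀ t) *
          U P ((K \ supp κ) \ S) (p - (supp κ).card - S.card) (line x₀ α₀ t)) * h κ t) =
        fun t => (V P (κ + α₀) (supp κ ∪ S) (K \ (supp κ ∪ S)) (line x₀ α₀ t) -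
          V P κ (supp κ) (K \ supp κ) (line x₀ α₀ t) *
            V P α₀ S ((K \ supp κ) \ S) (line x₀ α₀ t)) *
          (U P (K \ supp (κ + α₀)) (p - (supp (κ + α₀)).card) (line x₀ α₀ t) * h (κ + α₀) t) +
          (V P κ (supp κ) (K \ supp κ) (line x₀ α₀ t) *
            V P α₀ S ((K \ supp κ) \ S) (line x₀ α₀ t) *
            U P (K \ supp (κ + α₀)) (p - (supp (κ + α₀)).card) (line x₀ α₀ t)) *
            (h (κ + α₀) t - h κ t) := by
      ext t
      simp only [F, hu]
      rw [hpp, ← hsupp, hKK]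
      ring
    rw [e]
    exact (hVadd.mul_reg (hUreg.mul (hreg _))).add
      (((hVκ.mul_simple hVS).mul_reg hUreg).mul_tendsto hdiff)
  · simp only [Finset.mem_filter] at hκ
    obtain ⟨hκT, hnd, hnm⟩ := hκ
    have hVκ := hVreg κ hκT hnm
    simp only [hT, Finset.mem_filter] at hκT
    have hUreg : Reg (u κ) := by
      rw [hu2 κ hκT.1 hκT.2 hnd]
      refine (hx.simple_U hβ _ _).2 fun hsub => hnd ?_
      exact Finset.disjoint_right.2 fun j hj => (Finset.mem_sdiff.1 (hsub hj)).2
    exact ((hVκ.mul hUreg).mul (hreg κ)).null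

lemma V_zero (K : Finset (Fin n)) (x : Fin n → ℂ) : V P 0 ∅ K x = 1 := by
  simp [V]

lemma filter_steps_eq (K : Finset (Fin n)) (p : ℕ) :
    (steps K).filter (fun κ => (supp κ).card ≤ p) = insert 0 (steps' K p) := by
  ext κ
  rw [Finset.mem_filter, Finset.mem_insert, mem_steps']
  constructor
  · rintro ⟨h1, h2⟩
    by_cases h : κ = 0
    · exact Or.inl h
    · exact Or.inr ⟨h1, h, h2⟩
  · rintro (rfl | ⟨h1, -, h2⟩)
    · exact ⟨zero_mem_steps K, by simp [supp_zero]⟩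
    · exact ⟨h1, h2⟩

lemma Generic.null_U_add_polar (hβ : 0 < P.β) (hx : Generic P α₀ c₀ x₀) (hform : IsForm P α₀ c₀)
    (hc₀ : 0 < c₀.im) {K : Finset (Fin n)} (hS : supp α₀ ⊆ K) (p : ℕ) :
    Null fun t => U P K p (line x₀ α₀ t) + polar P α₀ K p (line x₀ α₀ t) := by
  classical
  induction p using Nat.strong_induction_on generalizing K with
  | _ p ih =>
    rcases eq_or_ne p 0 with rfl | hp
    · have h0 := card_supp_pos hx.ne
      have : ¬ (supp α₀).card ≤ 0 := by omega
      simp only [U_zero, polar, if_neg this]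
      exact (Reg.const _).null
    let u : (Fin n → ℤ) → ℂ → ℂ := fun κ t => if κ = 0 then -polar P α₀ K p (line x₀ α₀ t) else
      U P (K \ supp κ) (p - (supp κ).card) (line x₀ α₀ t)
    have key := hx.null_sum hβ hform hc₀ hS p u (fun _ _ => 1) (fun _ => 1)
      (fun _ => tendsto_const_nhds) (fun _ _ => rfl)
      (fun κ hκ hc hd => by
        by_cases h0 : κ = 0
        · subst h0
          simp only [u, if_true, supp_zero, Finset.sdiff_empty, Finset.card_empty, Nat.sub_zero,
            neg_add_cancel]
          exact (Reg.const _).null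
        · simp only [u, if_neg h0]
          have := card_supp_pos h0
          refine ih _ (by omega) fun j hj => Finset.mem_sdiff.2 ⟨hS hj, ?_⟩
          exact Finset.disjoint_right.1 hd hj)
      (fun κ hκ hc hd => by
        have h0 : κ ≠ 0 := by
          rintro rfl
          simp [supp_zero] at hd
        simp only [u, if_neg h0])
    have h0' : (0 : Fin n → ℤ) ∉ steps' K p := fun h => (mem_steps'.1 h).2.1 rfl
    have e : ∀ t, ∑ κ ∈ (steps K).filter (fun κ => (supp κ).card ≤ p),
        V P κ (supp κ) (K \ supp κ) (line x₀ α₀ t) * u κ t * 1 =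
        -(U P K p (line x₀ α₀ t) + polar P α₀ K p (line x₀ α₀ t)) := by
      intro t
      rw [filter_steps_eq, Finset.sum_insert h0', U_rec P K hp]
      have : ∑ κ ∈ steps' K p, V P κ (supp κ) (K \ supp κ) (line x₀ α₀ t) * u κ t * 1 =
          ∑ κ ∈ steps' K p, V P κ (supp κ) (K \ supp κ) (line x₀ α₀ t) *
            U P (K \ supp κ) (p - (supp κ).card) (line x₀ α₀ t) := by
        refine Finset.sum_congr rfl fun κ hκ => ?_
        simp only [u, if_neg (mem_steps'.1 hκ).2.1, mul_one]
      rw [this]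
      simp only [u, if_true, supp_zero, V_zero]
      ring
    simp only [e] at key
    simpa using key.neg

/-- On the shifted hyperplanes the poles cancel between different terms. -/
lemma Generic.null_Hop_of_shift (hβ : 0 < P.β) (hx : Generic P α₀ c₀ x₀) (hform : IsForm P α₀ c₀)
    (hc₀ : 0 < c₀.im) {w : SP n} {N m : ℤ} (hw : IsReflection w α₀ N)
    (hm : N * c₀ = Complex.I * P.β + 2 * Real.pi * m) (r : ℕ) {f : (Fin n → ℂ) → ℂ}
    (hf : f ∈ expPoly n) (hfi : Inv f) : Null fun t => Hop P r f (line x₀ α₀ t) := by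
  refine hx.null_sum hβ hform hc₀ (Finset.subset_univ _) r
    (fun κ t => U P (Finset.univ \ supp κ) (r - (supp κ).card) (line x₀ α₀ t))
    (fun κ t => f (line x₀ α₀ t + fun j => Complex.I * P.β * κ j))
    (fun κ => f (x₀ + fun j => Complex.I * P.β * κ j)) (fun κ => ?_) (fun κ hd => ?_)
    (fun κ hκ hc hd => ?_) (fun κ hκ hc hd => rfl)
  · exact ((continuous_expPoly hf).tendsto _).comp ((tendsto_line x₀ α₀).add_const _)
  · have horth : ∑ i, (α₀ i : ℂ) * κ i = 0 := by
      refine Finset.sum_eq_zero fun i _ => ?_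
      by_cases hi : κ i = 0
      · simp [hi]
      · have : i ∉ supp α₀ := Finset.disjoint_left.1 hd (mem_supp.2 hi)
        rw [mem_supp, not_not] at this
        simp [this]
    rw [← hfi w (x₀ + fun j => Complex.I * P.β * κ j), ← expPoly_add_two_pi hf (m • α₀) (x₀ + _),
      hw.1]
    congr 1
    have h1 : ∑ i, (α₀ i : ℂ) * (x₀ + fun j => Complex.I * P.β * κ j) i = -c₀ := by
      have h2 : ∑ i, (α₀ i : ℂ) * (Complex.I * P.β * κ i) =
          Complex.I * P.β * ∑ i, (α₀ i : ℂ) * κ i := by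
        rw [Finset.mul_sum]; exact Finset.sum_congr rfl fun _ _ => by ring
      simp only [Pi.add_apply, mul_add, Finset.sum_add_distrib, sum_eq_of_aff hx.zero, h2, horth]
      ring
    rw [h1]
    ext j
    simp only [Pi.add_apply, Pi.sub_apply, Pi.smul_apply, smul_eq_mul, Int.cast_add, Int.cast_mul]
    linear_combination (-(α₀ j : ℂ)) * hm
  · exact hx.null_U_add_polar hβ hform hc₀
      (fun j hj => Finset.mem_sdiff.2 ⟨Finset.mem_univ j, Finset.disjoint_right.1 hd hj⟩) _

lemma Generic.null_Hop (hβ : 0 < P.β) (hx : Generic P α₀ c₀ x₀) (hform : IsForm P α₀ c₀) (r : ℕ)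
    {f : (Fin n → ℂ) → ℂ} (hf : f ∈ expPoly n) (hfi : Inv f) :
    Null fun t => Hop P r f (line x₀ α₀ t) := by
  obtain ⟨w, N, hw, m, hm | hm⟩ := hform.cases
  · exact hx.null_Hop_of_symm hβ hw hm r hf hfi
  · refine hx.null_Hop_of_shift hβ hform ?_ hw hm r hf hfi
    have h1 := congrArg Complex.im hm
    simp at h1
    have h2 := consts_im_nonneg hβ hform.mem.2.2
    rcases h2.eq_or_lt with h3 | h3
    · rw [← h3] at h1; simp at h1; linarith
    · exact h3

end

end Koornwinder

namespace Koornwinder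

open Filter Topology

noncomputable section

variable {n : ℕ} (P : Params)

/-! ### The regular set -/

/-- The complement of all singular hyperplanes. -/
def good (n : ℕ) : Set (Fin n → ℂ) :=
  {x | ∀ α ∈ steps (Finset.univ : Finset (Fin n)), α ≠ 0 → ∀ c ∈ consts P, dv α c x ≠ 0}

lemma dv_ne_zero {α : Fin n → ℤ} (hα : α ≠ 0) (c : ℂ) : dv α c ≠ 0 := by
  intro h
  have h1 : ∀ x, ex α x * Complex.exp (Complex.I * c) = 1 := fun x => by
    rw [← exp_aff]
    exact (sub_eq_zero.1 (congrFun h x)).symm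
  have h2 : evalEx (Finsupp.single α 1) = evalEx (Finsupp.single 0 1) := by
    ext x
    have e1 := h1 x
    have e2 := h1 0
    rw [show ex α 0 = 1 by simp [ex], one_mul] at e2
    rw [e2, mul_one] at e1
    simpa [evalEx, ex_zero] using e1
  exact hα (Finsupp.single_left_injective one_ne_zero (evalEx_injective h2))

lemma isOpen_dense_good : IsOpen (good P n) ∧ Dense (good P n) := by
  classical
  let B := (steps (Finset.univ : Finset (Fin n))).filter (· ≠ 0) ×ˢ consts P
  have hmem : ∏ q ∈ B, dv q.1 q.2 ∈ expPoly n := Subalgebra.prod_mem _ fun q _ => dv_mem q.1 q.2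
  have hne : ∏ q ∈ B, dv q.1 q.2 ≠ 0 := expPoly_prod_ne_zero B (fun q _ => dv_mem q.1 q.2)
    fun q hq => dv_ne_zero (Finset.mem_filter.1 (Finset.mem_product.1 hq).1).2 q.2
  have e : good P n = {x | (∏ q ∈ B, dv q.1 q.2) x ≠ 0} := by
    ext x
    simp only [good, Set.mem_ofPred_eq, Finset.prod_apply, Finset.prod_ne_zero_iff, B,
      Finset.mem_product, Finset.mem_filter, Prod.forall]
    exact ⟨fun h α c hq => h α hq.1.1 hq.1.2 c hq.2, fun h α h1 h2 c h3 => h α c ⟨⟨h1, h2⟩, h3⟩⟩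
  rw [e]
  exact isOpen_dense_ne_zero hmem hne

lemma expPoly_eq_of_good {F G : (Fin n → ℂ) → ℂ} (hF : F ∈ expPoly n) (hG : G ∈ expPoly n)
    (h : ∀ x ∈ good P n, F x = G x) : F = G :=
  Continuous.ext_on (isOpen_dense_good P).2 (continuous_expPoly hF) (continuous_expPoly hG) h

lemma act_mem_good (w : SP n) {x : Fin n → ℂ} (hx : x ∈ good P n) : act w x ∈ good P n := by
  intro α hα h0 c hc h
  have e : aff α c (act w x) = aff (act (invSP w) α) c x := by
    rw [aff, aff, sum_mul_act, act_intCast]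
  have hu : (Finset.univ : Finset (Fin n)).map w.1.toEmbedding = Finset.univ := by simp
  refine hx (act (invSP w) α) (hu ▸ act_mem_steps.2 hα) (fun h' => h0 ?_) c hc ?_
  · rw [← act_invSP w α, h']; ext j; simp [act]
  · rw [dv, ← e]; exact h

lemma Generic.eventually_good {P : Params} {α₀ : Fin n → ℤ} {c₀ : ℂ} {x₀ : Fin n → ℂ}
    (hx : Generic P α₀ c₀ x₀) : ∀ᶠ t in 𝓝[≠] (0 : ℂ), line x₀ α₀ t ∈ good P n := by
  simp only [good, Set.mem_ofPred_eq]
  rw [Filter.eventually_all_finset]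
  intro α hα
  by_cases h0 : α = 0
  · simp [h0]
  have : ∀ c ∈ consts P, ∀ᶠ t in 𝓝[≠] (0 : ℂ), dv α c (line x₀ α₀ t) ≠ 0 := by
    intro c hc
    by_cases hd : dv α c x₀ = 0
    · obtain ⟨m, hm, rfl, -⟩ := hx.sep α hα h0 c hc hd
      have hexp : Complex.exp (Complex.I * aff (m • α₀) c x₀) = 1 := (sub_eq_zero.1 hd).symm
      set a : ℂ := ((∑ j, (m • α₀) j * α₀ j : ℤ) : ℂ) with ha
      have ha0 : a ≠ 0 := by
        rw [ha, Int.cast_ne_zero]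
        simp only [Pi.smul_apply, smul_eq_mul, mul_assoc, ← Finset.mul_sum]
        exact mul_ne_zero (by omega) (sum_mul_self_pos hx.ne).ne'
      have h1 := (tendsto_div_exp ha0).eventually_ne (by simp [ha0] : (-(Complex.I * a))⁻¹ ≠ 0)
      filter_upwards [h1] with t ht h2
      apply ht
      have h3 : dv (m • α₀) c (line x₀ α₀ t) = 1 - Complex.exp (Complex.I * (t * a)) := by
        rw [dv, aff_line, mul_add, Complex.exp_add, hexp, one_mul]
      rw [← h3, h2, div_zero]
    · exact (((continuous_expPoly (dv_mem α c)).tendsto x₀).comp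
        (tendsto_line x₀ α₀)).eventually_ne hd
  have h2 := (Filter.eventually_all_finset _).2 this
  filter_upwards [h2] with t ht _ c hc
  exact ht c hc

/-! ### Rational functions with poles on the singular hyperplanes -/

/-- The product of a list of divisors. -/
def dvProd (L : List ((Fin n → ℤ) × ℂ)) (x : Fin n → ℂ) : ℂ := (L.map fun q => dv q.1 q.2 x).prod

lemma dvProd_nil (x : Fin n → ℂ) : dvProd [] x = 1 := rfl

lemma dvProd_cons (q : (Fin n → ℤ) × ℂ) (L : List ((Fin n → ℤ) × ℂ)) (x : Fin n → ℂ) :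
    dvProd (q :: L) x = dv q.1 q.2 x * dvProd L x := rfl

lemma dvProd_append (L L' : List ((Fin n → ℤ) × ℂ)) (x : Fin n → ℂ) :
    dvProd (L ++ L') x = dvProd L x * dvProd L' x := by simp [dvProd]

lemma dvProd_mem (L : List ((Fin n → ℤ) × ℂ)) : dvProd L ∈ expPoly n := by
  induction L with
  | nil => exact one_mem (expPoly n)
  | cons q L ih => exact mul_mem (dv_mem q.1 q.2) ih

/-- Quotients of exponential polynomials by products of divisors. -/
def Rat' (F : (Fin n → ℂ) → ℂ) : Prop :=
  ∃ L : List ((Fin n → ℤ) × ℂ), (∀ q ∈ L, IsForm P q.1 q.2) ∧ ∃ N ∈ expPoly n,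
    ∀ x ∈ good P n, N x = dvProd L x * F x

variable {P}

lemma Rat'.of_mem {F : (Fin n → ℂ) → ℂ} (hF : F ∈ expPoly n) : Rat' P F :=
  ⟨[], by simp, F, hF, fun x _ => by rw [dvProd_nil, one_mul]⟩

lemma Rat'.mul {F G : (Fin n → ℂ) → ℂ} (hF : Rat' P F) (hG : Rat' P G) :
    Rat' P fun x => F x * G x := by
  obtain ⟨L, hL, N, hN, h⟩ := hF
  obtain ⟨L', hL', N', hN', h'⟩ := hG
  refine ⟨L ++ L', fun q hq => (List.mem_append.1 hq).elim (hL q) (hL' q), N * N',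
    mul_mem hN hN', fun x hx => ?_⟩
  rw [Pi.mul_apply, h x hx, h' x hx, dvProd_append]; ring

lemma Rat'.add {F G : (Fin n → ℂ) → ℂ} (hF : Rat' P F) (hG : Rat' P G) :
    Rat' P fun x => F x + G x := by
  obtain ⟨L, hL, N, hN, h⟩ := hF
  obtain ⟨L', hL', N', hN', h'⟩ := hG
  refine ⟨L ++ L', fun q hq => (List.mem_append.1 hq).elim (hL q) (hL' q),
    dvProd L' * N + dvProd L * N',
    add_mem (mul_mem (dvProd_mem _) hN) (mul_mem (dvProd_mem _) hN'), fun x hx => ?_⟩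
  rw [Pi.add_apply, Pi.mul_apply, Pi.mul_apply, h x hx, h' x hx, dvProd_append]; ring

lemma Rat'.neg {F : (Fin n → ℂ) → ℂ} (hF : Rat' P F) : Rat' P fun x => -F x := by
  simpa using (Rat'.of_mem (const_mem (-1))).mul hF

lemma Rat'.sum {ι : Type*} {s : Finset ι} {F : ι → (Fin n → ℂ) → ℂ} (h : ∀ i ∈ s, Rat' P (F i)) :
    Rat' P fun x => ∑ i ∈ s, F i x := by
  classical
  induction s using Finset.induction_on with
  | empty => exact Rat'.of_mem (const_mem 0)
  | insert a s ha ih =>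
    simp only [Finset.sum_insert ha]
    exact (h a (Finset.mem_insert_self _ _)).add
      (ih fun i hi => h i (Finset.mem_insert_of_mem hi))

lemma Rat'.prod {ι : Type*} {s : Finset ι} {F : ι → (Fin n → ℂ) → ℂ} (h : ∀ i ∈ s, Rat' P (F i)) :
    Rat' P fun x => ∏ i ∈ s, F i x := by
  classical
  induction s using Finset.induction_on with
  | empty => exact Rat'.of_mem (const_mem 1)
  | insert a s ha ih =>
    simp only [Finset.prod_insert ha]
    exact (h a (Finset.mem_insert_self _ _)).mul
      (ih fun i hi => h i (Finset.mem_insert_of_mem hi))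

lemma Rat'.qt (s : ℝ) {α : Fin n → ℤ} {c : ℂ} (h : IsForm P α c) :
    Rat' P fun x => qt P s (aff α c x) := by
  refine ⟨[(α, c)], by simpa using h, (fun _ => Complex.exp (P.β * s / 2)) *
    (1 - (fun _ => Complex.exp (-(P.β * s))) * fun x => Complex.exp (Complex.I * aff α c x)),
    mul_mem (const_mem _) (sub_mem (one_mem _) (mul_mem (const_mem _) (exp_aff_mem α c))),
    fun x hx => ?_⟩
  have h0 : dv α c x ≠ 0 := hx α h.mem.1 h.mem.2.1 c h.mem.2.2
  rw [dvProd_cons, dvProd_nil, mul_one]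
  unfold Koornwinder.qt
  have h1 : 1 - Complex.exp (Complex.I * aff α c x) = dv α c x := rfl
  simp only [Pi.mul_apply, Pi.sub_apply, Pi.one_apply, h1]
  field_simp

lemma Rat'.V {κ : Fin n → ℤ} {J K : Finset (Fin n)} (hκ : ∀ j ∈ J, κ j = 1 ∨ κ j = -1)
    (hJK : Disjoint J K) : Rat' P (V P κ J K) := by
  have hpr : ∀ {j k : Fin n} {a b : ℤ} {c : ℂ}, j ≠ k → (a = 1 ∨ a = -1) → (b = 1 ∨ b = -1) →
      (c = 0 ∨ c = Complex.I * P.β) → IsForm P (pr j a k b) c :=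
    fun hjk ha hb hc => Or.inl ⟨_, _, _, _, hjk, ha, hb, rfl, hc⟩
  refine Rat'.mul (Rat'.mul (Rat'.prod fun j hj => ?_) (Rat'.prod fun j hj =>
    Rat'.prod fun k hk => ?_)) (Rat'.prod fun j hj => Rat'.prod fun k hk => ?_)
  · have hs : ∀ c ∈ vbConsts P, IsForm P (Pi.single j (κ j)) c := fun c hc =>
      Or.inr ⟨j, κ j, hκ j hj, rfl, hc⟩
    simp only [vb_aff]
    exact (((Rat'.qt _ (hs _ (by simp [vbConsts]))).mul (Rat'.qt _ (hs _ (by simp [vbConsts])))).mul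
      (Rat'.qt _ (hs _ (by simp [vbConsts])))).mul (Rat'.qt _ (hs _ (by simp [vbConsts])))
  · rw [Finset.mem_filter] at hk
    have e : (fun x : Fin n → ℂ => va P (κ j * x j + κ k * x k) *
        va P (κ j * x j + κ k * x k + Complex.I * P.β)) =
        fun x => Koornwinder.qt P P.g (aff (pr j (κ j) k (κ k)) 0 x) *
          Koornwinder.qt P P.g (aff (pr j (κ j) k (κ k)) (Complex.I * P.β) x) := by
      ext x
      rw [← va_aff, ← va_aff, add_zero]
    rw [e]
    exact (Rat'.qt _ (hpr hk.2.ne (hκ j hj) (hκ k hk.1) (Or.inl rfl))).mul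
      (Rat'.qt _ (hpr hk.2.ne (hκ j hj) (hκ k hk.1) (Or.inr rfl)))
  · have hjk : j ≠ k := fun e => Finset.disjoint_left.1 hJK hj (e ▸ hk)
    have e : (fun x : Fin n → ℂ => va P (κ j * x j + x k) * va P (κ j * x j - x k)) =
        fun x => Koornwinder.qt P P.g (aff (pr j (κ j) k 1) 0 x) *
          Koornwinder.qt P P.g (aff (pr j (κ j) k (-1)) 0 x) :=
      funext fun x => cross_eq κ j k x
    rw [e]
    exact (Rat'.qt _ (hpr hjk (hκ j hj) (Or.inl rfl) (Or.inl rfl))).mul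
      (Rat'.qt _ (hpr hjk (hκ j hj) (Or.inr rfl) (Or.inl rfl)))

lemma Rat'.U (K : Finset (Fin n)) (p : ℕ) : Rat' P (U P K p) := by
  induction p using Nat.strong_induction_on generalizing K with
  | _ p ih =>
    rcases eq_or_ne p 0 with rfl | hp
    · have : Koornwinder.U P K 0 = 1 := funext fun x => U_zero P K x
      rw [this]
      exact Rat'.of_mem (one_mem _)
    · have : Koornwinder.U P K p = _ := funext fun x => U_rec P K hp x
      rw [this]
      refine (Rat'.sum fun κ hκ => ?_).neg
      have := card_supp_pos (mem_steps'.1 hκ).2.1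
      exact (Rat'.V (step_pm (mem_steps'.1 hκ).1) Finset.disjoint_sdiff).mul (ih _ (by omega) _)

lemma Rat'.Hop (r : ℕ) {f : (Fin n → ℂ) → ℂ} (hf : f ∈ expPoly n) : Rat' P (Hop P r f) := by
  refine Rat'.sum fun κ hκ => ?_
  exact ((Rat'.V (step_pm (Finset.mem_filter.1 hκ).1) Finset.disjoint_sdiff).mul
    (Rat'.U _ _)).mul (Rat'.of_mem (expPoly_translate _ hf))

/-- A rational function without residues is an exponential polynomial. -/
lemma Rat'.exists_of_null {F : (Fin n → ℂ) → ℂ} (hF : Rat' P F)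
    (hnull : ∀ α₀ c₀ x₀, IsForm P α₀ c₀ → Generic P α₀ c₀ x₀ →
      Null fun t => F (line x₀ α₀ t)) :
    ∃ Q ∈ expPoly n, ∀ x ∈ good P n, F x = Q x := by
  obtain ⟨L, hL, N, hN, h⟩ := hF
  induction L generalizing N with
  | nil => exact ⟨N, hN, fun x hx => by rw [h x hx, dvProd_nil, one_mul]⟩
  | cons q L ih =>
    have hq : IsForm P q.1 q.2 := hL q (by simp)
    obtain ⟨j, hj⟩ := Function.ne_iff.1 hq.mem.2.1
    have hj1 : q.1 j * q.1 j = 1 := by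
      rcases (mem_steps.1 hq.mem.1).1 j with h | h | h
      · exact absurd h hj
      · simp [h]
      · simp [h]
    have hz : ∀ x, aff q.1 q.2 x = 0 → N x = 0 := by
      intro x hx
      refine eq_zero_of_generic P hq.mem.1 hq.mem.2.1 hN (fun x₀ hx₀ => ?_) hx
      have t1 : Tendsto (fun t => N (line x₀ q.1 t)) (𝓝[≠] 0) (𝓝 (N x₀)) :=
        ((continuous_expPoly hN).tendsto x₀).comp (tendsto_line x₀ q.1)
      have hd0 : dv q.1 q.2 x₀ = 0 := by simp [dv, hx₀.zero]
      have t2 : Reg fun t => dv q.1 q.2 (line x₀ q.1 t) / t := by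
        have hdiff : DifferentiableAt ℂ (fun t => dv q.1 q.2 (line x₀ q.1 t)) 0 := by
          refine (differentiable_expPoly (dv_mem q.1 q.2) _).comp 0 ?_
          unfold line
          fun_prop
        have := hasDerivAt_iff_tendsto_slope.1 hdiff.hasDerivAt
        refine ⟨_, this.congr fun t => ?_⟩
        simp [slope_def_field, line_zero, hd0]
      have t3 := Null.mul_reg (hnull q.1 q.2 x₀ hq hx₀)
        (t2.mul (reg_of_continuous (continuous_expPoly (dvProd_mem L)) x₀ q.1))
      refine tendsto_nhds_unique t1 (Tendsto.congr' ?_ t3)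
      filter_upwards [hx₀.eventually_good, self_mem_nhdsWithin] with t ht ht0
      have ht0' : t ≠ 0 := ht0
      rw [h _ ht, dvProd_cons]
      field_simp
    obtain ⟨Q, hQ, hd⟩ := dv_dvd q.1 q.2 hj1 hN hz
    refine ih (fun q' hq' => hL q' (List.mem_cons_of_mem _ hq')) Q hQ fun x hx => ?_
    have h1 := h x hx
    rw [hd, dvProd_cons, mul_assoc] at h1
    exact mul_left_cancel₀ (hx q.1 hq.mem.1 hq.mem.2.1 q.2 hq.mem.2.2) h1

/-- The difference operators preserve the invariant exponential polynomials. -/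
theorem exists_Hop_eq (hβ : 0 < P.β) (r : ℕ) {f : (Fin n → ℂ) → ℂ} (hf : f ∈ expPoly n)
    (hfi : Inv f) : ∃ Q ∈ expPoly n, Inv Q ∧ ∀ x ∈ good P n, Hop P r f x = Q x := by
  obtain ⟨Q, hQ, h⟩ := (Rat'.Hop r hf).exists_of_null
    fun α₀ c₀ x₀ hform hx => hx.null_Hop hβ hform r hf hfi
  refine ⟨Q, hQ, fun w x => ?_, h⟩
  have hQw : Q ∘ act w ∈ expPoly n := by
    refine expPoly_comp (fun κ => ?_) hQ
    have : ex κ ∘ act w = ex (act (invSP w) κ) := funext fun x => ex_act w κ x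
    rw [this]
    exact ex_mem _
  have : Q ∘ act w = Q := expPoly_eq_of_good P hQw hQ fun x hx => by
    rw [Function.comp_apply, ← h _ (act_mem_good P w hx), ← h x hx, Hop_inv P r hfi]
  exact congrFun this x

end

end Koornwinder

namespace Koornwinder

open Filter Topology

noncomputable section

variable {n : ℕ}

/-! ### Sums over steps -/

lemma mem_signs {L : Finset (Fin n)} {ε : Fin n → ℤ} :
    ε ∈ signs L ↔ ∀ j, if j ∈ L then ε j = 1 ∨ ε j = -1 else ε j = 0 := by
  simp only [signs, Fintype.mem_piFinset]
  refine forall_congr' fun j => ?_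
  split_ifs <;> simp

lemma supp_of_mem_signs {L : Finset (Fin n)} {ε : Fin n → ℤ} (h : ε ∈ signs L) : supp ε = L := by
  ext j
  have := mem_signs.1 h j
  rw [mem_supp]
  split_ifs at this with hj
  · simp only [hj, iff_true]; omega
  · simp [hj, this]

lemma mem_signs_iff {L : Finset (Fin n)} {ε : Fin n → ℤ} :
    ε ∈ signs L ↔ ε ∈ steps L ∧ supp ε = L := by
  constructor
  · intro h
    refine ⟨mem_steps.2 ⟨fun j => ?_, (supp_of_mem_signs h).subset⟩, supp_of_mem_signs h⟩
    have := mem_signs.1 h j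
    split_ifs at this
    · exact Or.inr this
    · exact Or.inl this
  · rintro ⟨h1, h2⟩
    refine mem_signs.2 fun j => ?_
    split_ifs with hj
    · exact step_pm h1 j (h2.symm ▸ hj)
    · rw [← h2, mem_supp, not_not] at hj; exact hj

lemma sum_steps {M : Type*} [AddCommMonoid M] (K : Finset (Fin n)) (q : Finset (Fin n) → Prop)
    [DecidablePred q] (F : (Fin n → ℤ) → M) :
    ∑ κ ∈ (steps K).filter (fun κ => q (supp κ)), F κ =
      ∑ L ∈ K.powerset.filter q, ∑ ε ∈ signs L, F ε := by
  rw [← Finset.sum_fiberwise_of_maps_to (g := supp) (t := K.powerset.filter q)]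
  · refine Finset.sum_congr rfl fun L hL => Finset.sum_congr ?_ fun _ _ => rfl
    rw [Finset.mem_filter, Finset.mem_powerset] at hL
    ext κ
    rw [Finset.mem_filter, Finset.mem_filter, mem_signs_iff]
    constructor
    · rintro ⟨⟨h1, -⟩, h2⟩
      exact ⟨mem_steps.2 ⟨(mem_steps.1 h1).1, h2.subset⟩, h2⟩
    · rintro ⟨h1, h2⟩
      exact ⟨⟨steps_mono hL.1 h1, h2 ▸ hL.2⟩, h2⟩
  · intro κ hκ
    rw [Finset.mem_filter] at hκ ⊢
    exact ⟨Finset.mem_powerset.2 (mem_steps.1 hκ.1).2, hκ.2⟩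

lemma sum_signs_prod {R : Type*} [CommRing R] (L : Finset (Fin n)) (f : Fin n → ℤ → R) :
    ∑ ε ∈ signs L, ∏ j ∈ L, f j (ε j) = ∏ j ∈ L, (f j 1 + f j (-1)) := by
  have h1 : ∀ ε : Fin n → ℤ, ∏ j ∈ L, f j (ε j) = ∏ j, if j ∈ L then f j (ε j) else 1 := by
    intro ε; simp
  have h2 : ∏ j ∈ L, (f j 1 + f j (-1)) =
      ∏ j, ∑ e ∈ (if j ∈ L then ({1, -1} : Finset ℤ) else {0}), if j ∈ L then f j e else 1 := by
    rw [← Finset.prod_subset (Finset.subset_univ L)]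
    · refine Finset.prod_congr rfl fun j hj => ?_
      simp [hj]
    · intro j _ hj
      simp [hj]
  rw [h2, Finset.prod_univ_sum]
  exact Finset.sum_congr rfl fun ε _ => h1 ε

/-! ### Elementary and complete symmetric functions -/

/-- The elementary symmetric function of the `f j`, `j ∈ K`. -/
def el {ι : Type*} (K : Finset ι) (f : ι → ℝ) (l : ℕ) : ℝ := ∑ L ∈ K.powersetCard l, ∏ j ∈ L, f j

lemma el_zero {ι : Type*} (K : Finset ι) (f : ι → ℝ) : el K f 0 = 1 := by simp [el]

lemma sum_powerset_card {ι : Type*} (K : Finset ι) (f : ι → ℝ) (c : ℕ → ℝ) (p : ℕ) :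
    ∑ L ∈ K.powerset.filter (fun L => L.card ≤ p), (∏ j ∈ L, f j) * c L.card =
      ∑ l ∈ Finset.range (p + 1), el K f l * c l := by
  classical
  rw [← Finset.sum_fiberwise_of_maps_to (g := Finset.card) (t := Finset.range (p + 1))]
  · refine Finset.sum_congr rfl fun l hl => ?_
    rw [el, Finset.sum_mul]
    rw [Finset.mem_range] at hl
    refine Finset.sum_congr ?_ fun L hL => ?_
    · ext L
      rw [Finset.mem_filter, Finset.mem_filter, Finset.mem_powersetCard, Finset.mem_powerset]
      constructor
      · rintro ⟨⟨h1, -⟩, h2⟩; exact ⟨h1, h2⟩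
      · rintro ⟨h1, h2⟩; exact ⟨⟨h1, by omega⟩, h2⟩
    · rw [(Finset.mem_powersetCard.1 hL).2]
  · intro L hL
    rw [Finset.mem_filter] at hL
    rw [Finset.mem_range]; omega

open Polynomial in
lemma prod_one_add_eq {ι : Type*} (K : Finset ι) (f : ι → ℝ) (l : ℕ) :
    (∏ j ∈ K, (1 + C (f j) * X)).coeff l = el K f l := by
  classical
  rw [Finset.prod_one_add, finsetSum_coeff, el, Finset.powersetCard_eq_filter,
    Finset.sum_filter]
  refine Finset.sum_congr rfl fun L _ => ?_
  rw [Finset.prod_mul_distrib, Finset.prod_const, ← map_prod, coeff_C_mul, coeff_X_pow]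
  simp [eq_comm]

/-- The complete symmetric function of degree `q` of `b 0, …, b (d - 1)`. -/
def hs (b : ℕ → ℝ) : ℕ → ℕ → ℝ
  | _, 0 => 1
  | 0, _ + 1 => 0
  | d + 1, q + 1 => hs b d (q + 1) + b d * hs b (d + 1) q

lemma hs_zero_succ (b : ℕ → ℝ) (q : ℕ) : hs b 0 (q + 1) = 0 := by simp [hs]

lemma hs_succ_succ (b : ℕ → ℝ) (d q : ℕ) :
    hs b (d + 1) (q + 1) = hs b d (q + 1) + b d * hs b (d + 1) q := by simp [hs]

lemma hs_mk (b : ℕ → ℝ) (d : ℕ) :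
    (PowerSeries.mk fun q => (-1) ^ q * hs b d q) *
      ((∏ i ∈ Finset.range d, (1 + Polynomial.C (b i) * Polynomial.X) : Polynomial ℝ) :
        PowerSeries ℝ) = 1 := by
  induction d with
  | zero =>
    ext q
    rcases q with _ | q <;> simp [hs, PowerSeries.coeff_one]
  | succ d ih =>
    have h : (PowerSeries.mk fun q => (-1) ^ q * hs b (d + 1) q) *
        (1 + PowerSeries.C (b d) * PowerSeries.X) = PowerSeries.mk fun q => (-1) ^ q * hs b d q := by
      ext q
      rcases q with _ | q
      · simp [hs]
      · rw [mul_add, mul_one, mul_comm (PowerSeries.C _), ← mul_assoc, map_add,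
          PowerSeries.coeff_mul_C, PowerSeries.coeff_succ_mul_X]
        simp only [PowerSeries.coeff_mk, hs]
        ring
    rw [Finset.prod_range_succ, mul_comm (∏ i ∈ Finset.range d, _), Polynomial.coe_mul,
      ← mul_assoc]
    convert ih using 2
    rw [← h]
    congr 1
    simp

lemma sum_el_hs (b : ℕ → ℝ) {m p : ℕ} (hp : p ≠ 0) (hpm : p ≤ m) :
    ∑ l ∈ Finset.range (p + 1),
      el (Finset.range m) b l * ((-1) ^ (p - l) * hs b (m - p + 1) (p - l)) = 0 := by
  set d := m - p + 1 with hd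
  have hdm : d ≤ m := by omega
  set A : Polynomial ℝ := ∏ i ∈ Finset.range m, (1 + Polynomial.C (b i) * Polynomial.X) with hA
  set B : Polynomial ℝ := ∏ i ∈ Finset.Ico d m, (1 + Polynomial.C (b i) * Polynomial.X) with hB
  have h1 : (PowerSeries.mk fun q => (-1) ^ q * hs b d q) * (A : PowerSeries ℝ) = B := by
    rw [hA, ← Finset.prod_range_mul_prod_Ico _ hdm, Polynomial.coe_mul, ← mul_assoc, hs_mk, one_mul]
  have h2 : B.coeff p = 0 := by
    refine Polynomial.coeff_eq_zero_of_natDegree_lt ?_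
    refine (Polynomial.natDegree_prod_le _ _).trans_lt ?_
    have : ∀ i ∈ Finset.Ico d m,
        (1 + Polynomial.C (b i) * Polynomial.X : Polynomial ℝ).natDegree ≤ 1 := by
      intro i _
      compute_degree
    refine (Finset.sum_le_sum this).trans_lt ?_
    simp
    omega
  have h3 := congrArg (PowerSeries.coeff p) h1
  rw [Polynomial.coeff_coe, h2, mul_comm, PowerSeries.coeff_mul,
    Finset.Nat.sum_antidiagonal_eq_sum_range_succ_mk] at h3
  rw [← h3]
  refine Finset.sum_congr rfl fun l _ => ?_
  rw [Polynomial.coeff_coe, hA, prod_one_add_eq, PowerSeries.coeff_mk]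

open Classical in
/-- The sum over weakly increasing index sequences is a complete symmetric function. -/
lemma sum_monotone_eq_hs (t : Fin n → ℝ) (b : ℕ → ℝ) (hb : ∀ j : Fin n, t j = b (n - 1 - j))
    (d q : ℕ) (hd : d ≤ n) :
    ∑ i ∈ (Finset.univ : Finset (Fin q → Fin n)).filter
      (fun i : Fin q → Fin n => Monotone i ∧ ∀ k, n - d ≤ (i k : ℕ)), ∏ k, t (i k) = hs b d q := by
  induction q generalizing d with
  | zero =>
    have : (Finset.univ : Finset (Fin 0 → Fin n)).filter
      (fun i : Fin 0 → Fin n => Monotone i ∧ ∀ k, n - d ≤ (i k : ℕ)) = Finset.univ := by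
      ext i
      simp only [Finset.mem_filter, Finset.mem_univ, true_and, iff_true]
      exact ⟨fun a => a.elim0, fun a => a.elim0⟩
    rw [this]
    simp [hs]
  | succ q ihq =>
    induction d with
    | zero =>
      rw [hs_zero_succ]
      refine Finset.sum_eq_zero fun i hi => ?_
      have := (Finset.mem_filter.1 hi).2.2 0
      have := (i 0).2
      omega
    | succ d ihd =>
      have hlt : n - (d + 1) < n := by omega
      let a : Fin n := ⟨n - (d + 1), hlt⟩
      rw [hs_succ_succ, ← ihd (by omega), ← ihq (d + 1) hd,
        ← Finset.sum_filter_add_sum_filter_not _ (fun i : Fin (q + 1) → Fin n => i 0 ≠ a)]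
      congr 1
      · refine Finset.sum_congr ?_ fun _ _ => rfl
        ext i
        simp only [Finset.mem_filter, Finset.mem_univ, true_and]
        constructor
        · rintro ⟨⟨h1, h2⟩, h3⟩
          refine ⟨h1, fun k => ?_⟩
          have h4 := h2 0
          have h5 : (i 0 : ℕ) ≤ i k := h1 (Fin.zero_le k)
          have h6 : (i 0 : ℕ) ≠ n - (d + 1) := fun h => h3 (Fin.ext h)
          omega
        · rintro ⟨h1, h2⟩
          refine ⟨⟨h1, fun k => by have := h2 k; omega⟩, fun h => ?_⟩
          have h3 := h2 0
          have h4 : (i 0 : ℕ) = n - (d + 1) := congrArg Fin.val h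
          omega
      · rw [Finset.mul_sum]
        refine Finset.sum_bij' (fun i _ => Fin.tail i) (fun i _ => Fin.cons a i) ?_ ?_ ?_ ?_ ?_
        · intro i hi
          simp only [Finset.mem_filter, Finset.mem_univ, true_and] at hi ⊢
          exact ⟨fun k k' h => hi.1.1 (Fin.succ_le_succ_iff.2 h), fun k => hi.1.2 _⟩
        · intro i hi
          simp only [Finset.mem_filter, Finset.mem_univ, true_and, not_not] at hi ⊢
          refine ⟨⟨?_, ?_⟩, by simp⟩
          · intro k k' h
            induction k using Fin.cases with
            | zero =>
              induction k' using Fin.cases with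
              | zero => exact le_rfl
              | succ k' =>
                have := hi.2 k'
                simp only [Fin.cons_zero, Fin.cons_succ]
                exact Fin.le_def.2 this
            | succ k =>
              induction k' using Fin.cases with
              | zero => simp at h
              | succ k' => simpa using hi.1 (Fin.succ_le_succ_iff.1 h)
          · intro k
            induction k using Fin.cases with
            | zero => simp [a]
            | succ k => simpa using hi.2 k
        · intro i hi
          simp only [Finset.mem_filter, Finset.mem_univ, true_and, not_not] at hi
          rw [← hi.2]
          exact Fin.cons_self_tail i
        · intro i _
          exact Fin.tail_cons _ _
        · intro i hi
          simp only [Finset.mem_filter, Finset.mem_univ, true_and, not_not] at hi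
          rw [Fin.prod_univ_succ, hi.2, hb]
          congr 2
          simp only [a]
          omega

lemma el_const_mul {ι : Type*} (K : Finset ι) (f : ι → ℝ) (c : ℝ) (l : ℕ) :
    el K (fun j => c * f j) l = c ^ l * el K f l := by
  rw [el, el, Finset.mul_sum]
  refine Finset.sum_congr rfl fun L hL => ?_
  rw [Finset.prod_mul_distrib, Finset.prod_const, (Finset.mem_powersetCard.1 hL).2]

lemma hs_const_mul (b : ℕ → ℝ) (c : ℝ) (d q : ℕ) :
    hs (fun i => c * b i) d q = c ^ q * hs b d q := by
  induction q generalizing d with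
  | zero => simp [hs]
  | succ q ihq =>
    induction d with
    | zero => simp [hs]
    | succ d ihd => rw [hs_succ_succ, hs_succ_succ, ihd, ihq]; ring

/-- `E_r` in terms of elementary and complete symmetric functions. -/
lemma E_eq {r : ℕ} (hr : 1 ≤ r) (hrn : r ≤ n) (t p : Fin n → ℝ) (b : ℕ → ℝ)
    (hb : ∀ j : Fin n, p j = b (n - 1 - j)) :
    E r t p = ∑ s ∈ Finset.range (r + 1),
      el Finset.univ t s * ((-1) ^ (r - s) * hs b (n - r + 1) (r - s)) := by
  classical
  rw [E]
  refine Finset.sum_congr rfl fun s hs' => ?_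
  rw [Finset.mem_range] at hs'
  rw [← sum_monotone_eq_hs p b hb (n - r + 1) (r - s) (by omega), ← el]
  have e1 : (-1 : ℝ) ^ (r + s) = (-1) ^ (r - s) := by
    rw [show r + s = (r - s) + 2 * s by omega, pow_add, pow_mul]; simp
  have e2 : ∀ i : Fin (r - s) → Fin n, (Monotone i ∧ ∀ k, r ≤ (i k : ℕ) + 1) ↔
      (Monotone i ∧ ∀ k, n - (n - r + 1) ≤ (i k : ℕ)) := by
    intro i
    refine and_congr_right fun _ => forall_congr' fun k => ?_
    have := (i k).2
    omega
  rw [e1]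
  simp only [e2]
  ring

end

end Koornwinder

namespace Koornwinder

open Filter Topology

noncomputable section

variable {n : ℕ}

/-! ### Asymptotics of the coefficients -/

lemma exp_aff_ray (α ω : Fin n → ℤ) (c : ℂ) (x : Fin n → ℂ) (τ : ℝ) :
    Complex.exp (Complex.I * aff α c (ray x ω τ)) =
      Complex.exp (Complex.I * aff α c x) * (Real.exp (τ * (∑ j, α j * ω j : ℤ)) : ℂ) := by
  rw [exp_aff, exp_aff, ex_ray, mul_right_comm]

variable (P : Params)

/-- The limit of `qt` along a ray on which the exponent grows as `exp (mτ)`. -/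
def qtLim (s : ℝ) (m : ℤ) (z : ℂ) : ℂ :=
  if m = 0 then qt P s z else (Real.exp (-(m.sign * (P.β * s / 2))) : ℂ)

lemma tendsto_qt_ray (s : ℝ) (α ω : Fin n → ℤ) (c : ℂ) (x : Fin n → ℂ) :
    Tendsto (fun τ : ℝ => qt P s (aff α c (ray x ω τ))) atTop
      (𝓝 (qtLim P s (∑ j, α j * ω j) (aff α c x))) := by
  set m := ∑ j, α j * ω j with hm
  set e := Complex.exp (Complex.I * aff α c x) with he
  have hE : ∀ τ : ℝ, Complex.exp (Complex.I * aff α c (ray x ω τ)) = e * (Real.exp (τ * m) : ℂ) :=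
    fun τ => exp_aff_ray α ω c x τ
  have he0 : e ≠ 0 := Complex.exp_ne_zero _
  rw [qtLim]
  simp only [qt, hE]
  rcases lt_trichotomy m 0 with h | h | h
  · rw [if_neg h.ne, Int.sign_eq_neg_one_of_neg h]
    have h1 := (tendsto_exp_mul_int h).const_mul e
    rw [mul_zero] at h1
    have h2 := ((h1.const_mul (Complex.exp (-(P.β * s)))).const_sub 1).div (h1.const_sub 1)
      (by simp)
    have h3 := h2.const_mul (Complex.exp (P.β * s / 2))
    convert h3 using 2 <;> simp
  · rw [if_pos h]
    simp only [h, Int.cast_zero, mul_zero, Real.exp_zero, Complex.ofReal_one, mul_one]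
    exact tendsto_const_nhds
  · rw [if_neg h.ne', Int.sign_eq_one_of_pos h]
    have h1 := (tendsto_exp_mul_int (m := -m) (by omega)).const_mul e⁻¹
    rw [mul_zero] at h1
    have h2 := (h1.sub_const (Complex.exp (-(P.β * s)))).div (h1.sub_const 1) (by simp)
    have h3 := h2.const_mul (Complex.exp (P.β * s / 2))
    have h4 : Complex.exp (P.β * s / 2) * ((0 - Complex.exp (-(P.β * s))) / (0 - 1)) =
        (Real.exp (-(((1 : ℤ) : ℝ) * (P.β * s / 2))) : ℂ) := by
      rw [zero_sub, zero_sub, neg_div_neg_eq, div_one, ← Complex.exp_add]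
      push_cast
      congr 1; ring
    rw [h4] at h3
    refine h3.congr fun τ => ?_
    simp only [Pi.div_apply]
    have h5 : e⁻¹ * (Real.exp (τ * (-m : ℤ)) : ℂ) = (e * (Real.exp (τ * m) : ℂ))⁻¹ := by
      rw [mul_inv, ← Complex.ofReal_inv, ← Real.exp_neg]
      push_cast; ring_nf
    set E := e * (Real.exp (τ * m) : ℂ) with hEdef
    have hE0 : E ≠ 0 := mul_ne_zero he0 (by exact_mod_cast (Real.exp_pos _).ne')
    rw [h5, ← mul_div_mul_left (E⁻¹ - Complex.exp (-(P.β * s))) _ hE0, mul_sub, mul_sub,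
      mul_inv_cancel₀ hE0, mul_one, mul_comm E (Complex.exp _)]

lemma exists_tendsto_V (κ : Fin n → ℤ) (J K : Finset (Fin n)) (ω : Fin n → ℤ) (x : Fin n → ℂ) :
    ∃ L, Tendsto (fun τ : ℝ => V P κ J K (ray x ω τ)) atTop (𝓝 L) := by
  have ha : ∀ j a k b c, ∃ L,
      Tendsto (fun τ : ℝ => qt P P.g (aff (pr j a k b) c (ray x ω τ))) atTop (𝓝 L) :=
    fun j a k b c => ⟨_, tendsto_qt_ray P _ _ _ _ _⟩
  have hb : ∀ j (a : ℤ), ∃ L, Tendsto (fun τ : ℝ => vb P (a * ray x ω τ j)) atTop (𝓝 L) := by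
    intro j a
    simp only [vb_aff]
    exact ⟨_, (((tendsto_qt_ray P _ _ _ _ _).mul (tendsto_qt_ray P _ _ _ _ _)).mul
      (tendsto_qt_ray P _ _ _ _ _)).mul (tendsto_qt_ray P _ _ _ _ _)⟩
  choose A hA using ha
  choose B hB using hb
  refine ⟨(∏ j ∈ J, B j (κ j)) * (∏ j ∈ J, ∏ k ∈ J with j < k,
    A j (κ j) k (κ k) 0 * A j (κ j) k (κ k) (Complex.I * P.β)) *
    ∏ j ∈ J, ∏ k ∈ K, A j (κ j) k 1 0 * A j (κ j) k (-1) 0, ?_⟩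
  simp only [V_eq, pairProd, cross_eq]
  refine Tendsto.mul (Tendsto.mul (tendsto_finsetProd _ fun j _ => hB _ _)
    (tendsto_finsetProd _ fun j _ => tendsto_finsetProd _ fun k _ => ?_))
    (tendsto_finsetProd _ fun j _ => tendsto_finsetProd _ fun k _ => (hA _ _ _ _ _).mul (hA _ _ _ _ _))
  refine Tendsto.mul ?_ ?_
  · have := hA j (κ j) k (κ k) 0
    simp only [← va_aff, add_zero] at this
    exact this
  · have := hA j (κ j) k (κ k) (Complex.I * P.β)
    simp only [← va_aff] at this
    exact this

lemma exists_tendsto_U (K : Finset (Fin n)) (p : ℕ) (ω : Fin n → ℤ) (x : Fin n → ℂ) :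
    ∃ L, Tendsto (fun τ : ℝ => U P K p (ray x ω τ)) atTop (𝓝 L) := by
  induction p using Nat.strong_induction_on generalizing K with
  | _ p ih =>
    rcases eq_or_ne p 0 with rfl | hp
    · simp only [U_zero]; exact ⟨1, tendsto_const_nhds⟩
    · simp only [U_rec P K hp]
      have : ∀ κ ∈ steps' K p, ∃ L, Tendsto (fun τ : ℝ => V P κ (supp κ) (K \ supp κ) (ray x ω τ) *
          U P (K \ supp κ) (p - (supp κ).card) (ray x ω τ)) atTop (𝓝 L) := by
        intro κ hκ
        have hc := card_supp_pos (mem_steps'.1 hκ).2.1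
        obtain ⟨L, hL⟩ := exists_tendsto_V P κ (supp κ) (K \ supp κ) ω x
        obtain ⟨L', hL'⟩ := ih (p - (supp κ).card) (by omega) (K \ supp κ)
        exact ⟨_, hL.mul hL'⟩
      choose! A hA using this
      exact ⟨_, (tendsto_finsetSum _ hA).neg⟩

variable {P} in
lemma eventually_good_ray {x : Fin n → ℂ} (hx : x ∈ good P n) (ω : Fin n → ℤ) :
    ∀ᶠ τ : ℝ in atTop, ray x ω τ ∈ good P n := by
  simp only [good, Set.mem_ofPred_eq]
  refine (Filter.eventually_all_finset _).2 fun α hα => ?_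
  rcases eq_or_ne α 0 with h0 | h0
  · simp [h0]
  simp only [h0, ne_eq, not_false_eq_true, forall_true_left]
  refine (Filter.eventually_all_finset _).2 fun c hc => ?_
  have hx' := hx α hα h0 c hc
  simp only [dv, exp_aff_ray] at hx' ⊢
  set m := ∑ j, α j * ω j
  rcases eq_or_ne m 0 with h | h
  · rw [h]; exact Eventually.of_forall fun τ => by simpa using hx'
  · by_cases hex : ∃ τ₀ : ℝ, 1 - Complex.exp (Complex.I * aff α c x) * (Real.exp (τ₀ * m) : ℂ) = 0
    · obtain ⟨τ₀, h1⟩ := hex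
      filter_upwards [eventually_gt_atTop τ₀] with τ hτ h2
      have h3 := mul_left_cancel₀ (Complex.exp_ne_zero _)
        ((sub_eq_zero.1 h1).symm.trans (sub_eq_zero.1 h2))
      have h4 := mul_right_cancel₀ (Int.cast_ne_zero.2 h) (Real.exp_injective (by exact_mod_cast h3))
      exact hτ.ne h4
    · exact Eventually.of_forall fun τ hτ => hex ⟨τ, hτ⟩

/-! ### The leading coefficient -/

/-- The direction `(n, n - 1, …, 1)`. -/
def xi (n : ℕ) (j : Fin n) : ℤ := n - (j : ℕ)

lemma sum_pr_mul (j : Fin n) (a : ℤ) (k : Fin n) (b : ℤ) (ω : Fin n → ℤ) :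
    ∑ i, pr j a k b i * ω i = a * ω j + b * ω k := by
  simp [pr, add_mul, Finset.sum_add_distrib, Pi.single_apply]

/-- `β (G / 2 + g i)`, where `G` is the sum of the couplings of `v_b`. -/
def rate (i : ℕ) : ℝ := P.β * (P.g * i + (P.g₀ + P.g₁ + P.g₀' + P.g₁') / 2)

lemma sign_dir {a : ℤ} (ha : a = 1 ∨ a = -1) {b : ℤ} (hb : b = 1 ∨ b = -1) {j k : Fin n} (h : j < k) :
    (a * xi n j + b * xi n k).sign = a := by
  have h1 : (j : ℕ) < k := h
  have h2 := k.2
  rcases ha with rfl | rfl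
  · refine Int.sign_eq_one_of_pos ?_
    rcases hb with rfl | rfl <;> simp only [xi] <;> omega
  · refine Int.sign_eq_neg_one_of_neg ?_
    rcases hb with rfl | rfl <;> simp only [xi] <;> omega

lemma sign_dir' {a : ℤ} (ha : a = 1 ∨ a = -1) {b : ℤ} (hb : b = 1 ∨ b = -1) {j k : Fin n} (h : k < j) :
    (a * xi n j + b * xi n k).sign = b := by
  rw [add_comm]; exact sign_dir hb ha h

lemma qtLim_of_sign {s : ℝ} {m : ℤ} {a : ℤ} (ha : a = 1 ∨ a = -1) (h : m.sign = a) (z : ℂ) :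
    qtLim P s m z = (Real.exp (-(a * (P.β * s / 2))) : ℂ) := by
  have : m ≠ 0 := by
    rintro rfl
    simp at h; omega
  rw [qtLim, if_neg this, h]

lemma tendsto_V_xi {κ : Fin n → ℤ} {J K : Finset (Fin n)} (hJK : Disjoint J K)
    (hκ : ∀ j ∈ J, κ j = 1 ∨ κ j = -1) (x : Fin n → ℂ) :
    Tendsto (fun τ : ℝ => V P κ J K (ray x (xi n) τ)) atTop
      (𝓝 ((∏ j ∈ J, Real.exp (-(κ j * rate P ((J ∪ K).filter (j < ·)).card)) : ℝ) : ℂ)) := by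
  have hva : ∀ j ∈ J, ∀ k, ∀ b : ℤ, (b = 1 ∨ b = -1) → ∀ c, j ≠ k → Tendsto (fun τ : ℝ =>
      qt P P.g (aff (pr j (κ j) k b) c (ray x (xi n) τ))) atTop
      (𝓝 (Real.exp (-((if j < k then κ j else b) * (P.β * P.g / 2)) : ℝ) : ℂ)) := by
    intro j hj k b hb c hjk
    have h := tendsto_qt_ray P P.g (pr j (κ j) k b) (xi n) c x
    rw [sum_pr_mul] at h
    split_ifs with h'
    · rwa [qtLim_of_sign P (hκ j hj) (sign_dir (hκ j hj) hb h')] at h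
    · rwa [qtLim_of_sign P hb (sign_dir' (hκ j hj) hb (lt_of_le_of_ne (not_lt.1 h') hjk.symm))] at h
  have hvb : ∀ j ∈ J, Tendsto (fun τ : ℝ => vb P (κ j * ray x (xi n) τ j)) atTop
      (𝓝 (Real.exp (-(κ j * (P.β * ((P.g₀ + P.g₁ + P.g₀' + P.g₁') / 2)))) : ℂ)) := by
    intro j hj
    have hs : (∑ i, (Pi.single j (κ j) : Fin n → ℤ) i * xi n i).sign = κ j := by
      have e : ∑ i, (Pi.single j (κ j) : Fin n → ℤ) i * xi n i = κ j * xi n j := by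
        simp [Pi.single_apply]
      have h2 := j.2
      rw [e]
      rcases hκ j hj with h | h <;> rw [h]
      · exact Int.sign_eq_one_of_pos (by simp only [xi]; omega)
      · exact Int.sign_eq_neg_one_of_neg (by simp only [xi]; omega)
    have h : ∀ s c, Tendsto (fun τ : ℝ => qt P s (aff (Pi.single j (κ j)) c (ray x (xi n) τ))) atTop
        (𝓝 (Real.exp (-(κ j * (P.β * s / 2))) : ℂ)) := by
      intro s c
      have h := tendsto_qt_ray P s (Pi.single j (κ j)) (xi n) c x
      rwa [qtLim_of_sign P (hκ j hj) hs] at h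
    simp only [vb_aff]
    convert (((h P.g₀ _).mul (h P.g₁ _)).mul (h P.g₀' _)).mul (h P.g₁' _) using 2
    rw [← Complex.ofReal_mul, ← Complex.ofReal_mul, ← Complex.ofReal_mul, ← Real.exp_add,
      ← Real.exp_add, ← Real.exp_add]
    congr 2
    ring
  have hlim : ((∏ j ∈ J, Real.exp (-(κ j * rate P ((J ∪ K).filter (j < ·)).card)) : ℝ) : ℂ) =
      (∏ j ∈ J, (Real.exp (-(κ j * (P.β * ((P.g₀ + P.g₁ + P.g₀' + P.g₁') / 2)))) : ℂ)) *
      (∏ j ∈ J, ∏ k ∈ J with j < k, (Real.exp (-(κ j * (P.β * P.g))) : ℂ)) *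
      ∏ j ∈ J, ∏ k ∈ K, if j < k then (Real.exp (-(κ j * (P.β * P.g))) : ℂ) else 1 := by
    rw [← Finset.prod_mul_distrib, ← Finset.prod_mul_distrib, Complex.ofReal_prod]
    refine Finset.prod_congr rfl fun j _ => ?_
    rw [← Finset.prod_filter, Finset.prod_const, Finset.prod_const, mul_assoc, ← pow_add,
      Finset.filter_union, Finset.card_union_of_disjoint (Finset.disjoint_filter_filter hJK),
      ← Complex.ofReal_pow, ← Complex.ofReal_mul, ← Real.exp_nat_mul, ← Real.exp_add, rate]
    congr 2
    push_cast
    ring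
  rw [hlim]
  simp only [V_eq, pairProd, cross_eq]
  refine Tendsto.mul (Tendsto.mul (tendsto_finsetProd _ hvb)
    (tendsto_finsetProd _ fun j hj => tendsto_finsetProd _ fun k hk => ?_))
    (tendsto_finsetProd _ fun j hj => tendsto_finsetProd _ fun k hk => ?_)
  · rw [Finset.mem_filter] at hk
    have h1 := hva j hj k (κ k) (hκ k hk.1) 0 hk.2.ne
    have h2 := hva j hj k (κ k) (hκ k hk.1) (Complex.I * P.β) hk.2.ne
    simp only [← va_aff, add_zero, if_pos hk.2] at h1 h2
    have h3 := h1.mul h2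
    rw [← Complex.ofReal_mul, ← Real.exp_add, ← neg_add, ← mul_add, add_halves] at h3
    exact h3
  · have hjk : j ≠ k := fun h => Finset.disjoint_left.1 hJK hj (h ▸ hk)
    have h3 := (hva j hj k 1 (Or.inl rfl) 0 hjk).mul (hva j hj k (-1) (Or.inr rfl) 0 hjk)
    rw [← Complex.ofReal_mul, ← Real.exp_add] at h3
    convert h3 using 2
    split_ifs with h
    · congr 2
      ring
    · push_cast
      simp

lemma map_filter_lt_card {M : Type*} (K : Finset (Fin n)) (b : ℕ → M) :
    K.val.map (fun j => b (K.filter (j < ·)).card) = (Multiset.range K.card).map b := by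
  induction K using Finset.induction_on_min with
  | empty => simp
  | insert a s ha ih =>
    have has : a ∉ s := fun h => lt_irrefl _ (ha a h)
    rw [Finset.insert_val_of_notMem has, Multiset.map_cons, Finset.card_insert_of_notMem has,
      Multiset.range_succ, Multiset.map_cons, ← ih]
    congr 1
    · rw [Finset.filter_insert, if_neg (lt_irrefl a), Finset.filter_true_of_mem ha]
    · refine Multiset.map_congr rfl fun j hj => ?_
      rw [Finset.filter_insert, if_neg (not_lt.2 (ha j hj).le)]

lemma el_filter_lt_card (K : Finset (Fin n)) (b : ℕ → ℝ) (l : ℕ) :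
    el K (fun j => b (K.filter (j < ·)).card) l = el (Finset.range K.card) b l := by
  rw [el, ← Finset.esymm_map_val, map_filter_lt_card, el, ← Finset.esymm_map_val, Finset.range_val]

/-- The limit of `U` in the direction `xi`. -/
def uLim (m p : ℕ) : ℝ := (-1) ^ p * hs (fun i => 2 * Real.cosh (rate P i)) (m - p + 1) p

lemma sum_steps_exp (K : Finset (Fin n)) (f : Fin n → ℝ) (u : ℕ → ℝ) (p : ℕ) :
    ∑ κ ∈ (steps K).filter (fun κ => (supp κ).card ≤ p),
        (∏ j ∈ supp κ, Real.exp (-(κ j * f j))) * u (supp κ).card =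
      ∑ l ∈ Finset.range (p + 1), el K (fun j => 2 * Real.cosh (f j)) l * u l := by
  rw [sum_steps K (fun L => L.card ≤ p), ← sum_powerset_card K _ u]
  refine Finset.sum_congr rfl fun L _ => ?_
  have h : ∀ ε ∈ signs L, (∏ j ∈ supp ε, Real.exp (-(ε j * f j))) * u (supp ε).card =
      (∏ j ∈ L, Real.exp (-(ε j * f j))) * u L.card := fun ε hε => by rw [supp_of_mem_signs hε]
  rw [Finset.sum_congr rfl h, ← Finset.sum_mul,
    sum_signs_prod L (fun j e => Real.exp (-(e * f j)))]
  congr 1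
  refine Finset.prod_congr rfl fun j _ => ?_
  rw [Real.cosh_eq]
  push_cast
  ring_nf

lemma tendsto_U_xi (K : Finset (Fin n)) {p : ℕ} (hp : p ≤ K.card) (x : Fin n → ℂ) :
    Tendsto (fun τ : ℝ => U P K p (ray x (xi n) τ)) atTop (𝓝 (uLim P K.card p : ℂ)) := by
  induction p using Nat.strong_induction_on generalizing K with
  | _ p ih =>
    rcases eq_or_ne p 0 with rfl | hp0
    · simp only [U_zero, uLim, hs, pow_zero, one_mul, Complex.ofReal_one]; exact tendsto_const_nhds
    · simp only [U_rec P K hp0]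
      set f : Fin n → ℝ := fun j => rate P (K.filter (j < ·)).card with hf
      have h1 : ∀ κ ∈ steps' K p, Tendsto (fun τ : ℝ => V P κ (supp κ) (K \ supp κ) (ray x (xi n) τ) *
          U P (K \ supp κ) (p - (supp κ).card) (ray x (xi n) τ)) atTop
          (𝓝 (((∏ j ∈ supp κ, Real.exp (-(κ j * f j))) *
            uLim P (K.card - (supp κ).card) (p - (supp κ).card) : ℝ) : ℂ)) := by
        intro κ hκ
        obtain ⟨hk1, hk2, hk3⟩ := mem_steps'.1 hκ
        have hc := card_supp_pos hk2
        have hsub := (mem_steps.1 hk1).2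
        have h1 := tendsto_V_xi P (J := supp κ) (K := K \ supp κ) Finset.disjoint_sdiff
          (fun j hj => step_pm hk1 j hj) x
        rw [Finset.union_sdiff_of_subset hsub] at h1
        have h2 := ih (p - (supp κ).card) (by omega) (K \ supp κ)
          (by rw [Finset.card_sdiff_of_subset hsub]; omega)
        rw [Finset.card_sdiff_of_subset hsub] at h2
        rw [Complex.ofReal_mul]
        exact h1.mul h2
      convert (tendsto_finsetSum _ h1).neg using 2
      rw [← Complex.ofReal_sum, ← Complex.ofReal_neg]
      congr 1
      have h2 := sum_steps_exp K f (fun l => uLim P (K.card - l) (p - l)) p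
      rw [filter_steps_eq, Finset.sum_insert (by simp [mem_steps'])] at h2
      have h3 := sum_el_hs (fun i => 2 * Real.cosh (rate P i)) hp0 hp
      simp only [supp_zero, Finset.prod_empty, Finset.card_empty, one_mul, Nat.sub_zero] at h2
      have h4 : ∑ l ∈ Finset.range (p + 1), el K (fun j => 2 * Real.cosh (f j)) l *
          uLim P (K.card - l) (p - l) = 0 := by
        rw [← h3]
        refine Finset.sum_congr rfl fun l hl => ?_
        rw [Finset.mem_range] at hl
        rw [← el_filter_lt_card, uLim, show K.card - l - (p - l) = K.card - p by omega]
      linarith [h2.trans h4]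

end

end Koornwinder

namespace Koornwinder

open Filter Topology

noncomputable section

variable {n : ℕ} (P : Params)

/-! ### Triangularity of the difference operators -/

lemma ray_add (x y : Fin n → ℂ) (ω : Fin n → ℤ) (τ : ℝ) : ray x ω τ + y = ray (x + y) ω τ :=
  add_right_comm _ _ _

lemma sum_mul_xi (κ : Fin n → ℤ) : ∑ j, κ j * xi n j = ∑ k, ∑ j ∈ Finset.Iic k, κ j := by
  have h : ∀ k : Fin n, ∑ j ∈ Finset.Iic k, κ j = ∑ j, if j ≤ k then κ j else 0 := by
    intro k
    rw [← Finset.sum_filter]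
    congr 1
    ext j; simp
  simp only [h]
  rw [Finset.sum_comm]
  refine Finset.sum_congr rfl fun j _ => ?_
  rw [← Finset.sum_filter, Finset.sum_const, nsmul_eq_mul, mul_comm]
  congr 1
  have : (Finset.univ : Finset (Fin n)).filter (j ≤ ·) = Finset.Ici j := by ext; simp
  rw [this, Fin.card_Ici, xi]
  have := j.2
  omega

lemma eq_of_sum_Iic_eq {κ l : Fin n → ℤ}
    (h : ∀ k, ∑ j ∈ Finset.Iic k, κ j = ∑ j ∈ Finset.Iic k, l j) : κ = l := by
  funext k
  induction hk : (k : ℕ) using Nat.strong_induction_on generalizing k with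
  | _ m ih =>
    have h1 := h k
    have h2 : ∑ j ∈ Finset.Iio k, κ j = ∑ j ∈ Finset.Iio k, l j :=
      Finset.sum_congr rfl fun j hj =>
        ih (j : ℕ) (hk ▸ Fin.lt_def.1 (Finset.mem_Iio.1 hj)) j rfl
    rw [← Finset.Iio_insert k, Finset.sum_insert (by simp), Finset.sum_insert (by simp), h2] at h1
    exact add_right_cancel h1

lemma WeightLE.sum_mul_xi_le {κ l : Fin n → ℤ} (h : WeightLE κ l) :
    ∑ j, κ j * xi n j ≤ ∑ j, l j * xi n j := by
  rw [sum_mul_xi, sum_mul_xi]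
  exact Finset.sum_le_sum fun k _ => h k

lemma WeightLE.eq_of_sum_mul_xi_eq {κ l : Fin n → ℤ} (h : WeightLE κ l)
    (h' : ∑ j, κ j * xi n j = ∑ j, l j * xi n j) : κ = l := by
  rw [sum_mul_xi, sum_mul_xi] at h'
  refine eq_of_sum_Iic_eq fun k => ?_
  exact (Finset.sum_eq_sum_iff_of_le fun k _ => h k).1 h' k (Finset.mem_univ k)

lemma weightLE_of_mem_orbit {κ l : Fin n → ℤ} (hl : Dominant l) (h : κ ∈ orbit l) : WeightLE κ l := by
  obtain ⟨w, rfl⟩ := mem_orbit.1 h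
  exact fun k => sum_act_le hl w k

lemma weightLE_of_monoCoeff_ne {κ l : Fin n → ℤ} (hl : Dominant l) (h : monoCoeff l κ ≠ 0) :
    WeightLE κ l := by
  classical
  rw [monoCoeff_apply] at h
  exact weightLE_of_mem_orbit hl (by by_contra h'; simp [h'] at h)

lemma Dominant.eq_of_mem_orbit {κ l : Fin n → ℤ} (hκ : Dominant κ) (hl : Dominant l)
    (h : κ ∈ orbit l) : κ = l := by
  refine eq_of_sum_Iic_eq fun k => le_antisymm (weightLE_of_mem_orbit hl h k) ?_
  exact weightLE_of_mem_orbit hκ ((orbit_eq_of_mem h).symm ▸ self_mem_orbit l) k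

/-- The indicator function of the first indices, up to `k`. -/
def upTo (k : Fin n) (j : Fin n) : ℤ := if j ≤ k then 1 else 0

lemma sum_mul_upTo (κ : Fin n → ℤ) (k : Fin n) : ∑ j, κ j * upTo k j = ∑ j ∈ Finset.Iic k, κ j := by
  simp only [upTo, mul_ite, mul_one, mul_zero]
  rw [← Finset.sum_filter]
  congr 1
  ext j; simp

lemma tendsto_Hop_ray (r : ℕ) (f : (Fin n → ℤ) →₀ ℂ) (ω : Fin n → ℤ) (M : ℤ)
    (hM : ∀ κ, f κ ≠ 0 → ∑ j, κ j * ω j ≤ M) (x : Fin n → ℂ) :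
    ∃ L, Tendsto (fun τ : ℝ => Hop P r (evalEx f) (ray x ω τ) * (Real.exp (τ * (-M : ℤ)) : ℂ)) atTop
      (𝓝 L) := by
  choose A hA using fun κ : Fin n → ℤ => exists_tendsto_V P κ (supp κ) (Finset.univ \ supp κ) ω x
  choose B hB using fun κ : Fin n → ℤ =>
    exists_tendsto_U P (Finset.univ \ supp κ) (r - (supp κ).card) ω x
  have h := tendsto_finsetSum ((steps Finset.univ).filter fun κ : Fin n → ℤ => (supp κ).card ≤ r)
    fun κ _ => ((hA κ).mul (hB κ)).mul
      (tendsto_evalEx_ray f ω M hM (x + fun j => Complex.I * P.β * κ j))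
  refine ⟨_, h.congr fun τ => ?_⟩
  rw [Hop, Finset.sum_mul]
  simp only [ray_add, mul_assoc]

open Classical in
lemma filter_xi {l : Fin n → ℤ} {f : (Fin n → ℤ) →₀ ℂ}
    (hf : ∀ κ, f κ ≠ 0 → WeightLE κ l) :
    (f.filter fun κ => ∑ j, κ j * xi n j = ∑ j, l j * xi n j) = Finsupp.single l (f l) := by
  ext κ
  rw [Finsupp.filter_apply, Finsupp.single_apply]
  by_cases h : l = κ
  · subst h; simp
  · rw [if_neg h]
    split_ifs with h1
    · by_contra h2
      exact h ((hf κ h2).eq_of_sum_mul_xi_eq h1).symm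
    · rfl

lemma monoCoeff_self (l : Fin n → ℤ) : monoCoeff l l = 1 := by
  classical
  rw [monoCoeff_apply, if_pos (self_mem_orbit l)]

lemma rate_eq_rho (j : Fin n) :
    rate P ((Finset.univ : Finset (Fin n)).filter (j < ·)).card = P.β * rho P j := by
  have : (Finset.univ : Finset (Fin n)).filter (j < ·) = Finset.Ioi j := by ext; simp
  have h2 := j.2
  rw [this, Fin.card_Ioi, rate, rho, Nat.cast_sub (by omega), Nat.cast_sub (by omega)]
  push_cast
  ring

lemma leading_coeff {r : ℕ} (hr : 1 ≤ r) (hrn : r ≤ n) (l : Fin n → ℤ) :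
    ∑ κ ∈ (steps (Finset.univ : Finset (Fin n))).filter (fun κ => (supp κ).card ≤ r),
      (∏ j ∈ supp κ, Real.exp (-(κ j * (P.β * shifted P l j)))) *
        uLim P (n - (supp κ).card) (r - (supp κ).card) = 2 ^ r * Eθ P r (shifted P l) := by
  rw [sum_steps_exp _ (fun j => P.β * shifted P l j) (fun m => uLim P (n - m) (r - m)), Eθ,
    E_eq hr hrn _ _ (fun i => Real.cosh (rate P i)), Finset.mul_sum]
  · refine Finset.sum_congr rfl fun s hs => ?_
    rw [Finset.mem_range] at hs
    rw [el_const_mul, uLim, hs_const_mul, show n - s - (r - s) = n - r by omega,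
      show r = s + (r - s) by omega, pow_add, Nat.add_sub_cancel_left]
    ring
  · intro j
    congr 1
    rw [← rate_eq_rho]
    congr 1
    have : (Finset.univ : Finset (Fin n)).filter (j < ·) = Finset.Ioi j := by ext; simp
    rw [this, Fin.card_Ioi]

lemma tendsto_Hop_xi {r : ℕ} (hr : 1 ≤ r) (hrn : r ≤ n) {l : Fin n → ℤ} {f : (Fin n → ℤ) →₀ ℂ}
    (hf : ∀ κ, f κ ≠ 0 → WeightLE κ l) (x : Fin n → ℂ) :
    Tendsto (fun τ : ℝ => Hop P r (evalEx f) (ray x (xi n) τ) *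
      (Real.exp (τ * (-∑ j, l j * xi n j : ℤ)) : ℂ)) atTop
      (𝓝 (((2 ^ r * Eθ P r (shifted P l) : ℝ) : ℂ) * (f l * ex l x))) := by
  classical
  have h := tendsto_finsetSum ((steps Finset.univ).filter fun κ : Fin n → ℤ => (supp κ).card ≤ r)
    fun κ hκ => ((tendsto_V_xi P (J := supp κ) (K := Finset.univ \ supp κ) Finset.disjoint_sdiff
      (fun j hj => step_pm (Finset.mem_filter.1 hκ).1 j hj) x).mul
      (tendsto_U_xi P (Finset.univ \ supp κ) (p := r - (supp κ).card) (by
        rw [Finset.card_sdiff_of_subset (Finset.subset_univ _), Finset.card_univ, Fintype.card_fin]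
        omega) x)).mul
      (tendsto_evalEx_ray f (xi n) (∑ j, l j * xi n j) (fun κ hκ => (hf κ hκ).sum_mul_xi_le)
        (x + fun j => Complex.I * P.β * κ j))
  have hl : ∀ y, evalEx (f.filter fun κ => ∑ j, κ j * xi n j = ∑ j, l j * xi n j) y =
      f l * ex l y := by
    intro y
    rw [filter_xi hf]
    simp [evalEx]
  rw [← leading_coeff P hr hrn, Complex.ofReal_sum, Finset.sum_mul]
  have h' := h.congr (f₂ := fun τ : ℝ => Hop P r (evalEx f) (ray x (xi n) τ) *
      (Real.exp (τ * (-∑ j, l j * xi n j : ℤ)) : ℂ)) fun τ => by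
    rw [Hop, Finset.sum_mul]
    simp only [ray_add, mul_assoc]
  convert h' using 2
  refine Finset.sum_congr rfl fun κ hκ => ?_
  have hex : ex l (x + fun j => Complex.I * P.β * κ j) =
      ((∏ j ∈ supp κ, Real.exp (-(κ j * (P.β * l j))) : ℝ) : ℂ) * ex l x := by
    rw [ex_apply_add, mul_comm, ← Real.exp_sum, Complex.ofReal_exp, ex]
    congr 2
    rw [Finset.sum_subset (Finset.subset_univ (supp κ)), Finset.mul_sum]
    · push_cast
      refine Finset.sum_congr rfl fun j _ => ?_
      linear_combination ((l j : ℂ) * P.β * κ j) * Complex.I_sq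
    · intro j _ hj
      rw [mem_supp, not_not] at hj
      simp [hj]
  have hprod : ∏ j ∈ supp κ, Real.exp (-(κ j * (P.β * shifted P l j))) =
      (∏ j ∈ supp κ, Real.exp (-(κ j *
        rate P ((supp κ ∪ (Finset.univ \ supp κ)).filter (j < ·)).card))) *
      ∏ j ∈ supp κ, Real.exp (-(κ j * (P.β * l j))) := by
    rw [← Finset.prod_mul_distrib]
    refine Finset.prod_congr rfl fun j _ => ?_
    rw [Finset.union_sdiff_of_subset (Finset.subset_univ _), rate_eq_rho, ← Real.exp_add, shifted]
    congr 1
    ring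
  rw [hl, hex, hprod, Finset.card_sdiff_of_subset (Finset.subset_univ _), Finset.card_univ,
    Fintype.card_fin]
  push_cast
  ring

/-- The difference operators are triangular with respect to the monomial symmetric functions. -/
theorem Hop_monomial (hβ : 0 < P.β) {r : ℕ} (hr : 1 ≤ r) (hrn : r ≤ n) {l : Fin n → ℤ}
    (hl : Dominant l) : ∃ Q ∈ expPoly n, (∀ x ∈ good P n, Hop P r (monomial l) x = Q x) ∧
      Q - ((2 ^ r * Eθ P r (shifted P l) : ℝ) : ℂ) • monomial l ∈ Submodule.span ℂ
        (monomial '' {l' : Fin n → ℤ | Dominant l' ∧ WeightLE l' l ∧ l' ≠ l}) := by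
  obtain ⟨Q, hQ, hQi, hHQ⟩ := exists_Hop_eq hβ r (monomial_mem l) (monomial_inv l)
  refine ⟨Q, hQ, hHQ, ?_⟩
  obtain ⟨q, rfl⟩ := mem_expPoly_iff.1 hQ
  have hev : ∀ ω : Fin n → ℤ, ∀ M : ℤ, ∀ x ∈ good P n, ∀ᶠ τ : ℝ in atTop,
      Hop P r (evalEx (monoCoeff l)) (ray x ω τ) * (Real.exp (τ * (-M : ℤ)) : ℂ) =
      evalEx q (ray x ω τ) * (Real.exp (τ * (-M : ℤ)) : ℂ) := by
    intro ω M x hx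
    filter_upwards [eventually_good_ray hx ω] with τ hτ
    rw [evalEx_monoCoeff, hHQ _ hτ]
  have hle : ∀ κ, q κ ≠ 0 → WeightLE κ l := by
    intro κ hκ k
    by_contra! hlt
    refine hκ (coeff_eq_zero_of_growth q (upTo k) (∑ j ∈ Finset.Iic k, l j)
      (isOpen_dense_good P).2 (fun x hx => ?_) (by rwa [sum_mul_upTo]))
    obtain ⟨L, hL⟩ := tendsto_Hop_ray P r (monoCoeff l) (upTo k) (∑ j ∈ Finset.Iic k, l j)
      (fun κ hκ => by rw [sum_mul_upTo]; exact weightLE_of_monoCoeff_ne hl hκ k) x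
    exact ⟨L, hL.congr' (hev _ _ x hx)⟩
  have hlead : q l = ((2 ^ r * Eθ P r (shifted P l) : ℝ) : ℂ) := by
    classical
    obtain ⟨x, hx⟩ := (isOpen_dense_good P (n := n)).2.nonempty
    have h1 := (tendsto_Hop_xi P hr hrn (fun κ hκ => weightLE_of_monoCoeff_ne hl hκ) x).congr'
      (hev _ _ x hx)
    have h2 := tendsto_evalEx_ray q (xi n) (∑ j, l j * xi n j)
      (fun κ hκ => (hle κ hκ).sum_mul_xi_le) x
    rw [filter_xi hle] at h2
    have h3 := tendsto_nhds_unique h1 h2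
    rw [monoCoeff_self, one_mul] at h3
    have h4 : evalEx (Finsupp.single l (q l)) x = q l * ex l x := by simp [evalEx]
    rw [h4] at h3
    exact (mul_right_cancel₀ (Complex.exp_ne_zero _) h3).symm
  set c : ℂ := ((2 ^ r * Eθ P r (shifted P l) : ℝ) : ℂ)
  have e : evalEx q - c • monomial l = evalEx (q + (-c) • monoCoeff l) := by
    rw [evalEx_add, evalEx_smul, evalEx_monoCoeff, neg_smul, sub_eq_add_neg]
  rw [e]
  refine Submodule.span_mono ?_ (inv_mem_span _ ?_)
  · rintro _ ⟨μ, ⟨hμ, hne⟩, rfl⟩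
    refine ⟨μ, ⟨hμ, ?_, ?_⟩, rfl⟩
    · by_contra h
      refine hne ?_
      have h1 : q μ = 0 := by by_contra h'; exact h (hle μ h')
      have h2 : monoCoeff l μ = 0 := by by_contra h'; exact h (weightLE_of_monoCoeff_ne hl h')
      simp [h1, h2]
    · rintro rfl
      refine hne ?_
      simp [hlead, monoCoeff_self]
  · rw [← e]
    intro w x
    simp only [Pi.sub_apply, Pi.smul_apply, hQi w x, monomial_inv l w x]

end

end Koornwinder

namespace Koornwinder

open Filter Topology

noncomputable section

variable {n : ℕ} {P : Params}

/-! ### The `q`-shifted factorial -/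

lemma norm_geom {p : ℝ} (hp : 0 ≤ p) (hp1 : p < 1) (a : ℂ) : Summable fun m : ℕ => ‖-(a * (p : ℂ) ^ m)‖ := by
  simp only [norm_neg, norm_mul, norm_pow, Complex.norm_real, Real.norm_of_nonneg hp]
  exact (summable_geometric_of_lt_one hp hp1).mul_left _

lemma multipliable_geom {p : ℝ} (hp : 0 ≤ p) (hp1 : p < 1) (a : ℂ) :
    Multipliable fun m : ℕ => 1 - a * (p : ℂ) ^ m := by
  simpa only [sub_eq_add_neg] using multipliable_one_add_of_summable (norm_geom hp hp1 a)

lemma exp_neg_lt_one (hβ : 0 < P.β) : Real.exp (-P.β) < 1 := Real.exp_lt_one_iff.2 (by linarith)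

lemma qfac_eq_mul (hβ : 0 < P.β) (a : ℂ) :
    qfac P a = (1 - a) * qfac P ((Real.exp (-P.β) : ℂ) * a) := by
  have h := multipliable_geom (Real.exp_pos (-P.β)).le (exp_neg_lt_one hβ) ((Real.exp (-P.β) : ℂ) * a)
  rw [qfac, qfac, tprod_eq_zero_mul']
  · rw [pow_zero, mul_one]
    congr 1
    exact tprod_congr fun m => by ring
  · exact h.congr fun m => by ring

lemma differentiable_qfac (hβ : 0 < P.β) : Differentiable ℂ (qfac P) := by
  intro a
  set q := Real.exp (-P.β) with hq
  have hu : Summable fun m : ℕ => (‖a‖ + 1) * q ^ m :=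
    (summable_geometric_of_lt_one (Real.exp_pos _).le (exp_neg_lt_one hβ)).mul_left _
  have hb := Summable.hasProdLocallyUniformlyOn_nat_one_add
    (f := fun (m : ℕ) (a : ℂ) => -(a * (q : ℂ) ^ m)) (K := Metric.ball (0 : ℂ) (‖a‖ + 1))
    Metric.isOpen_ball hu (Eventually.of_forall fun m x hx => by
      rw [norm_neg, norm_mul, norm_pow, Complex.norm_real, Real.norm_of_nonneg (Real.exp_pos _).le]
      exact mul_le_mul_of_nonneg_right (by simpa using (Metric.mem_ball.1 hx).le)
        (pow_nonneg (Real.exp_pos _).le _)) (fun m => by fun_prop)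
  have hd := hb.differentiableOn (.of_forall fun s => by
    simpa [Finset.prod_fn] using DifferentiableOn.finsetProd (fun _ _ => by fun_prop))
    Metric.isOpen_ball
  have h := hd.differentiableAt (x := a) (Metric.isOpen_ball.mem_nhds (by simp))
  exact h.congr_of_eventuallyEq (Eventually.of_forall fun x => by simp [qfac, hq, sub_eq_add_neg])

lemma qfac_ne_zero_of_lt (hβ : 0 < P.β) {a : ℂ} (ha : ‖a‖ < 1) : qfac P a ≠ 0 := by
  have h := tprod_one_add_ne_zero_of_summable (f := fun m : ℕ => -(a * (Real.exp (-P.β) : ℂ) ^ m))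
    (fun m h => ?_) (norm_geom (Real.exp_pos _).le (exp_neg_lt_one hβ) a)
  · simpa only [qfac, sub_eq_add_neg] using h
  · rw [← sub_eq_add_neg, sub_eq_zero] at h
    have h1 : ‖a * (Real.exp (-P.β) : ℂ) ^ m‖ < 1 := by
      rw [norm_mul, norm_pow, Complex.norm_real, Real.norm_of_nonneg (Real.exp_pos _).le]
      exact (mul_le_of_le_one_right (norm_nonneg _)
        (pow_le_one₀ (Real.exp_pos _).le (exp_neg_lt_one hβ).le)).trans_lt ha
    rw [← h] at h1
    simp at h1

lemma norm_exp_mul_lt {t : ℝ} (ht : t < 0) {a : ℂ} (ha : ‖a‖ ≤ 1) : ‖(Real.exp t : ℂ) * a‖ < 1 := by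
  rw [norm_mul, Complex.norm_real, Real.norm_of_nonneg (Real.exp_pos _).le]
  exact (mul_le_of_le_one_right (Real.exp_pos _).le ha).trans_lt (Real.exp_lt_one_iff.2 ht)

lemma qfac_ne_zero (hβ : 0 < P.β) {a : ℂ} (ha : ‖a‖ ≤ 1) (h1 : a ≠ 1) : qfac P a ≠ 0 := by
  rw [qfac_eq_mul hβ]
  exact mul_ne_zero (sub_ne_zero.2 h1.symm) (qfac_ne_zero_of_lt hβ (norm_exp_mul_lt (by linarith) ha))

lemma conj_qfac (hβ : 0 < P.β) (a : ℂ) :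
    (starRingEnd ℂ) (qfac P a) = qfac P ((starRingEnd ℂ) a) := by
  rw [qfac, (multipliable_geom (Real.exp_pos _).le (exp_neg_lt_one hβ) a).map_tprod
    (starRingEnd ℂ) Complex.continuous_conj, qfac]
  exact tprod_congr fun m => by simp only [map_sub, map_one, map_mul, map_pow, Complex.conj_ofReal]

/-- The square root of `q`. -/
def sq (P : Params) : ℂ := (Real.exp (-P.β / 2) : ℂ)

lemma sq_mul_sq : sq P * sq P = (Real.exp (-P.β) : ℂ) := by
  rw [sq, ← Complex.ofReal_mul, ← Real.exp_add, add_halves]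

lemma qfac_sq (hβ : 0 < P.β) (a : ℂ) : qfac P (a * a) =
    qfac P a * qfac P (-a) * qfac P (sq P * a) * qfac P (-(sq P * a)) := by
  have hp : Real.exp (-P.β / 2) < 1 := Real.exp_lt_one_iff.2 (by linarith)
  have key : ∀ b : ℂ, qfac P b * qfac P (sq P * b) = ∏' m : ℕ, (1 - b * sq P ^ m) := by
    intro b
    rw [← tprod_even_mul_odd, qfac, qfac]
    · congr 1
      · exact tprod_congr fun m => by rw [pow_mul, pow_two, sq_mul_sq]
      · exact tprod_congr fun m => by rw [pow_succ, pow_mul, pow_two, sq_mul_sq]; ring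
    · refine (multipliable_geom (Real.exp_pos (-P.β)).le (exp_neg_lt_one hβ) b).congr fun m => ?_
      rw [pow_mul, pow_two, sq_mul_sq]
    · refine (multipliable_geom (Real.exp_pos (-P.β)).le (exp_neg_lt_one hβ) (sq P * b)).congr
        fun m => ?_
      rw [pow_succ, pow_mul, pow_two, sq_mul_sq]; ring
  rw [mul_right_comm (qfac P a), key, mul_assoc, ← mul_neg, key, ← Multipliable.tprod_mul, qfac]
  · refine tprod_congr fun m => ?_
    rw [← sq_mul_sq]; ring
  · exact multipliable_geom (Real.exp_pos _).le hp a
  · exact multipliable_geom (Real.exp_pos _).le hp (-a)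

/-! ### The factors of the weight function -/

/-- The quotient `(y; q)_∞ / (q^s y; q)_∞`, regularized for `s = 0`. -/
def psi (P : Params) (s : ℝ) (y : ℂ) : ℂ :=
  if s = 0 then 1 else qfac P y / qfac P ((Real.exp (-P.β * s) : ℂ) * y)

lemma neg_mul_neg_of_pos (hβ : 0 < P.β) {s : ℝ} (hs : 0 ≤ s) (h : s ≠ 0) : -P.β * s < 0 := by
  have := mul_pos hβ (lt_of_le_of_ne hs h.symm)
  linarith

lemma differentiableAt_psi (hβ : 0 < P.β) {s : ℝ} (hs : 0 ≤ s) {y : ℂ} (hy : ‖y‖ ≤ 1) :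
    DifferentiableAt ℂ (psi P s) y := by
  by_cases h : s = 0
  · have : psi P s = fun _ => 1 := by funext y; simp [psi, h]
    rw [this]; exact differentiableAt_const _
  · have : psi P s = fun y => qfac P y / qfac P ((Real.exp (-P.β * s) : ℂ) * y) := by
      funext y; simp [psi, h]
    rw [this]
    refine (differentiable_qfac hβ y).fun_div ?_
      (qfac_ne_zero_of_lt hβ (norm_exp_mul_lt (neg_mul_neg_of_pos hβ hs h) hy))
    exact (differentiable_qfac hβ _).comp y (by fun_prop)

lemma psi_eq (hβ : 0 < P.β) (s : ℝ) {y : ℂ} (hy : ‖y‖ ≤ 1) (h1 : y ≠ 1) :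
    psi P s y = qfac P y / qfac P ((Real.exp (-P.β * s) : ℂ) * y) := by
  rw [psi]
  split_ifs with h
  · simp [h, qfac_ne_zero hβ hy h1]
  · rfl

lemma psi_ne_zero (hβ : 0 < P.β) {s : ℝ} (hs : 0 ≤ s) {y : ℂ} (hy : ‖y‖ ≤ 1) (h1 : y ≠ 1) :
    psi P s y ≠ 0 := by
  rw [psi]
  split_ifs with h
  · exact one_ne_zero
  · exact div_ne_zero (qfac_ne_zero hβ hy h1)
      (qfac_ne_zero_of_lt hβ (norm_exp_mul_lt (neg_mul_neg_of_pos hβ hs h) hy))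

lemma qt_mul_psi (hβ : 0 < P.β) {s : ℝ} (hs : 0 ≤ s) {z y : ℂ} (hz : Complex.exp (Complex.I * z) = y)
    (hy : ‖y‖ ≤ 1) (h1 : y ≠ 1) :
    qt P s z * psi P s y = Complex.exp (P.β * s / 2) * psi P s ((Real.exp (-P.β) : ℂ) * y) := by
  have h1' : 1 - y ≠ 0 := sub_ne_zero.2 h1.symm
  rw [qt, hz, psi, psi]
  split_ifs with h
  · subst h
    simp [h1']
  · have h2 := norm_exp_mul_lt (neg_mul_neg_of_pos hβ hs h) hy
    have h3 : 1 - (Real.exp (-P.β * s) : ℂ) * y ≠ 0 := by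
      intro h'
      rw [← sub_eq_zero.1 h'] at h2; simp at h2
    have h4 := qfac_ne_zero_of_lt hβ (norm_exp_mul_lt (show -P.β < 0 by linarith) h2.le)
    have e : Complex.exp (-(P.β * s)) = (Real.exp (-P.β * s) : ℂ) := by push_cast; ring_nf
    rw [e, qfac_eq_mul hβ y, qfac_eq_mul hβ ((Real.exp (-P.β * s) : ℂ) * y),
      mul_left_comm (Real.exp (-P.β * s) : ℂ) (Real.exp (-P.β) : ℂ)]
    generalize (Real.exp (-P.β * s) : ℂ) = A at *
    field_simp

/-- The function `d_a^+` in the exponential variable, regularized. -/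
def pa (P : Params) (y : ℂ) : ℂ := psi P P.g y

/-- The function `d_b^+` in the exponential variable, regularized. -/
def pb (P : Params) (y : ℂ) : ℂ :=
  psi P P.g₀ y * psi P P.g₁ (-y) * psi P P.g₀' (sq P * y) * psi P P.g₁' (-(sq P * y))

/-- The couplings are nonnegative and `β` is positive. -/
structure Params.Pos (P : Params) : Prop where
  β : 0 < P.β
  g : 0 ≤ P.g
  g₀ : 0 ≤ P.g₀
  g₁ : 0 ≤ P.g₁
  g₀' : 0 ≤ P.g₀'
  g₁' : 0 ≤ P.g₁'

variable (hP : P.Pos)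

lemma norm_sq_mul (hP : P.Pos) {y : ℂ} (hy : ‖y‖ ≤ 1) : ‖sq P * y‖ < 1 :=
  norm_exp_mul_lt (by linarith [hP.β]) hy

lemma ne_one_of_norm_lt {y : ℂ} (hy : ‖y‖ < 1) : y ≠ 1 := by
  rintro rfl; simp at hy

lemma differentiableAt_pa (hP : P.Pos) {y : ℂ} (hy : ‖y‖ ≤ 1) : DifferentiableAt ℂ (pa P) y :=
  differentiableAt_psi hP.β hP.g hy

lemma differentiableAt_pb (hP : P.Pos) {y : ℂ} (hy : ‖y‖ ≤ 1) : DifferentiableAt ℂ (pb P) y := by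
  have h := (norm_sq_mul hP hy).le
  have hc : ∀ {s : ℝ} {f : ℂ → ℂ}, 0 ≤ s → ‖f y‖ ≤ 1 → DifferentiableAt ℂ f y →
      DifferentiableAt ℂ (fun y => psi P s (f y)) y := fun hs hf hd =>
    (differentiableAt_psi hP.β hs hf).comp y hd
  unfold pb
  exact (((hc hP.g₀ hy (by fun_prop)).fun_mul (hc hP.g₁ (by rwa [norm_neg]) (by fun_prop))).fun_mul
    (hc hP.g₀' h (by fun_prop))).fun_mul (hc hP.g₁' (by rwa [norm_neg]) (by fun_prop))

lemma va_mul_pa (hP : P.Pos) {z : ℂ} (hy : ‖Complex.exp (Complex.I * z)‖ ≤ 1)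
    (h1 : Complex.exp (Complex.I * z) ≠ 1) : va P z * pa P (Complex.exp (Complex.I * z)) =
      Complex.exp (P.β * P.g / 2) * pa P ((Real.exp (-P.β) : ℂ) * Complex.exp (Complex.I * z)) := by
  rw [va_eq]
  exact qt_mul_psi hP.β hP.g rfl hy h1

/-- The constant `q^(-G/2)`. -/
def cb (P : Params) : ℂ := Complex.exp (P.β * P.g₀ / 2) * Complex.exp (P.β * P.g₁ / 2) *
  Complex.exp (P.β * P.g₀' / 2) * Complex.exp (P.β * P.g₁' / 2)

lemma exp_I_add_pi (z : ℂ) :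
    Complex.exp (Complex.I * (z + Real.pi)) = -Complex.exp (Complex.I * z) := by
  rw [mul_add, Complex.exp_add, mul_comm Complex.I (Real.pi : ℂ), Complex.exp_pi_mul_I]; ring

lemma exp_I_add_Ibeta (z : ℂ) : Complex.exp (Complex.I * (z + Complex.I * P.β)) =
    (Real.exp (-P.β) : ℂ) * Complex.exp (Complex.I * z) := by
  rw [mul_add, Complex.exp_add, mul_comm (Complex.exp _), ← mul_assoc, Complex.I_mul_I]
  push_cast; ring_nf

lemma exp_I_add_Ibeta_half (z : ℂ) : Complex.exp (Complex.I * (z + Complex.I * P.β / 2)) =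
    sq P * Complex.exp (Complex.I * z) := by
  rw [mul_add, Complex.exp_add, mul_comm (Complex.exp _), sq, mul_div_assoc, ← mul_assoc,
    Complex.I_mul_I]
  push_cast; ring_nf

lemma vb_mul_pb (hP : P.Pos) {z : ℂ} (hy : ‖Complex.exp (Complex.I * z)‖ ≤ 1)
    (h1 : Complex.exp (Complex.I * z) ≠ 1) (h2 : -Complex.exp (Complex.I * z) ≠ 1) :
    vb P z * pb P (Complex.exp (Complex.I * z)) =
      cb P * pb P ((Real.exp (-P.β) : ℂ) * Complex.exp (Complex.I * z)) := by
  have h3 := norm_sq_mul hP hy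
  rw [vb_eq, pb, pb, ← add_assoc]
  have e1 := qt_mul_psi hP.β hP.g₀ rfl hy h1
  have e2 := qt_mul_psi hP.β hP.g₁ (exp_I_add_pi z) (by rwa [norm_neg]) h2
  have e3 := qt_mul_psi hP.β hP.g₀' (exp_I_add_Ibeta_half z) h3.le (ne_one_of_norm_lt h3)
  have e4 := qt_mul_psi hP.β hP.g₁' (z := z + Complex.I * P.β / 2 + Real.pi)
    (by rw [exp_I_add_pi, exp_I_add_Ibeta_half]) (by rw [norm_neg]; exact h3.le)
    (ne_one_of_norm_lt (by rwa [norm_neg]))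
  rw [mul_neg] at e2 e4
  rw [mul_left_comm _ (sq P)] at e3 e4
  calc _ = (qt P P.g₀ z * psi P P.g₀ (Complex.exp (Complex.I * z))) *
      (qt P P.g₁ (z + Real.pi) * psi P P.g₁ (-Complex.exp (Complex.I * z))) *
      (qt P P.g₀' (z + Complex.I * P.β / 2) * psi P P.g₀' (sq P * Complex.exp (Complex.I * z))) *
      (qt P P.g₁' (z + Complex.I * P.β / 2 + Real.pi) *
        psi P P.g₁' (-(sq P * Complex.exp (Complex.I * z)))) := by ring
    _ = _ := by rw [e1, e2, e3, e4, cb]; ring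

lemma daPlus_eq (hP : P.Pos) {z : ℂ} (hy : ‖Complex.exp (Complex.I * z)‖ ≤ 1)
    (h1 : Complex.exp (Complex.I * z) ≠ 1) : daPlus P z = pa P (Complex.exp (Complex.I * z)) := by
  rw [pa, psi_eq hP.β _ hy h1]; rfl

lemma dbPlus_eq (hP : P.Pos) {z : ℂ} (hy : ‖Complex.exp (Complex.I * z)‖ ≤ 1)
    (h1 : Complex.exp (Complex.I * z) ≠ 1) (h2 : -Complex.exp (Complex.I * z) ≠ 1) :
    dbPlus P z = pb P (Complex.exp (Complex.I * z)) := by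
  have h3 := norm_sq_mul hP hy
  have e : Complex.exp (2 * Complex.I * z) =
      Complex.exp (Complex.I * z) * Complex.exp (Complex.I * z) := by
    rw [← Complex.exp_add]; ring_nf
  have e2 : ∀ s : ℝ, (Real.exp (-P.β * (s + 1 / 2)) : ℂ) = (Real.exp (-P.β * s) : ℂ) * sq P := by
    intro s
    rw [sq, ← Complex.ofReal_mul, ← Real.exp_add]; ring_nf
  rw [pb, psi_eq hP.β _ hy h1, psi_eq hP.β _ (by rwa [norm_neg]) h2,
    psi_eq hP.β _ h3.le (ne_one_of_norm_lt h3), psi_eq hP.β _ (by rw [norm_neg]; exact h3.le)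
      (ne_one_of_norm_lt (by rwa [norm_neg])), dbPlus]
  simp only [e, qfac_sq hP.β, e2]
  simp only [div_mul_div_comm, mul_neg, neg_mul, mul_assoc]

end

end Koornwinder

namespace Koornwinder

open Filter Topology

noncomputable section

variable {n : ℕ} {P : Params}

/-! ### The regularized products of coefficients and weights -/

/-- The function `φ (e^(-t) e^(iz)) φ (e^(-iz))`. -/
def nf (φ : ℂ → ℂ) (t : ℝ) (z : ℂ) : ℂ :=
  φ ((Real.exp (-t) : ℂ) * Complex.exp (Complex.I * z)) * φ (Complex.exp (-(Complex.I * z)))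

lemma nf_shift (φ : ℂ → ℂ) (t : ℝ) (z : ℂ) : nf φ t (z - Complex.I * t) = nf φ t (-z) := by
  have h1 : (Real.exp (-t) : ℂ) * Complex.exp (Complex.I * (z - Complex.I * t)) =
      Complex.exp (-(Complex.I * -z)) := by
    rw [Complex.ofReal_exp, ← Complex.exp_add]
    congr 1
    push_cast
    linear_combination (-(t : ℂ)) * Complex.I_sq
  have h2 : (Real.exp (-t) : ℂ) * Complex.exp (Complex.I * -z) =
      Complex.exp (-(Complex.I * (z - Complex.I * t))) := by
    rw [Complex.ofReal_exp, ← Complex.exp_add]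
    congr 1
    push_cast
    linear_combination (-(t : ℂ)) * Complex.I_sq
  rw [nf, nf, h1, h2, mul_comm]

lemma nf_neg (φ : ℂ → ℂ) (z : ℂ) : nf φ 0 (-z) = nf φ 0 z := by
  simpa using (nf_shift φ 0 z).symm

lemma nf_zero (φ : ℂ → ℂ) (z : ℂ) :
    nf φ 0 z = φ (Complex.exp (Complex.I * z)) * φ (Complex.exp (-(Complex.I * z))) := by
  simp [nf]

lemma nf_add_two_pi (φ : ℂ → ℂ) (t : ℝ) (z : ℂ) (m : ℤ) :
    nf φ t (z + 2 * Real.pi * m) = nf φ t z := by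
  rw [nf, Complex.exp_neg, exp_I_add_two_pi, ← Complex.exp_neg, nf]

lemma differentiableAt_nf {φ : ℂ → ℂ} (hφ : ∀ y, ‖y‖ ≤ 1 → DifferentiableAt ℂ φ y) {t : ℝ} {z : ℂ}
    (h1 : -t ≤ z.im) (h2 : z.im ≤ 0) : DifferentiableAt ℂ (nf φ t) z := by
  have e1 : ‖(Real.exp (-t) : ℂ) * Complex.exp (Complex.I * z)‖ ≤ 1 := by
    rw [norm_mul, Complex.norm_real, Real.norm_of_nonneg (Real.exp_pos _).le, Complex.norm_exp,
      ← Real.exp_add, Real.exp_le_one_iff]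
    simp; linarith
  have e2 : ‖Complex.exp (-(Complex.I * z))‖ ≤ 1 := by
    rw [Complex.norm_exp, Real.exp_le_one_iff]
    simpa using h2
  unfold nf
  exact ((hφ _ e1).comp z (by fun_prop)).fun_mul ((hφ _ e2).comp z (by fun_prop))

lemma norm_exp_I_of_im {z : ℂ} (hz : z.im = 0) : ‖Complex.exp (Complex.I * z)‖ = 1 := by
  rw [Complex.norm_exp]; simp [hz]

lemma exp_neg_I_ne_one {z : ℂ} (h : Complex.exp (Complex.I * z) ≠ 1) :
    Complex.exp (Complex.I * -z) ≠ 1 := by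
  rw [mul_neg, Complex.exp_neg, ne_eq, inv_eq_one]; exact h

lemma da_eq (hP : P.Pos) {z : ℂ} (hz : z.im = 0) (h1 : Complex.exp (Complex.I * z) ≠ 1) :
    da P z = nf (pa P) 0 z := by
  rw [da, daPlus_eq hP (norm_exp_I_of_im hz).le h1,
    daPlus_eq hP (norm_exp_I_of_im (by simpa using hz)).le (exp_neg_I_ne_one h1), nf_zero, mul_neg]

lemma db_eq (hP : P.Pos) {z : ℂ} (hz : z.im = 0) (h1 : Complex.exp (Complex.I * z) ≠ 1)
    (h2 : -Complex.exp (Complex.I * z) ≠ 1) : db P z = nf (pb P) 0 z := by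
  have h2' : -Complex.exp (Complex.I * -z) ≠ 1 := by
    rw [mul_neg, Complex.exp_neg, ← inv_neg, ne_eq, inv_eq_one]; exact h2
  rw [db, dbPlus_eq hP (norm_exp_I_of_im hz).le h1 h2,
    dbPlus_eq hP (norm_exp_I_of_im (by simpa using hz)).le (exp_neg_I_ne_one h1) h2', nf_zero,
    mul_neg]

/-- The constant `q^(-g/2)`. -/
def ca (P : Params) : ℂ := Complex.exp (P.β * P.g / 2)

lemma va_mul_nf (hP : P.Pos) {z : ℂ} (hz : z.im = 0) (h1 : Complex.exp (Complex.I * z) ≠ 1) :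
    va P z * nf (pa P) 0 z = ca P * nf (pa P) P.β z := by
  rw [nf_zero, ← mul_assoc, va_mul_pa hP (norm_exp_I_of_im hz).le h1, nf, ca]
  ring

lemma va_mul_va_mul_nf (hP : P.Pos) {z : ℂ} (hz : z.im = 0) (h1 : Complex.exp (Complex.I * z) ≠ 1) :
    va P z * va P (z + Complex.I * P.β) * nf (pa P) 0 z = ca P * ca P * nf (pa P) (2 * P.β) z := by
  have h2 : ‖Complex.exp (Complex.I * (z + Complex.I * P.β))‖ < 1 := by
    rw [exp_I_add_Ibeta]
    exact norm_exp_mul_lt (by linarith [hP.β]) (norm_exp_I_of_im hz).le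
  have h3 := va_mul_pa hP h2.le (ne_one_of_norm_lt h2)
  rw [exp_I_add_Ibeta, ← mul_assoc (Real.exp (-P.β) : ℂ), ← Complex.ofReal_mul (Real.exp (-P.β)),
    ← Real.exp_add] at h3
  calc _ = va P (z + Complex.I * P.β) * (va P z * nf (pa P) 0 z) := by ring
    _ = ca P * (va P (z + Complex.I * P.β) * pa P ((Real.exp (-P.β) : ℂ) *
        Complex.exp (Complex.I * z))) * pa P (Complex.exp (-(Complex.I * z))) := by
      rw [va_mul_nf hP hz h1, nf]; ring
    _ = _ := by
      rw [h3, nf, ca, show -(2 * P.β) = -P.β + -P.β by ring]; ring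

lemma vb_mul_nf (hP : P.Pos) {z : ℂ} (hz : z.im = 0) (h1 : Complex.exp (Complex.I * z) ≠ 1)
    (h2 : -Complex.exp (Complex.I * z) ≠ 1) :
    vb P z * nf (pb P) 0 z = cb P * nf (pb P) P.β z := by
  rw [nf_zero, ← mul_assoc, vb_mul_pb hP (norm_exp_I_of_im hz).le h1 h2, nf]
  ring

/-- The inclusion of `ℝⁿ` in `ℂⁿ`. -/
def cr (x : Fin n → ℝ) : Fin n → ℂ := fun j => (x j : ℂ)

variable (P) in
/-- The weight function of the variables in `K`, regularized. -/
def Dl (K : Finset (Fin n)) (x : Fin n → ℂ) : ℂ :=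
  pairProd K (fun j k => nf (pa P) 0 (x j + x k) * nf (pa P) 0 (x j - x k)) *
    ∏ j ∈ K, nf (pb P) 0 (x j)

variable (P) in
/-- The part of the product of `V` and the weight function that involves the variables in `J`,
regularized. -/
def VD (κ : Fin n → ℤ) (J K : Finset (Fin n)) (x : Fin n → ℂ) : ℂ :=
  (∏ j ∈ J, cb P * nf (pb P) P.β (κ j * x j)) *
  pairProd J (fun j k => ca P * ca P * nf (pa P) (2 * P.β) (κ j * x j + κ k * x k) *
    nf (pa P) 0 (κ j * x j - κ k * x k)) *
  ∏ j ∈ J, ∏ k ∈ K, (ca P * nf (pa P) P.β (κ j * x j + x k)) *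
    (ca P * nf (pa P) P.β (κ j * x j - x k))

lemma exp_ne_one_of_good {x : Fin n → ℂ} (hx : x ∈ good P n) {j k : Fin n} (h : j ≠ k) {a b : ℤ}
    (ha : a = 1 ∨ a = -1) (hb : b = 1 ∨ b = -1) :
    Complex.exp (Complex.I * (a * x j + b * x k)) ≠ 1 := by
  have h1 := hx (pr j a k b) (pr_mem h ha hb) (pr_ne_zero h b ha) 0 zero_mem_consts
  rw [dv, aff_pr, add_zero] at h1
  exact fun h2 => h1 (by rw [h2, sub_self])

lemma exp_single_ne_one_of_good {x : Fin n → ℂ} (hx : x ∈ good P n) (j : Fin n) {a : ℤ}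
    (ha : a = 1 ∨ a = -1) : Complex.exp (Complex.I * (a * x j)) ≠ 1 ∧
      -Complex.exp (Complex.I * (a * x j)) ≠ 1 := by
  have h1 := hx (Pi.single j a) (single_mem ha) (single_ne_zero' ha) 0 zero_mem_consts
  have h2 := hx (Pi.single j a) (single_mem ha) (single_ne_zero' ha) Real.pi (by simp [consts])
  rw [dv, aff_single] at h1 h2
  rw [add_zero] at h1
  rw [exp_I_add_pi] at h2
  exact ⟨fun h => h1 (by rw [h, sub_self]), fun h => h2 (by rw [h, sub_self])⟩

lemma weight_eq_Dl (hP : P.Pos) {x : Fin n → ℝ} (hx : cr x ∈ good P n) :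
    weight P (cr x) = Dl P Finset.univ (cr x) := by
  rw [weight, Dl, pairProd]
  congr 1
  · refine Finset.prod_congr rfl fun j _ => Finset.prod_congr rfl fun k hk => ?_
    have hjk := (Finset.mem_filter.1 hk).2.ne
    have h1 := exp_ne_one_of_good hx hjk (a := 1) (b := 1) (Or.inl rfl) (Or.inl rfl)
    have h2 := exp_ne_one_of_good hx hjk (a := 1) (b := -1) (Or.inl rfl) (Or.inr rfl)
    simp only [Int.cast_one, Int.cast_neg, one_mul, neg_mul, ← sub_eq_add_neg] at h1 h2
    rw [da_eq hP (by simp [cr]) h1, da_eq hP (by simp [cr]) h2]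
  · refine Finset.prod_congr rfl fun j _ => ?_
    have h1 := exp_single_ne_one_of_good hx j (a := 1) (Or.inl rfl)
    rw [Int.cast_one, one_mul] at h1
    exact db_eq hP (by simp [cr]) h1.1 h1.2

lemma nf_unit_mul (φ : ℂ → ℂ) {a : ℤ} (ha : a = 1 ∨ a = -1) (z : ℂ) : nf φ 0 (a * z) = nf φ 0 z := by
  rcases ha with rfl | rfl
  · simp
  · simp [nf_neg]

lemma nf_sub_comm (φ : ℂ → ℂ) (z w : ℂ) : nf φ 0 (z - w) = nf φ 0 (w - z) := by
  rw [← nf_neg, neg_sub]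

lemma nf_pair (φ : ℂ → ℂ) {a b : ℤ} (ha : a = 1 ∨ a = -1) (hb : b = 1 ∨ b = -1) (z w : ℂ) :
    nf φ 0 (z + w) * nf φ 0 (z - w) = nf φ 0 (a * z + b * w) * nf φ 0 (a * z - b * w) := by
  have e1 : nf φ 0 (-z + -w) = nf φ 0 (z + w) := by rw [← nf_neg, neg_add, neg_neg, neg_neg]
  have e2 : nf φ 0 (-z - w) = nf φ 0 (z + w) := by rw [← e1, sub_eq_add_neg]
  have e3 : nf φ 0 (-z + w) = nf φ 0 (z - w) := by
    rw [nf_sub_comm, sub_eq_add_neg, add_comm]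
  rcases ha with rfl | rfl <;> rcases hb with rfl | rfl <;>
    simp only [Int.cast_one, Int.cast_neg, one_mul, neg_mul, sub_neg_eq_add, e2, e3,
      ← sub_eq_add_neg]
  · exact mul_comm _ _
  · exact mul_comm _ _

lemma V_mul_Dl (hP : P.Pos) {κ : Fin n → ℤ} {J K : Finset (Fin n)} (hJK : Disjoint J K)
    (hκ : ∀ j ∈ J, κ j = 1 ∨ κ j = -1) {x : Fin n → ℝ} (hx : cr x ∈ good P n) :
    V P κ J K (cr x) * Dl P (J ∪ K) (cr x) = VD P κ J K (cr x) * Dl P K (cr x) := by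
  have h1 : (∏ j ∈ J, vb P (κ j * cr x j)) * ∏ j ∈ J, nf (pb P) 0 (cr x j) =
      ∏ j ∈ J, cb P * nf (pb P) P.β (κ j * cr x j) := by
    rw [← Finset.prod_mul_distrib]
    refine Finset.prod_congr rfl fun j hj => ?_
    have h := exp_single_ne_one_of_good hx j (hκ j hj)
    rw [← nf_unit_mul (pb P) (hκ j hj), vb_mul_nf hP (by simp [cr]) h.1 h.2]
  have h2 : pairProd J (inner2 P κ (cr x)) *
      pairProd J (fun j k => nf (pa P) 0 (cr x j + cr x k) * nf (pa P) 0 (cr x j - cr x k)) =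
      pairProd J (fun j k => ca P * ca P * nf (pa P) (2 * P.β) (κ j * cr x j + κ k * cr x k) *
        nf (pa P) 0 (κ j * cr x j - κ k * cr x k)) := by
    rw [← pairProd_mul]
    refine pairProd_congr fun j hj k hk hjk => ?_
    rw [nf_pair (pa P) (hκ j hj) (hκ k hk), inner2, ← mul_assoc, va_mul_va_mul_nf hP (by simp [cr])
      (exp_ne_one_of_good hx hjk (hκ j hj) (hκ k hk))]
  have h3 : (∏ j ∈ J, ∏ k ∈ K, cross P κ (cr x) j k) *
      ∏ j ∈ J, ∏ k ∈ K, nf (pa P) 0 (cr x j + cr x k) * nf (pa P) 0 (cr x j - cr x k) =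
      ∏ j ∈ J, ∏ k ∈ K, (ca P * nf (pa P) P.β (κ j * cr x j + cr x k)) *
        (ca P * nf (pa P) P.β (κ j * cr x j - cr x k)) := by
    simp only [← Finset.prod_mul_distrib]
    refine Finset.prod_congr rfl fun j hj => Finset.prod_congr rfl fun k hk => ?_
    have hjk : j ≠ k := fun h => Finset.disjoint_left.1 hJK hj (h ▸ hk)
    have e1 := exp_ne_one_of_good hx hjk (hκ j hj) (b := 1) (Or.inl rfl)
    have e2 := exp_ne_one_of_good hx hjk (hκ j hj) (b := -1) (Or.inr rfl)
    simp only [Int.cast_one, Int.cast_neg, one_mul, neg_mul, ← sub_eq_add_neg] at e1 e2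
    have h := nf_pair (pa P) (hκ j hj) (b := 1) (Or.inl rfl) (cr x j) (cr x k)
    rw [Int.cast_one, one_mul] at h
    rw [h, cross, ← va_mul_nf hP (by simp [cr]) e1, ← va_mul_nf hP (by simp [cr]) e2]
    ring
  rw [V_eq, Dl, pairProd_union hJK, Finset.prod_union hJK, VD, ← h1, ← h2, ← h3, Dl]
  · ring
  · intro j k
    rw [add_comm, nf_sub_comm (pa P) (cr x j)]

/-! ### Shifting the regularized products -/

lemma VD_shift {κ : Fin n → ℤ} {J K : Finset (Fin n)} (hκ : ∀ j ∈ J, κ j = 1 ∨ κ j = -1)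
    (hK : ∀ k ∈ K, κ k = 0) (x : Fin n → ℂ) :
    VD P κ J K (x - fun j => Complex.I * P.β * κ j) = VD P (-κ) J K x := by
  have hm : ∀ j ∈ J, (κ j : ℂ) * (x j - Complex.I * P.β * κ j) = κ j * x j - Complex.I * P.β := by
    intro j hj
    rcases hκ j hj with h | h <;> rw [h] <;> push_cast <;> ring
  simp only [VD, Pi.sub_apply, Pi.neg_apply, Int.cast_neg, neg_mul]
  congr 1
  · congr 1
    · refine Finset.prod_congr rfl fun j hj => ?_
      rw [hm j hj, nf_shift]
    · refine pairProd_congr fun j hj k hk _ => ?_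
      rw [hm j hj, hm k hk]
      congr 1
      · congr 1
        have := nf_shift (pa P) (2 * P.β) (κ j * x j + κ k * x k)
        rw [neg_add] at this
        rw [← this]
        congr 1
        push_cast; ring
      · rw [← nf_neg]
        congr 1; ring
  · refine Finset.prod_congr rfl fun j hj => Finset.prod_congr rfl fun k hk => ?_
    rw [hm j hj, hK k hk, Int.cast_zero, mul_zero, sub_zero]
    have h1 := nf_shift (pa P) P.β (κ j * x j + x k)
    have h2 := nf_shift (pa P) P.β (κ j * x j - x k)
    rw [show -((κ j : ℂ) * x j + x k) = -(κ j * x j) - x k by ring,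
      show (κ j : ℂ) * x j + x k - Complex.I * P.β = κ j * x j - Complex.I * P.β + x k by ring] at h1
    rw [show -((κ j : ℂ) * x j - x k) = -(κ j * x j) + x k by ring,
      show (κ j : ℂ) * x j - x k - Complex.I * P.β = κ j * x j - Complex.I * P.β - x k by ring] at h2
    rw [h1, h2, mul_comm]

lemma differentiableAt_prod {E ι : Type*} [NormedAddCommGroup E] [NormedSpace ℂ E] {s : Finset ι}
    {f : ι → E → ℂ} {x : E} (h : ∀ i ∈ s, DifferentiableAt ℂ (f i) x) :
    DifferentiableAt ℂ (fun y => ∏ i ∈ s, f i y) x := by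
  classical
  have := (HasFDerivAt.finsetProd fun i hi => (h i hi).hasFDerivAt).differentiableAt
  simpa only [Finset.prod_fn] using this

lemma differentiableAt_VD (hP : P.Pos) {κ : Fin n → ℤ} {J K : Finset (Fin n)}
    (hκ : ∀ j ∈ J, κ j = 1 ∨ κ j = -1) (hK : ∀ k ∈ K, κ k = 0) (x : Fin n → ℝ) {w : ℂ}
    (h1 : -P.β ≤ w.im) (h2 : w.im ≤ 0) :
    DifferentiableAt ℂ (VD P κ J K) (cr x + fun j => w * κ j) := by
  have ha : ∀ {t : ℝ} {u : (Fin n → ℂ) → ℂ} {z : Fin n → ℂ}, -t ≤ (u z).im → (u z).im ≤ 0 →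
      DifferentiableAt ℂ u z → DifferentiableAt ℂ (fun z => nf (pa P) t (u z)) z :=
    fun h h' hu => (differentiableAt_nf (fun y hy => differentiableAt_pa hP hy) h h').comp _ hu
  have hb : ∀ {t : ℝ} {u : (Fin n → ℂ) → ℂ} {z : Fin n → ℂ}, -t ≤ (u z).im → (u z).im ≤ 0 →
      DifferentiableAt ℂ u z → DifferentiableAt ℂ (fun z => nf (pb P) t (u z)) z :=
    fun h h' hu => (differentiableAt_nf (fun y hy => differentiableAt_pb hP hy) h h').comp _ hu
  have hm : ∀ j ∈ J, ((κ j : ℂ) * (cr x + fun j => w * (κ j : ℂ)) j).im = w.im := by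
    intro j hj
    rcases hκ j hj with h | h <;> simp [h, cr]
  have hk : ∀ k ∈ K, ((cr x + fun j => w * (κ j : ℂ)) k).im = 0 := by
    intro k hk
    simp [hK k hk, cr]
  unfold VD pairProd
  refine DifferentiableAt.fun_mul (DifferentiableAt.fun_mul ?_ ?_) ?_
  · refine differentiableAt_prod fun j hj => ?_
    exact (hb (by rw [hm j hj]; exact h1) (by rw [hm j hj]; exact h2) (by fun_prop)).const_mul _
  · refine differentiableAt_prod fun j hj => ?_
    refine differentiableAt_prod fun k hk' => ?_
    have hk'' := (Finset.mem_filter.1 hk').1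
    refine ((ha ?_ ?_ (by fun_prop)).const_mul _).fun_mul (ha ?_ ?_ (by fun_prop))
    · rw [Complex.add_im, hm j hj, hm k hk'']; linarith
    · rw [Complex.add_im, hm j hj, hm k hk'']; linarith
    · rw [Complex.sub_im, hm j hj, hm k hk'']; simp
    · rw [Complex.sub_im, hm j hj, hm k hk'']; simp
  · refine differentiableAt_prod fun j hj => ?_
    refine differentiableAt_prod fun k hk' => ?_
    refine ((ha ?_ ?_ (by fun_prop)).const_mul _).fun_mul ((ha ?_ ?_ (by fun_prop)).const_mul _)
    · rw [Complex.add_im, hm j hj, hk k hk']; linarith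
    · rw [Complex.add_im, hm j hj, hk k hk']; linarith
    · rw [Complex.sub_im, hm j hj, hk k hk']; linarith
    · rw [Complex.sub_im, hm j hj, hk k hk']; linarith

lemma continuous_cr : Continuous (cr : (Fin n → ℝ) → Fin n → ℂ) := by
  unfold cr; fun_prop

lemma continuous_VD (hP : P.Pos) {κ : Fin n → ℤ} {J K : Finset (Fin n)}
    (hκ : ∀ j ∈ J, κ j = 1 ∨ κ j = -1) (hK : ∀ k ∈ K, κ k = 0) :
    Continuous fun x : Fin n → ℝ => VD P κ J K (cr x) := by
  refine continuous_iff_continuousAt.2 fun x => ?_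
  have h := (differentiableAt_VD hP hκ hK x (w := 0) (by simpa using hP.β.le) le_rfl).continuousAt
  have e : (cr x + fun j => (0 : ℂ) * κ j) = cr x := by funext j; simp
  rw [e] at h
  exact ContinuousAt.comp (f := cr) h continuous_cr.continuousAt

lemma continuous_Dl (hP : P.Pos) (K : Finset (Fin n)) :
    Continuous fun x : Fin n → ℝ => Dl P K (cr x) := by
  have ha : ∀ u : (Fin n → ℝ) → ℝ, Continuous u → Continuous fun x => nf (pa P) 0 (u x : ℂ) := by
    intro u hu
    have h : Continuous fun t : ℝ => nf (pa P) 0 (t : ℂ) := continuous_iff_continuousAt.2 fun t =>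
      ContinuousAt.comp (g := nf (pa P) 0) (differentiableAt_nf
        (fun y hy => differentiableAt_pa hP hy) (by simp) (by simp)).continuousAt
        Complex.continuous_ofReal.continuousAt
    exact h.comp hu
  have hb : ∀ u : (Fin n → ℝ) → ℝ, Continuous u → Continuous fun x => nf (pb P) 0 (u x : ℂ) := by
    intro u hu
    have h : Continuous fun t : ℝ => nf (pb P) 0 (t : ℂ) := continuous_iff_continuousAt.2 fun t =>
      ContinuousAt.comp (g := nf (pb P) 0) (differentiableAt_nf
        (fun y hy => differentiableAt_pb hP hy) (by simp) (by simp)).continuousAt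
        Complex.continuous_ofReal.continuousAt
    exact h.comp hu
  simp only [Dl, pairProd, cr, ← Complex.ofReal_add, ← Complex.ofReal_sub]
  refine Continuous.mul ?_ (continuous_finsetProd _ fun j _ => hb _ (by fun_prop))
  refine continuous_finsetProd _ fun j _ => continuous_finsetProd _ fun k _ => ?_
  exact (ha _ (by fun_prop)).mul (ha _ (by fun_prop))

lemma VD_add_two_pi (κ m : Fin n → ℤ) (J K : Finset (Fin n)) (x : Fin n → ℂ) :
    VD P κ J K (x + fun j => 2 * (Real.pi : ℂ) * m j) = VD P κ J K x := by
  have e1 : ∀ j, (κ j : ℂ) * (x j + 2 * Real.pi * m j) = κ j * x j + 2 * Real.pi * (κ j * m j : ℤ) :=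
    fun j => by push_cast; ring
  have e2 : ∀ (z w : ℂ) (a b : ℤ), z + 2 * Real.pi * a + (w + 2 * Real.pi * b) =
      z + w + 2 * Real.pi * (a + b : ℤ) := fun z w a b => by push_cast; ring
  have e3 : ∀ (z w : ℂ) (a b : ℤ), z + 2 * Real.pi * a - (w + 2 * Real.pi * b) =
      z - w + 2 * Real.pi * (a - b : ℤ) := fun z w a b => by push_cast; ring
  simp only [VD, Pi.add_apply, e1, e2, e3, nf_add_two_pi]

lemma Dl_add_two_pi (m : Fin n → ℤ) (K : Finset (Fin n)) (x : Fin n → ℂ) :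
    Dl P K (x + fun j => 2 * (Real.pi : ℂ) * m j) = Dl P K x := by
  have e2 : ∀ (z w : ℂ) (a b : ℤ), z + 2 * Real.pi * a + (w + 2 * Real.pi * b) =
      z + w + 2 * Real.pi * (a + b : ℤ) := fun z w a b => by push_cast; ring
  have e3 : ∀ (z w : ℂ) (a b : ℤ), z + 2 * Real.pi * a - (w + 2 * Real.pi * b) =
      z - w + 2 * Real.pi * (a - b : ℤ) := fun z w a b => by push_cast; ring
  simp only [Dl, Pi.add_apply, e2, e3, nf_add_two_pi]

end

end Koornwinder

namespace Koornwinder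

open Filter Topology MeasureTheory

noncomputable section

variable {n : ℕ} {P : Params}

/-! ### Integrals of periodic functions over the torus -/

/-- The cube `[-π, π]ⁿ`. -/
def cube (n : ℕ) : Set (Fin n → ℝ) := Set.Icc (fun _ => -Real.pi) fun _ => Real.pi

/-- Periodicity with respect to `2πℤⁿ`. -/
def Per (F : (Fin n → ℝ) → ℂ) : Prop :=
  ∀ (m : Fin n → ℤ) x, F (x + fun j => 2 * Real.pi * m j) = F x

/-- The basis of `ℝⁿ` that consists of the multiples by `2π` of the standard basis. -/
def periods (n : ℕ) : Module.Basis (Fin n) ℝ (Fin n → ℝ) :=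
  (Pi.basisFun ℝ (Fin n)).isUnitSMul (w := fun _ => 2 * Real.pi)
    fun _ => IsUnit.mk0 _ Real.two_pi_pos.ne'

open scoped Pointwise in
lemma vadd_fundamentalDomain (a : Fin n → ℝ) : a +ᵥ ZSpan.fundamentalDomain (periods n) =
    Set.univ.pi fun j => Set.Ico (a j) (a j + 2 * Real.pi) := by
  ext x
  have hr : ∀ (y : Fin n → ℝ) j, (periods n).repr y j = y j / (2 * Real.pi) := by
    intro y j
    rw [periods, Module.Basis.repr_isUnitSMul, Pi.basisFun_repr, Units.smul_def,
      Units.val_inv_eq_inv_val, IsUnit.unit_spec, smul_eq_mul, inv_mul_eq_div]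
  rw [Set.mem_vadd_set_iff_neg_vadd_mem]
  simp only [ZSpan.mem_fundamentalDomain, hr, Set.mem_univ_pi, Set.mem_Ico, vadd_eq_add,
    Pi.add_apply, Pi.neg_apply]
  refine forall_congr' fun j => and_congr ?_ ?_
  · rw [le_div_iff₀ Real.two_pi_pos]; constructor <;> intro h <;> linarith
  · rw [div_lt_iff₀ Real.two_pi_pos]; constructor <;> intro h <;> linarith

lemma Per.setIntegral_eq {F : (Fin n → ℝ) → ℂ} (hF : Per F) (a b : Fin n → ℝ) :
    ∫ x in Set.univ.pi (fun j => Set.Ico (a j) (a j + 2 * Real.pi)), F x =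
      ∫ x in Set.univ.pi (fun j => Set.Ico (b j) (b j + 2 * Real.pi)), F x := by
  have : Countable (Submodule.span ℤ (Set.range (periods n))).toAddSubgroup :=
    inferInstanceAs (Countable (Submodule.span ℤ (Set.range (periods n))))
  have h := ZSpan.isAddFundamentalDomain' (periods n) (volume : Measure (Fin n → ℝ))
  rw [← vadd_fundamentalDomain, ← vadd_fundamentalDomain]
  refine (h.vadd_of_comm a).setIntegral_eq (h.vadd_of_comm b) fun g x => ?_
  have hg : ∃ m : Fin n → ℤ, (g : Fin n → ℝ) = fun j => 2 * Real.pi * m j := by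
    obtain ⟨g, hg⟩ := g
    refine Submodule.span_induction (p := fun g _ => ∃ m : Fin n → ℤ, g = fun j => 2 * Real.pi * m j)
      ?_ ?_ ?_ ?_ hg
    · rintro _ ⟨i, rfl⟩
      refine ⟨Pi.single i 1, funext fun j => ?_⟩
      rw [periods, Module.Basis.isUnitSMul_apply, Pi.basisFun_apply]
      by_cases hj : j = i
      · subst hj; simp
      · simp [hj]
    · exact ⟨0, by ext; simp⟩
    · rintro x y _ _ ⟨m, rfl⟩ ⟨m', rfl⟩
      exact ⟨m + m', funext fun j => by simp; ring⟩
    · rintro z x _ ⟨m, rfl⟩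
      exact ⟨z • m, funext fun j => by simp; ring⟩
  obtain ⟨m, hm⟩ := hg
  rw [AddSubgroup.vadd_def, hm, vadd_eq_add, add_comm]
  exact hF m x

lemma Per.integral_add {F : (Fin n → ℝ) → ℂ} (hF : Per F) (a : Fin n → ℝ) :
    ∫ x in cube n, F (x + a) = ∫ x in cube n, F x := by
  have hc : cube n =ᵐ[volume] Set.univ.pi fun j : Fin n => Set.Ico (-Real.pi) (-Real.pi + 2 * Real.pi) := by
    rw [show -Real.pi + 2 * Real.pi = Real.pi by ring]
    exact Measure.univ_pi_Ico_ae_eq_Icc.symm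
  rw [setIntegral_congr_set hc, setIntegral_congr_set hc,
    hF.setIntegral_eq (fun _ => -Real.pi) fun j => -Real.pi + a j,
    ← (measurePreserving_add_right volume a).setIntegral_preimage_emb
      (MeasurableEquiv.addRight a).measurableEmbedding F
      (Set.univ.pi fun j => Set.Ico (-Real.pi + a j) (-Real.pi + a j + 2 * Real.pi))]
  congr 2
  ext x
  simp only [Set.mem_univ_pi, Set.mem_Ico, Set.mem_preimage, Pi.add_apply]
  refine forall_congr' fun j => and_congr ?_ ?_ <;> constructor <;> intro h <;> linarith

lemma integrableOn_cube {F : (Fin n → ℝ) → ℂ} (hF : Continuous F) : IntegrableOn F (cube n) :=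
  hF.continuousOn.integrableOn_compact isCompact_Icc

/-- Two continuous periodic functions with the same integrals along all closed lines in the
direction `κ` have the same integral over the torus. -/
lemma integral_cube_eq_of_lines {F G : (Fin n → ℝ) → ℂ} (hF : Continuous F) (hFp : Per F)
    (hG : Continuous G) (hGp : Per G) (κ : Fin n → ℝ)
    (h : ∀ x, ∫ θ in -Real.pi..Real.pi, F (x + θ • κ) = ∫ θ in -Real.pi..Real.pi, G (x + θ • κ)) :
    ∫ x in cube n, F x = ∫ x in cube n, G x := by
  have key : ∀ F : (Fin n → ℝ) → ℂ, Continuous F → Per F → (2 * Real.pi : ℝ) • ∫ x in cube n, F x =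
      ∫ x in cube n, ∫ θ in -Real.pi..Real.pi, F (x + θ • κ) := by
    intro F hF hFp
    have hle : -Real.pi ≤ Real.pi := by linarith [Real.pi_pos]
    have e1 : (2 * Real.pi : ℝ) • ∫ x in cube n, F x =
        ∫ θ in Set.Ioc (-Real.pi) Real.pi, ∫ x in cube n, F (x + θ • κ) := by
      simp only [hFp.integral_add]
      rw [setIntegral_const, Measure.real, Real.volume_Ioc, ENNReal.toReal_ofReal (by linarith)]
      congr 1; ring
    rw [e1, integral_integral_swap]
    · simp only [intervalIntegral.integral_of_le hle]
    · rw [Measure.prod_restrict]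
      refine IntegrableOn.mono_set (t := Set.Icc (-Real.pi) Real.pi ×ˢ cube n) ?_
        (Set.prod_mono Set.Ioc_subset_Icc_self le_rfl)
      refine ContinuousOn.integrableOn_compact (isCompact_Icc.prod isCompact_Icc) ?_
      exact (by fun_prop : Continuous fun q : ℝ × (Fin n → ℝ) => F (q.2 + q.1 • κ)).continuousOn
  have e := key F hF hFp
  simp only [h] at e
  rw [← key G hG hGp] at e
  exact smul_right_injective ℂ Real.two_pi_pos.ne' e

/-- Shift of the contour for periodic functions holomorphic in a horizontal strip. -/
lemma integral_shift {β : ℝ} {Φ : ℂ → ℂ} (hβ : 0 ≤ β)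
    (hd : ∀ w : ℂ, -β ≤ w.im → w.im ≤ 0 → DifferentiableAt ℂ Φ w)
    (hp : ∀ w, Φ (w + 2 * Real.pi) = Φ w) :
    ∫ θ in -Real.pi..Real.pi, Φ θ = ∫ θ in -Real.pi..Real.pi, Φ (θ - Complex.I * β) := by
  have h := Complex.integral_boundary_rect_eq_zero_of_differentiableOn Φ
    ⟨-Real.pi, -β⟩ ⟨Real.pi, 0⟩ fun w hw => by
      rw [Complex.mem_reProdIm, Set.uIcc_of_le (by linarith : -β ≤ 0)] at hw
      exact (hd w hw.2.1 hw.2.2).differentiableWithinAt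
  have e : ∀ y : ℝ, Φ (Real.pi + y * Complex.I) = Φ ((-Real.pi : ℝ) + y * Complex.I) := by
    intro y
    rw [← hp ((-Real.pi : ℝ) + y * Complex.I)]
    congr 1
    push_cast; ring
  simp only [e, add_sub_cancel_right, Complex.ofReal_zero, zero_mul, add_zero] at h
  rw [sub_eq_zero] at h
  rw [← h]
  refine intervalIntegral.integral_congr fun θ _ => ?_
  congr 1
  push_cast; ring

/-! ### Almost all real points are regular -/

lemma ae_good : ∀ᵐ x : Fin n → ℝ, cr x ∈ good P n := by
  simp only [good, Set.mem_ofPred_eq]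
  refine (Filter.eventually_all_finset _).2 fun α _ => ?_
  rcases eq_or_ne α 0 with h0 | h0
  · simp [h0]
  simp only [h0, ne_eq, not_false_eq_true, forall_true_left]
  refine (Filter.eventually_all_finset _).2 fun c _ => ?_
  let L : (Fin n → ℝ) →ₗ[ℝ] ℝ := ∑ j, (α j : ℝ) • LinearMap.proj j
  have hL : Function.Surjective L := by
    obtain ⟨j, hj⟩ := Function.ne_iff.1 h0
    intro t
    refine ⟨Pi.single j (t / α j), ?_⟩
    have hj' : (α j : ℝ) ≠ 0 := Int.cast_ne_zero.2 hj
    simp only [L, LinearMap.sum_apply, LinearMap.smul_apply, LinearMap.proj_apply, smul_eq_mul]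
    rw [Finset.sum_eq_single j (fun k _ hk => by simp [hk]) (by simp)]
    simp [mul_div_cancel₀ _ hj']
  have haff : ∀ x, aff α c (cr x) = (L x : ℂ) + c := by
    intro x
    simp [aff, L, cr]
  let s : Set ℝ := {t | 1 - Complex.exp (Complex.I * (t + c)) ≠ 0}
  have hs : MeasurableSet s := by
    refine (isOpen_ne_fun ?_ continuous_const).measurableSet
    fun_prop
  have hae : ∀ᵐ t : ℝ, t ∈ s := by
    have hc : (Set.range fun m : ℤ => (2 * Real.pi * m - c).re).Countable := Set.countable_range _
    filter_upwards [hc.ae_notMem volume] with t ht h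
    refine ht ?_
    obtain ⟨m, hm⟩ := Complex.exp_eq_one_iff.1 (sub_eq_zero.1 h).symm
    refine ⟨m, ?_⟩
    have : (t : ℂ) = 2 * Real.pi * m - c := by
      have := mul_left_cancel₀ Complex.I_ne_zero
        (hm.trans (by ring : _ = Complex.I * (2 * Real.pi * m)))
      linear_combination this
    simp only [← this, Complex.ofReal_re]
  have h := (ae_comp_linearMap_mem_iff L volume volume hL hs).2 hae
  filter_upwards [h] with x hx
  simp only [dv, haff]
  exact hx

/-! ### Symmetry -/

lemma cr_add_two_pi (x : Fin n → ℝ) (m : Fin n → ℤ) :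
    cr (x + fun j => 2 * Real.pi * m j) = cr x + fun j => 2 * (Real.pi : ℂ) * m j := by
  funext j; simp [cr]

lemma VD_congr {κ : Fin n → ℤ} {J K : Finset (Fin n)} {x y : Fin n → ℂ} (hJ : ∀ j ∈ J, x j = y j)
    (hK : ∀ j ∈ K, x j = y j) : VD P κ J K x = VD P κ J K y := by
  rw [VD, VD]
  congr 1
  · congr 1
    · exact Finset.prod_congr rfl fun j hj => by rw [hJ j hj]
    · exact pairProd_congr fun j hj k hk _ => by rw [hJ j hj, hJ k hk]
  · exact Finset.prod_congr rfl fun j hj => Finset.prod_congr rfl fun k hk => by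
      rw [hJ j hj, hK k hk]

lemma Dl_congr {K : Finset (Fin n)} {x y : Fin n → ℂ} (hK : ∀ j ∈ K, x j = y j) :
    Dl P K x = Dl P K y := by
  rw [Dl, Dl]
  congr 1
  · exact pairProd_congr fun j hj k hk _ => by rw [hK j hj, hK k hk]
  · exact Finset.prod_congr rfl fun j hj => by rw [hK j hj]

lemma exists_U_mul_Dl (hP : P.Pos) (K : Finset (Fin n)) (p : ℕ) : ∃ F : (Fin n → ℝ) → ℂ,
    Continuous F ∧ Per F ∧ (∀ x y : Fin n → ℝ, (∀ k ∈ K, x k = y k) → F x = F y) ∧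
      ∀ x, cr x ∈ good P n → U P K p (cr x) * Dl P K (cr x) = F x := by
  induction p using Nat.strong_induction_on generalizing K with
  | _ p ih =>
    rcases eq_or_ne p 0 with rfl | hp
    · refine ⟨fun x => Dl P K (cr x), continuous_Dl hP K, fun m x => ?_, fun x y h => ?_,
        fun x _ => by rw [U_zero, one_mul]⟩
      · simp only [cr_add_two_pi, Dl_add_two_pi]
      · exact Dl_congr fun k hk => by simp [cr, h k hk]
    · have : ∀ κ : Fin n → ℤ, ∃ F : (Fin n → ℝ) → ℂ, κ ∈ steps' K p → Continuous F ∧ Per F ∧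
          (∀ x y : Fin n → ℝ, (∀ k ∈ K \ supp κ, x k = y k) → F x = F y) ∧
          ∀ x, cr x ∈ good P n → U P (K \ supp κ) (p - (supp κ).card) (cr x) *
            Dl P (K \ supp κ) (cr x) = F x := by
        intro κ
        by_cases hκ : κ ∈ steps' K p
        · have hc := card_supp_pos (mem_steps'.1 hκ).2.1
          obtain ⟨F, hF⟩ := ih (p - (supp κ).card) (by omega) (K \ supp κ)
          exact ⟨F, fun _ => hF⟩
        · exact ⟨0, fun h => absurd h hκ⟩
      choose F hF' using this
      have hFc := fun κ hκ => (hF' κ hκ).1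
      have hFp := fun κ hκ => (hF' κ hκ).2.1
      have hFx := fun κ hκ => (hF' κ hκ).2.2.1
      have hF := fun κ hκ => (hF' κ hκ).2.2.2
      have hκ1 : ∀ κ ∈ steps' K p, ∀ j ∈ supp κ, κ j = 1 ∨ κ j = -1 := fun κ hκ j hj =>
        step_pm (mem_steps'.1 hκ).1 j hj
      have hκ0 : ∀ κ : Fin n → ℤ, ∀ j ∈ K \ supp κ, κ j = 0 := fun κ j hj => by
        simpa [mem_supp] using (Finset.mem_sdiff.1 hj).2
      refine ⟨fun x => -∑ κ ∈ steps' K p, VD P κ (supp κ) (K \ supp κ) (cr x) * F κ x, ?_, ?_, ?_, ?_⟩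
      · refine (continuous_finsetSum _ fun κ hκ => ?_).neg
        exact (continuous_VD hP (hκ1 κ hκ) (hκ0 κ)).mul (hFc κ hκ)
      · intro m x
        refine congrArg Neg.neg (Finset.sum_congr rfl fun κ hκ => ?_)
        rw [cr_add_two_pi, VD_add_two_pi, hFp κ hκ]
      · intro x y h
        refine congrArg Neg.neg (Finset.sum_congr rfl fun κ hκ => ?_)
        have hsub := (mem_steps.1 (mem_steps'.1 hκ).1).2
        rw [hFx κ hκ x y fun k hk => h k (Finset.mem_sdiff.1 hk).1,
          VD_congr (x := cr x) (y := cr y) (fun j hj => by simp [cr, h j (hsub hj)])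
            fun k hk => by simp [cr, h k (Finset.mem_sdiff.1 hk).1]]
      · intro x hx
        rw [U_rec P K hp, neg_mul, Finset.sum_mul]
        refine congrArg Neg.neg (Finset.sum_congr rfl fun κ hκ => ?_)
        have hsub := (mem_steps.1 (mem_steps'.1 hκ).1).2
        have h := V_mul_Dl hP (J := supp κ) (K := K \ supp κ) Finset.disjoint_sdiff (hκ1 κ hκ) hx
        rw [Finset.union_sdiff_of_subset hsub] at h
        rw [mul_right_comm, h, mul_assoc, mul_comm (Dl P _ _), hF κ hκ x hx]

lemma integral_step (hP : P.Pos) {κ : Fin n → ℤ} (hκ : κ ∈ steps (Finset.univ : Finset (Fin n)))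
    {F : (Fin n → ℝ) → ℂ} (hF : Continuous F) (hFp : Per F)
    (hFx : ∀ x y : Fin n → ℝ, (∀ k ∈ Finset.univ \ supp κ, x k = y k) → F x = F y)
    {f h : (Fin n → ℂ) → ℂ} (hf : f ∈ expPoly n) (hh : h ∈ expPoly n) :
    ∫ x in cube n, VD P κ (supp κ) (Finset.univ \ supp κ) (cr x) * F x *
        (f (cr x + fun j => Complex.I * P.β * κ j) * h (cr x)) =
      ∫ x in cube n, VD P (-κ) (supp κ) (Finset.univ \ supp κ) (cr x) * F x *
        (f (cr x) * h (cr x - fun j => Complex.I * P.β * κ j)) := by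
  have hκ1 : ∀ j ∈ supp κ, κ j = 1 ∨ κ j = -1 := fun j hj => step_pm hκ j hj
  have hκ1' : ∀ j ∈ supp κ, (-κ) j = 1 ∨ (-κ) j = -1 := fun j hj => by
    rcases hκ1 j hj with h | h <;> simp [h]
  have hκ0 : ∀ j ∈ Finset.univ \ supp κ, κ j = 0 := fun j hj => by
    simpa [mem_supp] using (Finset.mem_sdiff.1 hj).2
  have hκ0' : ∀ j ∈ Finset.univ \ supp κ, (-κ) j = 0 := fun j hj => by simp [hκ0 j hj]
  have hfc := continuous_expPoly hf
  have hhc := continuous_expPoly hh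
  have hcr := continuous_cr (n := n)
  refine integral_cube_eq_of_lines ?_ ?_ ?_ ?_ (fun j => (κ j : ℝ)) fun x => ?_
  · exact ((continuous_VD hP hκ1 hκ0).mul hF).mul
      ((hfc.comp (by fun_prop)).mul (hhc.comp hcr))
  · intro m x
    simp only
    rw [cr_add_two_pi, VD_add_two_pi, hFp, expPoly_add_two_pi hh, add_right_comm,
      expPoly_add_two_pi hf]
  · exact ((continuous_VD hP hκ1' hκ0').mul hF).mul
      ((hfc.comp hcr).mul (hhc.comp (by fun_prop)))
  · intro m x
    simp only
    rw [cr_add_two_pi, VD_add_two_pi, hFp, expPoly_add_two_pi hf, add_sub_right_comm,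
      expPoly_add_two_pi hh]
  · have hcrx : ∀ θ : ℝ, cr (x + θ • fun j => (κ j : ℝ)) = cr x + fun j => (θ : ℂ) * κ j := by
      intro θ; funext j; simp [cr]
    have hFθ : ∀ θ : ℝ, F (x + θ • fun j => (κ j : ℝ)) = F x := fun θ => hFx _ _ fun k hk => by
      simp [hκ0 k hk]
    simp only [hcrx, hFθ]
    let l : ℂ → Fin n → ℂ := fun w => cr x + fun j => w * (κ j : ℂ)
    have hl : Differentiable ℂ l := by
      refine differentiable_pi.2 fun j => ?_
      simp only [l, Pi.add_apply]
      fun_prop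
    have hper : ∀ w, l (w + 2 * Real.pi) = l w + fun j => 2 * (Real.pi : ℂ) * κ j := by
      intro w; funext j; simp [l]; ring
    have hsh : ∀ w, l (w - Complex.I * P.β) = l w - fun j => Complex.I * P.β * κ j := by
      intro w; funext j; simp [l]; ring
    have hmain := integral_shift (Φ := fun w => VD P κ (supp κ) (Finset.univ \ supp κ) (l w) * F x *
        (f (l w + fun j => Complex.I * P.β * κ j) * h (l w))) hP.β.le (fun w h1 h2 => ?_) fun w => ?_
    · refine hmain.trans (intervalIntegral.integral_congr fun θ _ => ?_)
      simp only [hsh, VD_shift hκ1 hκ0, sub_add_cancel]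
      rfl
    · have d1 : DifferentiableAt ℂ (fun w => VD P κ (supp κ) (Finset.univ \ supp κ) (l w)) w :=
        DifferentiableAt.comp (f := l) w (differentiableAt_VD hP hκ1 hκ0 x h1 h2) (hl w)
      have d2 : DifferentiableAt ℂ (fun w => f (l w + fun j => Complex.I * P.β * κ j)) w :=
        (differentiable_expPoly hf _).comp w ((hl w).add_const _)
      have d3 : DifferentiableAt ℂ (fun w => h (l w)) w := (differentiable_expPoly hh _).comp w (hl w)
      exact (d1.mul_const _).fun_mul (d2.fun_mul d3)
    · simp only [hper]
      rw [VD_add_two_pi, expPoly_add_two_pi hh, add_right_comm, expPoly_add_two_pi hf]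

end

end Koornwinder

namespace Koornwinder

open Filter Topology MeasureTheory

noncomputable section

variable {n : ℕ} {P : Params}

/-! ### The bilinear form -/

/-- The symmetric bilinear form defined by the weight function. -/
def bil (P : Params) (f h : (Fin n → ℂ) → ℂ) : ℂ :=
  ∫ x in cube n, f (cr x) * h (cr x) * weight P (cr x)

lemma ae_weight_eq (hP : P.Pos) :
    ∀ᵐ x : Fin n → ℝ, weight P (cr x) = Dl P Finset.univ (cr x) := by
  filter_upwards [ae_good (P := P)] with x hx using weight_eq_Dl hP hx

lemma continuous_expPoly_cr {f : (Fin n → ℂ) → ℂ} (hf : f ∈ expPoly n) :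
    Continuous fun x => f (cr x) := (continuous_expPoly hf).comp continuous_cr

lemma integrableOn_mul_weight (hP : P.Pos) {F : (Fin n → ℝ) → ℂ} (hF : Continuous F) :
    IntegrableOn (fun x => F x * weight P (cr x)) (cube n) := by
  have h := integrableOn_cube (hF.mul (continuous_Dl hP Finset.univ))
  refine h.congr_fun_ae (ae_restrict_of_ae ?_)
  filter_upwards [ae_weight_eq hP] with x hx
  simp only [hx, Pi.mul_apply]

lemma integral_Hop (hP : P.Pos) (r : ℕ) {F : Finset (Fin n) → (Fin n → ℝ) → ℂ}
    (hFc : ∀ L, Continuous (F L))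
    (hF : ∀ L x, cr x ∈ good P n → U P (Finset.univ \ L) (r - L.card) (cr x) *
      Dl P (Finset.univ \ L) (cr x) = F L x) {f h : (Fin n → ℂ) → ℂ} (hf : f ∈ expPoly n)
    (hh : h ∈ expPoly n) : ∫ x in cube n, Hop P r f (cr x) * h (cr x) * weight P (cr x) =
      ∑ κ ∈ (steps Finset.univ).filter fun κ => (supp κ).card ≤ r,
        ∫ x in cube n, VD P κ (supp κ) (Finset.univ \ supp κ) (cr x) * F (supp κ) x *
          (f (cr x + fun j => Complex.I * P.β * κ j) * h (cr x)) := by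
  have hκ1 : ∀ κ ∈ (steps (Finset.univ : Finset (Fin n))).filter fun κ => (supp κ).card ≤ r,
      ∀ j ∈ supp κ, κ j = 1 ∨ κ j = -1 := fun κ hκ j hj => step_pm (Finset.mem_filter.1 hκ).1 j hj
  have hκ0 : ∀ κ : Fin n → ℤ, ∀ j ∈ Finset.univ \ supp κ, κ j = 0 := fun κ j hj => by
    simpa [mem_supp] using (Finset.mem_sdiff.1 hj).2
  rw [← integral_finsetSum]
  · refine setIntegral_congr_ae measurableSet_Icc ?_
    filter_upwards [ae_good (P := P)] with x hx _
    rw [weight_eq_Dl hP hx, Hop, Finset.sum_mul, Finset.sum_mul]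
    refine Finset.sum_congr rfl fun κ hκ => ?_
    have h1 := V_mul_Dl hP (J := supp κ) (K := Finset.univ \ supp κ) Finset.disjoint_sdiff
      (hκ1 κ hκ) hx
    rw [Finset.union_sdiff_of_subset (Finset.subset_univ _)] at h1
    rw [← hF _ x hx]
    linear_combination (U P (Finset.univ \ supp κ) (r - (supp κ).card) (cr x) *
      f (cr x + fun j => Complex.I * P.β * κ j) * h (cr x)) * h1
  · intro κ hκ
    have hfc := continuous_expPoly hf
    have hcr := continuous_cr (n := n)
    exact integrableOn_cube (((continuous_VD hP (hκ1 κ hκ) (hκ0 κ)).mul (hFc _)).mul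
      ((hfc.comp (by fun_prop)).mul (continuous_expPoly_cr hh)))

lemma supp_neg (κ : Fin n → ℤ) : supp (-κ) = supp κ := by
  ext j; simp [mem_supp]

lemma neg_mem_steps {κ : Fin n → ℤ} {K : Finset (Fin n)} (h : κ ∈ steps K) : -κ ∈ steps K := by
  rw [mem_steps] at h ⊢
  refine ⟨fun j => ?_, by rw [supp_neg]; exact h.2⟩
  rcases h.1 j with h | h | h <;> simp [h]

/-- The difference operators are symmetric. -/
theorem Hop_symm (hP : P.Pos) (r : ℕ) {f h : (Fin n → ℂ) → ℂ} (hf : f ∈ expPoly n)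
    (hh : h ∈ expPoly n) : bil P (Hop P r f) h = bil P f (Hop P r h) := by
  choose F hFc hFp hFx hF using fun L : Finset (Fin n) =>
    exists_U_mul_Dl hP (Finset.univ \ L) (r - L.card)
  have e : bil P f (Hop P r h) =
      ∫ x in cube n, Hop P r h (cr x) * f (cr x) * weight P (cr x) := by
    simp only [bil, mul_comm (f _)]
  rw [e, bil, integral_Hop hP r hFc hF hf hh, integral_Hop hP r hFc hF hh hf]
  refine Finset.sum_bij' (fun κ _ => -κ) (fun κ _ => -κ) ?_ ?_ (fun κ _ => neg_neg κ)
    (fun κ _ => neg_neg κ) fun κ hκ => ?_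
  · intro κ hκ
    rw [Finset.mem_filter] at hκ ⊢
    exact ⟨neg_mem_steps hκ.1, by rw [supp_neg]; exact hκ.2⟩
  · intro κ hκ
    rw [Finset.mem_filter] at hκ ⊢
    exact ⟨neg_mem_steps hκ.1, by rw [supp_neg]; exact hκ.2⟩
  · rw [integral_step hP (Finset.mem_filter.1 hκ).1 (hFc _) (hFp _) (hFx _) hf hh, supp_neg]
    congr 1
    funext x
    rw [mul_comm (f _), sub_eq_add_neg]
    congr 4
    funext j; simp

lemma bil_congr {f f' h h' : (Fin n → ℂ) → ℂ} (hf : ∀ x ∈ good P n, f x = f' x)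
    (hh : ∀ x ∈ good P n, h x = h' x) : bil P f h = bil P f' h' := by
  refine setIntegral_congr_ae measurableSet_Icc ?_
  filter_upwards [ae_good (P := P)] with x hx _
  rw [hf _ hx, hh _ hx]

lemma bil_comm (f h : (Fin n → ℂ) → ℂ) : bil P f h = bil P h f := by
  simp only [bil, mul_comm (f _)]

lemma bil_add_left (hP : P.Pos) {f f' h : (Fin n → ℂ) → ℂ} (hf : f ∈ expPoly n)
    (hf' : f' ∈ expPoly n) (hh : h ∈ expPoly n) : bil P (f + f') h = bil P f h + bil P f' h := by
  refine Eq.trans ?_ (integral_add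
    (integrableOn_mul_weight hP ((continuous_expPoly_cr hf).mul (continuous_expPoly_cr hh)))
    (integrableOn_mul_weight hP ((continuous_expPoly_cr hf').mul (continuous_expPoly_cr hh))))
  refine congrArg (integral _) ?_
  funext x
  simp only [Pi.add_apply]; ring

lemma bil_smul_left (c : ℂ) (f h : (Fin n → ℂ) → ℂ) : bil P (c • f) h = c * bil P f h := by
  rw [bil, bil, ← integral_const_mul]
  congr 1
  funext x
  simp only [Pi.smul_apply, smul_eq_mul]; ring

lemma bil_add_right (hP : P.Pos) {f h h' : (Fin n → ℂ) → ℂ} (hf : f ∈ expPoly n)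
    (hh : h ∈ expPoly n) (hh' : h' ∈ expPoly n) : bil P f (h + h') = bil P f h + bil P f h' := by
  rw [bil_comm, bil_add_left hP hh hh' hf, bil_comm h, bil_comm h']

lemma bil_smul_right (c : ℂ) (f h : (Fin n → ℂ) → ℂ) : bil P f (c • h) = c * bil P f h := by
  rw [bil_comm, bil_smul_left, bil_comm h]

/-! ### Positivity -/

lemma conj_daPlus (hβ : 0 < P.β) (t : ℝ) : daPlus P (-(t : ℂ)) = (starRingEnd ℂ) (daPlus P t) := by
  have e : (starRingEnd ℂ) (Complex.exp (Complex.I * t)) = Complex.exp (Complex.I * -t) := by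
    rw [← Complex.exp_conj]; simp
  simp only [daPlus, map_div₀, conj_qfac hβ, map_mul, Complex.conj_ofReal, e]

lemma conj_dbPlus (hβ : 0 < P.β) (t : ℝ) : dbPlus P (-(t : ℂ)) = (starRingEnd ℂ) (dbPlus P t) := by
  have e : (starRingEnd ℂ) (Complex.exp (Complex.I * t)) = Complex.exp (Complex.I * -t) := by
    rw [← Complex.exp_conj]; simp
  have e' : (starRingEnd ℂ) (Complex.exp (2 * Complex.I * t)) =
      Complex.exp (2 * Complex.I * -t) := by
    rw [← Complex.exp_conj]; simp [Complex.conj_ofNat]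
  simp only [dbPlus, map_div₀, conj_qfac hβ, map_mul, map_neg, Complex.conj_ofReal, e, e']

lemma exists_weight_eq (hβ : 0 < P.β) (x : Fin n → ℝ) : ∃ w : ℝ, 0 ≤ w ∧ weight P (cr x) = w := by
  have ha : ∀ t : ℝ, da P t = (Complex.normSq (daPlus P t) : ℂ) := fun t => by
    rw [da, conj_daPlus hβ, Complex.mul_conj]
  have hb : ∀ t : ℝ, db P t = (Complex.normSq (dbPlus P t) : ℂ) := fun t => by
    rw [db, conj_dbPlus hβ, Complex.mul_conj]
  refine ⟨(∏ j, ∏ k with j < k, Complex.normSq (daPlus P (x j + x k : ℝ)) *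
    Complex.normSq (daPlus P (x j - x k : ℝ))) * ∏ j, Complex.normSq (dbPlus P (x j)), ?_, ?_⟩
  · refine mul_nonneg (Finset.prod_nonneg fun j _ => Finset.prod_nonneg fun k _ => ?_)
      (Finset.prod_nonneg fun j _ => Complex.normSq_nonneg _)
    exact mul_nonneg (Complex.normSq_nonneg _) (Complex.normSq_nonneg _)
  · simp only [weight, cr, ← Complex.ofReal_add, ← Complex.ofReal_sub, ha, hb]
    push_cast
    rfl

lemma nf_ne_zero {φ : ℂ → ℂ} {z : ℂ} (h1 : φ (Complex.exp (Complex.I * z)) ≠ 0)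
    (h2 : φ (Complex.exp (Complex.I * -z)) ≠ 0) : nf φ 0 z ≠ 0 := by
  rw [nf_zero]; exact mul_ne_zero h1 (by rwa [mul_neg] at h2)

lemma pb_ne_zero (hP : P.Pos) {y : ℂ} (hy : ‖y‖ ≤ 1) (h1 : y ≠ 1) (h2 : -y ≠ 1) : pb P y ≠ 0 := by
  have h := norm_sq_mul hP hy
  have h' : ‖-(sq P * y)‖ < 1 := by rwa [norm_neg]
  refine mul_ne_zero (mul_ne_zero (mul_ne_zero (psi_ne_zero hP.β hP.g₀ hy h1)
    (psi_ne_zero hP.β hP.g₁ (by rwa [norm_neg]) h2)) (psi_ne_zero hP.β hP.g₀' h.le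
    (ne_one_of_norm_lt h))) (psi_ne_zero hP.β hP.g₁' h'.le (ne_one_of_norm_lt h'))

lemma weight_ne_zero (hP : P.Pos) {x : Fin n → ℝ} (hx : cr x ∈ good P n) :
    weight P (cr x) ≠ 0 := by
  have ha : ∀ {z : ℂ}, z.im = 0 → Complex.exp (Complex.I * z) ≠ 1 → nf (pa P) 0 z ≠ 0 := by
    intro z hz h1
    exact nf_ne_zero (psi_ne_zero hP.β hP.g (norm_exp_I_of_im hz).le h1)
      (psi_ne_zero hP.β hP.g (norm_exp_I_of_im (by simpa using hz)).le (exp_neg_I_ne_one h1))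
  rw [weight_eq_Dl hP hx, Dl, pairProd]
  refine mul_ne_zero (Finset.prod_ne_zero_iff.2 fun j _ => Finset.prod_ne_zero_iff.2 fun k hk => ?_)
    (Finset.prod_ne_zero_iff.2 fun j _ => ?_)
  · have hjk := (Finset.mem_filter.1 hk).2.ne
    have h1 := exp_ne_one_of_good hx hjk (a := 1) (b := 1) (Or.inl rfl) (Or.inl rfl)
    have h2 := exp_ne_one_of_good hx hjk (a := 1) (b := -1) (Or.inl rfl) (Or.inr rfl)
    simp only [Int.cast_one, Int.cast_neg, one_mul, neg_mul, ← sub_eq_add_neg] at h1 h2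
    exact mul_ne_zero (ha (by simp [cr]) h1) (ha (by simp [cr]) h2)
  · have h1 := exp_single_ne_one_of_good hx j (a := 1) (Or.inl rfl)
    have h2 := exp_single_ne_one_of_good hx j (a := -1) (Or.inr rfl)
    simp only [Int.cast_one, Int.cast_neg, one_mul, neg_mul] at h1 h2
    exact nf_ne_zero (pb_ne_zero hP (norm_exp_I_of_im (by simp [cr])).le h1.1 h1.2)
      (pb_ne_zero hP (norm_exp_I_of_im (by simp [cr])).le h2.1 h2.2)

lemma eq_zero_of_innerΔ_self (hP : P.Pos) {f : (Fin n → ℂ) → ℂ} (hf : f ∈ expPoly n)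
    (h : innerΔ P f f = 0) : f = 0 := by
  choose w hw0 hw using exists_weight_eq (P := P) (n := n) hP.β
  have hfc := continuous_expPoly_cr hf
  have hint : IntegrableOn (fun x => Complex.normSq (f (cr x)) * w x) (cube n) := by
    have h1 := integrableOn_mul_weight hP (F := fun x => (Complex.normSq (f (cr x)) : ℂ))
      (Complex.continuous_ofReal.comp (Complex.continuous_normSq.comp hfc))
    simp only [hw, ← Complex.ofReal_mul] at h1
    exact h1.re
  have h0 : ∫ x in cube n, Complex.normSq (f (cr x)) * w x = 0 := by
    rw [← Complex.ofReal_eq_zero, ← integral_complex_ofReal, ← h]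
    refine integral_congr_ae (Eventually.of_forall fun x => ?_)
    change _ = f (cr x) * (starRingEnd ℂ) (f (cr x)) * weight P (cr x)
    rw [hw, Complex.mul_conj]
    exact Complex.ofReal_mul _ _
  rw [integral_eq_zero_iff_of_nonneg (fun x => mul_nonneg (Complex.normSq_nonneg _) (hw0 x)) hint] at h0
  have h1 : (fun x => f (cr x)) =ᵐ[volume.restrict (cube n)] fun _ => 0 := by
    filter_upwards [h0, ae_restrict_of_ae (ae_good (P := P))] with x hx hg
    rcases mul_eq_zero.1 hx with h | h
    · exact Complex.normSq_eq_zero.1 h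
    · exact absurd (by rw [hw, h, Complex.ofReal_zero]) (weight_ne_zero hP hg)
  have h2 : Set.EqOn (fun x => f (cr x)) (fun _ => 0)
      (Set.univ.pi fun _ : Fin n => Set.Ioo (-Real.pi) Real.pi) := by
    refine Measure.eqOn_open_of_ae_eq (μ := volume) (ae_restrict_of_ae_restrict_of_subset ?_ h1)
      (isOpen_set_pi Set.finite_univ fun _ _ => isOpen_Ioo) hfc.continuousOn continuousOn_const
    intro x hx
    exact ⟨fun j => (hx j trivial).1.le, fun j => (hx j trivial).2.le⟩
  have h3 := h2.closure hfc continuous_const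
  rw [closure_pi_set] at h3
  refine expPoly_eq_of_real hf (zero_mem _) fun x => ?_
  let m : Fin n → ℤ := fun j => toIcoDiv Real.two_pi_pos (-Real.pi) (x j)
  have h4 := expPoly_add_two_pi hf m (cr fun j => toIcoMod Real.two_pi_pos (-Real.pi) (x j))
  have h5 : ((cr fun j => toIcoMod Real.two_pi_pos (-Real.pi) (x j)) +
      fun j => 2 * (Real.pi : ℂ) * m j) = fun j => (x j : ℂ) := by
    funext j
    have := toIcoMod_add_toIcoDiv_zsmul Real.two_pi_pos (-Real.pi) (x j)
    rw [zsmul_eq_mul] at this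
    simp only [Pi.add_apply, cr, m]
    exact_mod_cast (by linarith : _ + 2 * Real.pi * _ = x j)
  rw [h5] at h4
  rw [h4]
  refine h3 fun j _ => ?_
  rw [closure_Ioo (by linarith [Real.pi_pos])]
  have := toIcoMod_mem_Ico Real.two_pi_pos (-Real.pi) (x j)
  exact ⟨this.1, by linarith [this.2]⟩

end

end Koornwinder

namespace Koornwinder

open Filter Topology MeasureTheory

noncomputable section

variable {n : ℕ} {P : Params}

/-! ### Existence, uniqueness and spectral property of Koornwinder's polynomials -/

/-- The dominant weights below `l`. -/
def below (l : Fin n → ℤ) : Set (Fin n → ℤ) := {l' | Dominant l' ∧ WeightLE l' l ∧ l' ≠ l}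

/-- The span of the monomial symmetric functions of the dominant weights below `l`. -/
def lower (l : Fin n → ℤ) : Submodule ℂ ((Fin n → ℂ) → ℂ) := Submodule.span ℂ (monomial '' below l)

lemma finite_below (l : Fin n → ℤ) : (below l).Finite := by
  refine (Set.finite_Icc (0 : Fin n → ℤ) fun j => ∑ i ∈ Finset.Iic j, l i).subset ?_
  rintro l' ⟨h1, h2, -⟩
  refine ⟨h1.2, fun j => (Finset.single_le_sum (fun i _ => h1.2 i) (Finset.mem_Iic.2 le_rfl)).trans
    (h2 j)⟩

lemma below_subset {l l' : Fin n → ℤ} (h : l' ∈ below l) : below l' ⊆ below l := by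
  rintro l'' ⟨h1, h2, h3⟩
  refine ⟨h1, fun k => (h2 k).trans (h.2.1 k), ?_⟩
  rintro rfl
  exact h3 (eq_of_sum_Iic_eq fun k => le_antisymm (h2 k) (h.2.1 k))

lemma lower_le_of_mem {l l' : Fin n → ℤ} (h : l' ∈ below l) : lower l' ≤ lower l :=
  Submodule.span_mono (Set.image_mono (below_subset h))

lemma monomial_mem_lower {l l' : Fin n → ℤ} (h : l' ∈ below l) : monomial l' ∈ lower l :=
  Submodule.subset_span ⟨l', h, rfl⟩

lemma lower_le_expPoly (l : Fin n → ℤ) {f : (Fin n → ℂ) → ℂ} (hf : f ∈ lower l) : f ∈ expPoly n := by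
  refine (Submodule.span_le (p := Subalgebra.toSubmodule (expPoly n))).2 ?_ hf
  rintro _ ⟨l', -, rfl⟩
  exact monomial_mem l'

lemma conj_monomial (l : Fin n → ℤ) (x : Fin n → ℝ) :
    (starRingEnd ℂ) (monomial l (cr x)) = monomial l (cr x) := by
  have h : (starRingEnd ℂ) (monomial l (cr x)) = monomial l (act (1, fun _ => -1) (cr x)) := by
    simp only [monomial, map_sum]
    refine Finset.sum_congr rfl fun κ _ => ?_
    rw [← Complex.exp_conj, map_mul, map_sum, Complex.conj_I, neg_mul, ← mul_neg,
      ← Finset.sum_neg_distrib]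
    congr 2
    refine Finset.sum_congr rfl fun j _ => ?_
    simp [act, cr]
  rw [h, monomial_inv]

lemma innerΔ_monomial (f : (Fin n → ℂ) → ℂ) (l : Fin n → ℤ) :
    innerΔ P f (monomial l) = bil P f (monomial l) := by
  refine integral_congr_ae (Eventually.of_forall fun x => ?_)
  change f (cr x) * (starRingEnd ℂ) (monomial l (cr x)) * weight P (cr x) = _
  rw [conj_monomial]

lemma bil_eq_zero_of_lower (hP : P.Pos) {l : Fin n → ℤ} {f : (Fin n → ℂ) → ℂ} (hf : f ∈ expPoly n)
    (h : ∀ l' ∈ below l, bil P f (monomial l') = 0) {v : (Fin n → ℂ) → ℂ} (hv : v ∈ lower l) :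
    bil P f v = 0 := by
  have : v ∈ expPoly n ∧ bil P f v = 0 := by
    refine Submodule.span_induction (p := fun v _ => v ∈ expPoly n ∧ bil P f v = 0) ?_ ?_ ?_ ?_ hv
    · rintro _ ⟨l', hl', rfl⟩
      exact ⟨monomial_mem l', h l' hl'⟩
    · exact ⟨zero_mem _, by simp [bil]⟩
    · rintro v w _ _ ⟨h1, h2⟩ ⟨h3, h4⟩
      exact ⟨add_mem h1 h3, by rw [bil_add_right hP hf h1 h3, h2, h4, add_zero]⟩
    · rintro c v _ ⟨h1, h2⟩
      exact ⟨Subalgebra.smul_mem _ h1 c, by rw [bil_smul_right, h2, mul_zero]⟩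
  exact this.2

lemma exists_conj {l : Fin n → ℤ} {v : (Fin n → ℂ) → ℂ} (hv : v ∈ lower l) :
    ∃ w ∈ lower l, ∀ x : Fin n → ℝ, (starRingEnd ℂ) (v (cr x)) = w (cr x) := by
  refine Submodule.span_induction (p := fun v _ => ∃ w ∈ lower l, ∀ x : Fin n → ℝ,
    (starRingEnd ℂ) (v (cr x)) = w (cr x)) ?_ ?_ ?_ ?_ hv
  · rintro _ ⟨l', hl', rfl⟩
    exact ⟨monomial l', monomial_mem_lower hl', conj_monomial l'⟩
  · exact ⟨0, zero_mem _, fun x => by simp⟩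
  · rintro v w _ _ ⟨v', h1, h2⟩ ⟨w', h3, h4⟩
    exact ⟨v' + w', add_mem h1 h3, fun x => by simp [h2, h4]⟩
  · rintro c v _ ⟨v', h1, h2⟩
    exact ⟨(starRingEnd ℂ) c • v', Submodule.smul_mem _ _ h1, fun x => by simp [h2]⟩

/-- The bilinear form is nondegenerate on `lower l`. -/
lemma eq_zero_of_lower (hP : P.Pos) {l : Fin n → ℤ} {v : (Fin n → ℂ) → ℂ} (hv : v ∈ lower l)
    (h : ∀ l' ∈ below l, bil P v (monomial l') = 0) : v = 0 := by
  obtain ⟨w, hw, hvw⟩ := exists_conj hv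
  refine eq_zero_of_innerΔ_self hP (lower_le_expPoly l hv) ?_
  rw [← bil_eq_zero_of_lower hP (lower_le_expPoly l hv) h hw]
  refine integral_congr_ae (Eventually.of_forall fun x => ?_)
  change v (cr x) * (starRingEnd ℂ) (v (cr x)) * weight P (cr x) = _
  rw [hvw]

lemma isKoornwinder_iff {l : Fin n → ℤ} {p : (Fin n → ℂ) → ℂ} : IsKoornwinder P l p ↔
    p - monomial l ∈ lower l ∧ ∀ l' ∈ below l, bil P p (monomial l') = 0 := by
  refine and_congr Iff.rfl ?_
  simp only [innerΔ_monomial]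
  exact ⟨fun h l' hl' => h l' hl'.1 hl'.2.1 hl'.2.2, fun h l' h1 h2 h3 => h l' ⟨h1, h2, h3⟩⟩

lemma IsKoornwinder.mem_expPoly {l : Fin n → ℤ} {p : (Fin n → ℂ) → ℂ} (h : IsKoornwinder P l p) :
    p ∈ expPoly n := by
  have := add_mem (lower_le_expPoly l (isKoornwinder_iff.1 h).1) (monomial_mem l)
  rwa [sub_add_cancel] at this

theorem existsUnique_isKoornwinder (hP : P.Pos) (l : Fin n → ℤ) :
    ∃! p : (Fin n → ℂ) → ℂ, IsKoornwinder P l p := by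
  have hmem : ∀ v : lower l, (v : (Fin n → ℂ) → ℂ) ∈ expPoly n := fun v => lower_le_expPoly l v.2
  let B : lower l → lower l → ℂ := fun v w => bil (n := n) P v w
  let T : lower l →ₗ[ℂ] Module.Dual ℂ (lower l) := LinearMap.mk₂ ℂ B
    (fun v v' w => bil_add_left hP (hmem v) (hmem v') (hmem w))
    (fun c v w => bil_smul_left c (v : (Fin n → ℂ) → ℂ) (w : (Fin n → ℂ) → ℂ))
    (fun v w w' => bil_add_right hP (hmem v) (hmem w) (hmem w'))
    (fun c v w => bil_smul_right c (v : (Fin n → ℂ) → ℂ) (w : (Fin n → ℂ) → ℂ))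
  have : FiniteDimensional ℂ (lower l) :=
    FiniteDimensional.span_of_finite ℂ ((finite_below l).image _)
  have hT : Function.Injective T := by
    rw [← LinearMap.ker_eq_bot, LinearMap.ker_eq_bot']
    intro v hv
    refine Subtype.ext (eq_zero_of_lower hP v.2 fun l' hl' => ?_)
    exact LinearMap.congr_fun hv ⟨monomial l', monomial_mem_lower hl'⟩
  have hT' : Function.Surjective T :=
    (LinearMap.injective_iff_surjective_of_finrank_eq_finrank (Subspace.dual_finrank_eq).symm).1 hT
  let ψ : Module.Dual ℂ (lower l) :=
    { toFun := fun w => -bil P (monomial l) w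
      map_add' := fun w w' => by
        rw [Submodule.coe_add, bil_add_right hP (monomial_mem l) (hmem w) (hmem w'), neg_add]
      map_smul' := fun c w => by
        rw [Submodule.coe_smul, bil_smul_right, ← mul_neg]; rfl }
  obtain ⟨v, hv⟩ := hT' ψ
  refine ⟨monomial l + v, isKoornwinder_iff.2 ⟨?_, fun l' hl' => ?_⟩, fun p hp => ?_⟩
  · simp only [add_sub_cancel_left]; exact v.2
  · have h1 : bil P v (monomial l') = -bil P (monomial l) (monomial l') :=
      LinearMap.congr_fun hv ⟨monomial l', monomial_mem_lower hl'⟩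
    rw [bil_add_left hP (monomial_mem l) (hmem v) (monomial_mem l'), h1, add_neg_cancel]
  · replace hp := isKoornwinder_iff.1 hp
    have h0 : p - monomial l - v ∈ lower l := sub_mem hp.1 v.2
    rw [← sub_eq_zero, ← sub_sub]
    refine eq_zero_of_lower hP h0 fun l' hl' => ?_
    have h1 : bil P v (monomial l') = -bil P (monomial l) (monomial l') :=
      LinearMap.congr_fun hv ⟨monomial l', monomial_mem_lower hl'⟩
    have hpe : p ∈ expPoly n := by
      have := add_mem (lower_le_expPoly l hp.1) (monomial_mem l)
      rwa [sub_add_cancel] at this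
    have e : p = (p - monomial l - v) + (monomial l + v) := by abel
    have h2 := hp.2 l' hl'
    rw [e, bil_add_left hP (lower_le_expPoly l h0) (add_mem (monomial_mem l) (hmem v))
      (monomial_mem l'), bil_add_left hP (monomial_mem l) (hmem v) (monomial_mem l'), h1,
      add_neg_cancel, add_zero] at h2
    exact h2

lemma Hop_add (r : ℕ) (f h : (Fin n → ℂ) → ℂ) : Hop P r (f + h) = Hop P r f + Hop P r h := by
  funext x
  simp only [Hop, Pi.add_apply, mul_add, Finset.sum_add_distrib]

lemma Hop_smul (r : ℕ) (c : ℂ) (f : (Fin n → ℂ) → ℂ) : Hop P r (c • f) = c • Hop P r f := by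
  funext x
  simp only [Hop, Pi.smul_apply, smul_eq_mul, Finset.mul_sum]
  exact Finset.sum_congr rfl fun κ _ => by ring

lemma exists_Hop_lower (hβ : 0 < P.β) {r : ℕ} (hr : 1 ≤ r) (hrn : r ≤ n) {l : Fin n → ℤ}
    {v : (Fin n → ℂ) → ℂ} (hv : v ∈ lower l) :
    ∃ Q ∈ lower l, ∀ x ∈ good P n, Hop P r v x = Q x := by
  refine Submodule.span_induction (p := fun v _ => ∃ Q ∈ lower l, ∀ x ∈ good P n, Hop P r v x = Q x)
    ?_ ?_ ?_ ?_ hv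
  · rintro _ ⟨l', hl', rfl⟩
    obtain ⟨Q, -, h1, h2⟩ := Hop_monomial P hβ hr hrn hl'.1
    refine ⟨Q, ?_, h1⟩
    rw [← sub_add_cancel Q (((2 ^ r * Eθ P r (shifted P l') : ℝ) : ℂ) • monomial l')]
    exact add_mem (lower_le_of_mem hl' h2) (Submodule.smul_mem _ _ (monomial_mem_lower hl'))
  · exact ⟨0, zero_mem _, fun x _ => by simp [Hop]⟩
  · rintro v w _ _ ⟨Q, h1, h2⟩ ⟨R, h3, h4⟩
    exact ⟨Q + R, add_mem h1 h3, fun x hx => by simp [Hop_add, h2 x hx, h4 x hx]⟩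
  · rintro c v _ ⟨Q, h1, h2⟩
    exact ⟨c • Q, Submodule.smul_mem _ _ h1, fun x hx => by simp [Hop_smul, h2 x hx]⟩

/-- Koornwinder's polynomials are joint eigenfunctions of the difference operators. -/
theorem Hop_koornwinder (hP : P.Pos) {r : ℕ} (hr : 1 ≤ r) (hrn : r ≤ n) {l : Fin n → ℤ}
    (hl : Dominant l) {p : (Fin n → ℂ) → ℂ} (hp : IsKoornwinder P l p) :
    ∀ x ∈ good P n, Hop P r p x = ((2 ^ r * Eθ P r (shifted P l) : ℝ) : ℂ) * p x := by
  set c : ℂ := ((2 ^ r * Eθ P r (shifted P l) : ℝ) : ℂ)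
  have hpe := hp.mem_expPoly
  rw [isKoornwinder_iff] at hp
  obtain ⟨Q₁, hQ₁, hH₁, hc⟩ := Hop_monomial P hP.β hr hrn hl
  obtain ⟨Q₂, hQ₂, hH₂⟩ := exists_Hop_lower hP.β hr hrn hp.1
  have hQ : ∀ x ∈ good P n, Hop P r p x = (Q₁ + Q₂) x := by
    intro x hx
    rw [Pi.add_apply, ← hH₁ x hx, ← hH₂ x hx, ← Pi.add_apply, ← Hop_add, add_sub_cancel]
  have hQe : Q₁ + Q₂ ∈ expPoly n := add_mem hQ₁ (lower_le_expPoly l hQ₂)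
  have hmem : Q₁ + Q₂ - c • p ∈ lower l := by
    have e : Q₁ + Q₂ - c • p = (Q₁ - c • monomial l) + (Q₂ - c • (p - monomial l)) := by
      rw [smul_sub]; abel
    rw [e]
    exact add_mem hc (sub_mem hQ₂ (Submodule.smul_mem _ _ hp.1))
  have hzero : Q₁ + Q₂ - c • p = 0 := by
    refine eq_zero_of_lower hP hmem fun l' hl' => ?_
    have e : Q₁ + Q₂ = (Q₁ + Q₂ - c • p) + c • p := (sub_add_cancel _ _).symm
    have h1 : bil P (Q₁ + Q₂) (monomial l') = 0 := by
      obtain ⟨R, hR, hHR⟩ := exists_Hop_lower hP.β hr hrn (monomial_mem_lower hl')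
      rw [bil_congr (fun x hx => (hQ x hx).symm) (fun x _ => rfl),
        Hop_symm hP r hpe (monomial_mem l'), bil_congr (fun x _ => rfl) hHR]
      exact bil_eq_zero_of_lower hP hpe hp.2 hR
    rw [e, bil_add_left hP (lower_le_expPoly l hmem) (Subalgebra.smul_mem _ hpe c)
      (monomial_mem l'), bil_smul_left, hp.2 l' hl', mul_zero, add_zero] at h1
    exact h1
  intro x hx
  rw [hQ x hx, sub_eq_zero.1 hzero]
  rfl

lemma isKoornwinder_koornwinder (hP : P.Pos) (l : Fin n → ℤ) :
    IsKoornwinder P l (koornwinder P l) :=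
  Classical.epsilon_spec (existsUnique_isKoornwinder hP l).exists

end

end Koornwinder

namespace Koornwinder

open Filter Topology

noncomputable section

variable {n : ℕ} {P : Params}

/-! ### The difference operators as sums over steps -/

open Classical in
/-- The chains of length `s` that start at `A`, together with the signs of the `p` indices that are
added to `A`. -/
def signedChains (A : Finset (Fin n)) (s p : ℕ) :
    Finset ((Fin n → ℤ) × (Fin (s + 1) → Finset (Fin n))) :=
  (steps Aᶜ ×ˢ Finset.univ).filter fun q =>
    StrictMono q.2 ∧ q.2 0 = A ∧ q.2 (Fin.last s) = A ∪ supp q.1 ∧ (supp q.1).card = p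

lemma mem_signedChains {A : Finset (Fin n)} {s p : ℕ} {ε : Fin n → ℤ}
    {C : Fin (s + 1) → Finset (Fin n)} : (ε, C) ∈ signedChains A s p ↔ ε ∈ steps Aᶜ ∧
      StrictMono C ∧ C 0 = A ∧ C (Fin.last s) = A ∪ supp ε ∧ (supp ε).card = p := by
  simp [signedChains]

/-- The restriction of `ε` to the set `L`. -/
def restr (L : Finset (Fin n)) (ε : Fin n → ℤ) : Fin n → ℤ := fun j => if j ∈ L then ε j else 0

lemma supp_restr (L : Finset (Fin n)) (ε : Fin n → ℤ) : supp (restr L ε) = L ∩ supp ε := by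
  ext j
  simp [mem_supp, restr]

lemma restr_mem_steps {K : Finset (Fin n)} (L : Finset (Fin n)) {ε : Fin n → ℤ} (h : ε ∈ steps K) :
    restr L ε ∈ steps (L ∩ K) := by
  rw [mem_steps] at h ⊢
  refine ⟨fun j => ?_, ?_⟩
  · by_cases hj : j ∈ L
    · simpa [restr, hj] using h.1 j
    · simp [restr, hj]
  · rw [supp_restr]
    exact Finset.inter_subset_inter_left h.2

lemma supp_subset_of_mem {K : Finset (Fin n)} {κ : Fin n → ℤ} (h : κ ∈ steps K) : supp κ ⊆ K :=
  (mem_steps.1 h).2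

lemma disjoint_supp_of_mem {A : Finset (Fin n)} {κ ε : Fin n → ℤ}
    (h : ε ∈ steps (A ∪ supp κ)ᶜ) : Disjoint (supp κ) (supp ε) := by
  have h1 := supp_subset_of_mem h
  rw [Finset.disjoint_left]
  intro j hj hj'
  have := h1 hj'
  simp [hj] at this

lemma restr_add {A : Finset (Fin n)} {κ ε : Fin n → ℤ} (h4 : ε ∈ steps (A ∪ supp κ)ᶜ) :
    restr (A ∪ supp κ) (κ + ε) = κ := by
  have hε : ∀ j ∈ A ∪ supp κ, ε j = 0 := fun j hj => by
    by_contra h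
    have := supp_subset_of_mem h4 (mem_supp.2 h)
    exact Finset.mem_compl.1 this hj
  funext j
  by_cases hj : j ∈ A ∪ supp κ
  · simp [restr, hj, hε j hj]
  · have : κ j = 0 := by
      by_contra h
      exact hj (Finset.mem_union_right _ (mem_supp.2 h))
    simp [restr, hj, this]

lemma sum_signedChains_succ {M : Type*} [AddCommMonoid M] (A : Finset (Fin n)) (s p : ℕ)
    (F : (Fin n → ℤ) → (Fin (s + 2) → Finset (Fin n)) → M) :
    ∑ q ∈ signedChains A (s + 1) p, F q.1 q.2 = ∑ κ ∈ steps' Aᶜ p,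
      ∑ q ∈ signedChains (A ∪ supp κ) s (p - (supp κ).card), F (κ + q.1) (Fin.cons A q.2) := by
  rw [Finset.sum_sigma']
  refine Finset.sum_bij'
    (fun q _ => (⟨restr (q.2 1) q.1, (restr (q.2 1)ᶜ q.1, Fin.tail q.2)⟩ :
      Σ _ : Fin n → ℤ, (Fin n → ℤ) × (Fin (s + 1) → Finset (Fin n))))
    (fun q _ => (q.1 + q.2.1, Fin.cons A q.2.2)) ?_ ?_ ?_ ?_ ?_
  · rintro ⟨ε, C⟩ hq
    obtain ⟨h1, h2, h3, h4, h5⟩ := mem_signedChains.1 hq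
    have h01 : A ⊂ C 1 := h3 ▸ h2 (Fin.succ_pos 0)
    have hlast : C 1 ⊆ A ∪ supp ε := h4 ▸ h2.monotone (Fin.le_last 1)
    have hA : A ∪ C 1 ∩ supp ε = C 1 := by
      ext j
      have e1 := @h01.1 j
      have e2 := @hlast j
      simp only [Finset.mem_union, Finset.mem_inter] at e2 ⊢
      tauto
    have hsplit : (C 1 ∩ supp ε).card + ((C 1)ᶜ ∩ supp ε).card = p := by
      rw [← h5, ← Finset.card_union_of_disjoint]
      · congr 1
        rw [← Finset.union_inter_distrib_right, Finset.union_compl, Finset.univ_inter]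
      · exact Finset.disjoint_of_subset_left Finset.inter_subset_left
          (Finset.disjoint_of_subset_right Finset.inter_subset_left disjoint_compl_right)
    simp only [Finset.mem_sigma, mem_steps', mem_signedChains, supp_restr, hA]
    refine ⟨⟨steps_mono Finset.inter_subset_right (restr_mem_steps _ h1), ?_, by omega⟩,
      ?_, ?_, rfl, ?_, by omega⟩
    · intro h
      have := supp_restr (C 1) ε
      rw [h, supp_zero] at this
      rw [← this, Finset.union_empty] at hA
      exact h01.ne hA
    · exact steps_mono Finset.inter_subset_left (restr_mem_steps _ h1)
    · exact fun i j hij => h2 (Fin.succ_lt_succ_iff.2 hij)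
    · change C (Fin.last (s + 1)) = _
      rw [h4]
      ext j
      have e1 := @h01.1 j
      have e2 := @hlast j
      simp only [Finset.mem_union, Finset.mem_inter, Finset.mem_compl] at e2 ⊢
      tauto
  · rintro ⟨κ, ε, C⟩ hq
    simp only [Finset.mem_sigma, mem_steps', mem_signedChains] at hq
    obtain ⟨⟨h1, h2, h3⟩, h4, h5, h6, h7, h8⟩ := hq
    have hd := disjoint_supp_of_mem h4
    rw [mem_signedChains, supp_add_of_disjoint hd, Finset.card_union_of_disjoint hd]
    refine ⟨?_, ?_, rfl, ?_, by omega⟩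
    · rw [mem_steps, supp_add_of_disjoint hd]
      refine ⟨fun j => ?_, Finset.union_subset (supp_subset_of_mem h1)
        ((supp_subset_of_mem h4).trans (Finset.compl_subset_compl.2 Finset.subset_union_left))⟩
      have e : j ∈ supp κ → j ∉ supp ε := fun h => Finset.disjoint_left.1 hd h
      have e1 := (mem_steps.1 h1).1 j
      have e2 := (mem_steps.1 h4).1 j
      simp only [mem_supp, ne_eq] at e
      by_cases h : κ j = 0
      · simpa [h] using e2
      · simpa [not_not.1 (e h)] using e1
    · intro i j hij
      induction i using Fin.cases with
      | zero =>
        induction j using Fin.cases with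
        | zero => simp at hij
        | succ j =>
          have e : C 0 ≤ C j := h5.monotone (Fin.zero_le j)
          rw [h6] at e
          refine lt_of_lt_of_le ?_ e
          rw [Fin.cons_zero]
          refine Finset.ssubset_iff_subset_ne.2 ⟨Finset.subset_union_left, fun h => h2 ?_⟩
          rw [← supp_eq_empty, ← Finset.subset_empty]
          intro j hj
          have e1 := supp_subset_of_mem h1 hj
          rw [Finset.mem_compl, h] at e1
          exact absurd (Finset.mem_union_right _ hj) e1
      | succ i =>
        induction j using Fin.cases with
        | zero => simp at hij
        | succ j => simpa using h5 (Fin.succ_lt_succ_iff.1 hij)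
    · rw [← Fin.succ_last, Fin.cons_succ]
      exact h7.trans (Finset.union_assoc _ _ _)
  · rintro ⟨ε, C⟩ hq
    obtain ⟨h1, h2, h3, h4, h5⟩ := mem_signedChains.1 hq
    refine Prod.ext (funext fun j => ?_) ?_
    · by_cases hj : j ∈ C 1 <;> simp [restr, hj]
    · simp only
      rw [← h3, Fin.cons_self_tail]
  · rintro ⟨κ, ε, C⟩ hq
    simp only [Finset.mem_sigma, mem_steps', mem_signedChains] at hq
    obtain ⟨⟨h1, h2, h3⟩, h4, h5, h6, h7, h8⟩ := hq
    have hC1 : (Fin.cons A C : Fin (s + 2) → Finset (Fin n)) 1 = A ∪ supp κ := h6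
    have hε : ∀ j ∈ A ∪ supp κ, ε j = 0 := fun j hj => by
      by_contra h
      have := supp_subset_of_mem h4 (mem_supp.2 h)
      exact Finset.mem_compl.1 this hj
    have e1 := restr_add h4
    have e2 : restr (A ∪ supp κ)ᶜ (κ + ε) = ε := by
      funext j
      by_cases hj : j ∈ A ∪ supp κ
      · rw [restr, if_neg (fun h => Finset.mem_compl.1 h hj), hε j hj]
      · have : κ j = 0 := by
          by_contra h
          exact hj (Finset.mem_union_right _ (mem_supp.2 h))
        rw [restr, if_pos (Finset.mem_compl.2 hj), Pi.add_apply, this, zero_add]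
    simp only [hC1, e1, e2, Fin.tail_cons]
  · rintro ⟨ε, C⟩ hq
    obtain ⟨h1, h2, h3, h4, h5⟩ := mem_signedChains.1 hq
    have e : restr (C 1) ε + restr (C 1)ᶜ ε = ε := by
      funext j
      by_cases hj : j ∈ C 1 <;> simp [restr, hj]
    simp only [e]
    rw [← h3, Fin.cons_self_tail]

variable (P) in
/-- The product of the coefficients along a chain. -/
def chainProd {s : ℕ} (ε : Fin n → ℤ) (C : Fin (s + 1) → Finset (Fin n)) (x : Fin n → ℂ) : ℂ :=
  ∏ t : Fin s, V P ε (C t.succ \ C t.castSucc) (C t.succ)ᶜ x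

lemma chainProd_succ {s : ℕ} (ε : Fin n → ℤ) (C : Fin (s + 2) → Finset (Fin n)) (x : Fin n → ℂ) :
    chainProd P ε C x = V P ε (C 1 \ C 0) (C 1)ᶜ x * chainProd P ε (Fin.tail C) x :=
  Fin.prod_univ_succ _

lemma chainProd_congr {s : ℕ} {ε ε' : Fin n → ℤ} {C : Fin (s + 1) → Finset (Fin n)}
    (hC : Monotone C) (h : ∀ j ∉ C 0, ε j = ε' j) (x : Fin n → ℂ) :
    chainProd P ε C x = chainProd P ε' C x := by
  refine Finset.prod_congr rfl fun t _ => V_congr P (fun j hj => h j fun h0 => ?_) x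
  exact (Finset.mem_sdiff.1 hj).2 (hC (Fin.zero_le _) h0)

lemma sdiff_cons_eq {A B : Finset (Fin n)} (hs : B ⊆ Aᶜ) :
    (A ∪ B) \ A = B ∧ (A ∪ B)ᶜ = Aᶜ \ B := by
  constructor
  · rw [Finset.union_sdiff_left]
    exact Finset.sdiff_eq_self_of_disjoint (Finset.disjoint_left.2 fun j hj hA =>
      Finset.mem_compl.1 (hs hj) hA)
  · ext j; simp

lemma chainProd_cons {A : Finset (Fin n)} {s p : ℕ} {κ ε : Fin n → ℤ} (hκ : κ ∈ steps Aᶜ)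
    {C : Fin (s + 1) → Finset (Fin n)} (h : (ε, C) ∈ signedChains (A ∪ supp κ) s p)
    (x : Fin n → ℂ) : chainProd P (κ + ε) (Fin.cons A C : Fin (s + 2) → Finset (Fin n)) x =
      V P κ (supp κ) (Aᶜ \ supp κ) x * chainProd P ε C x := by
  obtain ⟨h1, h2, h3, h4, h5⟩ := mem_signedChains.1 h
  obtain ⟨e3, e4⟩ := sdiff_cons_eq (supp_subset_of_mem hκ)
  have e1 : (Fin.cons A C : Fin (s + 2) → Finset (Fin n)) 1 = A ∪ supp κ := h3
  rw [chainProd_succ, e1, Fin.cons_zero, Fin.tail_cons, e3, e4]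
  have k1 : V P (κ + ε) (supp κ) (Aᶜ \ supp κ) x = V P κ (supp κ) (Aᶜ \ supp κ) x := by
    refine V_congr P (fun j hj => ?_) x
    have := Finset.disjoint_left.1 (disjoint_supp_of_mem h1) hj
    rw [mem_supp, not_not] at this
    rw [Pi.add_apply, this, add_zero]
  have k2 : chainProd P (κ + ε) C x = chainProd P ε C x := by
    refine chainProd_congr h2.monotone (fun j hj => ?_) x
    have h7 : j ∉ supp κ := fun h => hj (h3 ▸ Finset.mem_union_right _ h)
    rw [mem_supp, not_not] at h7
    rw [Pi.add_apply, h7, zero_add]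
  rw [k1, k2]

lemma sum_chainProd (A : Finset (Fin n)) (s p : ℕ) (x : Fin n → ℂ) :
    ∑ q ∈ signedChains A s p, chainProd P q.1 q.2 x = (-1) ^ s * blocks P s Aᶜ p x := by
  induction s generalizing A p with
  | zero =>
    rw [blocks, pow_zero, one_mul]
    have h : ∀ q, q ∈ signedChains A 0 p ↔ q = (0, fun _ => A) ∧ p = 0 := by
      rintro ⟨ε, C⟩
      rw [mem_signedChains]
      constructor
      · rintro ⟨h1, h2, h3, h4, h5⟩
        have h6 : supp ε = ∅ := by
          rw [← Finset.subset_empty]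
          intro j hj
          have e1 := supp_subset_of_mem h1 hj
          have e2 : j ∈ C 0 := by
            have : C 0 = A ∪ supp ε := h4
            rw [this]; exact Finset.mem_union_right _ hj
          rw [h3] at e2
          exact absurd e2 (Finset.mem_compl.1 e1)
        refine ⟨Prod.ext (supp_eq_empty.1 h6) (funext fun i => ?_), ?_⟩
        · change C i = A
          rw [Subsingleton.elim (α := Fin 1) i 0, h3]
        · rw [← h5, h6, Finset.card_empty]
      · rintro ⟨h1, rfl⟩
        obtain ⟨rfl, rfl⟩ := Prod.ext_iff.1 h1
        exact ⟨zero_mem_steps _, Subsingleton.strictMono (α := Fin 1) _, rfl, by simp [supp_zero],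
          by simp [supp_zero]⟩
    split_ifs with hp
    · have : signedChains A 0 p = {(0, fun _ => A)} := by
        ext q; rw [h]; simp [hp]
      rw [this, Finset.sum_singleton, chainProd]
      simp
    · refine Finset.sum_eq_zero fun q hq => absurd ((h q).1 hq).2 hp
  | succ s ih =>
    rw [sum_signedChains_succ A s p fun ε C => chainProd P ε C x, blocks, pow_succ, mul_assoc,
      neg_one_mul, neg_neg, Finset.mul_sum]
    refine Finset.sum_congr rfl fun κ hκ => ?_
    rw [Finset.sum_congr rfl fun q hq => chainProd_cons (mem_steps'.1 hκ).1 hq x, ← Finset.mul_sum,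
      ih, mul_left_comm]
    congr 3
    ext j; simp

end

end Koornwinder

namespace Koornwinder

open Filter Topology

noncomputable section

variable {n : ℕ} {P : Params}

lemma Hop_eq {r : ℕ} (hr : 1 ≤ r) (f : (Fin n → ℂ) → ℂ) (x : Fin n → ℂ) :
    Hop P r f x = ∑ κ ∈ steps' Finset.univ r, V P κ (supp κ) (Finset.univ \ supp κ) x *
      U P (Finset.univ \ supp κ) (r - (supp κ).card) x *
      (f (x + fun j => Complex.I * P.β * κ j) - f x) := by
  have h0 : (0 : Fin n → ℤ) ∉ steps' Finset.univ r := fun h => (mem_steps'.1 h).2.1 rfl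
  have hx : (x + fun j => Complex.I * P.β * ((0 : Fin n → ℤ) j : ℂ)) = x := by
    funext j; simp
  rw [Hop, filter_steps_eq, Finset.sum_insert h0, hx, supp_zero, V_zero, Finset.sdiff_empty,
    Finset.card_empty, Nat.sub_zero, one_mul, U_rec P _ (by omega)]
  simp only [mul_sub, Finset.sum_sub_distrib]
  rw [← Finset.sum_mul]
  ring

lemma sum_chains {M : Type*} [AddCommMonoid M] (s r : ℕ)
    (G : (Fin n → ℤ) → (Fin (s + 1) → Finset (Fin n)) → M) :
    ∑ J ∈ Finset.powersetCard r (Finset.univ : Finset (Fin n)), ∑ ε ∈ signs J,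
      ∑ C ∈ chains J s, G ε C = ∑ q ∈ signedChains ∅ s r, G q.1 q.2 := by
  have h : ∀ J ∈ Finset.powersetCard r (Finset.univ : Finset (Fin n)), ∑ ε ∈ signs J,
      ∑ C ∈ chains J s, G ε C = ∑ ε ∈ signs J, ∑ C ∈ chains (supp ε) s, G ε C := fun J _ =>
    Finset.sum_congr rfl fun ε hε => by rw [supp_of_mem_signs hε]
  have h' : Finset.powersetCard r (Finset.univ : Finset (Fin n)) =
      Finset.univ.powerset.filter fun L => L.card = r := by
    ext L; simp
  rw [Finset.sum_congr rfl h, h', ← sum_steps Finset.univ (fun L => L.card = r)]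
  refine (Finset.sum_finset_product' _ _ _ ?_).symm
  rintro ⟨ε, C⟩
  rw [mem_signedChains, Finset.mem_filter, chains, Finset.mem_filter, Finset.compl_empty,
    Finset.empty_union]
  simp only [Finset.mem_univ, true_and]
  tauto

lemma sum_Icc_one {M : Type*} [AddCommMonoid M] (r : ℕ) (F : ℕ → M) :
    ∑ s ∈ Finset.Icc 1 r, F s = ∑ s ∈ Finset.range r, F (s + 1) := by
  refine Finset.sum_nbij' (· - 1) (· + 1) ?_ ?_ ?_ ?_ ?_
  · intro s hs; rw [Finset.mem_Icc] at hs; rw [Finset.mem_range]; omega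
  · intro s hs; rw [Finset.mem_range] at hs; rw [Finset.mem_Icc]; omega
  · intro s hs; rw [Finset.mem_Icc] at hs; omega
  · intro s hs; omega
  · intro s hs; rw [Finset.mem_Icc] at hs; rw [Nat.sub_add_cancel hs.1]

lemma sum_range_blocks (K : Finset (Fin n)) {p r : ℕ} (h : p < r) (x : Fin n → ℂ) :
    ∑ s ∈ Finset.range r, blocks P s K p x = U P K p x := by
  refine (Finset.sum_subset (Finset.range_subset_range.2 h) fun s _ hs => ?_).symm
  rw [Finset.mem_range, not_lt] at hs
  exact blocks_eq_zero P s K p x hs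

variable (P) in
lemma sum_chains_eq_Hop {r : ℕ} (hr : 1 ≤ r) (f : (Fin n → ℂ) → ℂ) (x : Fin n → ℂ) :
    ∑ J ∈ Finset.powersetCard r (Finset.univ : Finset (Fin n)), ∑ ε ∈ signs J,
      ∑ s ∈ Finset.Icc 1 r, ∑ C ∈ chains J s, (-1) ^ (s - 1) * chainProd P ε C x *
        (f (x + fun j => Complex.I * P.β * (restr (C 1) ε j : ℂ)) - f x) = Hop P r f x := by
  have h : ∀ J ∈ Finset.powersetCard r (Finset.univ : Finset (Fin n)), ∑ ε ∈ signs J,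
      ∑ s ∈ Finset.Icc 1 r, ∑ C ∈ chains J s, (-1) ^ (s - 1) * chainProd P ε C x *
        (f (x + fun j => Complex.I * P.β * (restr (C 1) ε j : ℂ)) - f x) =
      ∑ s ∈ Finset.Icc 1 r, ∑ ε ∈ signs J, ∑ C ∈ chains J s, (-1) ^ (s - 1) * chainProd P ε C x *
        (f (x + fun j => Complex.I * P.β * (restr (C 1) ε j : ℂ)) - f x) := fun J _ =>
    Finset.sum_comm
  rw [Finset.sum_congr rfl h, Finset.sum_comm, sum_Icc_one, Hop_eq hr]
  have h2 : ∀ s ∈ Finset.range r, ∑ J ∈ Finset.powersetCard r (Finset.univ : Finset (Fin n)),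
      ∑ ε ∈ signs J, ∑ C ∈ chains J (s + 1), (-1) ^ (s + 1 - 1) * chainProd P ε C x *
        (f (x + fun j => Complex.I * P.β * (restr (C 1) ε j : ℂ)) - f x) =
      ∑ κ ∈ steps' Finset.univ r, V P κ (supp κ) (Finset.univ \ supp κ) x *
        (f (x + fun j => Complex.I * P.β * κ j) - f x) *
        blocks P s (Finset.univ \ supp κ) (r - (supp κ).card) x := by
    intro s _
    rw [sum_chains, sum_signedChains_succ ∅ s r fun ε C => (-1) ^ (s + 1 - 1) * chainProd P ε C x *
        (f (x + fun j => Complex.I * P.β * (restr (C 1) ε j : ℂ)) - f x), Finset.compl_empty]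
    refine Finset.sum_congr rfl fun κ hκ => ?_
    have e : ∀ q ∈ signedChains (∅ ∪ supp κ) s (r - (supp κ).card),
        (-1) ^ (s + 1 - 1) *
          chainProd P (κ + q.1) (Fin.cons ∅ q.2 : Fin (s + 2) → Finset (Fin n)) x *
          (f (x + fun j => Complex.I * P.β *
            (restr ((Fin.cons ∅ q.2 : Fin (s + 2) → Finset (Fin n)) 1) (κ + q.1) j : ℂ)) - f x) =
        V P κ (supp κ) (Finset.univ \ supp κ) x *
          (f (x + fun j => Complex.I * P.β * κ j) - f x) * (-1) ^ s * chainProd P q.1 q.2 x := by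
      rintro ⟨ε, C⟩ hq
      obtain ⟨h1, h2, h3, -, -⟩ := mem_signedChains.1 hq
      have h4 : restr ((Fin.cons ∅ C : Fin (s + 2) → Finset (Fin n)) 1) (κ + ε) = κ := by
        have : (Fin.cons ∅ C : Fin (s + 2) → Finset (Fin n)) 1 = ∅ ∪ supp κ := h3
        rw [this]
        exact restr_add h1
      rw [h4, chainProd_cons (by rw [Finset.compl_empty]; exact (mem_steps'.1 hκ).1) hq,
        Finset.compl_empty, Nat.add_sub_cancel]
      ring
    rw [Finset.sum_congr rfl e, ← Finset.mul_sum, sum_chainProd, mul_assoc, ← mul_assoc ((-1) ^ s),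
      ← mul_pow, neg_one_mul, neg_neg, one_pow, one_mul, Finset.empty_union,
      ← Finset.compl_eq_univ_sdiff]
  rw [Finset.sum_congr rfl h2, Finset.sum_comm]
  refine Finset.sum_congr rfl fun κ hκ => ?_
  rw [← Finset.mul_sum, sum_range_blocks]
  · ring
  · have := card_supp_pos (mem_steps'.1 hκ).2.1
    omega

lemma toFun_add (f h : (Fin n → ℂ) → ℂ) : toFun (f + h) = toFun f + toFun h := rfl

lemma toFun_smul (c : ℂ) (f : (Fin n → ℂ) → ℂ) : toFun (c • f) = c • toFun f := rfl

lemma toFun_sum {ι : Type*} (s : Finset ι) (f : ι → (Fin n → ℂ) → ℂ) :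
    toFun (∑ i ∈ s, f i) = ∑ i ∈ s, toFun (f i) :=
  map_sum (Filter.Germ.coeAddHom (openDense (Fin n → ℂ)) (M := ℂ)) f s

lemma toFun_eq_iff {f h : (Fin n → ℂ) → ℂ} :
    toFun f = toFun h ↔ ∀ᶠ x in openDense (Fin n → ℂ), f x = h x := Filter.Germ.coe_eq

variable (P) in
lemma diffOp_toFun {r : ℕ} (hr : 1 ≤ r) (f : (Fin n → ℂ) → ℂ) :
    diffOp P n r (toFun f) = toFun (Hop P r f) := by
  have : Hop P r f = ∑ J ∈ Finset.powersetCard r (Finset.univ : Finset (Fin n)), ∑ ε ∈ signs J,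
      ∑ s ∈ Finset.Icc 1 r, ∑ C ∈ chains J s, fun x => (-1) ^ (s - 1) * chainProd P ε C x *
        (f (x + fun j => Complex.I * P.β * (restr (C 1) ε j : ℂ)) - f x) := by
    funext x
    rw [← sum_chains_eq_Hop P hr f x]
    simp only [Finset.sum_apply]
  rw [this]
  simp only [toFun_sum, diffOp, LinearMap.sum_apply]
  rfl

end

end Koornwinder

namespace Koornwinder

open Filter Topology

noncomputable section

variable {n : ℕ} {P : Params}

/-! ### Difference operators are determined by their action on Koornwinder's polynomials -/

lemma mem_openDense_of {X : Type*} [TopologicalSpace X] {s U : Set X} (hU : IsOpen U)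
    (hd : Dense U) (h : U ⊆ s) : s ∈ openDense X := ⟨U, hU, hd, h⟩

lemma eventually_ne_zero {F : (Fin n → ℂ) → ℂ} (hF : F ∈ expPoly n) (h : F ≠ 0) :
    ∀ᶠ x in openDense (Fin n → ℂ), F x ≠ 0 :=
  mem_openDense_of (isOpen_dense_ne_zero hF h).1 (isOpen_dense_ne_zero hF h).2 subset_rfl

instance neBot_openDense : NeBot (openDense (Fin n → ℂ)) := by
  refine ⟨fun h => ?_⟩
  obtain ⟨U, -, hd, hU⟩ : ∅ ∈ openDense (Fin n → ℂ) := by rw [h]; trivial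
  obtain ⟨x, hx⟩ := hd.nonempty
  exact hU hx

lemma toFun_ne_zero {F : (Fin n → ℂ) → ℂ} (hF : F ∈ expPoly n) (h : F ≠ 0) : toFun F ≠ 0 := by
  intro h0
  have h1 : ∀ᶠ x in openDense (Fin n → ℂ), F x = 0 := toFun_eq_iff.1 h0
  obtain ⟨x, hx⟩ := (h1.and (eventually_ne_zero hF h)).exists
  exact hx.2 hx.1

/-- The difference operator with coefficients `a`. -/
def opOf (n : ℕ) (β : ℝ) :
    ((Fin n → ℤ) →₀ ((Fin n → ℂ) → ℂ)) →+ Module.End ℂ (Fun n) :=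
  Finsupp.liftAddHom fun κ =>
    { toFun := fun a => mulOp a * shiftOp β κ
      map_zero' := LinearMap.ext fun _ => zero_mul _
      map_add' := fun a b => LinearMap.ext fun f => add_mul (toFun a) (toFun b) (shiftOp β κ f) }

lemma opOf_single (β : ℝ) (κ : Fin n → ℤ) (a : (Fin n → ℂ) → ℂ) :
    opOf n β (Finsupp.single κ a) = mulOp a * shiftOp β κ :=
  Finsupp.liftAddHom_apply_single _ _ _

lemma opOf_apply_toFun (β : ℝ) (a : (Fin n → ℤ) →₀ ((Fin n → ℂ) → ℂ)) (f : (Fin n → ℂ) → ℂ) :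
    opOf n β a (toFun f) = toFun fun x =>
      ∑ κ ∈ a.support, a κ x * f (x + fun j => Complex.I * β * κ j) := by
  have : (fun x => ∑ κ ∈ a.support, a κ x * f (x + fun j => Complex.I * β * κ j)) =
      ∑ κ ∈ a.support, fun x => a κ x * f (x + fun j => Complex.I * β * κ j) := by
    funext x; rw [Finset.sum_apply]
  rw [this, toFun_sum, opOf, Finsupp.liftAddHom_apply, Finsupp.sum, LinearMap.sum_apply]
  rfl

lemma opOf_single_mul (β : ℝ) (κ κ' : Fin n → ℤ) (a b : (Fin n → ℂ) → ℂ) :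
    opOf n β (Finsupp.single κ a) * opOf n β (Finsupp.single κ' b) =
      opOf n β (Finsupp.single (κ + κ')
        fun x => a x * b (x + fun j => Complex.I * β * κ j)) := by
  rw [opOf_single, opOf_single, opOf_single]
  refine LinearMap.ext fun f => ?_
  induction f using Filter.Germ.inductionOn with
  | _ f =>
    refine congrArg toFun (funext fun x => ?_)
    change a x * (b _ * f _) = a x * b _ * f _
    rw [mul_assoc]
    congr 3
    funext j
    simp only [Pi.add_apply, Int.cast_add]
    ring

/-- The algebra of all difference operators. -/
def opAlg (n : ℕ) (β : ℝ) : Subalgebra ℝ (Module.End ℂ (Fun n)) where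
  carrier := Set.range (opOf n β)
  add_mem' := by
    rintro _ _ ⟨a, rfl⟩ ⟨b, rfl⟩
    exact ⟨a + b, map_add _ _ _⟩
  mul_mem' := by
    rintro _ _ ⟨a, rfl⟩ ⟨b, rfl⟩
    change _ ∈ AddMonoidHom.mrange (opOf n β)
    induction a using Finsupp.induction_linear with
    | zero => rw [map_zero, zero_mul]; exact zero_mem _
    | add a a' h h' => rw [map_add, add_mul]; exact add_mem h h'
    | single κ a =>
      induction b using Finsupp.induction_linear with
      | zero => rw [map_zero, mul_zero]; exact zero_mem _
      | add b b' h h' => rw [map_add, mul_add]; exact add_mem h h'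
      | single κ' b => exact ⟨_, (opOf_single_mul β κ κ' a b).symm⟩
  algebraMap_mem' r := by
    refine ⟨Finsupp.single 0 fun _ => (r : ℂ), ?_⟩
    rw [opOf_single]
    refine LinearMap.ext fun f => ?_
    induction f using Filter.Germ.inductionOn with
    | _ f =>
      refine congrArg toFun (funext fun x => ?_)
      change (r : ℂ) * f _ = r • f x
      rw [Complex.real_smul]
      congr 2
      funext j
      simp

lemma shiftOp_mem (β : ℝ) (κ : Fin n → ℤ) : shiftOp β κ ∈ opAlg n β := by
  refine ⟨Finsupp.single κ 1, ?_⟩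
  rw [opOf_single]
  exact LinearMap.ext fun f => one_mul _

lemma mulOp_mem (β : ℝ) (a : (Fin n → ℂ) → ℂ) : mulOp a ∈ opAlg n β := by
  refine ⟨Finsupp.single 0 a, ?_⟩
  have h : shiftOp β (0 : Fin n → ℤ) = 1 := by
    refine LinearMap.ext fun f => ?_
    induction f using Filter.Germ.inductionOn with
    | _ f =>
      refine congrArg toFun (funext fun x => congrArg f (funext fun j => ?_))
      simp
  rw [opOf_single, h, mul_one]

variable (P) in
lemma diffAlg_le : diffAlg P n ≤ opAlg n P.β := by
  refine Algebra.adjoin_le ?_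
  rintro _ ⟨r, -, rfl⟩
  refine sum_mem fun J _ => sum_mem fun ε _ => sum_mem fun s _ => sum_mem fun C _ => ?_
  exact mul_mem (mulOp_mem _ _) (sub_mem (shiftOp_mem _ _) (one_mem _))

/-- The function `∑ⱼ cos xⱼ`. -/
def sumCos (x : Fin n → ℂ) : ℂ := ∑ j, Complex.cos (x j)

lemma sumCos_mem : sumCos ∈ expPoly n := by
  have h : (sumCos : (Fin n → ℂ) → ℂ) =
      ∑ j, (2⁻¹ : ℂ) • (ex (Pi.single j 1) + ex (Pi.single j (-1))) := by
    funext x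
    have h1 : ∀ (j : Fin n) (a : ℤ), ex (Pi.single j a) x = Complex.exp (Complex.I * (a * x j)) := by
      intro j a
      rw [ex]
      congr 2
      rw [Finset.sum_eq_single j]
      · simp
      · intro i _ hi; simp [hi]
      · simp
    simp only [sumCos, Finset.sum_apply, Pi.smul_apply, Pi.add_apply, h1, Complex.cos, smul_eq_mul]
    refine Finset.sum_congr rfl fun j _ => ?_
    rw [div_eq_inv_mul]
    congr 2
    · congr 1; push_cast; ring
    · congr 1; push_cast; ring
  rw [h]
  exact sum_mem fun j _ => Subalgebra.smul_mem _ (add_mem (ex_mem _) (ex_mem _)) _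

lemma sumCos_inv : Inv (sumCos : (Fin n → ℂ) → ℂ) := by
  intro w x
  have h : ∀ j, Complex.cos (act w x j) = Complex.cos (x (w.1 j)) := by
    intro j
    rw [act]
    rcases Int.units_eq_one_or (w.2 j) with h | h <;> simp [h]
  simp only [sumCos, h]
  exact Equiv.sum_comp w.1 fun j => Complex.cos (x j)

lemma sumCos_translate_ne {β : ℝ} (hβ : 0 < β) {κ κ' : Fin n → ℤ} (h : κ ≠ κ') :
    (fun x : Fin n → ℂ => sumCos (x + fun j => Complex.I * β * κ j) -
      sumCos (x + fun j => Complex.I * β * κ' j)) ≠ 0 := by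
  obtain ⟨j, hj⟩ := Function.ne_iff.1 h
  intro h0
  have key : ∀ (z : ℂ) (μ : Fin n → ℤ), sumCos ((Pi.single j z : Fin n → ℂ) +
      fun i => Complex.I * β * μ i) = Complex.cos (z + Complex.I * β * μ j) +
        ∑ i ∈ Finset.univ.erase j, Complex.cos (Complex.I * β * μ i) := by
    intro z μ
    rw [sumCos, ← Finset.add_sum_erase _ _ (Finset.mem_univ j)]
    congr 1
    · simp
    · refine Finset.sum_congr rfl fun i hi => ?_
      simp [Finset.ne_of_mem_erase hi]
  have h1 := congrFun h0 (Pi.single j ((Real.pi / 2 : ℝ) : ℂ))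
  have h2 := congrFun h0 (Pi.single j ((-(Real.pi / 2) : ℝ) : ℂ))
  simp only [key, Pi.zero_apply] at h1 h2
  have hc : ∀ μ : ℤ, Complex.cos (((Real.pi / 2 : ℝ) : ℂ) + Complex.I * β * μ) -
      Complex.cos (((-(Real.pi / 2) : ℝ) : ℂ) + Complex.I * β * μ) =
      -2 * (Real.sinh (β * μ) : ℂ) * Complex.I := by
    intro μ
    have e1 : ((Real.pi / 2 : ℝ) : ℂ) + Complex.I * β * μ =
        Complex.I * β * μ + (Real.pi : ℂ) / 2 := by push_cast; ring
    have e2 : ((-(Real.pi / 2) : ℝ) : ℂ) + Complex.I * β * μ =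
        Complex.I * β * μ - (Real.pi : ℂ) / 2 := by push_cast; ring
    have e3 : Complex.I * β * μ = ((β * μ : ℝ) : ℂ) * Complex.I := by push_cast; ring
    rw [e1, e2, Complex.cos_add_pi_div_two, Complex.cos_sub_pi_div_two, e3, Complex.sin_mul_I,
      Complex.ofReal_sinh]
    ring
  have h3 : (-2 * (Real.sinh (β * κ j) : ℂ) * Complex.I) =
      -2 * (Real.sinh (β * κ' j) : ℂ) * Complex.I := by
    rw [← hc, ← hc]
    linear_combination h1 - h2
  have h4 : (Real.sinh (β * κ j) : ℂ) = Real.sinh (β * κ' j) := by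
    have := mul_right_cancel₀ Complex.I_ne_zero h3
    exact mul_left_cancel₀ (by norm_num) this
  have h5 := Real.sinh_injective (Complex.ofReal_injective h4)
  have h6 := mul_left_cancel₀ hβ.ne' h5
  exact hj (by exact_mod_cast h6)

/-- A difference operator that annihilates all powers of `∑ⱼ cos xⱼ` vanishes. -/
lemma opOf_eq_zero {β : ℝ} (hβ : 0 < β) {a : (Fin n → ℤ) →₀ ((Fin n → ℂ) → ℂ)}
    (h : ∀ k : ℕ, opOf n β a (toFun (sumCos ^ k)) = 0) : opOf n β a = 0 := by
  have h1 : ∀ k : ℕ, ∀ᶠ x in openDense (Fin n → ℂ),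
      ∑ κ ∈ a.support, a κ x * sumCos (x + fun j => Complex.I * β * κ j) ^ k = 0 := by
    intro k
    have := h k
    rw [opOf_apply_toFun] at this
    exact toFun_eq_iff.1 this
  have h2 : ∀ᶠ x in openDense (Fin n → ℂ), ∀ k ∈ Finset.range a.support.card,
      ∑ κ ∈ a.support, a κ x * sumCos (x + fun j => Complex.I * β * κ j) ^ k = 0 :=
    (Filter.eventually_all_finset _).2 fun k _ => h1 k
  have h3 : ∀ᶠ x in openDense (Fin n → ℂ), ∀ κ ∈ a.support, ∀ κ' ∈ a.support, κ ≠ κ' →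
      sumCos (x + fun j => Complex.I * β * κ j) -
        sumCos (x + fun j => Complex.I * β * κ' j) ≠ 0 := by
    refine (Filter.eventually_all_finset _).2 fun κ _ =>
      (Filter.eventually_all_finset _).2 fun κ' _ => ?_
    by_cases hne : κ = κ'
    · simp [hne]
    · filter_upwards [eventually_ne_zero (sub_mem (expPoly_translate _ sumCos_mem)
        (expPoly_translate _ sumCos_mem)) (sumCos_translate_ne hβ hne)] with x hx _
      exact hx
  have h4 : ∀ᶠ x in openDense (Fin n → ℂ), ∀ κ ∈ a.support, a κ x = 0 := by
    filter_upwards [h2, h3] with x hx hx'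
    let e := a.support.equivFin.symm
    have hinj : Function.Injective fun i =>
        sumCos (x + fun j => Complex.I * β * ((e i : Fin n → ℤ) j : ℂ)) := by
      intro i i' hi
      by_contra hne
      exact hx' _ (e i).2 _ (e i').2 (fun h => hne (e.injective (Subtype.ext h)))
        (sub_eq_zero.2 hi)
    have := Matrix.eq_zero_of_forall_pow_sum_mul_pow_eq_zero (v := fun i => a (e i) x) hinj ?_
    · intro κ hκ
      have := congrFun this (e.symm ⟨κ, hκ⟩)
      simpa using this
    · intro k
      rw [← hx k (Finset.mem_range.2 k.2), ← Finset.sum_coe_sort a.support]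
      exact Equiv.sum_comp e fun κ : a.support =>
        a κ x * sumCos (x + fun j => Complex.I * β * ((κ : Fin n → ℤ) j : ℂ)) ^ (k : ℕ)
  refine LinearMap.ext fun f => ?_
  induction f using Filter.Germ.inductionOn with
  | _ f =>
    change opOf n β a (toFun f) = toFun 0
    rw [opOf_apply_toFun, toFun_eq_iff]
    filter_upwards [h4] with x hx
    exact Finset.sum_eq_zero fun κ hκ => by rw [hx κ hκ, zero_mul]

lemma monomial_mem_span_koornwinder (hP : P.Pos) {l : Fin n → ℤ} (hl : Dominant l) :
    monomial l ∈ Submodule.span ℂ (koornwinder P '' {l : Fin n → ℤ | Dominant l}) := by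
  induction hN : (∑ j, l j * xi n j).toNat using Nat.strong_induction_on generalizing l with
  | _ N ih =>
    have h1 := (isKoornwinder_iff.1 (isKoornwinder_koornwinder hP l)).1
    have h2 : lower l ≤ Submodule.span ℂ (koornwinder P '' {l : Fin n → ℤ | Dominant l}) := by
      refine Submodule.span_le.2 ?_
      rintro _ ⟨l', hl', rfl⟩
      refine ih _ ?_ hl'.1 rfl
      have h3 := hl'.2.1.sum_mul_xi_le
      have h4 : ∑ j, l' j * xi n j ≠ ∑ j, l j * xi n j := fun h =>
        hl'.2.2 (hl'.2.1.eq_of_sum_mul_xi_eq h)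
      have h5 : 0 ≤ ∑ j, l' j * xi n j := Finset.sum_nonneg fun j _ =>
        mul_nonneg (hl'.1.2 j) (by have := j.2; simp only [xi]; omega)
      omega
    rw [← sub_sub_cancel (koornwinder P l) (monomial l)]
    exact sub_mem (Submodule.subset_span ⟨l, hl, rfl⟩) (h2 h1)

lemma opAlg_eq_zero (hP : P.Pos) {D : Module.End ℂ (Fun n)} (hD : D ∈ opAlg n P.β)
    (h : ∀ l : Fin n → ℤ, Dominant l → D (toFun (koornwinder P l)) = 0) : D = 0 := by
  have h1 : ∀ f ∈ Submodule.span ℂ (koornwinder P '' {l : Fin n → ℤ | Dominant l}),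
      D (toFun f) = 0 := by
    intro f hf
    refine Submodule.span_induction (p := fun f _ => D (toFun f) = 0) ?_ ?_ ?_ ?_ hf
    · rintro _ ⟨l, hl, rfl⟩
      exact h l hl
    · exact map_zero D
    · intro f g _ _ hf hg
      rw [toFun_add, map_add, hf, hg, add_zero]
    · intro c f _ hf
      rw [toFun_smul, map_smul, hf, smul_zero]
  obtain ⟨a, rfl⟩ := hD
  refine opOf_eq_zero hP.β fun k => h1 _ ?_
  obtain ⟨q, hq⟩ := mem_expPoly_iff.1 (pow_mem (sumCos_mem (n := n)) k)
  have hinv : Inv (evalEx q) := by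
    rw [← hq]
    intro w x
    rw [Pi.pow_apply, Pi.pow_apply, sumCos_inv]
  rw [hq]
  refine Submodule.span_le.2 ?_ (inv_mem_span q hinv)
  rintro _ ⟨l, hl, rfl⟩
  exact monomial_mem_span_koornwinder hP hl.1

lemma monomial_notMem_lower {l : Fin n → ℤ} (hl : Dominant l) : monomial l ∉ lower l := by
  classical
  intro h
  have h1 : ∃ q : (Fin n → ℤ) →₀ ℂ, monomial l = evalEx q ∧ q l = 0 := by
    refine Submodule.span_induction (p := fun f _ => ∃ q : (Fin n → ℤ) →₀ ℂ, f = evalEx q ∧ q l = 0)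
      ?_ ⟨0, by funext x; simp [evalEx], rfl⟩ ?_ ?_ h
    · rintro _ ⟨l', hl', rfl⟩
      refine ⟨monoCoeff l', (evalEx_monoCoeff l').symm, ?_⟩
      rw [monoCoeff_apply, if_neg fun h => hl'.2.2 (hl.eq_of_mem_orbit hl'.1 h).symm]
    · rintro _ _ _ _ ⟨q, rfl, hq⟩ ⟨q', rfl, hq'⟩
      exact ⟨q + q', (evalEx_add q q').symm, by simp [hq, hq']⟩
    · rintro c _ _ ⟨q, rfl, hq⟩
      exact ⟨c • q, (evalEx_smul c q).symm, by simp [hq]⟩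
  obtain ⟨q, h2, h3⟩ := h1
  rw [← evalEx_monoCoeff] at h2
  rw [← evalEx_injective h2, monoCoeff_self] at h3
  exact one_ne_zero h3

lemma toFun_koornwinder_ne_zero (hP : P.Pos) {l : Fin n → ℤ} (hl : Dominant l) :
    toFun (koornwinder P l) ≠ 0 := by
  have h := isKoornwinder_koornwinder hP l
  refine toFun_ne_zero h.mem_expPoly fun h0 => monomial_notMem_lower hl ?_
  have := (isKoornwinder_iff.1 h).1
  rw [h0, zero_sub] at this
  exact neg_mem_iff.1 this

lemma diffOp_koornwinder (hP : P.Pos) {r : ℕ} (hr : 1 ≤ r) (hrn : r ≤ n) {l : Fin n → ℤ}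
    (hl : Dominant l) : diffOp P n r (toFun (koornwinder P l)) =
      ((2 ^ r * Eθ P r (shifted P l) : ℝ) : ℂ) • toFun (koornwinder P l) := by
  rw [diffOp_toFun P hr, ← toFun_smul, toFun_eq_iff]
  exact mem_openDense_of (isOpen_dense_good P).1 (isOpen_dense_good P).2
    (Hop_koornwinder hP hr hrn hl (isKoornwinder_koornwinder hP l))

end

end Koornwinder

namespace Koornwinder

open Filter Topology

noncomputable section

variable {n : ℕ} {P : Params}

/-! ### The symmetric algebra -/

lemma aeval_fun_apply {ι X : Type*} (F : ι → X → ℝ) (Q : MvPolynomial ι ℝ) (x : X) :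
    (MvPolynomial.aeval F Q : X → ℝ) x = MvPolynomial.eval (fun i => F i x) Q := by
  induction Q using MvPolynomial.induction_on with
  | C a => simp
  | add p q hp hq => simp [hp, hq]
  | mul_X p i hp => simp [hp]

lemma eval_aeval {ι κ : Type*} (t : κ → ℝ) (e : ι → MvPolynomial κ ℝ) (Q : MvPolynomial ι ℝ) :
    MvPolynomial.eval t (MvPolynomial.aeval e Q) =
      MvPolynomial.eval (fun i => MvPolynomial.eval t (e i)) Q := by
  induction Q using MvPolynomial.induction_on with
  | C a => simp
  | add p q hp hq => rw [map_add, map_add, map_add, hp, hq]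
  | mul_X p i hp => rw [map_mul, map_mul, map_mul, hp, MvPolynomial.aeval_X, MvPolynomial.eval_X]

variable (P) in
/-- The functions `ch βθⱼ`. -/
def coshFun (j : Fin n) (θ : Fin n → ℝ) : ℝ := Real.cosh (P.β * θ j)

lemma exists_polynomial {S : (Fin n → ℝ) → ℝ}
    (hS : S ∈ Algebra.adjoin ℝ (Set.range (coshFun (n := n) P))) :
    ∃ Q : MvPolynomial (Fin n) ℝ, ∀ θ, S θ = MvPolynomial.eval (fun j => coshFun P j θ) Q := by
  rw [Algebra.adjoin_range_eq_range_aeval] at hS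
  obtain ⟨Q, rfl⟩ := hS
  exact ⟨Q, aeval_fun_apply _ Q⟩

lemma rho_nonneg (hP : P.Pos) (j : Fin n) : 0 ≤ rho P j := by
  have h1 : ((j : ℕ) : ℝ) + 1 ≤ n := by exact_mod_cast j.2
  have := hP.g₀; have := hP.g₁; have := hP.g₀'; have := hP.g₁'
  exact add_nonneg (mul_nonneg (sub_nonneg.2 h1) hP.g) (by linarith)

lemma cosh_shift_injective (hP : P.Pos) (j : Fin n) {a b : ℕ}
    (h : Real.cosh (P.β * (a + rho P j)) = Real.cosh (P.β * (b + rho P j))) : a = b := by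
  have hρ := rho_nonneg hP j
  have h0 : ∀ m : ℕ, 0 ≤ P.β * (m + rho P j) := fun m =>
    mul_nonneg hP.β.le (add_nonneg m.cast_nonneg hρ)
  have h2 : P.β * (a + rho P j) = P.β * (b + rho P j) := by
    refine le_antisymm ?_ ?_
    · have := Real.cosh_le_cosh.1 h.le
      rwa [abs_of_nonneg (h0 a), abs_of_nonneg (h0 b)] at this
    · have := Real.cosh_le_cosh.1 h.ge
      rwa [abs_of_nonneg (h0 a), abs_of_nonneg (h0 b)] at this
  have h3 := mul_left_cancel₀ hP.β.ne' h2
  exact_mod_cast add_right_cancel h3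

/-- A polynomial in the `ch βθⱼ` is determined by its values at the points `l + ρ`. -/
lemma eq_zero_of_shifted (hP : P.Pos) {S : (Fin n → ℝ) → ℝ}
    (hS : S ∈ Algebra.adjoin ℝ (Set.range (coshFun (n := n) P)))
    (h : ∀ l : Fin n → ℤ, Dominant l → S (shifted P l) = 0) : S = 0 := by
  classical
  obtain ⟨Q, hQ⟩ := exists_polynomial hS
  set d := Q.totalDegree
  let I : Fin n → Finset ℕ := fun j => Finset.Icc ((n - 1 - j) * d) ((n - 1 - j) * d + d)
  let c : Fin n → ℕ → ℝ := fun j m => Real.cosh (P.β * (m + rho P j))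
  have hQ0 : Q = 0 := by
    refine MvPolynomial.eq_zero_of_eval_zero_at_prod_finset Q (fun j => (I j).image (c j)) ?_ ?_
    · intro j
      rw [Finset.card_image_of_injective _ fun a b hab => cosh_shift_injective hP j hab,
        Nat.card_Icc]
      have := Q.degreeOf_le_totalDegree j
      omega
    · intro x hx
      choose l hl hlx using fun j => Finset.mem_image.1 (hx j)
      have hdom : Dominant fun j => (l j : ℤ) := by
        refine ⟨fun i j hij => ?_, fun j => Int.natCast_nonneg _⟩
        rcases hij.eq_or_lt with rfl | hij
        · exact le_rfl
        · have h1 := (Finset.mem_Icc.1 (hl i)).1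
          have h2 := (Finset.mem_Icc.1 (hl j)).2
          have h3 : (n - 1 - j) * d + d ≤ (n - 1 - i) * d := by
            rw [← Nat.succ_mul]
            refine Nat.mul_le_mul_right d ?_
            have := Fin.lt_def.1 hij
            have := j.2
            omega
          exact Int.ofNat_le.2 (h2.trans (h3.trans h1))
      have h4 := h _ hdom
      rw [hQ] at h4
      have h5 : x = fun j => coshFun P j (shifted P fun j => (l j : ℤ)) := by
        funext j
        rw [← hlx j, coshFun, shifted, Int.cast_natCast]
      rw [h5, h4]
  funext θ
  rw [hQ, hQ0, map_zero, Pi.zero_apply]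

/-! ### Elementary symmetric functions -/

variable (P) in
/-- The elementary symmetric functions of the `ch βθⱼ`. -/
def elCosh (s : ℕ) (θ : Fin n → ℝ) : ℝ := el Finset.univ (fun j => coshFun P j θ) s

lemma eval_esymm (s : ℕ) (t : Fin n → ℝ) :
    MvPolynomial.eval t (MvPolynomial.esymm (Fin n) ℝ s) = el Finset.univ t s := by
  simp [MvPolynomial.esymm, el]

lemma elCosh_mem (s : ℕ) : elCosh P s ∈ symAlg P n := by
  refine ⟨?_, fun σ θ => ?_⟩
  · have : elCosh P s = ∑ L ∈ (Finset.univ : Finset (Fin n)).powersetCard s,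
        ∏ j ∈ L, coshFun P j := by
      funext θ
      simp [elCosh, el]
    rw [this]
    exact sum_mem fun L _ => prod_mem fun j _ => Algebra.subset_adjoin ⟨j, rfl⟩
  · rw [elCosh, elCosh, ← eval_esymm, ← eval_esymm]
    conv_rhs => rw [← MvPolynomial.rename_esymm (Fin n) ℝ s σ, MvPolynomial.eval_rename]
    rfl

lemma Eθ_eq {r : ℕ} (hr : 1 ≤ r) (hrn : r ≤ n) : (Eθ P r : (Fin n → ℝ) → ℝ) =
    ∑ s ∈ Finset.range (r + 1),
      ((-1) ^ (r - s) * hs (fun i => Real.cosh (rate P i)) (n - r + 1) (r - s)) • elCosh P s := by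
  funext θ
  rw [Eθ, E_eq hr hrn _ _ (fun i => Real.cosh (rate P i)), Finset.sum_apply]
  · exact Finset.sum_congr rfl fun s _ => mul_comm _ _
  · intro j
    congr 1
    rw [← rate_eq_rho]
    congr 1
    have : (Finset.univ : Finset (Fin n)).filter (j < ·) = Finset.Ioi j := by ext; simp
    rw [this, Fin.card_Ioi]

lemma Eθ_mem {r : ℕ} (hr : 1 ≤ r) (hrn : r ≤ n) : (Eθ P r : (Fin n → ℝ) → ℝ) ∈ symAlg P n := by
  rw [Eθ_eq hr hrn]
  exact sum_mem fun s _ => Subalgebra.smul_mem _ (elCosh_mem s) _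

lemma elCosh_mem_of_Eθ_mem {A : Subalgebra ℝ ((Fin n → ℝ) → ℝ)}
    (h : ∀ r, 1 ≤ r → r ≤ n → Eθ P r ∈ A) {s : ℕ} (hs : s ≤ n) : elCosh P s ∈ A := by
  induction s using Nat.strong_induction_on with
  | _ s ih =>
    rcases Nat.eq_zero_or_pos s with rfl | hpos
    · have : elCosh P 0 = (1 : (Fin n → ℝ) → ℝ) := funext fun θ => el_zero _ _
      rw [this]
      exact one_mem A
    · have h1 := h s hpos hs
      rw [Eθ_eq hpos hs, Finset.sum_range_succ, Nat.sub_self, pow_zero, Koornwinder.hs, one_mul,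
        one_smul] at h1
      refine (add_mem_cancel_left (sum_mem fun t ht => ?_)).1 h1
      rw [Finset.mem_range] at ht
      exact Subalgebra.smul_mem _ (ih t ht (by omega)) _

lemma exists_symmetric {S : (Fin n → ℝ) → ℝ} (hS : S ∈ symAlg P n) :
    ∃ Q : MvPolynomial (Fin n) ℝ, Q.IsSymmetric ∧
      ∀ θ, S θ = MvPolynomial.eval (fun j => coshFun P j θ) Q := by
  obtain ⟨hS1, hS2⟩ := hS
  obtain ⟨Q, hQ⟩ := exists_polynomial (P := P) hS1
  refine ⟨((n.factorial : ℝ)⁻¹) • ∑ σ : Equiv.Perm (Fin n), MvPolynomial.rename σ Q, ?_, ?_⟩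
  · intro τ
    rw [map_smul, map_sum]
    congr 1
    simp only [MvPolynomial.rename_rename]
    exact Equiv.sum_comp (Equiv.mulLeft τ) fun σ : Equiv.Perm (Fin n) => MvPolynomial.rename σ Q
  · intro θ
    have h1 : ∀ σ : Equiv.Perm (Fin n), MvPolynomial.eval (fun j => coshFun P j θ)
        (MvPolynomial.rename σ Q) = S θ := by
      intro σ
      rw [MvPolynomial.eval_rename, ← hS2 σ θ, hQ]
      rfl
    rw [MvPolynomial.smul_eval, map_sum, Finset.sum_congr rfl fun σ _ => h1 σ, Finset.sum_const,
      Finset.card_univ, Fintype.card_perm, Fintype.card_fin, nsmul_eq_mul,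
      inv_mul_cancel_left₀ (Nat.cast_ne_zero.2 n.factorial_ne_zero)]

lemma symAlg_le {A : Subalgebra ℝ ((Fin n → ℝ) → ℝ)} (h : ∀ r, 1 ≤ r → r ≤ n → Eθ P r ∈ A) :
    symAlg P n ≤ A := by
  intro S hS
  obtain ⟨Q, hsym, hQ⟩ := exists_symmetric hS
  obtain ⟨R, hR⟩ := MvPolynomial.esymmAlgHom_surjective (σ := Fin n) ℝ (n := n) (by simp)
    ⟨Q, hsym⟩
  have hR' := MvPolynomial.esymmAlgHom_apply (σ := Fin n) R
  rw [hR] at hR'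
  have hSR : S = MvPolynomial.aeval (fun i : Fin n => elCosh P ((i : ℕ) + 1)) R := by
    funext θ
    rw [aeval_fun_apply, hQ]
    rw [show Q = _ from hR', eval_aeval]
    simp only [eval_esymm]
    rfl
  rw [hSR]
  have : MvPolynomial.aeval (fun i : Fin n => elCosh P ((i : ℕ) + 1)) R ∈
      Algebra.adjoin ℝ (Set.range fun i : Fin n => elCosh (n := n) P ((i : ℕ) + 1)) := by
    rw [Algebra.adjoin_range_eq_range_aeval]
    exact ⟨R, rfl⟩
  refine Algebra.adjoin_le ?_ this
  rintro _ ⟨i, rfl⟩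
  exact elCosh_mem_of_Eθ_mem h i.2

/-! ### Eigenvalues -/

variable (P) in
/-- `S` gives the eigenvalues of `D` on Koornwinder's polynomials. -/
def IsSpectrum (D : Module.End ℂ (Fun n)) (S : (Fin n → ℝ) → ℝ) : Prop :=
  ∀ l : Fin n → ℤ, Dominant l → D (toFun (koornwinder P l)) =
    ((S (shifted P l) : ℝ) : ℂ) • toFun (koornwinder P l)

lemma IsSpectrum.add {D D' : Module.End ℂ (Fun n)} {S S' : (Fin n → ℝ) → ℝ}
    (h : IsSpectrum P D S) (h' : IsSpectrum P D' S') : IsSpectrum P (D + D') (S + S') := by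
  intro l hl
  rw [LinearMap.add_apply, h l hl, h' l hl, ← add_smul, Pi.add_apply, Complex.ofReal_add]

lemma IsSpectrum.mul {D D' : Module.End ℂ (Fun n)} {S S' : (Fin n → ℝ) → ℝ}
    (h : IsSpectrum P D S) (h' : IsSpectrum P D' S') : IsSpectrum P (D * D') (S * S') := by
  intro l hl
  rw [Module.End.mul_apply, h' l hl, map_smul, h l hl, smul_smul, Pi.mul_apply, Complex.ofReal_mul,
    mul_comm]

variable (P) in
lemma isSpectrum_algebraMap (c : ℝ) : IsSpectrum P (algebraMap ℝ (Module.End ℂ (Fun n)) c)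
    (algebraMap ℝ ((Fin n → ℝ) → ℝ) c) := by
  intro l _
  refine congrArg toFun (funext fun x => ?_)
  exact Complex.real_smul

lemma isSpectrum_diffOp (hP : P.Pos) {r : ℕ} (hr : 1 ≤ r) (hrn : r ≤ n) :
    IsSpectrum P (diffOp P n r) fun θ => 2 ^ r * Eθ P r θ :=
  fun _ hl => diffOp_koornwinder hP hr hrn hl

lemma two_pow_mul_Eθ_mem {r : ℕ} (hr : 1 ≤ r) (hrn : r ≤ n) :
    (fun θ : Fin n → ℝ => 2 ^ r * Eθ P r θ) ∈ symAlg P n :=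
  Subalgebra.smul_mem _ (Eθ_mem hr hrn) ((2 : ℝ) ^ r)

lemma exists_isSpectrum (hP : P.Pos) {D : Module.End ℂ (Fun n)} (hD : D ∈ diffAlg P n) :
    ∃ S ∈ symAlg P n, IsSpectrum P D S := by
  refine Algebra.adjoin_induction (p := fun D _ => ∃ S ∈ symAlg P n, IsSpectrum P D S)
    ?_ ?_ ?_ ?_ hD
  · rintro _ ⟨r, hr, rfl⟩
    exact ⟨_, two_pow_mul_Eθ_mem hr.1 hr.2, isSpectrum_diffOp hP hr.1 hr.2⟩
  · exact fun c => ⟨_, Subalgebra.algebraMap_mem _ c, isSpectrum_algebraMap P c⟩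
  · rintro D D' _ _ ⟨S, h1, h2⟩ ⟨S', h3, h4⟩
    exact ⟨_, add_mem h1 h3, h2.add h4⟩
  · rintro D D' _ _ ⟨S, h1, h2⟩ ⟨S', h3, h4⟩
    exact ⟨_, mul_mem h1 h3, h2.mul h4⟩

lemma exists_diffAlg (hP : P.Pos) {S : (Fin n → ℝ) → ℝ} (hS : S ∈ symAlg P n) :
    ∃ D ∈ diffAlg P n, IsSpectrum P D S := by
  let A : Subalgebra ℝ ((Fin n → ℝ) → ℝ) :=
    { carrier := {S | ∃ D ∈ diffAlg P n, IsSpectrum P D S}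
      add_mem' := by
        rintro S S' ⟨D, h1, h2⟩ ⟨D', h3, h4⟩
        exact ⟨_, add_mem h1 h3, h2.add h4⟩
      mul_mem' := by
        rintro S S' ⟨D, h1, h2⟩ ⟨D', h3, h4⟩
        exact ⟨_, mul_mem h1 h3, h2.mul h4⟩
      algebraMap_mem' := fun c => ⟨_, Subalgebra.algebraMap_mem _ c, isSpectrum_algebraMap P c⟩ }
  refine symAlg_le (A := A) (fun r hr hrn => ?_) hS
  have h1 : (fun θ => 2 ^ r * Eθ P r θ) ∈ A :=
    ⟨_, Algebra.subset_adjoin ⟨r, ⟨hr, hrn⟩, rfl⟩, isSpectrum_diffOp hP hr hrn⟩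
  have h2 := Subalgebra.smul_mem A h1 ((2 : ℝ) ^ r)⁻¹
  convert h2 using 1
  funext θ
  simp

lemma IsSpectrum.unique (hP : P.Pos) {D : Module.End ℂ (Fun n)} {S S' : (Fin n → ℝ) → ℝ}
    (hS : S ∈ symAlg P n) (hS' : S' ∈ symAlg P n) (h : IsSpectrum P D S)
    (h' : IsSpectrum P D S') : S = S' := by
  rw [← sub_eq_zero]
  refine eq_zero_of_shifted hP (sub_mem hS hS').1 fun l hl => ?_
  have h1 := smul_left_injective ℂ (toFun_koornwinder_ne_zero hP hl) ((h l hl).symm.trans (h' l hl))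
  rw [Pi.sub_apply, Complex.ofReal_injective h1, sub_self]

lemma IsSpectrum.operator_unique (hP : P.Pos) {D D' : Module.End ℂ (Fun n)}
    {S : (Fin n → ℝ) → ℝ} (hD : D ∈ diffAlg P n) (hD' : D' ∈ diffAlg P n)
    (h : IsSpectrum P D S) (h' : IsSpectrum P D' S) : D = D' := by
  rw [← sub_eq_zero]
  refine opAlg_eq_zero hP (diffAlg_le P (sub_mem hD hD')) fun l hl => ?_
  rw [LinearMap.sub_apply, h l hl, h' l hl, sub_self]

/-- The Harish-Chandra isomorphism. -/
theorem exists_harishChandra (hP : P.Pos) : ∃ HC : diffAlg P n ≃ₐ[ℝ] symAlg P n,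
    ∀ D : diffAlg P n, IsSpectrum P (D : Module.End ℂ (Fun n)) (HC D : (Fin n → ℝ) → ℝ) := by
  choose F hF hspec using fun D : diffAlg P n => exists_isSpectrum hP D.2
  let HC : diffAlg P n →ₐ[ℝ] symAlg P n :=
    { toFun := fun D => ⟨F D, hF D⟩
      map_one' := Subtype.ext ((hspec 1).unique hP (hF 1) (one_mem _)
        (by simpa using isSpectrum_algebraMap P (n := n) 1))
      map_mul' := fun D D' => Subtype.ext ((hspec (D * D')).unique hP (hF _)
        (mul_mem (hF D) (hF D')) ((hspec D).mul (hspec D')))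
      map_zero' := Subtype.ext ((hspec 0).unique hP (hF 0) (zero_mem _)
        (by simpa using isSpectrum_algebraMap P (n := n) 0))
      map_add' := fun D D' => Subtype.ext ((hspec (D + D')).unique hP (hF _)
        (add_mem (hF D) (hF D')) ((hspec D).add (hspec D')))
      commutes' := fun c => Subtype.ext ((hspec _).unique hP (hF _)
        (Subalgebra.algebraMap_mem _ c) (isSpectrum_algebraMap P c)) }
  refine ⟨AlgEquiv.ofBijective HC ⟨fun D D' h => ?_, fun S => ?_⟩, hspec⟩
  · have h1 : F D = F D' := congrArg Subtype.val h
    exact Subtype.ext (IsSpectrum.operator_unique hP D.2 D'.2 (hspec D) (h1 ▸ hspec D'))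
  · obtain ⟨D, hD, h⟩ := exists_diffAlg hP S.2
    exact ⟨⟨D, hD⟩, Subtype.ext ((hspec ⟨D, hD⟩).unique hP (hF _) S.2 h)⟩

end

end Koornwinder

theorem mainTheorem3 (n : ℕ) (P : Koornwinder.Params) (hβ : 0 < P.β) (hg : 0 ≤ P.g)
    (hg₀ : 0 ≤ P.g₀) (hg₁ : 0 ≤ P.g₁) (hg₀' : 0 ≤ P.g₀') (hg₁' : 0 ≤ P.g₁') :
    -- the Koornwinder polynomials are well defined
    (∀ l : Fin n → ℤ, Koornwinder.Dominant l →
      ∃! p : (Fin n → ℂ) → ℂ, Koornwinder.IsKoornwinder P l p) ∧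
    -- every symmetric function is the spectrum of a unique difference operator
    (∀ S ∈ Koornwinder.symAlg P n, ∃! D : Module.End ℂ (Koornwinder.Fun n),
      D ∈ Koornwinder.diffAlg P n ∧
        ∀ l : Fin n → ℤ, Koornwinder.Dominant l →
          D (Koornwinder.toFun (Koornwinder.koornwinder P l)) =
            ((S (Koornwinder.shifted P l) : ℝ) : ℂ) •
              Koornwinder.toFun (Koornwinder.koornwinder P l)) ∧
    -- this correspondence is an isomorphism of real algebras
    ∃ HC : Koornwinder.diffAlg P n ≃ₐ[ℝ] Koornwinder.symAlg P n,
      (∀ (D : Koornwinder.diffAlg P n) (l : Fin n → ℤ), Koornwinder.Dominant l →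
        (D : Module.End ℂ (Koornwinder.Fun n))
            (Koornwinder.toFun (Koornwinder.koornwinder P l)) =
          (((HC D : (Fin n → ℝ) → ℝ) (Koornwinder.shifted P l) : ℝ) : ℂ) •
            Koornwinder.toFun (Koornwinder.koornwinder P l)) ∧
      ∀ (r : ℕ) (hr : r ∈ Set.Icc 1 n),
        (HC ⟨Koornwinder.diffOp P n r, Algebra.subset_adjoin ⟨r, hr, rfl⟩⟩ : (Fin n → ℝ) → ℝ) =
          fun θ => 2 ^ r * Koornwinder.Eθ P r θ := by
  have hP : P.Pos := ⟨hβ, hg, hg₀, hg₁, hg₀', hg₁'⟩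
  refine ⟨fun l _ => Koornwinder.existsUnique_isKoornwinder hP l, fun S hS => ?_, ?_⟩
  · obtain ⟨D, hD, h⟩ := Koornwinder.exists_diffAlg hP hS
    exact ⟨D, ⟨hD, h⟩, fun D' hD' =>
      Koornwinder.IsSpectrum.operator_unique hP hD'.1 hD hD'.2 h⟩
  · obtain ⟨HC, h⟩ := Koornwinder.exists_harishChandra (n := n) hP
    exact ⟨HC, h, fun r hr => (h _).unique hP (HC _).2
      (Koornwinder.two_pow_mul_Eθ_mem hr.1 hr.2)
      (Koornwinder.isSpectrum_diffOp hP hr.1 hr.2)⟩
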